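/- **Conventions.** Let $Q$ be an integral lattice: a free abelian group of finite rank with a non-degenerate symmetric $\mathbb Z$-valued bilinear form $(\cdot,\cdot)$. Put $\mathfrak h=\mathbb C\otimes_{\mathbb Z}Q$, with the form extended bilinearly, and $W=\Pi\mathfrak h$ (reversed parity). Let $Z=(z,\theta)$, $W=(w,\zeta)$ be pairs of one even and one odd formal variable, $Z^{j|J}=z^j\theta^J$, $D_W=\partial_\zeta+\zeta\partial_w$, $D_W^{(j|1)}=-\frac1{j!}\partial_w^jD_W$ and $\delta(Z,W)=(\theta-\zeta)\sum_{n\in\mathbb Z}z^{-n-1}w^n$. An $N_K=1$ SUSY vertex algebra is a complex superspace $V$ with an even vacuum $|0\rangle$, an odd operator $S$ and a parity preserving linear map $a\mapsto Y(a,Z)=\sum_{j\in\mathbb Z,\,J\in\{0,1\}}Z^{-1-j|1-J}a_{(j|J)}$ into $\operatorname{End}(V)$-valued superfields, such that $Y(|0\rangle,Z)=\mathrm{Id}$, $Y(a,Z)|0\rangle=a+O(Z)$, $S|0\rangle=0$, $[S,Y(a,Z)]=(\partial_\theta-\theta\partial_z)Y(a,Z)$, and $(z-w)^n[Y(a,Z),Y(b,W)]=0$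 for $n\gg0$ (brackets are supercommutators). Its $\Lambda$-bracket is $[a_\Lambda b]=\sum_{j\ge0}\frac{\lambda^j}{j!}\bigl(a_{(j|0)}b+\chi\,a_{(j|1)}b\bigr)$. $V^1(W)$ is the Fock space of the operators $h_{(j|0)}$ (even) and $h_{(j|1)}$ (odd), $h\in\mathfrak h$, $j\in\mathbb Z$, with $[h_{(j|0)},h'_{(k|0)}]=j(h,h')\delta_{j,-k}$, $[h_{(j|1)},h'_{(k|1)}]=(h,h')\delta_{j+k,-1}$, $[h_{(j|0)},h'_{(k|1)}]=0$, and $h_{(j|J)}|0\rangle=0$ for $j\ge0$. For a $2$-cocycle $\varepsilon:Q\times Q\to\mathbb C^\times$ let $\mathbb C_\varepsilon[Q]$ be the unital algebra with basis $e^\alpha$ $(\alpha\in Q)$ and $e^\alpha e^\beta=\varepsilon(\alpha,\beta)e^{\alpha+\beta}$. Put $V_Q=V^1(W)\otimes\mathbb C_\varepsilon[Q]$, with vacuum $|0\rangle\otimes1$, where $e^\alpha$ has the parity of $(\alpha,\alpha)$. Write $h$ also for the state $h_{(-1|1)}|0\rangle\otimes1$ and $e^\alpha$ for the state $|0\rangle\otimes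 e^\alpha$. The operators $h_{(j|J)}$ are extended to $V_Q$ by $h_{(0|0)}(s\otimes e^\beta)=(h,\beta)\,s\otimes e^\beta$ and $h_{(j|J)}(s\otimes e^\beta)=h_{(j|J)}s\otimes e^\beta$ for $(j|J)\ne(0|0)$, and the operator $e^\alpha$ is multiplication by $|0\rangle\otimes e^\alpha$, that is, $e^\alpha(s\otimes x)=(-1)^{p(s)(\alpha,\alpha)}s\otimes e^\alpha x$. Define superfields on $V_Q$ by $$\Gamma_\alpha(Z)=e^\alpha Z^{\alpha_{(0|0)}|0}\Bigl(1+\sum_{j\in\mathbb Z}Z^{-1-j|1}\alpha_{(j|1)}\Bigr)\exp\Bigl(-\sum_{j<0}\tfrac{Z^{-j|0}}{j}\alpha_{(j|0)}\Bigr)\exp\Bigl(-\sum_{j>0}\tfrac{Z^{-j|0}}{j}\alpha_{(j|0)}\Bigr)\tag{1}$$ and $$\begin{aligned}\Gamma_{\alpha,\beta}(Z,W)={}&e^{\alpha+\beta}Z^{\alpha_{(0|0)}|0}W^{\beta_{(0|0)}|0}\exp\Bigl(\sum_{j<0}Z^{-1-j|1}\alpha_{(j|1)}+W^{-1-j|1}\beta_{(j|1)}\Bigr)\exp\Bigl(-\sum_{j<0}\tfrac{Z^{-j|0}}{j}\alpha_{(j|0)}+\tfrac{W^{-j|0}}{j}\beta_{(j|0)}\Bigr)\\&\times\exp\Bigl(-\sum_{j>0}\tfrac{Z^{-j|0}}{j}\alpha_{(j|0)}+\tfrac{W^{-j|0}}{j}\beta_{(j|0)}\Bigr)\exp\Bigl(\sum_{j\ge0}Z^{-1-j|1}\alpha_{(j|1)}+W^{-1-j|1}\beta_{(j|1)}\Bigr).\end{aligned}$$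 Consider the condition $$\varepsilon(\alpha,\beta)=(-1)^{(\alpha,\beta)+(\alpha,\alpha)(\beta,\beta)}\,\varepsilon(\beta,\alpha),\tag{2}$$ the $\Lambda$-brackets $$[h_\Lambda h']=(h,h')\chi,\qquad[h_\Lambda e^\beta]=(h,\beta)e^\beta\qquad(h,h'\in\mathfrak h,\ \beta\in Q),\tag{3}$$ the requirement that $$\text{for }h\in\mathfrak h\text{ and }j<0\text{ the modes of }Y(h,Z)\text{ are the operators }h_{(j|J)}\text{ above},\tag{4}$$ and the normalization $$\text{the coefficient of }z^{(\alpha,\beta)}\theta^0\text{ in }Y(e^\alpha,Z)e^\beta\text{ is the product }e^\alpha e^\beta\text{ of }\mathbb C_\varepsilon[Q],\text{ for all }\alpha,\beta\in Q.\tag{5}$$ **Theorem.** There exist $2$-cocycles $\varepsilon$ that satisfy (2) for all $\alpha,\beta\in Q$. For every $\mathbb C^\times$-valued $2$-cocycle $\varepsilon$ on $Q$ the following hold. 1. (Existence and uniqueness) If (2) holds for all $\alpha,\beta\in Q$, there is an $N_K=1$ SUSY vertex algebra structure on $V_Q$ satisfying (3), (4) and (5). In it all modes of $Y(h,Z)$,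 $h\in\mathfrak h$, are the operators $h_{(j|J)}$ above. It is the only structure on $V_Q$ satisfying (3), (4) and (5). 2. (Form of the superfields) In every $N_K=1$ SUSY vertex algebra structure on $V_Q$ satisfying (3) and (4), all modes of $Y(h,Z)$ are the operators $h_{(j|J)}$ above, and there are constants $c_{\alpha,\beta}\in\mathbb C$ with $c_{\alpha,0}=1$ such that $Y(e^\alpha,Z)$ is given on $V^1(W)\otimes e^\beta$ by $c_{\alpha,\beta}\Gamma_\alpha(Z)$, for all $\alpha,\beta\in Q$. If (5) holds too, then $Y(e^\alpha,Z)=\Gamma_\alpha(Z)$ for all $\alpha\in Q$, and (2) holds for all $\alpha,\beta\in Q$. 3. (Locality) For all $\alpha,\beta\in Q$, the superfields $\Gamma_\alpha$ and $\Gamma_\beta$, of parity $(\alpha,\alpha)$ and $(\beta,\beta)$ modulo $2$, are mutually local if and only if (2) holds for $\alpha,\beta$. 4. (Commutators) If (2) holds for $\alpha,\beta$, then $$[\Gamma_\alpha(Z),\Gamma_\beta(W)]=\begin{cases}0,&(\alpha,\beta)\ge0,\\ \varepsilon(\alpha,\beta)\bigl(D_W^{(-1-(\alpha,\beta)|1)}\delta(Z,W)\bigr)\Gamma_{\alpha,\beta}(Z,W),&(\alpha,\beta)<0.\end{cases}$$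 -/

import Mathlib

open scoped TensorProduct

noncomputable section

namespace SUSY

/-! ### Formal superdistributions

`Z = (z, θ)` and `W = (w, ζ)` are pairs of formal variables, with `z, w` even and `θ, ζ` odd.
A superspace is a complex vector space with an involution `σ` (`σ v = (-1)^p v` on vectors of
parity `p`).  Moving an odd variable past an operator `A` replaces `A` by `σ A σ`. -/

section Series

variable {V : Type*} [AddCommGroup V] [Module ℂ V]

/-- Formal distributions in `Z`: `a n I` is the coefficient of `z^n θ^I` (written on the left). -/
abbrev Series (X : Type*) := ℤ → Fin 2 → X

/-- Formal distributions in `Z` and `W`: `f (m, n) (I, K)` is the coefficient of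
`z^m w^n θ^I ζ^K` (written on the left, in this order). -/
abbrev BiSeries (X : Type*) := ℤ × ℤ → Fin 2 × Fin 2 → X

/-- A distribution in `Z` viewed as a distribution in `Z` and `W`. -/
def inZ {X : Type*} [Zero X] (a : Series X) : BiSeries X :=
  fun n I => if n.2 = 0 ∧ I.2 = 0 then a n.1 I.1 else 0

/-- The distribution in `W` obtained by substituting `W` for `Z`, as a distribution in `Z`, `W`. -/
def inW {X : Type*} [Zero X] (a : Series X) : BiSeries X :=
  fun n I => if n.1 = 0 ∧ I.1 = 0 then a n.2 I.2 else 0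

/-- Constant series. -/
def const {X : Type*} [Zero X] (x : X) : Series X :=
  fun n I => if n = 0 ∧ I = 0 then x else 0

/-- The product `A(Z,W) f(Z,W)` of an operator valued and a vector valued distribution, with the
Koszul signs: `θ^I ζ^K A θ^I' ζ^K' f = (-1)^(K I') θ^(I+I') ζ^(K+K') (σ^(I'+K') A σ^(I'+K')) f`.
(The sums over the exponents of `z, w` are meant to have finitely many nonzero terms.) -/
def act (σ : Module.End ℂ V) (A : BiSeries (Module.End ℂ V)) (f : BiSeries V) : BiSeries V :=
  fun n L => ∑ I ∈ Finset.Iic L,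
    (-1 : ℂ) ^ ((I.2 : ℕ) * ((L - I).1 : ℕ)) •
      ∑ᶠ k : ℤ × ℤ,
        (σ ^ (((L - I).1 : ℕ) + ((L - I).2 : ℕ)) * A k I *
          σ ^ (((L - I).1 : ℕ) + ((L - I).2 : ℕ))) (f (n - k) (L - I))

/-- `exp(A(Z,W)) f(Z,W) = ∑ₘ A(Z,W)^m f(Z,W) / m!`. -/
def expAct (σ : Module.End ℂ V) (A : BiSeries (Module.End ℂ V)) (f : BiSeries V) : BiSeries V :=
  fun n L => ∑ᶠ m : ℕ, ((m.factorial : ℂ)⁻¹) • ((act σ A)^[m] f) n L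

/-- `a(Z) b(W) v`. -/
def mulZW (σ : Module.End ℂ V) (a b : Series (V → V)) (v : V) : BiSeries V :=
  fun n I => (σ ^ (I.2 : ℕ)) (a n.1 I.1 ((σ ^ (I.2 : ℕ)) (b n.2 I.2 v)))

/-- `b(W) a(Z) v`. -/
def mulWZ (σ : Module.End ℂ V) (a b : Series (V → V)) (v : V) : BiSeries V :=
  fun n I => (-1 : ℂ) ^ ((I.1 : ℕ) * (I.2 : ℕ)) •
    (σ ^ (I.1 : ℕ)) (b n.2 I.2 ((σ ^ (I.1 : ℕ)) (a n.1 I.1 v)))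

/-- The supercommutator `[a(Z), b(W)] v`, for superfields `a`, `b` of parity `p`, `q`. -/
def bracket (σ : Module.End ℂ V) (p q : ℤ) (a b : Series (V → V)) (v : V) : BiSeries V :=
  fun n I => mulZW σ a b v n I - (-1 : ℂ) ^ (p * q) • mulWZ σ a b v n I

/-- Multiplication by `z - w`. -/
def mulSub (f : BiSeries V) : BiSeries V :=
  fun n I => f (n.1 - 1, n.2) I - f (n.1, n.2 - 1) I

/-- `(z - w)^N [a(Z), b(W)] = 0` for some `N`. -/
def MutuallyLocal (σ : Module.End ℂ V) (p q : ℤ) (a b : Series (V → V)) : Prop :=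
  ∃ N : ℕ, ∀ v n I, (mulSub^[N] (bracket σ p q a b v)) n I = 0

/-- The underlying maps of an operator valued distribution. -/
def toFuns (a : Series (Module.End ℂ V)) : Series (V → V) := fun n I v => a n I v

/-- `(∂_θ - θ ∂_z) a(Z)`. -/
def dBar (a : Series (Module.End ℂ V)) : Series (Module.End ℂ V) :=
  fun n I => if I = 0 then a n 1 else -(((n + 1 : ℤ) : ℂ) • a (n + 1) 0)

end Series

/-! ### `N_K = 1` SUSY vertex algebras -/

/-- An `N_K = 1` SUSY vertex algebra structure on the superspace `(V, σ)` with vacuum `vac`.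
`Y a n I` is the coefficient of `z^n θ^I` in the superfield `Y(a, Z)`. -/
@[ext]
structure SUSYVertexAlgebra (V : Type*) [AddCommGroup V] [Module ℂ V]
    (σ : Module.End ℂ V) (vac : V) where
  /-- The odd translation operator. -/
  S : Module.End ℂ V
  /-- The state-superfield correspondence. -/
  Y : V →ₗ[ℂ] Series (Module.End ℂ V)
  sigma_sq : σ * σ = 1
  vac_even : σ vac = vac
  S_odd : σ * S = -(S * σ)
  Y_parity : ∀ (p : ℤ) (a : V), σ a = (-1 : ℂ) ^ p • a → ∀ n (I : Fin 2),
    σ * Y a n I = (-1 : ℂ) ^ (p + ((I : ℕ) : ℤ)) • (Y a n I * σ)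
  field : ∀ a v : V, ∃ N : ℤ, ∀ n < N, ∀ I, Y a n I v = 0
  Y_vac : Y vac = const 1
  S_vac : S vac = 0
  Y_apply_vac_neg : ∀ a n I, n < 0 → Y a n I vac = 0
  Y_apply_vac : ∀ a, Y a 0 0 vac = a
  /-- `[S, Y(a, Z)] = (∂_θ - θ ∂_z) Y(a, Z)`. -/
  translation : ∀ (p : ℤ) (a : V), σ a = (-1 : ℂ) ^ p • a → ∀ n (I : Fin 2),
    (-1 : ℂ) ^ (I : ℕ) • (S * Y a n I) - (-1 : ℂ) ^ p • (Y a n I * S) = dBar (Y a) n I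
  locality : ∀ (p q : ℤ) (a b : V), σ a = (-1 : ℂ) ^ p • a → σ b = (-1 : ℂ) ^ q • b →
    MutuallyLocal σ p q (toFuns (Y a)) (toFuns (Y b))

namespace SUSYVertexAlgebra

variable {V : Type*} [AddCommGroup V] [Module ℂ V] {σ : Module.End ℂ V} {vac : V}

/-- The mode `a_(j|J)`, where `Y(a, Z) = ∑ Z^(-1-j|1-J) a_(j|J)`. -/
def mode (𝒱 : SUSYVertexAlgebra V σ vac) (a : V) (j : ℤ) (J : Fin 2) : Module.End ℂ V :=
  𝒱.Y a (-1 - j) (1 - J)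

/-- The `Λ`-bracket `[a_Λ b] = ∑_{j ≥ 0} (λ^j / j!) (a_(j|0) b + χ a_(j|1) b)`, given by its
coefficients of `λ^j χ^J`. -/
def lambdaBracket (𝒱 : SUSYVertexAlgebra V σ vac) (a b : V) : ℕ → Fin 2 → V :=
  fun j J => ((j.factorial : ℂ)⁻¹) • 𝒱.mode a j J b

end SUSYVertexAlgebra

/-! ### The space `V^1(W) ⊗ ℂ_ε[Q]` -/

section Lattice

/-- The derivation of the symmetric algebra extending a linear form. -/
def symDeriv {M : Type*} [AddCommGroup M] [Module ℂ M] (φ : Module.Dual ℂ M) :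
    Module.End ℂ (SymmetricAlgebra ℂ M) :=
  (TrivSqZeroExt.sndHom (SymmetricAlgebra ℂ M) (SymmetricAlgebra ℂ M)).restrictScalars ℂ ∘ₗ
    (SymmetricAlgebra.lift
      ((TrivSqZeroExt.inlAlgHom ℂ (SymmetricAlgebra ℂ M) (SymmetricAlgebra ℂ M)).toLinearMap ∘ₗ
          SymmetricAlgebra.ι ℂ M +
        (TrivSqZeroExt.inrHom (SymmetricAlgebra ℂ M) (SymmetricAlgebra ℂ M)).restrictScalars ℂ ∘ₗ
          Algebra.linearMap ℂ (SymmetricAlgebra ℂ M) ∘ₗ φ)).toLinearMap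

variable (Q : Type*) [AddCommGroup Q]

/-- `𝔥 = ℂ ⊗ Q`. -/
abbrev Hsp := ℂ ⊗[ℤ] Q

/-- `⨁_{n ≥ 0} 𝔥 t^(-1-n)`. -/
abbrev NegModes := ℕ →₀ Hsp Q

/-- `V^1(W)`, `W = Π𝔥`, in its Fock space realization: the symmetric algebra on the creation
operators `h_(-1-n|0)` (even) tensor the exterior algebra on the `h_(-1-n|1)` (odd). -/
def Fock := SymmetricAlgebra ℂ (NegModes Q) ⊗[ℂ] ExteriorAlgebra ℂ (NegModes Q)

instance : AddCommGroup (Fock Q) :=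
  inferInstanceAs
    (AddCommGroup (SymmetricAlgebra ℂ (NegModes Q) ⊗[ℂ] ExteriorAlgebra ℂ (NegModes Q)))

instance : Module ℂ (Fock Q) :=
  inferInstanceAs
    (Module ℂ (SymmetricAlgebra ℂ (NegModes Q) ⊗[ℂ] ExteriorAlgebra ℂ (NegModes Q)))

/-- The underlying space of `V^1(W) ⊗ ℂ_ε[Q]`; `e^α` is `Finsupp.single α 1`. -/
abbrev VQ := Fock Q ⊗[ℂ] (Q →₀ ℂ)

variable {Q}

/-- `α ∈ Q` as an element of `𝔥`. -/
def toH (α : Q) : Hsp Q := (1 : ℂ) ⊗ₜ[ℤ] α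

/-- The element `x ⊗ y` of the Fock space. -/
def fockMk (x : SymmetricAlgebra ℂ (NegModes Q)) (y : ExteriorAlgebra ℂ (NegModes Q)) : Fock Q :=
  x ⊗ₜ[ℂ] y

/-- The operator `f ⊗ 1` on the Fock space. -/
def fockLeft (f : Module.End ℂ (SymmetricAlgebra ℂ (NegModes Q))) : Module.End ℂ (Fock Q) :=
  LinearMap.rTensor (ExteriorAlgebra ℂ (NegModes Q)) f

/-- The operator `1 ⊗ g` on the Fock space. -/
def fockRight (g : Module.End ℂ (ExteriorAlgebra ℂ (NegModes Q))) : Module.End ℂ (Fock Q) :=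
  LinearMap.lTensor (SymmetricAlgebra ℂ (NegModes Q)) g

/-- The parity of `V^1(W)`. -/
def fockParity : Module.End ℂ (Fock Q) :=
  fockRight
    (CliffordAlgebra.involute (Q := (0 : QuadraticForm ℂ (NegModes Q)))).toLinearMap

/-- `e^β ↦ c β e^β`. -/
def diag (c : Q → ℂ) : Module.End ℂ (Q →₀ ℂ) :=
  Finsupp.lsum ℂ fun β => c β • Finsupp.lsingle β

/-- The multiplication `e^α e^β = ε(α,β) e^(α+β)` of `ℂ_ε[Q]`. -/
def twMul (ε : Q → Q → ℂ) : (Q →₀ ℂ) →ₗ[ℂ] (Q →₀ ℂ) →ₗ[ℂ] (Q →₀ ℂ) :=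
  Finsupp.lsum ℂ fun α => LinearMap.toSpanSingleton ℂ _
    (Finsupp.lsum ℂ fun β => ε α β • Finsupp.lsingle (α + β))

variable (B : LinearMap.BilinForm ℤ Q)

/-- The bilinear extension of the form to `𝔥`. -/
def formC : LinearMap.BilinForm ℂ (Hsp Q) := B.baseChange ℂ

/-- The linear form `h' t^(-1-m) ↦ δ_{mn} (h, h')`. -/
def pairing (n : ℕ) (h : Hsp Q) : Module.Dual ℂ (NegModes Q) :=
  formC B h ∘ₗ Finsupp.lapply n

/-- The operators `h_(j|J)` on `V^1(W)`. They satisfy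
`[h_(j|0), h'_(k|0)] = j (h, h') δ_{j,-k}`, `[h_(j|1), h'_(k|1)] = (h, h') δ_{j+k,-1}`. -/
def fockOp (h : Hsp Q) (j : ℤ) (J : Fin 2) : Module.End ℂ (Fock Q) :=
  if J = 0 then
    if j < 0 then
      fockLeft (LinearMap.mulLeft ℂ
        (SymmetricAlgebra.ι ℂ (NegModes Q) (Finsupp.single (-1 - j).toNat h)))
    else (j : ℂ) • fockLeft (symDeriv (pairing B (j - 1).toNat h))
  else
    if j < 0 then
      fockRight (LinearMap.mulLeft ℂ
        (ExteriorAlgebra.ι ℂ (Finsupp.single (-1 - j).toNat h)))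
    else fockRight (CliffordAlgebra.contractLeft
        (Q := (0 : QuadraticForm ℂ (NegModes Q))) (pairing B j.toNat h))

/-- The operators `h_(j|J)` on `V^1(W) ⊗ ℂ_ε[Q]`: `h_(0|0) (s ⊗ e^β) = (h, β) s ⊗ e^β`, and
`h_(j|J) (s ⊗ e^β) = h_(j|J) s ⊗ e^β` for `(j|J) ≠ (0|0)`. -/
def hOp (h : Hsp Q) (j : ℤ) (J : Fin 2) : Module.End ℂ (VQ Q) :=
  if j = 0 ∧ J = 0 then LinearMap.lTensor _ (diag fun β => formC B h (toH β))
  else LinearMap.rTensor _ (fockOp B h j J)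

/-- The parity of `V^1(W) ⊗ ℂ_ε[Q]`, where `e^β` has the parity of `(β, β)`. -/
def parity : Module.End ℂ (VQ Q) :=
  TensorProduct.map fockParity (diag fun β => (-1 : ℂ) ^ (B β β))

/-- The operator of multiplication by `1 ⊗ e^α`:
`e^α (s ⊗ x) = (-1)^{p(s) (α,α)} s ⊗ e^α x`. -/
def eOp (ε : Q → Q → ℂ) (α : Q) : Module.End ℂ (VQ Q) :=
  TensorProduct.map (fockParity ^ (B α α).natAbs) (twMul ε (Finsupp.single α 1))

/-- The state `1 ⊗ e^α`. -/
def eState (α : Q) : VQ Q := fockMk 1 1 ⊗ₜ[ℂ] Finsupp.single α 1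

/-- The unit `ε(0,0)⁻¹ e^0` of `ℂ_ε[Q]`. -/
def twOne (ε : Q → Q → ℂ) : Q →₀ ℂ := (ε 0 0)⁻¹ • Finsupp.single 0 1

/-- The vacuum `|0⟩ ⊗ 1`. -/
def vacuum (ε : Q → Q → ℂ) : VQ Q := fockMk 1 1 ⊗ₜ[ℂ] twOne ε

/-- The state `h = h_(-1|1) |0⟩ ⊗ 1`. -/
def hState (ε : Q → Q → ℂ) (h : Hsp Q) : VQ Q :=
  fockMk 1 (ExteriorAlgebra.ι ℂ (Finsupp.single 0 h)) ⊗ₜ[ℂ] twOne ε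

/-! ### Vertex operators -/

/-- `∑_j Z^(-1-j|1) α_(j|1)`. -/
def oddAll (α : Q) : Series (Module.End ℂ (VQ Q)) :=
  fun n I => if I = 1 then hOp B (toH α) (-1 - n) 1 else 0

/-- `∑_{j < 0} Z^(-1-j|1) α_(j|1)`. -/
def oddCre (α : Q) : Series (Module.End ℂ (VQ Q)) :=
  fun n I => if 0 ≤ n then oddAll B α n I else 0

/-- `∑_{j ≥ 0} Z^(-1-j|1) α_(j|1)`. -/
def oddAnn (α : Q) : Series (Module.End ℂ (VQ Q)) :=
  fun n I => if n < 0 then oddAll B α n I else 0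

/-- `- ∑_{j < 0} (Z^(-j|0) / j) α_(j|0)`. -/
def bosCre (α : Q) : Series (Module.End ℂ (VQ Q)) :=
  fun n I => if 0 < n ∧ I = 0 then -(((-n : ℤ) : ℂ)⁻¹ • hOp B (toH α) (-n) 0) else 0

/-- `- ∑_{j > 0} (Z^(-j|0) / j) α_(j|0)`. -/
def bosAnn (α : Q) : Series (Module.End ℂ (VQ Q)) :=
  fun n I => if n < 0 ∧ I = 0 then -(((-n : ℤ) : ℂ)⁻¹ • hOp B (toH α) (-n) 0) else 0

/-- `Z^(α_(0|0)|0)`, that is, `s ⊗ e^β ↦ z^(α,β) s ⊗ e^β`. -/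
def zPow (α : Q) : Series (Module.End ℂ (VQ Q)) :=
  fun n I => if I = 0 then LinearMap.lTensor _ (diag fun β => if B α β = n then 1 else 0) else 0

/-- `e^α Z^(α_(0|0)|0) (1 + ∑_j Z^(-1-j|1) α_(j|1)) exp(- ∑_{j<0} (Z^(-j|0)/j) α_(j|0))
exp(- ∑_{j>0} (Z^(-j|0)/j) α_(j|0)) v`. -/
def gammaSeries (ε : Q → Q → ℂ) (α : Q) (v : VQ Q) : BiSeries (VQ Q) :=
  act (parity B) (inZ (const (eOp B ε α))) <|
  act (parity B) (inZ (zPow B α)) <|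
  act (parity B) (inZ (const 1 + oddAll B α)) <|
  expAct (parity B) (inZ (bosCre B α)) <|
  expAct (parity B) (inZ (bosAnn B α)) <|
  inZ (const v)

/-- The superfield `Γ_α(Z)`. -/
def Gam (ε : Q → Q → ℂ) (α : Q) : Series (VQ Q → VQ Q) :=
  fun n I v => gammaSeries B ε α v (n, 0) (I, 0)

/-- `Γ_{α,β}(Z, W) v`. -/
def Gam₂ (ε : Q → Q → ℂ) (α β : Q) (v : VQ Q) : BiSeries (VQ Q) :=
  act (parity B) (inZ (const (eOp B ε (α + β)))) <|
  act (parity B) (inZ (zPow B α)) <|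
  act (parity B) (inW (zPow B β)) <|
  expAct (parity B) (inZ (oddCre B α) + inW (oddCre B β)) <|
  expAct (parity B) (inZ (bosCre B α) + inW (bosCre B β)) <|
  expAct (parity B) (inZ (bosAnn B α) + inW (bosAnn B β)) <|
  expAct (parity B) (inZ (oddAnn B α) + inW (oddAnn B β)) <|
  inZ (const v)

/-- `δ(Z, W) = (θ - ζ) ∑_n z^(-n-1) w^n`. -/
def delta : BiSeries ℂ := fun n I =>
  if n.1 + n.2 = -1 then
    if I = (1, 0) then 1 else if I = (0, 1) then -1 else 0
  else 0

/-- `∂_w`. -/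
def dw (f : BiSeries ℂ) : BiSeries ℂ := fun n I => ((n.2 + 1 : ℤ) : ℂ) * f (n.1, n.2 + 1) I

/-- `D_W = ∂_ζ + ζ ∂_w`. -/
def DW (f : BiSeries ℂ) : BiSeries ℂ := fun n I =>
  (-1 : ℂ) ^ (I.1 : ℕ) * (if I.2 = 0 then f n (I.1, 1) else dw f n (I.1, 0))

/-- `D_W^(j|1) = - (1/j!) ∂_w^j D_W`. -/
def DWdiv (j : ℕ) (f : BiSeries ℂ) : BiSeries ℂ := fun n I =>
  -((j.factorial : ℂ)⁻¹ * (dw^[j] (DW f)) n I)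

/-- A scalar distribution as an operator valued one. -/
def scalarOp (f : BiSeries ℂ) : BiSeries (Module.End ℂ (VQ Q)) := fun n I => f n I • 1

end Lattice

section Cocycle

variable {Q : Type*} [AddCommGroup Q]

/-- `ε` is a `ℂ^×`-valued 2-cocycle, that is, `ℂ_ε[Q]` is associative. -/
def IsTwoCocycle (ε : Q → Q → ℂˣ) : Prop :=
  ∀ α β γ, ε α β * ε (α + β) γ = ε β γ * ε α (β + γ)

/-- `ε` as a complex valued function. -/
def val (ε : Q → Q → ℂˣ) : Q → Q → ℂ := fun α β => ε α β

/-- `ε(α,β) = (-1)^{(α,β) + (α,α)(β,β)} ε(β,α)`. -/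
def SignRule (B : LinearMap.BilinForm ℤ Q) (ε : Q → Q → ℂˣ) (α β : Q) : Prop :=
  ε α β = (-1) ^ (B α β + B α α * B β β) * ε β α

variable (B : LinearMap.BilinForm ℤ Q) (ε : Q → Q → ℂˣ)

/-- `N_K = 1` SUSY vertex algebra structures on `V^1(W) ⊗ ℂ_ε[Q]` with vacuum `|0⟩ ⊗ 1`. -/
abbrev Str := SUSYVertexAlgebra (VQ Q) (parity B) (vacuum (val ε))

variable {B ε}

/-- The modes `h_(j|J)`, `j < 0`, of the superfields `h(Z)`, `h ∈ W`, act on the first factor of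
`V^1(W) ⊗ ℂ_ε[Q]`, as on `V^1(W)`. -/
def Str.Creation (𝒱 : Str B ε) : Prop :=
  ∀ h (j : ℤ) J, j < 0 → SUSYVertexAlgebra.mode 𝒱 (hState (val ε) h) j J = hOp B h j J

/-- All modes of the superfields `h(Z)`, `h ∈ W`, are the operators `h_(j|J)` above. -/
def Str.Extends (𝒱 : Str B ε) : Prop :=
  ∀ h j J, SUSYVertexAlgebra.mode 𝒱 (hState (val ε) h) j J = hOp B h j J

/-- The coefficient of `z^(α,β)` in `Y(e^α, Z) e^β` is the product `e^α e^β` of `ℂ_ε[Q]`. -/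
def Str.Normalized (𝒱 : Str B ε) : Prop :=
  ∀ α β, SUSYVertexAlgebra.mode 𝒱 (eState α) (-1 - B α β) 1 (eState β) =
    fockMk 1 1 ⊗ₜ[ℂ] twMul (val ε) (Finsupp.single α 1) (Finsupp.single β 1)

/-- `[h_Λ h'] = (h, h') χ` and `[h_Λ e^β] = (h, β) e^β`. -/
def Str.HasBrackets (𝒱 : Str B ε) : Prop :=
  (∀ h h' : Hsp Q, SUSYVertexAlgebra.lambdaBracket 𝒱 (hState (val ε) h) (hState (val ε) h') =
    fun j J => if j = 0 ∧ J = 1 then formC B h h' • vacuum (val ε) else 0) ∧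
  (∀ (h : Hsp Q) (β : Q), SUSYVertexAlgebra.lambdaBracket 𝒱 (hState (val ε) h) (eState β) =
    fun j J => if j = 0 ∧ J = 0 then formC B h (toH β) • eState β else 0)

end Cocycle

end SUSY

end

open scoped TensorProduct

set_option linter.unusedSectionVars false

noncomputable section

namespace SUSY

/-! ### Derivations of the symmetric algebra -/

section SymDeriv

variable {M : Type*} [AddCommGroup M] [Module ℂ M]

/-- The algebra homomorphism `x ↦ x + ε D x` whose second component is `symDeriv`. -/
def symDerivHom (φ : Module.Dual ℂ M) :
    SymmetricAlgebra ℂ M →ₐ[ℂ] TrivSqZeroExt (SymmetricAlgebra ℂ M) (SymmetricAlgebra ℂ M) :=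
  SymmetricAlgebra.lift
      ((TrivSqZeroExt.inlAlgHom ℂ (SymmetricAlgebra ℂ M) (SymmetricAlgebra ℂ M)).toLinearMap ∘ₗ
          SymmetricAlgebra.ι ℂ M +
        (TrivSqZeroExt.inrHom (SymmetricAlgebra ℂ M) (SymmetricAlgebra ℂ M)).restrictScalars ℂ ∘ₗ
          Algebra.linearMap ℂ (SymmetricAlgebra ℂ M) ∘ₗ φ)

theorem symDeriv_apply (φ : Module.Dual ℂ M) (x : SymmetricAlgebra ℂ M) :
    symDeriv φ x = (symDerivHom φ x).snd := rfl

theorem fst_symDerivHom (φ : Module.Dual ℂ M) (x : SymmetricAlgebra ℂ M) :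
    (symDerivHom φ x).fst = x := by
  have : ((TrivSqZeroExt.fstHom ℂ (SymmetricAlgebra ℂ M) (SymmetricAlgebra ℂ M)).comp
      (symDerivHom φ)) = AlgHom.id ℂ _ := by
    ext m
    simp [symDerivHom]
  exact DFunLike.congr_fun this x

theorem symDeriv_mul (φ : Module.Dual ℂ M) (x y : SymmetricAlgebra ℂ M) :
    symDeriv φ (x * y) = x * symDeriv φ y + symDeriv φ x * y := by
  simp only [symDeriv_apply, map_mul, TrivSqZeroExt.snd_mul, fst_symDerivHom]
  simp [mul_comm]

theorem symDeriv_ι (φ : Module.Dual ℂ M) (m : M) :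
    symDeriv φ (SymmetricAlgebra.ι ℂ M m) = algebraMap ℂ _ (φ m) := by
  simp [symDeriv_apply, symDerivHom, Algebra.algebraMap_eq_smul_one]

theorem symDeriv_algebraMap (φ : Module.Dual ℂ M) (r : ℂ) :
    symDeriv φ (algebraMap ℂ (SymmetricAlgebra ℂ M) r) = 0 := by
  rw [symDeriv_apply, AlgHom.commutes]
  rfl

theorem symDeriv_one (φ : Module.Dual ℂ M) : symDeriv φ (1 : SymmetricAlgebra ℂ M) = 0 := by
  simpa using symDeriv_algebraMap φ 1

theorem symDeriv_comm (φ ψ : Module.Dual ℂ M) (x : SymmetricAlgebra ℂ M) :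
    symDeriv φ (symDeriv ψ x) = symDeriv ψ (symDeriv φ x) := by
  induction x using SymmetricAlgebra.induction with
  | algebraMap r => simp [symDeriv_algebraMap]
  | ι m => simp [symDeriv_ι, symDeriv_algebraMap]
  | mul a b ha hb =>
    simp only [symDeriv_mul, map_add, ha, hb]
    ring
  | add a b ha hb => simp [ha, hb]

theorem symDeriv_add_form (φ ψ : Module.Dual ℂ M) :
    symDeriv (φ + ψ) = symDeriv φ + symDeriv ψ := by
  ext x
  induction x using SymmetricAlgebra.induction with
  | algebraMap r => simp [symDeriv_algebraMap]
  | ι m => simp [symDeriv_ι]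
  | mul a b ha hb =>
    simp only [symDeriv_mul, ha, hb, LinearMap.add_apply]
    ring
  | add a b ha hb => simp only [map_add, ha, hb]

theorem symDeriv_smul_form (c : ℂ) (φ : Module.Dual ℂ M) :
    symDeriv (c • φ) = c • symDeriv φ := by
  ext x
  induction x using SymmetricAlgebra.induction with
  | algebraMap r => simp [symDeriv_algebraMap]
  | ι m => simp [symDeriv_ι, Algebra.smul_def]
  | mul a b ha hb =>
    simp only [symDeriv_mul, ha, hb, LinearMap.smul_apply, smul_add, mul_smul_comm, smul_mul_assoc]
  | add a b ha hb => simp only [map_add, ha, hb]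

/-- A submodule of the symmetric algebra that contains `1` and is stable under multiplication by
generators is everything. -/
theorem symmetricAlgebra_left_induction {P : SymmetricAlgebra ℂ M → Prop}
    (one : P 1) (smul : ∀ (c : ℂ) x, P x → P (c • x)) (add : ∀ x y, P x → P y → P (x + y))
    (ι_mul : ∀ m x, P x → P (SymmetricAlgebra.ι ℂ M m * x)) (x : SymmetricAlgebra ℂ M) : P x := by
  have key : ∀ x y : SymmetricAlgebra ℂ M, P y → P (x * y) := by
    intro x
    induction x using SymmetricAlgebra.induction with
    | algebraMap r => intro y hy; rw [← Algebra.smul_def]; exact smul _ _ hy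
    | ι m => exact fun y hy => ι_mul m y hy
    | mul a b ha hb => intro y hy; rw [mul_assoc]; exact ha _ (hb _ hy)
    | add a b ha hb => intro y hy; rw [add_mul]; exact add _ _ (ha _ hy) (hb _ hy)
  simpa using key x 1 one

theorem involute_contractLeft {q : QuadraticForm ℂ M} (d : Module.Dual ℂ M)
    (x : CliffordAlgebra q) :
    CliffordAlgebra.involute (CliffordAlgebra.contractLeft d x) =
      -CliffordAlgebra.contractLeft d (CliffordAlgebra.involute x) := by
  induction x using CliffordAlgebra.left_induction with
  | algebraMap r => simp
  | add x y hx hy => simp only [map_add, hx, hy, neg_add]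
  | ι_mul x m hx =>
    simp only [CliffordAlgebra.contractLeft_ι_mul, map_sub, map_smul, map_mul,
      CliffordAlgebra.involute_ι, hx, neg_mul, map_neg]
    simp

end SymDeriv

/-! ### The operators `h_(j|J)` on the Fock space -/

section Fock

variable {Q : Type*} [AddCommGroup Q]

theorem fock_ext {X : Type*} [AddCommGroup X] [Module ℂ X] {f g : Fock Q →ₗ[ℂ] X}
    (h : ∀ x y, f (fockMk x y) = g (fockMk x y)) : f = g :=
  TensorProduct.ext' h

@[simp] theorem fockLeft_mk (f x) (y : ExteriorAlgebra ℂ (NegModes Q)) :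
    fockLeft f (fockMk x y) = fockMk (f x) y := rfl

@[simp] theorem fockRight_mk (f y) (x : SymmetricAlgebra ℂ (NegModes Q)) :
    fockRight f (fockMk x y) = fockMk x (f y) := rfl

theorem fockMk_add_left (x x' : SymmetricAlgebra ℂ (NegModes Q)) (y) :
    fockMk (x + x') y = fockMk x y + fockMk x' y := TensorProduct.add_tmul x x' y

theorem fockMk_add_right (x : SymmetricAlgebra ℂ (NegModes Q)) (y y') :
    fockMk x (y + y') = fockMk x y + fockMk x y' := TensorProduct.tmul_add x y y'

theorem fockMk_smul_left (c : ℂ) (x : SymmetricAlgebra ℂ (NegModes Q)) (y) :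
    fockMk (c • x) y = c • fockMk x y := (TensorProduct.smul_tmul' c x y).symm

theorem fockMk_smul_right (c : ℂ) (x : SymmetricAlgebra ℂ (NegModes Q)) (y) :
    fockMk x (c • y) = c • fockMk x y := TensorProduct.tmul_smul c x y

theorem fockMk_neg_right (x : SymmetricAlgebra ℂ (NegModes Q)) (y) :
    fockMk x (-y) = -fockMk x y := TensorProduct.tmul_neg x y

theorem fockMk_zero_left (y) : fockMk (0 : SymmetricAlgebra ℂ (NegModes Q)) y = 0 :=
  TensorProduct.zero_tmul _ y

theorem fockMk_zero_right (x : SymmetricAlgebra ℂ (NegModes Q)) : fockMk x 0 = 0 :=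
  TensorProduct.tmul_zero _ x

theorem fockParity_mk (x : SymmetricAlgebra ℂ (NegModes Q)) (y) :
    fockParity (fockMk x y) = fockMk x (CliffordAlgebra.involute y) := rfl

theorem fockParity_mul_self : (fockParity : Module.End ℂ (Fock Q)) * fockParity = 1 := by
  refine fock_ext fun x y => ?_
  change fockMk x (CliffordAlgebra.involute (CliffordAlgebra.involute y)) = fockMk x y
  rw [CliffordAlgebra.involute_involute]

variable (B : LinearMap.BilinForm ℤ Q)

theorem pairing_apply (n m : ℕ) (h h' : Hsp Q) :
    pairing B n h (Finsupp.single m h') = if m = n then formC B h h' else 0 := by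
  simp only [pairing, LinearMap.comp_apply, Finsupp.lapply_apply, Finsupp.single_apply]
  split_ifs <;> simp

/-- Creation operators of even type. -/
def creB (n : ℕ) (h : Hsp Q) : Module.End ℂ (SymmetricAlgebra ℂ (NegModes Q)) :=
  LinearMap.mulLeft ℂ (SymmetricAlgebra.ι ℂ (NegModes Q) (Finsupp.single n h))

/-- Creation operators of odd type. -/
def creF (n : ℕ) (h : Hsp Q) : Module.End ℂ (ExteriorAlgebra ℂ (NegModes Q)) :=
  LinearMap.mulLeft ℂ (ExteriorAlgebra.ι ℂ (Finsupp.single n h))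

/-- Annihilation operators of odd type. -/
def annF (n : ℕ) (h : Hsp Q) : Module.End ℂ (ExteriorAlgebra ℂ (NegModes Q)) :=
  CliffordAlgebra.contractLeft (Q := (0 : QuadraticForm ℂ (NegModes Q))) (pairing B n h)

theorem annF_creF (n m : ℕ) (h h' : Hsp Q) (y) :
    annF B n h (creF m h' y) = (if m = n then formC B h h' else 0) • y - creF m h' (annF B n h y) := by
  have := CliffordAlgebra.contractLeft_ι_mul (Q := (0 : QuadraticForm ℂ (NegModes Q)))
    (d := pairing B n h) (Finsupp.single m h') y
  rw [pairing_apply] at this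
  exact this

theorem annF_annF (n m : ℕ) (h h' : Hsp Q) (y) :
    annF B n h (annF B m h' y) = - annF B m h' (annF B n h y) :=
  CliffordAlgebra.contractLeft_comm (Q := (0 : QuadraticForm ℂ (NegModes Q))) _ _ y

theorem creF_creF (n m : ℕ) (h h' : Hsp Q) (y) :
    creF n h (creF m h' y) = - creF m h' (creF n h y) := by
  simp only [creF, LinearMap.mulLeft_apply, ← mul_assoc]
  rw [eq_neg_of_add_eq_zero_left (ExteriorAlgebra.ι_add_mul_swap _ _), neg_mul]

theorem symDeriv_creB (n m : ℕ) (h h' : Hsp Q) (x) :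
    symDeriv (pairing B n h) (creB m h' x) =
      (if m = n then formC B h h' else 0) • x + creB m h' (symDeriv (pairing B n h) x) := by
  simp only [creB, LinearMap.mulLeft_apply, symDeriv_mul, symDeriv_ι, pairing_apply,
    Algebra.smul_def]
  ring

theorem fockOp_even_neg (h : Hsp Q) {j : ℤ} (hj : j < 0) :
    fockOp B h j 0 = fockLeft (creB (-1 - j).toNat h) := by simp [fockOp, hj, creB]

theorem fockOp_even_nonneg (h : Hsp Q) {j : ℤ} (hj : 0 ≤ j) :
    fockOp B h j 0 = (j : ℂ) • fockLeft (symDeriv (pairing B (j - 1).toNat h)) := by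
  simp [fockOp, not_lt.mpr hj]

theorem fockOp_odd_neg (h : Hsp Q) {j : ℤ} (hj : j < 0) :
    fockOp B h j 1 = fockRight (creF (-1 - j).toNat h) := by simp [fockOp, hj, creF]

theorem fockOp_odd_nonneg (h : Hsp Q) {j : ℤ} (hj : 0 ≤ j) :
    fockOp B h j 1 = fockRight (annF B j.toNat h) := by
  simp [fockOp, not_lt.mpr hj, annF]

theorem exists_fockOp_even (h : Hsp Q) (j : ℤ) : ∃ f, fockOp B h j 0 = fockLeft f := by
  by_cases hj : j < 0
  · exact ⟨_, fockOp_even_neg B h hj⟩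
  · refine ⟨(j : ℂ) • symDeriv (pairing B (j - 1).toNat h), ?_⟩
    rw [fockOp_even_nonneg B h (not_lt.mp hj)]
    exact (LinearMap.rTensor_smul _ _ _).symm

theorem exists_fockOp_odd (h : Hsp Q) (j : ℤ) : ∃ f, fockOp B h j 1 = fockRight f := by
  by_cases hj : j < 0
  · exact ⟨_, fockOp_odd_neg B h hj⟩
  · exact ⟨_, fockOp_odd_nonneg B h (not_lt.mp hj)⟩

theorem fockOp_even_odd (h h' : Hsp Q) (j k : ℤ) :
    fockOp B h j 0 * fockOp B h' k 1 = fockOp B h' k 1 * fockOp B h j 0 := by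
  obtain ⟨f, hf⟩ := exists_fockOp_even B h j
  obtain ⟨g, hg⟩ := exists_fockOp_odd B h' k
  rw [hf, hg]
  exact fock_ext fun x y => rfl

theorem formC_symm (hs : B.IsSymm) (h h' : Hsp Q) : formC B h h' = formC B h' h := by
  induction h using TensorProduct.induction_on with
  | zero => simp
  | add x y hx hy => simp [hx, hy]
  | tmul a q =>
    induction h' using TensorProduct.induction_on with
    | zero => simp
    | add x y hx hy => simp [hx, hy]
    | tmul b r => simp [formC, mul_comm, hs.eq q r]

theorem fockOp_even_even (hs : B.IsSymm) (h h' : Hsp Q) (j k : ℤ) (v : Fock Q) :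
    fockOp B h j 0 (fockOp B h' k 0 v) =
      fockOp B h' k 0 (fockOp B h j 0 v) + (if j + k = 0 then (j : ℂ) * formC B h h' else 0) • v := by
  suffices fockOp B h j 0 * fockOp B h' k 0 = fockOp B h' k 0 * fockOp B h j 0 +
      (if j + k = 0 then (j : ℂ) * formC B h h' else 0) • 1 from DFunLike.congr_fun this v
  refine fock_ext fun x y => ?_
  simp only [Module.End.mul_apply, LinearMap.add_apply, LinearMap.smul_apply, Module.End.one_apply]
  rcases lt_or_ge j 0 with hj | hj <;> rcases lt_or_ge k 0 with hk | hk
  · rw [if_neg (by lia), fockOp_even_neg B h hj, fockOp_even_neg B h' hk]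
    simp only [fockLeft_mk, zero_smul, add_zero, creB, LinearMap.mulLeft_apply, mul_left_comm]
  · rw [fockOp_even_neg B h hj, fockOp_even_nonneg B h' hk]
    simp only [LinearMap.smul_apply, fockLeft_mk, map_smul, symDeriv_creB, fockMk_add_left,
      fockMk_smul_left, smul_add]
    by_cases hjk : j + k = 0
    · have : (-1 - j).toNat = (k - 1).toNat := by lia
      rw [if_pos hjk, if_pos this, formC_symm B hs h' h]
      obtain rfl : j = -k := by lia
      simp only [smul_smul]
      push_cast
      module
    · rcases hk.eq_or_lt with rfl | hk'
      · simp
        intro h0; lia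
      · have : ¬ (-1 - j).toNat = (k - 1).toNat := by lia
        rw [if_neg hjk, if_neg this]
        simp
  · rw [fockOp_even_neg B h' hk, fockOp_even_nonneg B h hj]
    simp only [LinearMap.smul_apply, fockLeft_mk, map_smul, symDeriv_creB, fockMk_add_left,
      fockMk_smul_left, smul_add]
    by_cases hjk : j + k = 0
    · have : (-1 - k).toNat = (j - 1).toNat := by lia
      rw [if_pos hjk, if_pos this]
      simp only [smul_smul]
      module
    · rcases hj.eq_or_lt with rfl | hj'
      · simp
      · have : ¬ (-1 - k).toNat = (j - 1).toNat := by lia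
        rw [if_neg hjk, if_neg this]
        simp
  · rw [fockOp_even_nonneg B h hj, fockOp_even_nonneg B h' hk]
    have : (if j + k = 0 then (j : ℂ) * formC B h h' else 0) = 0 := by
      split_ifs with h0
      · obtain rfl : j = 0 := by lia
        simp
      · rfl
    rw [this]
    simp only [LinearMap.smul_apply, fockLeft_mk, map_smul, zero_smul, add_zero,
      symDeriv_comm (pairing B (j - 1).toNat h)]
    rw [smul_comm]

theorem fockOp_odd_odd (hs : B.IsSymm) (h h' : Hsp Q) (j k : ℤ) (v : Fock Q) :
    fockOp B h j 1 (fockOp B h' k 1 v) =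
      (if j + k = -1 then formC B h h' else 0) • v - fockOp B h' k 1 (fockOp B h j 1 v) := by
  suffices fockOp B h j 1 * fockOp B h' k 1 = (if j + k = -1 then formC B h h' else 0) • 1 -
      fockOp B h' k 1 * fockOp B h j 1 from DFunLike.congr_fun this v
  refine fock_ext fun x y => ?_
  simp only [Module.End.mul_apply, LinearMap.sub_apply, LinearMap.smul_apply, Module.End.one_apply]
  rcases lt_or_ge j 0 with hj | hj <;> rcases lt_or_ge k 0 with hk | hk
  · rw [if_neg (by lia), fockOp_odd_neg B h hj, fockOp_odd_neg B h' hk]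
    simp only [fockRight_mk, zero_smul, zero_sub, creF_creF (-1 - j).toNat, fockMk_neg_right]
  · rw [fockOp_odd_neg B h hj, fockOp_odd_nonneg B h' hk]
    simp only [fockRight_mk, annF_creF, sub_eq_add_neg, fockMk_add_right, fockMk_smul_right,
      fockMk_neg_right]
    simp only [show ((-1 + -j).toNat = k.toNat) ↔ (j + k = -1) by lia, formC_symm B hs h' h]
    abel
  · rw [fockOp_odd_neg B h' hk, fockOp_odd_nonneg B h hj]
    simp only [fockRight_mk, annF_creF, sub_eq_add_neg, fockMk_add_right, fockMk_smul_right,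
      fockMk_neg_right]
    simp only [show ((-1 + -k).toNat = j.toNat) ↔ (j + k = -1) by lia]
  · rw [if_neg (by lia), fockOp_odd_nonneg B h hj, fockOp_odd_nonneg B h' hk]
    simp only [fockRight_mk, zero_smul, zero_sub, annF_annF B j.toNat, fockMk_neg_right]

theorem fockParity_fockOp_even (h : Hsp Q) (j : ℤ) :
    fockParity * fockOp B h j 0 = fockOp B h j 0 * fockParity := by
  obtain ⟨f, hf⟩ := exists_fockOp_even B h j
  rw [hf]
  exact fock_ext fun x y => rfl

theorem fockParity_fockOp_odd (h : Hsp Q) (j : ℤ) :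
    fockParity * fockOp B h j 1 = -(fockOp B h j 1 * fockParity) := by
  refine fock_ext fun x y => ?_
  simp only [Module.End.mul_apply, LinearMap.neg_apply]
  by_cases hj : j < 0
  · rw [fockOp_odd_neg B h hj]
    simp only [fockRight_mk, fockParity_mk, ← fockMk_neg_right]
    congr 1
    simp only [creF, LinearMap.mulLeft_apply, map_mul, ExteriorAlgebra.ι, ← neg_mul]
    congr 1
    exact CliffordAlgebra.involute_ι _
  · rw [fockOp_odd_nonneg B h (not_lt.mp hj)]
    simp only [fockRight_mk, fockParity_mk, ← fockMk_neg_right]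
    congr 1
    exact involute_contractLeft _ _

theorem fockOp_one (h : Hsp Q) {j : ℤ} (hj : 0 ≤ j) (J : Fin 2) :
    fockOp B h j J (fockMk 1 1) = 0 := by
  match J with
  | 0 => simp [fockOp_even_nonneg B h hj, symDeriv_one, fockMk_zero_left]
  | 1 =>
    rw [fockOp_odd_nonneg B h hj, fockRight_mk, annF]
    erw [CliffordAlgebra.contractLeft_one]
    exact fockMk_zero_right _

/-- Multiplication by even creation operators, linear in the operator. -/
def fockMulB : NegModes Q →ₗ[ℂ] Module.End ℂ (Fock Q) :=
  LinearMap.rTensorHom (ExteriorAlgebra ℂ (NegModes Q)) ∘ₗ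
    LinearMap.mul ℂ (SymmetricAlgebra ℂ (NegModes Q)) ∘ₗ SymmetricAlgebra.ι ℂ (NegModes Q)

/-- Multiplication by odd creation operators, linear in the operator. -/
def fockMulF : NegModes Q →ₗ[ℂ] Module.End ℂ (Fock Q) :=
  LinearMap.lTensorHom (SymmetricAlgebra ℂ (NegModes Q)) ∘ₗ
    LinearMap.mul ℂ (ExteriorAlgebra ℂ (NegModes Q)) ∘ₗ ExteriorAlgebra.ι ℂ

theorem fock_induction {P : Fock Q → Prop} (one : P (fockMk 1 1))
    (smul : ∀ (c : ℂ) x, P x → P (c • x)) (add : ∀ x y, P x → P y → P (x + y))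
    (cre : ∀ h (j : ℤ) J x, j < 0 → P x → P (fockOp B h j J x)) (x : Fock Q) : P x := by
  have zero : P 0 := by simpa using smul 0 _ one
  have key : ∀ m : NegModes Q, ∀ J : Fin 2, ∀ x, P x →
      P (if J = 0 then fockMulB m x else fockMulF m x) := by
    intro m J x hx
    induction m using Finsupp.induction_linear with
    | zero => split_ifs <;> simpa using zero
    | add f g hf hg =>
      convert add _ _ hf hg using 1
      split_ifs <;> simp
    | single n h =>
      have := cre h (-1 - n) J x (by lia) hx
      match J with
      | 0 =>
        rw [fockOp_even_neg B h (by lia)] at this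
        have e : (-1 - (-1 - (n : ℤ))).toNat = n := by lia
        rw [e] at this
        exact this
      | 1 =>
        rw [fockOp_odd_neg B h (by lia)] at this
        have e : (-1 - (-1 - (n : ℤ))).toNat = n := by lia
        rw [e] at this
        exact this
  have key2 : ∀ (y : ExteriorAlgebra ℂ (NegModes Q)), P (fockMk 1 y) := by
    intro y
    induction y using CliffordAlgebra.left_induction with
    | algebraMap r =>
      rw [Algebra.algebraMap_eq_smul_one, fockMk_smul_right]
      exact smul _ _ one
    | add x y hx hy => rw [fockMk_add_right]; exact add _ _ hx hy
    | ι_mul x m hx => exact key m 1 _ hx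
  have key3 : ∀ (x : SymmetricAlgebra ℂ (NegModes Q)) y, P (fockMk x y) := by
    intro x y
    induction x using symmetricAlgebra_left_induction with
    | one => exact key2 y
    | smul c x hx => rw [fockMk_smul_left]; exact smul _ _ hx
    | add x x' hx hx' => rw [fockMk_add_left]; exact add _ _ hx hx'
    | ι_mul m x hx => exact key m 0 _ hx
  exact TensorProduct.induction_on x zero key3 add

end Fock

section LocallyFinite

variable {V ι : Type*} [AddCommGroup V] [Module ℂ V]

/-- The sum of a locally finite family of operators. -/
def lfSum (A : ι → Module.End ℂ V) (hA : ∀ v, (Function.support fun i => A i v).Finite) :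
    Module.End ℂ V where
  toFun v := ∑ᶠ i, A i v
  map_add' v w := by
    simp only [map_add]
    exact finsum_add_distrib (hA v) (hA w)
  map_smul' c v := by
    simp only [map_smul, RingHom.id_apply]
    exact (smul_finsum' c (hA v)).symm

theorem lfSum_apply (A : ι → Module.End ℂ V) (hA) (v : V) : lfSum A hA v = ∑ᶠ i, A i v := rfl

theorem lfSum_comm {A : ι → Module.End ℂ V} (hA) {X Y : Module.End ℂ V} {s : ℂ} (m : ι)
    [DecidableEq ι]
    (h : ∀ n v, A n (X v) = s • X (A n v) + if n = m then Y v else 0) (v : V) :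
    lfSum A hA (X v) = s • X (lfSum A hA v) + Y v := by
  have h1 : (Function.support fun n => s • X (A n v)).Finite :=
    (hA v).subset fun n hn h0 => hn (by simp [h0])
  have h2 : (Function.support fun n => if n = m then Y v else 0).Finite :=
    (Set.finite_singleton m).subset fun n hn => by
      by_contra h0
      exact hn (if_neg h0)
  simp only [lfSum_apply, h]
  rw [finsum_add_distrib h1 h2, finsum_eq_single _ m fun n hn => if_neg hn, if_pos rfl,
    ← smul_finsum' s, map_finsum X (hA v)]
  exact (hA v).subset fun n hn h0 => hn (by simp [h0])

end LocallyFinite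

section VQ

variable {Q : Type*} [AddCommGroup Q]

theorem vq_ext {X : Type*} [AddCommGroup X] [Module ℂ X] {f g : VQ Q →ₗ[ℂ] X}
    (h : ∀ (s : Fock Q) (β : Q), f (s ⊗ₜ Finsupp.single β 1) = g (s ⊗ₜ Finsupp.single β 1)) :
    f = g := by
  refine TensorProduct.ext' fun s x => ?_
  induction x using Finsupp.induction_linear with
  | zero => simp
  | add f g hf hg => simp only [TensorProduct.tmul_add, map_add, hf, hg]
  | single β c =>
    have : Finsupp.single β c = c • Finsupp.single β (1 : ℂ) := by simp
    rw [this, TensorProduct.tmul_smul, map_smul, map_smul, h]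

@[simp] theorem diag_single (c : Q → ℂ) (β : Q) (x : ℂ) :
    diag c (Finsupp.single β x) = c β • Finsupp.single β x := by simp [diag]

variable (B : LinearMap.BilinForm ℤ Q)

theorem formC_toH (α β : Q) : formC B (toH α) (toH β) = (B α β : ℂ) := by
  simp [formC, toH]

theorem formC_toH_add_right (h : Hsp Q) (α β : Q) :
    formC B h (toH (α + β)) = formC B h (toH α) + formC B h (toH β) := by
  simp [toH, TensorProduct.tmul_add]

theorem hOp_even_tmul (h : Hsp Q) (j : ℤ) (s : Fock Q) (β : Q) :
    hOp B h j 0 (s ⊗ₜ Finsupp.single β 1) = fockOp B h j 0 s ⊗ₜ Finsupp.single β 1 +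
      (if j = 0 then formC B h (toH β) else 0) • (s ⊗ₜ Finsupp.single β 1) := by
  by_cases hj : j = 0
  · subst hj
    have : fockOp B h 0 0 s = 0 := by simp [fockOp_even_nonneg B h le_rfl]
    rw [this, TensorProduct.zero_tmul, zero_add, if_pos rfl, hOp, if_pos ⟨rfl, rfl⟩,
      LinearMap.lTensor_tmul, diag_single, TensorProduct.tmul_smul]
  · simp [hOp, hj]

theorem hOp_odd_tmul (h : Hsp Q) (j : ℤ) (s : Fock Q) (x : Q →₀ ℂ) :
    hOp B h j 1 (s ⊗ₜ x) = fockOp B h j 1 s ⊗ₜ x := by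
  simp [hOp]

theorem hOp_even_even (hs : B.IsSymm) (h h' : Hsp Q) (j k : ℤ) (v : VQ Q) :
    hOp B h j 0 (hOp B h' k 0 v) = hOp B h' k 0 (hOp B h j 0 v) +
      (if j + k = 0 then (j : ℂ) * formC B h h' else 0) • v := by
  suffices hOp B h j 0 * hOp B h' k 0 = hOp B h' k 0 * hOp B h j 0 +
      (if j + k = 0 then (j : ℂ) * formC B h h' else 0) • 1 from DFunLike.congr_fun this v
  refine vq_ext fun s β => ?_
  simp only [Module.End.mul_apply, LinearMap.add_apply, LinearMap.smul_apply, Module.End.one_apply,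
    hOp_even_tmul, map_add, map_smul, fockOp_even_even B hs h h' j k s, TensorProduct.add_tmul,
    ← TensorProduct.smul_tmul']
  module

theorem hOp_odd_odd (hs : B.IsSymm) (h h' : Hsp Q) (j k : ℤ) (v : VQ Q) :
    hOp B h j 1 (hOp B h' k 1 v) =
      (if j + k = -1 then formC B h h' else 0) • v - hOp B h' k 1 (hOp B h j 1 v) := by
  suffices hOp B h j 1 * hOp B h' k 1 = (if j + k = -1 then formC B h h' else 0) • 1 -
      hOp B h' k 1 * hOp B h j 1 from DFunLike.congr_fun this v
  refine vq_ext fun s β => ?_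
  simp only [Module.End.mul_apply, LinearMap.sub_apply, LinearMap.smul_apply, Module.End.one_apply,
    hOp_odd_tmul, fockOp_odd_odd B hs h h' j k s, TensorProduct.sub_tmul, TensorProduct.smul_tmul']

theorem hOp_even_odd (h h' : Hsp Q) (j k : ℤ) (v : VQ Q) :
    hOp B h j 0 (hOp B h' k 1 v) = hOp B h' k 1 (hOp B h j 0 v) := by
  suffices hOp B h j 0 * hOp B h' k 1 = hOp B h' k 1 * hOp B h j 0 from DFunLike.congr_fun this v
  refine vq_ext fun s β => ?_
  have := DFunLike.congr_fun (fockOp_even_odd B h h' j k) s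
  simp only [Module.End.mul_apply] at this
  simp only [Module.End.mul_apply, hOp_odd_tmul, hOp_even_tmul, map_add, map_smul, this]

/-- The scalar value of the supercommutator of `h_(j|J)` and `h'_(k|K)`. -/
def hOpComm (h h' : Hsp Q) (j k : ℤ) (J K : Fin 2) : ℂ :=
  if J = 0 ∧ K = 0 then if j + k = 0 then (j : ℂ) * formC B h h' else 0
  else if J = 1 ∧ K = 1 then if j + k = -1 then formC B h h' else 0
  else 0

theorem hOp_hOp (hs : B.IsSymm) (h h' : Hsp Q) (j k : ℤ) (J K : Fin 2) (v : VQ Q) :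
    hOp B h j J (hOp B h' k K v) =
      (-1 : ℂ) ^ ((J : ℕ) * (K : ℕ)) • hOp B h' k K (hOp B h j J v) +
        hOpComm B h h' j k J K • v := by
  match J, K with
  | 0, 0 => simp [hOpComm, hOp_even_even B hs h h']
  | 0, 1 => simp [hOpComm, hOp_even_odd]
  | 1, 0 => simp [hOpComm, hOp_even_odd]
  | 1, 1 => rw [hOp_odd_odd B hs h h']; simp [hOpComm]; abel

theorem hOpComm_eq_zero (h h' : Hsp Q) {j k : ℤ} (J K : Fin 2) (h0 : j + k ≠ 0)
    (h1 : j + k ≠ -1) : hOpComm B h h' j k J K = 0 := by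
  simp [hOpComm, h0, h1]

theorem hOpComm_cre_eq_zero (h h' : Hsp Q) {j k : ℤ} (J K : Fin 2) (hj : j < 0) (hk : k < 0) :
    hOpComm B h h' j k J K = 0 := by
  simp only [hOpComm]
  split_ifs <;> first | rfl | lia

theorem hOp_eState (h : Hsp Q) {j : ℤ} (hj : 0 ≤ j) (J : Fin 2) (β : Q) :
    hOp B h j J (eState β) = if j = 0 ∧ J = 0 then formC B h (toH β) • eState β else 0 := by
  match J with
  | 0 => simp [eState, hOp_even_tmul, fockOp_one B h hj]
  | 1 => simp [eState, hOp_odd_tmul, fockOp_one B h hj]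

theorem vq_induction {P : VQ Q → Prop} (e : ∀ β, P (eState β))
    (smul : ∀ (c : ℂ) x, P x → P (c • x)) (add : ∀ x y, P x → P y → P (x + y))
    (cre : ∀ h (j : ℤ) J x, j < 0 → P x → P (hOp B h j J x)) (x : VQ Q) : P x := by
  have zero : P 0 := by simpa using smul 0 _ (e 0)
  refine TensorProduct.induction_on x zero (fun s y => ?_) add
  induction y using Finsupp.induction_linear with
  | zero => simpa using zero
  | add f g hf hg => rw [TensorProduct.tmul_add]; exact add _ _ hf hg
  | single β c =>
    have : Finsupp.single β c = c • Finsupp.single β (1 : ℂ) := by simp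
    rw [this, TensorProduct.tmul_smul]
    refine smul c _ ?_
    induction s using fock_induction B with
    | one => exact e β
    | smul c x hx => rw [← TensorProduct.smul_tmul']; exact smul c _ hx
    | add x y hx hy => rw [TensorProduct.add_tmul]; exact add _ _ hx hy
    | cre h j J x hj hx =>
      have := cre h j J _ hj hx
      match J with
      | 0 => simpa [hOp_even_tmul, hj.ne] using this
      | 1 => simpa [hOp_odd_tmul] using this

/-- Every vector is annihilated by almost all annihilation operators. -/
theorem exists_hOp_eq_zero (hs : B.IsSymm) (v : VQ Q) :
    ∃ N : ℕ, ∀ h (j : ℤ) J, (N : ℤ) < j → hOp B h j J v = 0 := by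
  induction v using vq_induction B with
  | e β =>
    refine ⟨0, fun h j J hj => ?_⟩
    rw [hOp_eState B h (by simpa using hj.le), if_neg (by push_cast at hj; lia)]
  | smul c x hx =>
    obtain ⟨N, hN⟩ := hx
    exact ⟨N, fun h j J hj => by rw [map_smul, hN h j J hj, smul_zero]⟩
  | add x y hx hy =>
    obtain ⟨N, hN⟩ := hx
    obtain ⟨M, hM⟩ := hy
    exact ⟨N + M, fun h j J hj => by
      push_cast at hj
      rw [map_add, hN h j J (by lia), hM h j J (by lia), add_zero]⟩
  | cre h' k K x hk hx =>
    obtain ⟨N, hN⟩ := hx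
    refine ⟨N + k.natAbs, fun h j J hj => ?_⟩
    rw [Nat.cast_add] at hj
    rw [hOp_hOp B hs, hN h j J (by lia), hOpComm_eq_zero B _ _ _ _ (by lia) (by lia)]
    simp

theorem creB_lin (n : ℕ) (h : Hsp Q) : fockLeft (creB n h) = fockMulB (Finsupp.lsingle (R := ℂ) n h) := rfl
theorem creF_lin (n : ℕ) (h : Hsp Q) : fockRight (creF n h) = fockMulF (Finsupp.lsingle (R := ℂ) n h) := rfl

theorem pairing_add (n : ℕ) (h h' : Hsp Q) : pairing B n (h + h') = pairing B n h + pairing B n h' := by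
  ext; simp [pairing]

theorem pairing_smul (n : ℕ) (c : ℂ) (h : Hsp Q) : pairing B n (c • h) = c • pairing B n h := by
  ext; simp [pairing]

theorem fockOp_add (h h' : Hsp Q) (j : ℤ) (J : Fin 2) :
    fockOp B (h + h') j J = fockOp B h j J + fockOp B h' j J := by
  match J with
  | 0 =>
    rcases lt_or_ge j 0 with hj | hj
    · simp only [fockOp_even_neg B _ hj, creB_lin, map_add]
    · simp only [fockOp_even_nonneg B _ hj, pairing_add, symDeriv_add_form, ← smul_add]
      congr 1
      exact LinearMap.rTensor_add _ _ _
  | 1 =>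
    rcases lt_or_ge j 0 with hj | hj
    · simp only [fockOp_odd_neg B _ hj, creF_lin, map_add]
    · simp only [fockOp_odd_nonneg B _ hj, annF, pairing_add, map_add]
      exact LinearMap.lTensor_add _ _ _

theorem fockOp_smul (c : ℂ) (h : Hsp Q) (j : ℤ) (J : Fin 2) :
    fockOp B (c • h) j J = c • fockOp B h j J := by
  match J with
  | 0 =>
    rcases lt_or_ge j 0 with hj | hj
    · simp only [fockOp_even_neg B _ hj, creB_lin, map_smul]
    · simp only [fockOp_even_nonneg B _ hj, pairing_smul, symDeriv_smul_form]
      rw [smul_comm c]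
      congr 1
      exact LinearMap.rTensor_smul _ _ _
  | 1 =>
    rcases lt_or_ge j 0 with hj | hj
    · simp only [fockOp_odd_neg B _ hj, creF_lin, map_smul]
    · simp only [fockOp_odd_nonneg B _ hj, annF, pairing_smul, map_smul]
      exact LinearMap.lTensor_smul _ _ _

/-- `h ↦ h_(j|J)` as a linear map. -/
def hOpLin (j : ℤ) (J : Fin 2) : Hsp Q →ₗ[ℂ] Module.End ℂ (VQ Q) where
  toFun h := hOp B h j J
  map_add' h h' := by
    refine vq_ext fun s β => ?_
    match J with
    | 0 =>
      simp only [hOp_even_tmul, fockOp_add, LinearMap.add_apply, map_add, TensorProduct.add_tmul]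
      split_ifs <;> module
    | 1 => simp only [hOp_odd_tmul, fockOp_add, LinearMap.add_apply, TensorProduct.add_tmul]
  map_smul' c h := by
    refine vq_ext fun s β => ?_
    match J with
    | 0 =>
      simp only [hOp_even_tmul, fockOp_smul, LinearMap.smul_apply, map_smul, RingHom.id_apply,
        ← TensorProduct.smul_tmul', smul_eq_mul]
      split_ifs <;> module
    | 1 =>
      simp only [hOp_odd_tmul, fockOp_smul, LinearMap.smul_apply, RingHom.id_apply,
        TensorProduct.smul_tmul']

theorem hOpLin_apply (j : ℤ) (J : Fin 2) (h : Hsp Q) : hOpLin B j J h = hOp B h j J := rfl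

/-! ### Parity -/

theorem neg_one_zpow_mul_self (n : ℤ) : ((-1 : ℂ) ^ n) * (-1) ^ n = 1 := by
  rw [← mul_zpow]; simp

theorem neg_one_pow_natAbs (n : ℤ) : (-1 : ℂ) ^ n.natAbs = (-1) ^ n := by
  rcases Int.even_or_odd n with h | h
  · rw [Even.neg_one_pow (by simpa using h), Even.neg_one_zpow h]
  · rw [Odd.neg_one_pow (by simpa using h), Odd.neg_one_zpow h]

theorem neg_one_zpow_form_add (hs : B.IsSymm) (α β : Q) :
    (-1 : ℂ) ^ (B (α + β) (α + β)) = (-1) ^ (B α α) * (-1) ^ (B β β) := by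
  have : B (α + β) (α + β) = B α α + B β β + (B α β + B α β) := by
    simp only [map_add, LinearMap.add_apply, hs.eq β α]
    ring
  rw [this, zpow_add₀ (by norm_num), zpow_add₀ (by norm_num), zpow_add₀ (by norm_num),
    neg_one_zpow_mul_self, mul_one]

theorem parity_tmul (s : Fock Q) (β : Q) : parity B (s ⊗ₜ Finsupp.single β 1) =
    (-1 : ℂ) ^ (B β β) • (fockParity s ⊗ₜ Finsupp.single β 1) := by
  rw [parity, TensorProduct.map_tmul, diag_single, TensorProduct.tmul_smul]

theorem parity_parity (v : VQ Q) : parity B (parity B v) = v := by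
  suffices parity B * parity B = 1 from DFunLike.congr_fun this v
  refine vq_ext fun s β => ?_
  have := DFunLike.congr_fun (fockParity_mul_self (Q := Q)) s
  simp only [Module.End.mul_apply, Module.End.one_apply] at this
  simp only [Module.End.mul_apply, parity_tmul, map_smul, this, smul_smul, neg_one_zpow_mul_self,
    one_smul, Module.End.one_apply]

theorem parity_mul_self : parity B * parity B = 1 := LinearMap.ext (parity_parity B)

theorem parity_hOp (h : Hsp Q) (j : ℤ) (J : Fin 2) (v : VQ Q) :
    parity B (hOp B h j J v) = (-1 : ℂ) ^ (J : ℕ) • hOp B h j J (parity B v) := by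
  suffices parity B * hOp B h j J = (-1 : ℂ) ^ (J : ℕ) • (hOp B h j J * parity B) from
    DFunLike.congr_fun this v
  refine vq_ext fun s β => ?_
  match J with
  | 0 =>
    have := DFunLike.congr_fun (fockParity_fockOp_even B h j) s
    simp only [Module.End.mul_apply] at this
    simp only [Module.End.mul_apply, LinearMap.smul_apply, hOp_even_tmul, parity_tmul, map_add,
      map_smul, this]
    simp
    split_ifs <;> module
  | 1 =>
    have := DFunLike.congr_fun (fockParity_fockOp_odd B h j) s
    simp only [Module.End.mul_apply, LinearMap.neg_apply] at this
    simp only [Module.End.mul_apply, LinearMap.smul_apply, hOp_odd_tmul, parity_tmul, map_smul,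
      this]
    simp [TensorProduct.neg_tmul]

theorem fockParity_one : fockParity (fockMk (1 : SymmetricAlgebra ℂ (NegModes Q)) 1) = fockMk 1 1 := by
  rw [fockParity_mk]
  congr 1
  exact map_one _

theorem parity_eState (β : Q) : parity B (eState β) = (-1 : ℂ) ^ (B β β) • eState β := by
  rw [eState, parity_tmul, fockParity_one]

/-! ### The projection to the Fock vacuum -/

/-- The augmentation of the Fock space. -/
def fockAug : Fock Q →ₗ[ℂ] ℂ :=
  (TensorProduct.lid ℂ ℂ).toLinearMap ∘ₗ TensorProduct.map
    (SymmetricAlgebra.algebraMapInv (R := ℂ) (M := NegModes Q)).toLinearMap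
    (ExteriorAlgebra.algebraMapInv (R := ℂ) (M := NegModes Q)).toLinearMap

theorem fockAug_mk (x : SymmetricAlgebra ℂ (NegModes Q)) (y) : fockAug (fockMk x y) =
    SymmetricAlgebra.algebraMapInv x * ExteriorAlgebra.algebraMapInv y := rfl

/-- The projection `V^1(W) ⊗ ℂ[Q] → ℂ[Q]` to the component of the Fock vacuum. -/
def vacProj : VQ Q →ₗ[ℂ] (Q →₀ ℂ) :=
  (TensorProduct.lid ℂ (Q →₀ ℂ)).toLinearMap ∘ₗ LinearMap.rTensor (Q →₀ ℂ) fockAug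

theorem vacProj_tmul (s : Fock Q) (x : Q →₀ ℂ) : vacProj (s ⊗ₜ x) = fockAug s • x := rfl

theorem fockAug_cre (h : Hsp Q) {j : ℤ} (hj : j < 0) (J : Fin 2) (s : Fock Q) :
    fockAug (fockOp B h j J s) = 0 := by
  suffices fockAug ∘ₗ fockOp B h j J = 0 from DFunLike.congr_fun this s
  refine fock_ext fun x y => ?_
  match J with
  | 0 =>
    simp [fockOp_even_neg B h hj, fockAug_mk, creB, SymmetricAlgebra.algebraMapInv_ι]
  | 1 =>
    simp [fockOp_odd_neg B h hj, fockAug_mk, creF, ExteriorAlgebra.algebraMapInv]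

theorem fockAug_parity (s : Fock Q) : fockAug (fockParity s) = fockAug s := by
  suffices fockAug ∘ₗ fockParity = fockAug (Q := Q) from DFunLike.congr_fun this s
  refine fock_ext fun x y => ?_
  simp only [LinearMap.comp_apply, fockParity_mk, fockAug_mk]
  congr 1
  have : (ExteriorAlgebra.algebraMapInv (R := ℂ) (M := NegModes Q)).comp
      (CliffordAlgebra.involute (Q := (0 : QuadraticForm ℂ (NegModes Q)))) =
      ExteriorAlgebra.algebraMapInv := by
    refine ExteriorAlgebra.hom_ext (LinearMap.ext fun m => ?_)
    have : (CliffordAlgebra.involute (Q := (0 : QuadraticForm ℂ (NegModes Q))))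
      (ExteriorAlgebra.ι ℂ m) = - ExteriorAlgebra.ι ℂ m := CliffordAlgebra.involute_ι _
    simp [this, ExteriorAlgebra.algebraMapInv]
  exact DFunLike.congr_fun this y

theorem fockAug_parity_pow (n : ℕ) (s : Fock Q) : fockAug ((fockParity ^ n) s) = fockAug s := by
  induction n with
  | zero => simp
  | succ n ih => rw [pow_succ', Module.End.mul_apply, fockAug_parity, ih]

theorem vacProj_cre (h : Hsp Q) {j : ℤ} (hj : j < 0) (J : Fin 2) (v : VQ Q) :
    vacProj (hOp B h j J v) = 0 := by
  suffices vacProj ∘ₗ hOp B h j J = 0 from DFunLike.congr_fun this v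
  refine vq_ext fun s β => ?_
  match J with
  | 0 => simp [hOp_even_tmul, hj.ne, vacProj_tmul, fockAug_cre B h hj]
  | 1 => simp [hOp_odd_tmul, vacProj_tmul, fockAug_cre B h hj]

theorem fockAug_one : fockAug (fockMk (1 : SymmetricAlgebra ℂ (NegModes Q)) 1) = 1 := by
  simp [fockAug_mk]

theorem vacProj_eState (β : Q) : vacProj (eState β) = Finsupp.single β 1 := by
  rw [eState, vacProj_tmul, fockAug_one, one_smul]

theorem vacProj_parity (v : VQ Q) :
    vacProj (parity B v) = diag (fun β => (-1 : ℂ) ^ (B β β)) (vacProj v) := by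
  suffices vacProj ∘ₗ parity B = diag (fun β => (-1 : ℂ) ^ (B β β)) ∘ₗ vacProj from
    DFunLike.congr_fun this v
  refine vq_ext fun s β => ?_
  simp only [LinearMap.comp_apply, parity_tmul, map_smul, vacProj_tmul, fockAug_parity, diag_single]
  rw [smul_comm]

theorem vacProj_hOp_zero (h : Hsp Q) (v : VQ Q) :
    vacProj (hOp B h 0 0 v) = diag (fun β => formC B h (toH β)) (vacProj v) := by
  suffices vacProj ∘ₗ hOp B h 0 0 = diag (fun β => formC B h (toH β)) ∘ₗ vacProj from
    DFunLike.congr_fun this v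
  refine vq_ext fun s β => ?_
  simp only [LinearMap.comp_apply, hOp_even_tmul, map_add, map_smul, vacProj_tmul, diag_single,
    fockOp_even_nonneg B h le_rfl]
  simp only [Int.cast_zero, zero_smul, LinearMap.zero_apply, map_zero, if_true, zero_add]
  rw [smul_comm]

theorem diag_apply (c : Q → ℂ) (x : Q →₀ ℂ) (β : Q) : diag c x β = c β * x β := by
  induction x using Finsupp.induction_linear with
  | zero => simp
  | add f g hf hg => simp [hf, hg, mul_add]
  | single γ a =>
    simp only [diag_single, Finsupp.smul_apply, smul_eq_mul]
    by_cases h : γ = β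
    · rw [h]
    · simp [Finsupp.single_eq_of_ne' h]

/-! ### The operators `e^α` and `z^α` -/

variable (ε : Q → Q → ℂ)

theorem twMul_single (α β : Q) : twMul ε (Finsupp.single α 1) (Finsupp.single β 1) =
    ε α β • Finsupp.single (α + β) 1 := by
  simp [twMul]

theorem eOp_tmul (α : Q) (s : Fock Q) (β : Q) : eOp B ε α (s ⊗ₜ Finsupp.single β 1) =
    ε α β • ((fockParity ^ (B α α).natAbs) s ⊗ₜ Finsupp.single (α + β) 1) := by
  rw [eOp, TensorProduct.map_tmul, twMul_single, TensorProduct.tmul_smul]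

theorem fockParity_pow_even (n : ℕ) (h : Hsp Q) (j : ℤ) (s : Fock Q) :
    (fockParity ^ n) (fockOp B h j 0 s) = fockOp B h j 0 ((fockParity ^ n) s) := by
  have : Commute (fockParity ^ n) (fockOp B h j 0) :=
    Commute.pow_left (fockParity_fockOp_even B h j) n
  exact DFunLike.congr_fun this.eq s

theorem fockParity_pow_odd (n : ℕ) (h : Hsp Q) (j : ℤ) (s : Fock Q) :
    (fockParity ^ n) (fockOp B h j 1 s) =
      (-1 : ℂ) ^ n • fockOp B h j 1 ((fockParity ^ n) s) := by
  induction n with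
  | zero => simp
  | succ n ih =>
    have := DFunLike.congr_fun (fockParity_fockOp_odd B h j) ((fockParity ^ n) s)
    simp only [Module.End.mul_apply, LinearMap.neg_apply] at this
    rw [pow_succ', Module.End.mul_apply, ih, map_smul, this, pow_succ, Module.End.mul_apply]
    simp

theorem hOp_even_eOp (h : Hsp Q) (j : ℤ) (α : Q) (v : VQ Q) :
    hOp B h j 0 (eOp B ε α v) = eOp B ε α (hOp B h j 0 v) +
      (if j = 0 then formC B h (toH α) else 0) • eOp B ε α v := by
  suffices hOp B h j 0 * eOp B ε α = eOp B ε α * hOp B h j 0 +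
      (if j = 0 then formC B h (toH α) else 0) • eOp B ε α from DFunLike.congr_fun this v
  refine vq_ext fun s β => ?_
  simp only [Module.End.mul_apply, LinearMap.add_apply, LinearMap.smul_apply, eOp_tmul, map_smul,
    hOp_even_tmul, map_add, fockParity_pow_even, formC_toH_add_right]
  split_ifs <;> module

theorem hOp_odd_eOp (h : Hsp Q) (j : ℤ) (α : Q) (v : VQ Q) :
    hOp B h j 1 (eOp B ε α v) = (-1 : ℂ) ^ (B α α) • eOp B ε α (hOp B h j 1 v) := by
  suffices hOp B h j 1 * eOp B ε α = (-1 : ℂ) ^ (B α α) • (eOp B ε α * hOp B h j 1) from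
    DFunLike.congr_fun this v
  refine vq_ext fun s β => ?_
  simp only [Module.End.mul_apply, LinearMap.smul_apply, eOp_tmul, map_smul,
    hOp_odd_tmul, fockParity_pow_odd, neg_one_pow_natAbs, ← TensorProduct.smul_tmul']
  rw [smul_comm, smul_smul ((-1 : ℂ) ^ _), neg_one_zpow_mul_self, one_smul]

theorem parity_eOp (hs : B.IsSymm) (α : Q) (v : VQ Q) :
    parity B (eOp B ε α v) = (-1 : ℂ) ^ (B α α) • eOp B ε α (parity B v) := by
  suffices parity B * eOp B ε α = (-1 : ℂ) ^ (B α α) • (eOp B ε α * parity B) from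
    DFunLike.congr_fun this v
  refine vq_ext fun s β => ?_
  have : fockParity ((fockParity ^ (B α α).natAbs) s) =
      (fockParity ^ (B α α).natAbs) (fockParity s) := by
    rw [← Module.End.mul_apply, ← pow_succ', pow_succ, Module.End.mul_apply]
  simp only [Module.End.mul_apply, LinearMap.smul_apply, eOp_tmul, map_smul, parity_tmul, this,
    neg_one_zpow_form_add B hs]
  module

theorem vacProj_eOp (α : Q) (v : VQ Q) :
    vacProj (eOp B ε α v) = twMul ε (Finsupp.single α 1) (vacProj v) := by
  suffices vacProj ∘ₗ eOp B ε α = twMul ε (Finsupp.single α 1) ∘ₗ vacProj from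
    DFunLike.congr_fun this v
  refine vq_ext fun s β => ?_
  simp only [LinearMap.comp_apply, eOp_tmul, map_smul, vacProj_tmul, fockAug_parity_pow,
    twMul_single]
  rw [smul_comm]

theorem zPow_tmul (α : Q) (n : ℤ) (s : Fock Q) (β : Q) :
    zPow B α n 0 (s ⊗ₜ Finsupp.single β 1) = (if B α β = n then (1 : ℂ) else 0) •
      (s ⊗ₜ Finsupp.single β 1) := by
  rw [zPow, if_pos rfl, LinearMap.lTensor_tmul, diag_single, TensorProduct.tmul_smul]

theorem zPow_hOp (α : Q) (n : ℤ) (h : Hsp Q) (j : ℤ) (J : Fin 2) (v : VQ Q) :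
    zPow B α n 0 (hOp B h j J v) = hOp B h j J (zPow B α n 0 v) := by
  suffices zPow B α n 0 * hOp B h j J = hOp B h j J * zPow B α n 0 from DFunLike.congr_fun this v
  refine vq_ext fun s β => ?_
  match J with
  | 0 =>
    simp only [Module.End.mul_apply, hOp_even_tmul, map_add, zPow_tmul, map_smul]
    split_ifs <;> module
  | 1 => simp only [Module.End.mul_apply, hOp_odd_tmul, zPow_tmul, map_smul]

theorem zPow_parity (α : Q) (n : ℤ) (v : VQ Q) :
    zPow B α n 0 (parity B v) = parity B (zPow B α n 0 v) := by
  suffices zPow B α n 0 * parity B = parity B * zPow B α n 0 from DFunLike.congr_fun this v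
  refine vq_ext fun s β => ?_
  simp only [Module.End.mul_apply, parity_tmul, zPow_tmul, map_smul]
  rw [smul_comm]

theorem zPow_zPow (α β : Q) (n m : ℤ) (v : VQ Q) :
    zPow B α n 0 (zPow B β m 0 v) = zPow B β m 0 (zPow B α n 0 v) := by
  suffices zPow B α n 0 * zPow B β m 0 = zPow B β m 0 * zPow B α n 0 from DFunLike.congr_fun this v
  refine vq_ext fun s β => ?_
  simp only [Module.End.mul_apply, zPow_tmul, map_smul]
  rw [smul_comm]

theorem vacProj_zPow (α : Q) (n : ℤ) (v : VQ Q) :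
    vacProj (zPow B α n 0 v) = diag (fun β => if B α β = n then 1 else 0) (vacProj v) := by
  suffices vacProj ∘ₗ zPow B α n 0 = diag (fun β => if B α β = n then 1 else 0) ∘ₗ vacProj from
    DFunLike.congr_fun this v
  refine vq_ext fun s β => ?_
  simp only [LinearMap.comp_apply, zPow_tmul, map_smul, vacProj_tmul, diag_single]
  rw [smul_comm]

theorem exists_zPow_eq_zero (α : Q) (v : VQ Q) :
    ∃ N : ℕ, ∀ n : ℤ, N < n.natAbs → zPow B α n 0 v = 0 := by
  induction v using vq_induction B with
  | e β =>
    refine ⟨(B α β).natAbs, fun n hn => ?_⟩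
    rw [eState, zPow_tmul, if_neg (by rintro rfl; exact lt_irrefl _ hn), zero_smul]
  | smul c x hx =>
    obtain ⟨N, hN⟩ := hx
    exact ⟨N, fun n hn => by rw [map_smul, hN n hn, smul_zero]⟩
  | add x y hx hy =>
    obtain ⟨N, hN⟩ := hx
    obtain ⟨M, hM⟩ := hy
    exact ⟨N + M, fun n hn => by rw [map_add, hN n (by lia), hM n (by lia), add_zero]⟩
  | cre h k K x hk hx =>
    obtain ⟨N, hN⟩ := hx
    exact ⟨N, fun n hn => by rw [zPow_hOp, hN n hn, map_zero]⟩

end VQ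

section Number

variable {Q : Type*} [AddCommGroup Q] (B : LinearMap.BilinForm ℤ Q)

theorem nondegenerate_formC [Module.Free ℤ Q] [Module.Finite ℤ Q] (hnd : B.Nondegenerate) :
    (formC B).Nondegenerate := by
  classical
  let b := Module.Free.chooseBasis ℤ Q
  let bC := b.baseChange ℂ
  rw [LinearMap.BilinForm.nondegenerate_iff_det_ne_zero bC]
  have h := (LinearMap.BilinForm.nondegenerate_iff_det_ne_zero b).mp hnd
  have : LinearMap.BilinForm.toMatrix bC (formC B) =
      (LinearMap.BilinForm.toMatrix b B).map (Int.castRingHom ℂ) := by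
    ext i j
    simp [bC, LinearMap.BilinForm.toMatrix_apply, formC]
  rw [this, ← RingHom.mapMatrix_apply, ← RingHom.map_det]
  simpa using h

theorem toH_injective_form [Module.Free ℤ Q] [Module.Finite ℤ Q] (hnd : B.Nondegenerate)
    {β γ : Q} (h : ∀ h : Hsp Q, formC B h (toH β) = formC B h (toH γ)) : β = γ := by
  have key : ∀ α, B α (β - γ) = 0 := fun α => by
    have := h (toH α)
    rw [formC_toH, formC_toH] at this
    rw [map_sub, sub_eq_zero]
    exact_mod_cast this
  exact sub_eq_zero.mp (hnd.2 _ key)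

theorem exists_dual_bases [Module.Free ℤ Q] [Module.Finite ℤ Q] (hs : B.IsSymm)
    (hnd : B.Nondegenerate) : ∃ (n : ℕ) (b b' : Fin n → Hsp Q),
      (∀ h, ∑ i, formC B (b' i) h • b i = h) ∧ ∀ h, ∑ i, formC B (b i) h • b' i = h := by
  classical
  have hC := nondegenerate_formC B hnd
  let b := Module.finBasis ℂ (Hsp Q)
  refine ⟨_, b, (formC B).dualBasis hC b, fun h => ?_, fun h => ?_⟩
  · conv_rhs => rw [← b.sum_repr h]
    refine Finset.sum_congr rfl fun i _ => ?_
    congr 1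
    conv_lhs => rw [← b.sum_repr h, map_sum]
    simp only [map_smul, LinearMap.BilinForm.apply_dualBasis_left, smul_eq_mul, mul_ite, mul_one,
      mul_zero, Finset.sum_ite_eq', Finset.mem_univ, if_true]
  · conv_rhs => rw [← ((formC B).dualBasis hC b).sum_repr h]
    refine Finset.sum_congr rfl fun i _ => ?_
    rw [LinearMap.BilinForm.dualBasis_repr_apply, formC_symm B hs]

variable {n : ℕ} (b b' : Fin n → Hsp Q)

/-- `∑ᵢ (bᵢ)_(j|J) (b'ᵢ)_(k|K)`. -/
def casimir (j : ℤ) (J : Fin 2) (k : ℤ) (K : Fin 2) : Module.End ℂ (VQ Q) :=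
  ∑ i, hOp B (b i) j J * hOp B (b' i) k K

theorem casimir_apply (j : ℤ) (J : Fin 2) (k : ℤ) (K : Fin 2) (v : VQ Q) :
    casimir B b b' j J k K v = ∑ i, hOp B (b i) j J (hOp B (b' i) k K v) := by
  simp [casimir, LinearMap.sum_apply]

theorem sum_form_smul_hOp {b b' : Fin n → Hsp Q} (hb : ∀ h, ∑ i, formC B (b' i) h • b i = h)
    (h : Hsp Q) (j : ℤ) (J : Fin 2) (v : VQ Q) :
    ∑ i, formC B (b' i) h • hOp B (b i) j J v = hOp B h j J v := by
  conv_rhs => rw [← hb h, ← hOpLin_apply, map_sum]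
  simp [LinearMap.sum_apply, hOpLin_apply]

theorem finite_support_casimir (hs : B.IsSymm) (f : ℕ → ℤ × Fin 2)
    (g : ℕ → ℤ) (hg : ∀ m : ℕ, (m : ℤ) ≤ g m) (K : Fin 2) (v : VQ Q) :
    (Function.support fun m => casimir B b b' (f m).1 (f m).2 (g m) K v).Finite := by
  obtain ⟨N, hN⟩ := exists_hOp_eq_zero B hs v
  refine (Set.finite_Iic N).subset fun m hm => ?_
  by_contra h
  refine hm ?_
  simp only [Set.mem_Iic, not_le] at h
  have hgm := hg m
  simp only [casimir_apply]
  exact Finset.sum_eq_zero fun i _ => by rw [hN _ _ _ (by lia), map_zero]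

theorem finite_support_add {ι V : Type*} [AddCommGroup V] {f g : ι → V}
    (hf : (Function.support f).Finite) (hg : (Function.support g).Finite) :
    (Function.support fun i => f i + g i).Finite :=
  (hf.union hg).subset (Function.support_add f g)

/-- The commutation of `casimir` with a mode. -/
theorem casimir_hOp (hs : B.IsSymm) (j : ℤ) (J : Fin 2) (k : ℤ) (K : Fin 2)
    (h : Hsp Q) (l : ℤ) (L : Fin 2) (v : VQ Q) :
    casimir B b b' j J k K (hOp B h l L v) =
      (-1 : ℂ) ^ ((J : ℕ) * L + K * L) • hOp B h l L (casimir B b b' j J k K v) +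
      ∑ i, hOpComm B (b' i) h k l K L • hOp B (b i) j J v +
      (-1 : ℂ) ^ ((K : ℕ) * L) • ∑ i, hOpComm B (b i) h j l J L • hOp B (b' i) k K v := by
  simp only [casimir_apply, map_sum, Finset.smul_sum, ← Finset.sum_add_distrib]
  refine Finset.sum_congr rfl fun i _ => ?_
  rw [hOp_hOp B hs (b' i) h, map_add, map_smul, map_smul, hOp_hOp B hs (b i) h, pow_add]
  module

/-- The operator counting creation operators. -/
theorem exists_number [Module.Free ℤ Q] [Module.Finite ℤ Q] (hs : B.IsSymm)
    (hnd : B.Nondegenerate) : ∃ N : Module.End ℂ (VQ Q),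
      (∀ v, (∀ h (j : ℤ) J, (0 < j ∨ j = 0 ∧ J = 1) → hOp B h j J v = 0) → N v = 0) ∧
      ∀ h (j : ℤ) J, j < 0 → ∀ v, N (hOp B h j J v) = hOp B h j J (N v) + hOp B h j J v := by
  obtain ⟨n, b, b', hb, -⟩ := exists_dual_bases B hs hnd
  let A : ℕ → Module.End ℂ (VQ Q) := fun m =>
    ((m + 1 : ℂ)⁻¹) • casimir B b b' (-1 - m) 0 (m + 1) 0 + casimir B b b' (-1 - m) 1 m 1
  have hA : ∀ v, (Function.support fun m => A m v).Finite := fun v => by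
    refine finite_support_add (f := fun m : ℕ => ((m + 1 : ℂ)⁻¹) •
      casimir B b b' (-1 - m) 0 (m + 1) 0 v) (Set.Finite.subset (finite_support_casimir B b b' hs
        (fun m => (-1 - m, 0)) (fun m => m + 1) (fun m => by lia) 0 v) fun m hm h0 => hm ?_)
      (finite_support_casimir B b b' hs (fun m => (-1 - m, 1)) (fun m => m) (fun m => le_rfl) 1 v)
    simp only at h0 ⊢
    rw [h0, smul_zero]
  refine ⟨lfSum A hA, fun v hv => ?_, fun h j J hj v => ?_⟩
  · rw [lfSum_apply]
    refine finsum_eq_zero_of_forall_eq_zero fun m => ?_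
    simp only [A, LinearMap.add_apply, LinearMap.smul_apply, casimir_apply]
    rw [Finset.sum_eq_zero, Finset.sum_eq_zero, smul_zero, add_zero]
    · intro i _
      rw [hv _ _ _ (by lia), map_zero]
    · intro i _
      rw [hv _ _ _ (by lia), map_zero]
  · have := lfSum_comm (A := A) hA (X := hOp B h j J) (Y := hOp B h j J) (s := 1) (-1 - j).toNat
      (fun m v => ?_) v
    · rw [this, one_smul]
    have e1 : (m = (-1 - j).toNat) ↔ j = -1 - m := by lia
    simp only [A, LinearMap.add_apply, LinearMap.smul_apply, casimir_hOp B b b' hs, map_add,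
      map_smul, e1]
    have z1 : ∀ K i, hOpComm B (b i) h (-1 - m) j K J = 0 := fun K i =>
      hOpComm_cre_eq_zero B _ _ _ _ (by lia) hj
    simp only [z1, zero_smul, Finset.sum_const_zero, smul_zero, add_zero]
    match J with
    | 0 =>
      simp only [hOpComm]
      by_cases hjm : j = -1 - m
      · subst hjm
        have : (m + 1 : ℂ) ≠ 0 := by exact_mod_cast Nat.succ_ne_zero m
        have e := sum_form_smul_hOp B hb h (-1 - m) 0 v
        have e' : ∑ i, ((m + 1 : ℂ) * formC B (b' i) h) • hOp B (b i) (-1 - m) 0 v =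
            (m + 1 : ℂ) • hOp B h (-1 - m) 0 v := by
          simp only [mul_smul, ← Finset.smul_sum, e]
        simp only [Fin.val_zero, mul_zero, add_zero, pow_zero, one_smul, and_self, if_true,
          show (m : ℤ) + 1 + (-1 - m) = 0 by ring]
        push_cast
        rw [e', smul_add, inv_smul_smul₀ this]
        simp [add_right_comm]
      · have : ¬ ((m : ℤ) + 1 + j = 0) := by lia
        simp [this, hjm]
    | 1 =>
      simp only [hOpComm]
      by_cases hjm : j = -1 - m
      · subst hjm
        have e := sum_form_smul_hOp B hb h (-1 - m) 1 v
        simp [e]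
        abel
      · have : ¬ ((m : ℤ) + j = -1) := by lia
        simp [this, hjm]

/-- The odd translation operator `S`. -/
theorem exists_translation [Module.Free ℤ Q] [Module.Finite ℤ Q] (hs : B.IsSymm)
    (hnd : B.Nondegenerate) : ∃ S : Module.End ℂ (VQ Q),
      (∀ h j v, S (hOp B h j 1 v) = hOp B h j 0 v - hOp B h j 1 (S v)) ∧
      (∀ h j v, S (hOp B h j 0 v) = hOp B h j 0 (S v) - (j : ℂ) • hOp B h (j - 1) 1 v) ∧
      ∀ α, S (eState α) = hOp B (toH α) (-1) 1 (eState α) := by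
  obtain ⟨n, b, b', hb, hb'⟩ := exists_dual_bases B hs hnd
  let A : ℕ → Module.End ℂ (VQ Q) := fun m =>
    casimir B b b' (-1 - m) 0 m 1 + casimir B b b' (-1 - m) 1 m 0
  have hA : ∀ v, (Function.support fun m => A m v).Finite := fun v =>
    finite_support_add (finite_support_casimir B b b' hs (fun m => (-1 - m, 0)) (fun m => m)
      (fun m => le_rfl) 1 v) (finite_support_casimir B b b' hs (fun m => (-1 - m, 1)) (fun m => m)
      (fun m => le_rfl) 0 v)
  refine ⟨lfSum A hA, fun h j v => ?_, fun h j v => ?_, fun α => ?_⟩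
  · have := lfSum_comm (A := A) hA (X := hOp B h j 1) (Y := hOp B h j 0) (s := -1)
      (if j < 0 then (-1 - j).toNat else j.toNat) (fun m v => ?_) v
    · rw [this]; module
    simp only [A, LinearMap.add_apply, casimir_hOp B b b' hs, map_add, smul_add, hOpComm]
    rcases lt_or_ge j 0 with hj | hj
    · have e1 : (m = (-1 - j).toNat) ↔ j = -1 - m := by lia
      have e2 : ¬ (-1 - (m : ℤ) + j = -1) := by lia
      simp only [hj, if_true, e1]
      by_cases hjm : j = -1 - m
      · subst hjm
        have e := sum_form_smul_hOp B hb h (-1 - m) 0 v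
        simp [e, e2]
        abel
      · have : ¬ ((m : ℤ) + j = -1) := by lia
        simp [this, hjm, e2]
    · have e1 : (m = j.toNat) ↔ j = m := by lia
      have e2 : ¬ ((m : ℤ) + j = -1) := by lia
      simp only [not_lt.mpr hj, if_false, e1]
      by_cases hjm : j = m
      · subst hjm
        have e := sum_form_smul_hOp B hb' h m 0 v
        simp [e, e2]
        abel
      · have : ¬ (-1 - (m : ℤ) + j = -1) := by lia
        simp [this, hjm, e2]
  · have := lfSum_comm (A := A) hA (X := hOp B h j 0) (Y := -(j : ℂ) • hOp B h (j - 1) 1) (s := 1)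
      (if j < 0 then (-j).toNat else (j - 1).toNat) (fun m v => ?_) v
    · rw [this, LinearMap.smul_apply]; module
    simp only [A, LinearMap.add_apply, casimir_hOp B b b' hs, map_add, smul_add, hOpComm,
      LinearMap.smul_apply]
    rcases lt_or_ge j 0 with hj | hj
    · have e1 : (m = (-j).toNat) ↔ j = -m := by lia
      have e2 : ¬ (-1 - (m : ℤ) + j = 0) := by lia
      simp only [hj, if_true, e1]
      by_cases hjm : j = -m
      · subst hjm
        have e := sum_form_smul_hOp B hb h (-1 - m) 1 v
        have e3 : -(m : ℤ) - 1 = -1 - m := by ring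
        simp [e, e2, mul_smul, ← Finset.smul_sum, e3]
        abel
      · have : ¬ ((m : ℤ) + j = 0) := by lia
        simp [this, hjm, e2]
    · simp only [not_lt.mpr hj, if_false]
      rcases hj.eq_or_lt with rfl | hj'
      · have e2 : ¬ (-1 - (m : ℤ) = 0) := by lia
        simp [e2]
        intro h0
        simp [h0]
      have e1 : (m = (j - 1).toNat) ↔ j = m + 1 := by lia
      have e2 : ¬ ((m : ℤ) + j = 0) := by lia
      simp only [e1]
      by_cases hjm : j = m + 1
      · subst hjm
        have e := sum_form_smul_hOp B hb' h m 1 v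
        have e' : ∑ i, ((-1 - m : ℂ) * formC B (b i) h) • hOp B (b' i) m 1 v =
            (-1 - m : ℂ) • hOp B h m 1 v := by
          simp only [mul_smul, ← Finset.smul_sum, e]
        simp [e', e2, show (-1 - (m : ℤ) + (m + 1)) = 0 by ring]
        module
      · have : ¬ (-1 - (m : ℤ) + j = 0) := by lia
        simp [this, hjm, e2]
  · rw [lfSum_apply, finsum_eq_single _ 0]
    · simp only [A, LinearMap.add_apply, casimir_apply]
      have e := sum_form_smul_hOp B hb (toH α) (-1) 1 (eState α)
      simp [hOp_eState, e]
    · intro m hm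
      simp only [A, LinearMap.add_apply, casimir_apply]
      have : (m : ℤ) ≠ 0 := by exact_mod_cast hm
      simp [hOp_eState, hm]

/-! ### Rigidity -/

/-- Vectors obtained from the `e^β` by at most `d` creation operators. -/
def fockFil : ℕ → Submodule ℂ (VQ Q)
  | 0 => Submodule.span ℂ (Set.range eState)
  | d + 1 => fockFil d ⊔
      Submodule.span ℂ {x | ∃ h, ∃ j : ℤ, ∃ J, ∃ v ∈ fockFil d, j < 0 ∧ hOp B h j J v = x}

theorem fockFil_le_succ (d : ℕ) : fockFil B d ≤ fockFil B (d + 1) := le_sup_left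

theorem fockFil_mono {d d' : ℕ} (h : d ≤ d') : fockFil B d ≤ fockFil B d' :=
  monotone_nat_of_le_succ (fockFil_le_succ B) h

theorem hOp_mem_fockFil (h : Hsp Q) {j : ℤ} (hj : j < 0) (J : Fin 2) {d : ℕ} {v : VQ Q}
    (hv : v ∈ fockFil B d) : hOp B h j J v ∈ fockFil B (d + 1) :=
  Submodule.mem_sup_right (Submodule.subset_span ⟨h, j, J, v, hv, hj, rfl⟩)

theorem fockFil_succ_induction {d : ℕ} {P : VQ Q → Prop} (base : ∀ v ∈ fockFil B d, P v)
    (cre : ∀ h (j : ℤ) J, ∀ v ∈ fockFil B d, j < 0 → P (hOp B h j J v)) (zero : P 0)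
    (add : ∀ x y, P x → P y → P (x + y)) (smul : ∀ (c : ℂ) x, P x → P (c • x))
    {v : VQ Q} (hv : v ∈ fockFil B (d + 1)) : P v := by
  obtain ⟨x, hx, y, hy, rfl⟩ := Submodule.mem_sup.mp hv
  clear hv
  refine add _ _ (base x hx) ?_
  induction hy using Submodule.span_induction with
  | mem y hy =>
    obtain ⟨h, j, J, v, hv, hj, rfl⟩ := hy
    exact cre h j J v hv hj
  | zero => exact zero
  | add x y _ _ hx hy => exact add _ _ hx hy
  | smul c x _ hx => exact smul c _ hx

theorem ann_fockFil_zero (h : Hsp Q) {j : ℤ} {J : Fin 2} (hj : 0 < j ∨ j = 0 ∧ J = 1)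
    {v : VQ Q} (hv : v ∈ fockFil B 0) : hOp B h j J v = 0 := by
  simp only [fockFil] at hv
  induction hv using Submodule.span_induction with
  | mem y hy =>
    obtain ⟨β, rfl⟩ := hy
    rw [hOp_eState B h (by lia), if_neg]
    rintro ⟨rfl, rfl⟩
    simp at hj
  | zero => simp
  | add x y _ _ hx hy => rw [map_add, hx, hy, add_zero]
  | smul c x _ hx => rw [map_smul, hx, smul_zero]

theorem ann_mem_fockFil (hs : B.IsSymm) (h : Hsp Q) {j : ℤ} {J : Fin 2}
    (hj : 0 < j ∨ j = 0 ∧ J = 1) (d : ℕ) {v : VQ Q} (hv : v ∈ fockFil B (d + 1)) :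
    hOp B h j J v ∈ fockFil B d := by
  induction d generalizing v with
  | zero =>
    refine fockFil_succ_induction B (P := fun v => hOp B h j J v ∈ fockFil B 0)
      (fun v hv => ?_) (fun h' k K v hv hk => ?_) (by simp)
      (fun x y hx hy => by rw [map_add]; exact add_mem hx hy)
      (fun c x hx => by rw [map_smul]; exact Submodule.smul_mem _ _ hx) hv
    · rw [ann_fockFil_zero B h hj hv]; exact zero_mem _
    · rw [hOp_hOp B hs, ann_fockFil_zero B h hj hv]
      simpa using Submodule.smul_mem _ _ hv
  | succ d ih =>
    refine fockFil_succ_induction B (P := fun v => hOp B h j J v ∈ fockFil B (d + 1))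
      (fun v hv => fockFil_le_succ B d (ih hv)) (fun h' k K v hv hk => ?_) (by simp)
      (fun x y hx hy => by rw [map_add]; exact add_mem hx hy)
      (fun c x hx => by rw [map_smul]; exact Submodule.smul_mem _ _ hx) hv
    rw [hOp_hOp B hs]
    exact add_mem (Submodule.smul_mem _ _ (hOp_mem_fockFil B h' hk K (ih hv)))
      (Submodule.smul_mem _ _ hv)

theorem exists_mem_fockFil (v : VQ Q) : ∃ d, v ∈ fockFil B d := by
  induction v using vq_induction B with
  | e β => exact ⟨0, Submodule.subset_span ⟨β, rfl⟩⟩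
  | smul c x hx => exact hx.imp fun d hd => Submodule.smul_mem _ _ hd
  | add x y hx hy =>
    obtain ⟨d, hd⟩ := hx
    obtain ⟨d', hd'⟩ := hy
    exact ⟨max d d', add_mem (fockFil_mono B (le_max_left _ _) hd)
      (fockFil_mono B (le_max_right _ _) hd')⟩
  | cre h j J x hj hx =>
    obtain ⟨d, hd⟩ := hx
    exact ⟨d + 1, hOp_mem_fockFil B h hj J hd⟩

variable [Module.Free ℤ Q] [Module.Finite ℤ Q]

/-- A subspace stable under the annihilation operators contains a vector with nonzero vacuum
component, unless it is zero. -/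
theorem eq_zero_of_stable (hs : B.IsSymm) (hnd : B.Nondegenerate) (K : Submodule ℂ (VQ Q))
    (hK : ∀ h (j : ℤ) J, (0 < j ∨ j = 0 ∧ J = 1) → ∀ v ∈ K, hOp B h j J v ∈ K)
    (hvac : ∀ v ∈ K, vacProj v = 0) : ∀ v ∈ K, v = 0 := by
  obtain ⟨N, hN0, hN⟩ := exists_number B hs hnd
  have hNF : ∀ d, ∀ v ∈ fockFil B d, N v - (d : ℂ) • v ∈ fockFil B (d - 1) ∧ (d = 0 → N v = 0) := by
    intro d
    induction d with
    | zero =>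
      intro v hv
      have : N v = 0 := hN0 v fun h j J hj => ann_fockFil_zero B h hj hv
      rw [this]
      exact ⟨by simp, fun _ => rfl⟩
    | succ d ih =>
      refine fun v hv => ⟨?_, fun h => absurd h (Nat.succ_ne_zero d)⟩
      refine fockFil_succ_induction B
        (P := fun v => N v - ((d + 1 : ℕ) : ℂ) • v ∈ fockFil B (d + 1 - 1))
        (fun v hv => ?_) (fun h j J v hv hj => ?_) (by simp) (fun x y hx hy => ?_)
        (fun c x hx => ?_) hv
      · have h1 : N v - (d : ℂ) • v ∈ fockFil B d :=
          fockFil_mono B (Nat.sub_le d 1) (ih v hv).1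
        have : N v - ((d + 1 : ℕ) : ℂ) • v = (N v - (d : ℂ) • v) - v := by push_cast; module
        rw [this]
        exact sub_mem h1 hv
      · have : N (hOp B h j J v) - ((d + 1 : ℕ) : ℂ) • hOp B h j J v =
            hOp B h j J (N v - (d : ℂ) • v) := by
          rw [hN h j J hj, map_sub, map_smul]; push_cast; module
        rw [this]
        rcases Nat.eq_zero_or_pos d with rfl | hd
        · rw [(ih v hv).2 rfl]; simp
        · have := hOp_mem_fockFil B h hj J (ih v hv).1
          rwa [Nat.sub_add_cancel hd] at this
      · rw [map_add, smul_add, add_sub_add_comm]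
        exact add_mem hx hy
      · rw [map_smul, smul_comm, ← smul_sub]
        exact Submodule.smul_mem _ _ hx
  have key : ∀ d, ∀ v ∈ K, v ∈ fockFil B d → v = 0 := by
    intro d
    induction d with
    | zero =>
      intro v hvK hv
      simp only [fockFil] at hv
      obtain ⟨c, rfl⟩ := (Finsupp.mem_span_range_iff_exists_finsupp).mp hv
      have := hvac _ hvK
      simp only [Finsupp.sum, map_sum, map_smul, vacProj_eState] at this
      have hc : c = 0 := by
        rw [← this]
        conv_lhs => rw [← Finsupp.sum_single c]
        simp [Finsupp.sum]
      simp [hc]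
    | succ d ih =>
      intro v hvK hv
      have hann : N v = 0 := hN0 v fun h j J hj =>
        ih _ (hK h j J hj v hvK) (ann_mem_fockFil B hs h hj d hv)
      have := (hNF (d + 1) v hv).1
      rw [hann, zero_sub, neg_mem_iff] at this
      refine ih v hvK ?_
      rw [Nat.add_sub_cancel] at this
      exact (Submodule.smul_mem_iff _ (by exact_mod_cast Nat.succ_ne_zero d)).mp this
  intro v hv
  obtain ⟨d, hd⟩ := exists_mem_fockFil B v
  exact key d v hv hd

/-- A family of operators whose span is stable under supercommutators with the `h_(j|J)` is
determined by the vacuum components of its values on the `e^γ`. -/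
theorem rigidity (hs : B.IsSymm) (hnd : B.Nondegenerate) {ι : Type*}
    (F : ι → Module.End ℂ (VQ Q))
    (hF : ∀ h (j : ℤ) J, ∃ s : ι → ℂ, (∀ i, s i ≠ 0) ∧ ∀ i v,
      hOp B h j J (F i v) - s i • F i (hOp B h j J v) ∈
        Submodule.span ℂ (Set.range fun k => F k v))
    (hvac : ∀ i γ, vacProj (F i (eState γ)) = 0) (i : ι) : F i = 0 := by
  have h0 : ∀ γ i, F i (eState γ) = 0 := by
    intro γ i
    refine eq_zero_of_stable B hs hnd (Submodule.span ℂ (Set.range fun k => F k (eState γ)))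
      (fun h j J hj v hv => ?_) (fun v hv => ?_) _ (Submodule.subset_span ⟨i, rfl⟩)
    · obtain ⟨s, -, hs'⟩ := hF h j J
      induction hv using Submodule.span_induction with
      | mem y hy =>
        obtain ⟨k, rfl⟩ := hy
        have := hs' k (eState γ)
        rwa [ann_fockFil_zero B h hj (Submodule.subset_span ⟨γ, rfl⟩), map_zero, smul_zero,
          sub_zero] at this
      | zero => simp
      | add x y _ _ hx hy => rw [map_add]; exact add_mem hx hy
      | smul c x _ hx => rw [map_smul]; exact Submodule.smul_mem _ _ hx
    · induction hv using Submodule.span_induction with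
      | mem y hy => obtain ⟨k, rfl⟩ := hy; exact hvac k γ
      | zero => simp
      | add x y _ _ hx hy => rw [map_add, hx, hy, add_zero]
      | smul c x _ hx => rw [map_smul, hx, smul_zero]
  have key : ∀ v, ∀ i, F i v = 0 := by
    intro v
    induction v using vq_induction B with
    | e β => exact h0 β
    | smul c x hx => intro i; rw [map_smul, hx, smul_zero]
    | add x y hx hy => intro i; rw [map_add, hx, hy, add_zero]
    | cre h j J x hj hx =>
      intro i
      obtain ⟨s, hs0, hs'⟩ := hF h j J
      have := hs' i x
      have hr : (Set.range fun k => F k x) ⊆ {0} := by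
        rintro _ ⟨k, rfl⟩; exact hx k
      have h1 := Submodule.span_mono (R := ℂ) hr this
      rw [hx i, map_zero, zero_sub, Submodule.span_zero_singleton, Submodule.mem_bot,
        neg_eq_zero] at h1
      exact (smul_eq_zero.mp h1).resolve_left (hs0 i)
  exact LinearMap.ext fun v => key v i

end Number

/-! ### Calculus of vector valued distributions -/

section Calculus

variable {V : Type*} [AddCommGroup V] [Module ℂ V]

/-- Multiplication by `z^m.1 w^m.2`. -/
def shiftBy (m : ℤ × ℤ) : BiSeries V →ₗ[ℂ] BiSeries V where
  toFun f n L := f (n - m) L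
  map_add' _ _ := rfl
  map_smul' _ _ := rfl

/-- Left multiplication by `θ`. -/
def mulTheta : BiSeries V →ₗ[ℂ] BiSeries V where
  toFun f n L := if L.1 = 1 then f n (0, L.2) else 0
  map_add' f g := by ext n L; by_cases h : L.1 = 1 <;> simp [h]
  map_smul' c f := by ext n L; by_cases h : L.1 = 1 <;> simp [h]

/-- Left multiplication by `ζ`. -/
def mulZeta : BiSeries V →ₗ[ℂ] BiSeries V where
  toFun f n L := if L.2 = 1 then (-1 : ℂ) ^ (L.1 : ℕ) • f n (L.1, 0) else 0
  map_add' f g := by ext n L; by_cases h : L.2 = 1 <;> simp [h]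
  map_smul' c f := by ext n L; by_cases h : L.2 = 1 <;> simp [h, smul_comm c]

/-- The sign `(-1)^(I+K)` on the coefficient of `θ^I ζ^K`. -/
def twist : BiSeries V →ₗ[ℂ] BiSeries V where
  toFun f n L := (-1 : ℂ) ^ ((L.1 : ℕ) + L.2) • f n L
  map_add' f g := by ext n L; simp
  map_smul' c f := by ext n L; simp [smul_comm c]

/-- An operator applied to the coefficients. -/
def onCoeff (h : Module.End ℂ V) : BiSeries V →ₗ[ℂ] BiSeries V where
  toFun f n L := h (f n L)
  map_add' f g := by ext n L; simp
  map_smul' c f := by ext n L; simp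

theorem shiftBy_apply (m : ℤ × ℤ) (f : BiSeries V) (n L) : shiftBy m f n L = f (n - m) L := rfl

theorem mulTheta_apply (f : BiSeries V) (n L) :
    mulTheta f n L = if L.1 = 1 then f n (0, L.2) else 0 := rfl

theorem mulZeta_apply (f : BiSeries V) (n L) :
    mulZeta f n L = if L.2 = 1 then (-1 : ℂ) ^ (L.1 : ℕ) • f n (L.1, 0) else 0 := rfl

theorem twist_apply (f : BiSeries V) (n L) :
    twist f n L = (-1 : ℂ) ^ ((L.1 : ℕ) + L.2) • f n L := rfl

theorem onCoeff_apply (h : Module.End ℂ V) (f : BiSeries V) (n L) :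
    onCoeff h f n L = h (f n L) := rfl

theorem twist_twist (f : BiSeries V) : twist (twist f) = f := by
  ext n L
  rw [twist_apply, twist_apply, smul_smul, ← mul_pow]
  simp

theorem forall_fin2_prod {P : Fin 2 × Fin 2 → Prop} (h00 : P (0, 0)) (h10 : P (1, 0))
    (h01 : P (0, 1)) (h11 : P (1, 1)) (L) : P L := by
  match L with
  | (0, 0) => exact h00
  | (1, 0) => exact h10
  | (0, 1) => exact h01
  | (1, 1) => exact h11

theorem twist_mulTheta (f : BiSeries V) : twist (mulTheta f) = -mulTheta (twist f) := by
  ext n L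
  refine forall_fin2_prod (P := fun L => twist (mulTheta f) n L = (-mulTheta (twist f)) n L)
    ?_ ?_ ?_ ?_ L <;> simp [twist_apply, mulTheta_apply]

theorem twist_mulZeta (f : BiSeries V) : twist (mulZeta f) = -mulZeta (twist f) := by
  ext n L
  refine forall_fin2_prod (P := fun L => twist (mulZeta f) n L = (-mulZeta (twist f)) n L)
    ?_ ?_ ?_ ?_ L <;> simp [twist_apply, mulZeta_apply]

theorem onCoeff_twist (h : Module.End ℂ V) (f : BiSeries V) :
    onCoeff h (twist f) = twist (onCoeff h f) := by
  ext n L; simp [onCoeff_apply, twist_apply]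

theorem onCoeff_mulTheta (h : Module.End ℂ V) (f : BiSeries V) :
    onCoeff h (mulTheta f) = mulTheta (onCoeff h f) := by
  ext n L; simp only [onCoeff_apply, mulTheta_apply]; split_ifs <;> simp

theorem onCoeff_mulZeta (h : Module.End ℂ V) (f : BiSeries V) :
    onCoeff h (mulZeta f) = mulZeta (onCoeff h f) := by
  ext n L; simp only [onCoeff_apply, mulZeta_apply]; split_ifs <;> simp

theorem mulTheta_mulTheta (f : BiSeries V) : mulTheta (mulTheta f) = 0 := by
  ext n L; simp [mulTheta_apply]

theorem mulZeta_mulTheta (f : BiSeries V) : mulZeta (mulTheta f) = -mulTheta (mulZeta f) := by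
  ext n L
  refine forall_fin2_prod (P := fun L => mulZeta (mulTheta f) n L = (-mulTheta (mulZeta f)) n L)
    ?_ ?_ ?_ ?_ L <;> simp [mulZeta_apply, mulTheta_apply]

theorem mulZeta_mulZeta (f : BiSeries V) : mulZeta (mulZeta f) = 0 := by
  ext n L; simp [mulZeta_apply]

/-- The product with an operator valued distribution in the even variables. -/
def convAct (a : ℤ × ℤ → Module.End ℂ V) (f : BiSeries V) : BiSeries V :=
  fun n L => ∑ᶠ k, a k (f (n - k) L)

/-- All sums in `convAct a f` are finite. -/
def Summable (a : ℤ × ℤ → Module.End ℂ V) (f : BiSeries V) : Prop :=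
  ∀ n L, (Function.support fun k => a k (f (n - k) L)).Finite

theorem convAct_add {a : ℤ × ℤ → Module.End ℂ V} {f g : BiSeries V} (hf : Summable a f)
    (hg : Summable a g) : convAct a (f + g) = convAct a f + convAct a g := by
  ext n L
  simp only [convAct, Pi.add_apply, map_add]
  exact finsum_add_distrib (hf n L) (hg n L)

theorem convAct_smul {a : ℤ × ℤ → Module.End ℂ V} {f : BiSeries V} (hf : Summable a f) (c : ℂ) :
    convAct a (c • f) = c • convAct a f := by
  ext n L
  simp only [convAct, Pi.smul_apply, map_smul]
  exact (smul_finsum' c (hf n L)).symm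

theorem convAct_shiftBy (a : ℤ × ℤ → Module.End ℂ V) (f : BiSeries V) (m) :
    convAct a (shiftBy m f) = shiftBy m (convAct a f) := by
  ext n L
  simp only [convAct, shiftBy_apply]
  exact finsum_congr fun k => by rw [sub_right_comm]

theorem convAct_mulTheta (a : ℤ × ℤ → Module.End ℂ V) (f : BiSeries V) :
    convAct a (mulTheta f) = mulTheta (convAct a f) := by
  ext n L
  simp only [convAct, mulTheta_apply]
  split_ifs <;> simp

theorem convAct_twist {a : ℤ × ℤ → Module.End ℂ V} {f : BiSeries V} (hf : Summable a f) :
    convAct a (twist f) = twist (convAct a f) := by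
  ext n L
  simp only [convAct, twist_apply, map_smul]
  exact (smul_finsum' _ (hf n L)).symm

theorem convAct_mulZeta {a : ℤ × ℤ → Module.End ℂ V} {f : BiSeries V} (hf : Summable a f) :
    convAct a (mulZeta f) = mulZeta (convAct a f) := by
  ext n L
  simp only [convAct, mulZeta_apply]
  split_ifs
  · simp only [map_smul]
    exact (smul_finsum' _ (hf n (L.1, 0))).symm
  · simp

theorem onCoeff_convAct {a : ℤ × ℤ → Module.End ℂ V} {f : BiSeries V} {h : Module.End ℂ V}
    (hf : Summable a f) (hhf : Summable a (onCoeff h f)) {s A B : ℂ} {p q : ℤ × ℤ}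
    (hc : ∀ k v, h (a k v) = s • a k (h v) +
      ((if k = p then A else 0) + (if k = q then B else 0)) • v) :
    onCoeff h (convAct a f) = s • convAct a (onCoeff h f) + A • shiftBy p f + B • shiftBy q f := by
  ext n L
  have single : ∀ (C : ℂ) (p : ℤ × ℤ),
      ∑ᶠ k, (if k = p then C else 0) • f (n - k) L = C • f (n - p) L := fun C p => by
    rw [finsum_eq_single _ p fun k hk => by simp [hk]]
    simp
  have fin : ∀ (C : ℂ) (p : ℤ × ℤ),
      (Function.support fun k => (if k = p then C else 0) • f (n - k) L).Finite := fun C p =>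
    (Set.finite_singleton p).subset fun k hk => by
      by_contra h0
      exact hk (by simp [show k ≠ p from h0])
  have fin1 : (Function.support fun k => a k (h (f (n - k) L))).Finite := hhf n L
  have fin2 : (Function.support fun k => s • a k (h (f (n - k) L))).Finite :=
    fin1.subset fun k hk h0 => hk (by simp only at h0 ⊢; rw [h0, smul_zero])
  simp only [onCoeff_apply, convAct, Pi.add_apply, Pi.smul_apply, shiftBy_apply]
  rw [map_finsum h (hf n L)]
  simp only [hc, add_smul]
  rw [finsum_add_distrib fin2 (finite_support_add (fin A p) (fin B q)),
    finsum_add_distrib (fin A p) (fin B q), single, single]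
  rw [← smul_finsum' s fin1, add_assoc]

theorem finsum_mem_submodule {ι : Type*} (U : Submodule ℂ V) {f : ι → V} (h : ∀ i, f i ∈ U) :
    ∑ᶠ i, f i ∈ U :=
  finsum_induction (· ∈ U) U.zero_mem (fun _ _ => U.add_mem) h

theorem convAct_mem {a : ℤ × ℤ → Module.End ℂ V} {f : BiSeries V} (U : Submodule ℂ V) (n L)
    (h : ∀ k, a k (f (n - k) L) ∈ U) : convAct a f n L ∈ U :=
  finsum_mem_submodule U h

/-- The coefficients of `A` are odd or even according to the powers of `θ, ζ`. -/
structure SuperEven (σ : Module.End ℂ V) (A : BiSeries (Module.End ℂ V)) : Prop where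
  comm : ∀ k I v, σ (A k I v) = (-1 : ℂ) ^ ((I.1 : ℕ) + I.2) • A k I (σ v)
  top : ∀ k, A k (1, 1) = 0

/-- `act σ A` in terms of its components. -/
def actComp (A : BiSeries (Module.End ℂ V)) (f : BiSeries V) : BiSeries V :=
  convAct (A · (0, 0)) f + mulTheta (twist (convAct (A · (1, 0)) f)) +
    mulZeta (twist (convAct (A · (0, 1)) f))

theorem act_eq_actComp {σ : Module.End ℂ V} (hσ : σ * σ = 1) {A : BiSeries (Module.End ℂ V)}
    (hA : SuperEven σ A) : act σ A = actComp A := by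
  have hσ' : ∀ v, σ (σ v) = v := fun v => DFunLike.congr_fun hσ v
  have h0 : ∀ k v, σ (A k (0, 0) v) = A k (0, 0) (σ v) := fun k v => by
    simpa using hA.comm k (0, 0) v
  have h1 : ∀ k v, σ (A k (1, 0) v) = -A k (1, 0) (σ v) := fun k v => by
    simpa using hA.comm k (1, 0) v
  have h2 : ∀ k v, σ (A k (0, 1) v) = -A k (0, 1) (σ v) := fun k v => by
    simpa using hA.comm k (0, 1) v
  funext f n L
  refine forall_fin2_prod (P := fun L => act σ A f n L = actComp A f n L) ?_ ?_ ?_ ?_ L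
  · have : Finset.Iic ((0, 0) : Fin 2 × Fin 2) = {(0, 0)} := by decide
    simp [act, this, actComp, convAct, mulTheta_apply, mulZeta_apply]
    rfl
  · have : Finset.Iic ((1, 0) : Fin 2 × Fin 2) = {(0, 0), (1, 0)} := by decide
    simp [act, this, actComp, convAct, mulTheta_apply, mulZeta_apply, twist_apply, h0, hσ']
    rfl
  · have : Finset.Iic ((0, 1) : Fin 2 × Fin 2) = {(0, 0), (0, 1)} := by decide
    simp [act, this, actComp, convAct, mulTheta_apply, mulZeta_apply, twist_apply, h0, hσ']
    rfl
  · have : Finset.Iic ((1, 1) : Fin 2 × Fin 2) = {(0, 0), (1, 0), (0, 1), (1, 1)} := by decide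
    simp [act, this, actComp, convAct, mulTheta_apply, mulZeta_apply, twist_apply, h0, h1, h2, hσ',
      hA.top, pow_succ, finsum_neg_distrib]
    abel

/-! ### Linear operators on spaces of distributions -/

/-- `X` is linear on `K`, maps `K` to `K'` and commutes with multiplication by the variables. -/
structure LinOn (K K' : Submodule ℂ (BiSeries V)) (X : BiSeries V → BiSeries V) : Prop where
  maps : ∀ f ∈ K, X f ∈ K'
  add : ∀ f ∈ K, ∀ g ∈ K, X (f + g) = X f + X g
  smul : ∀ (c : ℂ), ∀ f ∈ K, X (c • f) = c • X f
  shift : ∀ m, ∀ f ∈ K, X (shiftBy m f) = shiftBy m (X f)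
  theta : ∀ f ∈ K, X (mulTheta f) = mulTheta (X f)
  zeta : ∀ f ∈ K, X (mulZeta f) = mulZeta (X f)

/-- `K` is stable under multiplication by the variables. -/
structure Stable (K : Submodule ℂ (BiSeries V)) : Prop where
  shift : ∀ m, ∀ f ∈ K, shiftBy m f ∈ K
  theta : ∀ f ∈ K, mulTheta f ∈ K
  zeta : ∀ f ∈ K, mulZeta f ∈ K
  twist : ∀ f ∈ K, twist f ∈ K

theorem LinOn.comp {K K' K'' : Submodule ℂ (BiSeries V)} {X Y : BiSeries V → BiSeries V}
    (hX : LinOn K K' X) (hY : LinOn K' K'' Y) : LinOn K K'' (Y ∘ X) where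
  maps f hf := hY.maps _ (hX.maps f hf)
  add f hf g hg := by
    simp only [Function.comp, hX.add f hf g hg, hY.add _ (hX.maps f hf) _ (hX.maps g hg)]
  smul c f hf := by simp only [Function.comp, hX.smul c f hf, hY.smul c _ (hX.maps f hf)]
  shift m f hf := by simp only [Function.comp, hX.shift m f hf, hY.shift m _ (hX.maps f hf)]
  theta f hf := by simp only [Function.comp, hX.theta f hf, hY.theta _ (hX.maps f hf)]
  zeta f hf := by simp only [Function.comp, hX.zeta f hf, hY.zeta _ (hX.maps f hf)]

theorem linOn_convAct {K K' : Submodule ℂ (BiSeries V)} {a : ℤ × ℤ → Module.End ℂ V}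
    (hs : ∀ f ∈ K, Summable a f) (hm : ∀ f ∈ K, convAct a f ∈ K') : LinOn K K' (convAct a) where
  maps := hm
  add f hf g hg := convAct_add (hs f hf) (hs g hg)
  smul c f hf := convAct_smul (hs f hf) c
  shift m f _ := convAct_shiftBy a f m
  theta f _ := convAct_mulTheta a f
  zeta f hf := convAct_mulZeta (hs f hf)

/-- The odd part `θ a₁(z,w) + ζ a₂(z,w)`. -/
def oddAct (a₁ a₂ : ℤ × ℤ → Module.End ℂ V) (f : BiSeries V) : BiSeries V :=
  mulTheta (twist (convAct a₁ f)) + mulZeta (twist (convAct a₂ f))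

theorem linOn_oddAct {K K' : Submodule ℂ (BiSeries V)} (hK' : Stable K')
    {a₁ a₂ : ℤ × ℤ → Module.End ℂ V}
    (h₁ : LinOn K K' (convAct a₁)) (h₂ : LinOn K K' (convAct a₂)) :
    LinOn K K' (oddAct a₁ a₂) where
  maps f hf := add_mem (hK'.theta _ (hK'.twist _ (h₁.maps f hf)))
    (hK'.zeta _ (hK'.twist _ (h₂.maps f hf)))
  add f hf g hg := by
    simp only [oddAct, h₁.add f hf g hg, h₂.add f hf g hg, map_add]; abel
  smul c f hf := by simp only [oddAct, h₁.smul c f hf, h₂.smul c f hf, map_smul, smul_add]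
  shift m f hf := by
    simp only [oddAct, h₁.shift m f hf, h₂.shift m f hf, map_add]
    rfl
  theta f hf := by
    simp only [oddAct, h₁.theta f hf, h₂.theta f hf, map_add, twist_mulTheta, map_neg,
      mulTheta_mulTheta, mulZeta_mulTheta]
    simp
  zeta f hf := by
    have : ∀ g : BiSeries V, mulTheta (mulZeta g) = -mulZeta (mulTheta g) := fun g => by
      rw [mulZeta_mulTheta, neg_neg]
    simp only [oddAct, h₁.zeta f hf, h₂.zeta f hf, map_add, twist_mulZeta, map_neg,
      mulZeta_mulZeta, this]
    simp

/-- The action of an operator of parity `J` on distributions. -/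
def superCoeff (J : Fin 2) (h : Module.End ℂ V) : BiSeries V →ₗ[ℂ] BiSeries V :=
  if J = 0 then onCoeff h else twist ∘ₗ onCoeff h

/-- `a z^j + b w^j` for `J = 0`, `-(a θ z^j + b ζ w^j)` for `J = 1`. -/
def scalarCoeff (J : Fin 2) (j : ℤ) (a b : ℂ) : BiSeries V →ₗ[ℂ] BiSeries V :=
  if J = 0 then a • shiftBy (j, 0) + b • shiftBy (0, j)
  else -(a • mulTheta ∘ₗ shiftBy (j, 0) + b • mulZeta ∘ₗ shiftBy (0, j))

theorem scalarCoeff_mem {K : Submodule ℂ (BiSeries V)} (hK : Stable K) (J : Fin 2) (j : ℤ) (a b : ℂ)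
    {f : BiSeries V} (hf : f ∈ K) : scalarCoeff J j a b f ∈ K := by
  match J with
  | 0 =>
    exact add_mem (K.smul_mem _ (hK.shift _ f hf)) (K.smul_mem _ (hK.shift _ f hf))
  | 1 =>
    exact neg_mem (add_mem (K.smul_mem _ (hK.theta _ (hK.shift _ f hf)))
      (K.smul_mem _ (hK.zeta _ (hK.shift _ f hf))))

theorem LinOn.neg {K K' : Submodule ℂ (BiSeries V)} {X : BiSeries V → BiSeries V}
    (hX : LinOn K K' X) {f : BiSeries V} (hf : f ∈ K) : X (-f) = -X f := by
  simpa using hX.smul (-1) f hf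

theorem LinOn.scalarCoeff {K K' : Submodule ℂ (BiSeries V)} (hK : Stable K)
    {X : BiSeries V → BiSeries V} (hX : LinOn K K' X) (J : Fin 2) (j : ℤ) (a b : ℂ)
    {f : BiSeries V} (hf : f ∈ K) :
    X (SUSY.scalarCoeff J j a b f) = SUSY.scalarCoeff J j a b (X f) := by
  match J with
  | 0 =>
    change X (a • shiftBy (j, 0) f + b • shiftBy (0, j) f) = _
    rw [hX.add _ (K.smul_mem _ (hK.shift _ f hf)) _ (K.smul_mem _ (hK.shift _ f hf)),
      hX.smul _ _ (hK.shift _ f hf), hX.smul _ _ (hK.shift _ f hf), hX.shift _ f hf,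
      hX.shift _ f hf]
    rfl
  | 1 =>
    have h1 := hK.shift (j, 0) f hf
    have h2 := hK.shift (0, j) f hf
    change X (-(a • mulTheta (shiftBy (j, 0) f) + b • mulZeta (shiftBy (0, j) f))) = _
    rw [hX.neg (add_mem (K.smul_mem _ (hK.theta _ h1)) (K.smul_mem _ (hK.zeta _ h2))),
      hX.add _ (K.smul_mem _ (hK.theta _ h1)) _ (K.smul_mem _ (hK.zeta _ h2)),
      hX.smul _ _ (hK.theta _ h1), hX.smul _ _ (hK.zeta _ h2), hX.theta _ h1, hX.zeta _ h2,
      hX.shift _ f hf, hX.shift _ f hf]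
    rfl

theorem scalarCoeff_add (J : Fin 2) (j : ℤ) (a b a' b' : ℂ) (f : BiSeries V) :
    scalarCoeff J j (a + a') (b + b') f = scalarCoeff J j a b f + scalarCoeff J j a' b' f := by
  match J with
  | 0 =>
    change (a + a') • shiftBy (j, 0) f + (b + b') • shiftBy (0, j) f =
      a • shiftBy (j, 0) f + b • shiftBy (0, j) f + (a' • shiftBy (j, 0) f + b' • shiftBy (0, j) f)
    module
  | 1 =>
    change -((a + a') • mulTheta (shiftBy (j, 0) f) + (b + b') • mulZeta (shiftBy (0, j) f)) =
      -(a • mulTheta (shiftBy (j, 0) f) + b • mulZeta (shiftBy (0, j) f)) +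
        -(a' • mulTheta (shiftBy (j, 0) f) + b' • mulZeta (shiftBy (0, j) f))
    module

/-- `X` satisfies `h X = X h + C X` with `C = scalarCoeff J j a b`. -/
def CommOn (K : Submodule ℂ (BiSeries V)) (X : BiSeries V → BiSeries V) (J : Fin 2)
    (h : Module.End ℂ V) (j : ℤ) (a b : ℂ) : Prop :=
  ∀ f ∈ K, superCoeff J h (X f) = X (superCoeff J h f) + scalarCoeff J j a b (X f)

theorem CommOn.comp {K K' K'' : Submodule ℂ (BiSeries V)} {X Y : BiSeries V → BiSeries V}
    {J : Fin 2} {h : Module.End ℂ V} {j : ℤ} {a b a' b' : ℂ} (hK' : Stable K')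
    (hh : ∀ f ∈ K, superCoeff J h f ∈ K)
    (hX : LinOn K K' X) (hY : LinOn K' K'' Y) (cX : CommOn K X J h j a b)
    (cY : CommOn K' Y J h j a' b') : CommOn K (Y ∘ X) J h j (a + a') (b + b') := by
  intro f hf
  simp only [Function.comp]
  rw [cY _ (hX.maps f hf), cX f hf, hY.add _ (hX.maps _ (hh f hf)) _
    (scalarCoeff_mem hK' _ _ _ _ (hX.maps f hf)), hY.scalarCoeff hK' _ _ _ _ (hX.maps f hf),
    scalarCoeff_add]
  abel

/-! ### Exponentials -/

/-- `∑ₘ Xᵐ f / m!`. -/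
def expOp (X : BiSeries V → BiSeries V) (f : BiSeries V) : BiSeries V :=
  fun n L => ∑ᶠ m : ℕ, ((m.factorial : ℂ)⁻¹) • (X^[m] f) n L

/-- `∑_{m < M} Xᵐ f / m!`. -/
def expTrunc (X : BiSeries V → BiSeries V) (M : ℕ) (f : BiSeries V) : BiSeries V :=
  ∑ m ∈ Finset.range M, ((m.factorial : ℂ)⁻¹) • X^[m] f

/-- `X` is nilpotent on each coefficient. -/
def NilOn (K : Submodule ℂ (BiSeries V)) (X : BiSeries V → BiSeries V) : Prop :=
  ∀ f ∈ K, ∀ n L, ∃ M : ℕ, ∀ m, M ≤ m → (X^[m] f) n L = 0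

theorem NilOn.exists_expTrunc {K : Submodule ℂ (BiSeries V)} {X : BiSeries V → BiSeries V}
    (hX : NilOn K X) {f : BiSeries V} (hf : f ∈ K) (n L) :
    ∃ M : ℕ, ∀ m, M ≤ m → expOp X f n L = expTrunc X m f n L := by
  obtain ⟨M, hM⟩ := hX f hf n L
  refine ⟨M, fun m hm => ?_⟩
  rw [expOp, expTrunc, Finset.sum_apply, Finset.sum_apply]
  simp only [Pi.smul_apply]
  refine finsum_eq_sum_of_support_subset _ fun k hk => ?_
  by_contra h
  simp only [Finset.coe_range, Set.mem_Iio, not_lt] at h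
  exact hk (by simp only; rw [hM k (hm.trans h), smul_zero])

/-- Finitely many coefficients of `expOp` agree with those of a truncation. -/
theorem NilOn.exists_expTrunc_finset {K : Submodule ℂ (BiSeries V)}
    {X : BiSeries V → BiSeries V} (hX : NilOn K X) {f : BiSeries V} (hf : f ∈ K)
    (s : Finset ((ℤ × ℤ) × (Fin 2 × Fin 2))) :
    ∃ M : ℕ, ∀ m, M ≤ m → ∀ p ∈ s, expOp X f p.1 p.2 = expTrunc X m f p.1 p.2 := by
  choose M hM using fun p : (ℤ × ℤ) × (Fin 2 × Fin 2) => hX.exists_expTrunc hf p.1 p.2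
  exact ⟨s.sup M, fun m hm p hp => hM p m ((Finset.le_sup hp).trans hm)⟩

theorem LinOn.iterate {K : Submodule ℂ (BiSeries V)} {X : BiSeries V → BiSeries V}
    (hX : LinOn K K X) (m : ℕ) : LinOn K K (X^[m]) := by
  induction m with
  | zero => exact ⟨fun _ => id, fun _ _ _ _ => rfl, fun _ _ _ => rfl, fun _ _ _ => rfl,
      fun _ _ => rfl, fun _ _ => rfl⟩
  | succ m ih =>
    rw [Function.iterate_succ]
    exact hX.comp ih

theorem LinOn.linOn_expTrunc {K : Submodule ℂ (BiSeries V)} {X : BiSeries V → BiSeries V}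
    (hX : LinOn K K X) (M : ℕ) : LinOn K K (expTrunc X M) where
  maps f hf := Submodule.sum_mem _ fun m _ => K.smul_mem _ ((hX.iterate m).maps f hf)
  add f hf g hg := by
    simp only [expTrunc, (hX.iterate _).add f hf g hg, smul_add, Finset.sum_add_distrib]
  smul c f hf := by
    simp only [expTrunc, (hX.iterate _).smul c f hf, smul_comm _ c, Finset.smul_sum]
  shift m f hf := by simp only [expTrunc, (hX.iterate _).shift m f hf, map_sum, map_smul]
  theta f hf := by simp only [expTrunc, (hX.iterate _).theta f hf, map_sum, map_smul]
  zeta f hf := by simp only [expTrunc, (hX.iterate _).zeta f hf, map_sum, map_smul]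

theorem linOn_expOp {K K' : Submodule ℂ (BiSeries V)} {X : BiSeries V → BiSeries V}
    (hK : Stable K) (hX : LinOn K K X) (hn : NilOn K X) (hm : ∀ f ∈ K, expOp X f ∈ K') :
    LinOn K K' (expOp X) where
  maps := hm
  add f hf g hg := by
    ext n L
    obtain ⟨M₁, h₁⟩ := hn.exists_expTrunc hf n L
    obtain ⟨M₂, h₂⟩ := hn.exists_expTrunc hg n L
    obtain ⟨M₃, h₃⟩ := hn.exists_expTrunc (add_mem hf hg) n L
    let M := max M₁ (max M₂ M₃)
    rw [Pi.add_apply, Pi.add_apply, h₁ M (by simp [M]), h₂ M (by simp [M]), h₃ M (by simp [M]),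
      (hX.linOn_expTrunc M).add f hf g hg]
    rfl
  smul c f hf := by
    ext n L
    obtain ⟨M₁, h₁⟩ := hn.exists_expTrunc hf n L
    obtain ⟨M₂, h₂⟩ := hn.exists_expTrunc (K.smul_mem c hf) n L
    let M := max M₁ M₂
    rw [Pi.smul_apply, Pi.smul_apply, h₁ M (by simp [M]), h₂ M (by simp [M]),
      (hX.linOn_expTrunc M).smul c f hf]
    rfl
  shift m f hf := by
    ext n L
    obtain ⟨M₁, h₁⟩ := hn.exists_expTrunc hf (n - m) L
    obtain ⟨M₂, h₂⟩ := hn.exists_expTrunc (hK.shift m f hf) n L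
    let M := max M₁ M₂
    rw [shiftBy_apply, h₁ M (by simp [M]), h₂ M (by simp [M]),
      (hX.linOn_expTrunc M).shift m f hf]
    rfl
  theta f hf := by
    ext n L
    obtain ⟨M₁, h₁⟩ := hn.exists_expTrunc hf n (0, L.2)
    obtain ⟨M₂, h₂⟩ := hn.exists_expTrunc (hK.theta f hf) n L
    let M := max M₁ M₂
    rw [mulTheta_apply, h₁ M (by simp [M]), h₂ M (by simp [M]),
      (hX.linOn_expTrunc M).theta f hf]
    rfl
  zeta f hf := by
    ext n L
    obtain ⟨M₁, h₁⟩ := hn.exists_expTrunc hf n (L.1, 0)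
    obtain ⟨M₂, h₂⟩ := hn.exists_expTrunc (hK.zeta f hf) n L
    let M := max M₁ M₂
    rw [mulZeta_apply, h₁ M (by simp [M]), h₂ M (by simp [M]),
      (hX.linOn_expTrunc M).zeta f hf]
    rfl

theorem scalarCoeff_congr (J : Fin 2) (j : ℤ) (a b : ℂ) {f g : BiSeries V} (n L)
    (h : ∀ p ∈ ({(n - (j, 0), L), (n - (0, j), L), (n - (j, 0), (0, L.2)),
      (n - (0, j), (L.1, 0))} : Finset ((ℤ × ℤ) × (Fin 2 × Fin 2))), f p.1 p.2 = g p.1 p.2) :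
    scalarCoeff J j a b f n L = scalarCoeff J j a b g n L := by
  simp only [Finset.mem_insert, Finset.mem_singleton, forall_eq_or_imp, forall_eq] at h
  obtain ⟨h1, h2, h3, h4⟩ := h
  match J with
  | 0 =>
    change a • f (n - (j, 0)) L + b • f (n - (0, j)) L = a • g (n - (j, 0)) L + b • g (n - (0, j)) L
    rw [h1, h2]
  | 1 =>
    change -(a • (if L.1 = 1 then f (n - (j, 0)) (0, L.2) else 0) +
      b • (if L.2 = 1 then (-1 : ℂ) ^ (L.1 : ℕ) • f (n - (0, j)) (L.1, 0) else 0)) =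
      -(a • (if L.1 = 1 then g (n - (j, 0)) (0, L.2) else 0) +
      b • (if L.2 = 1 then (-1 : ℂ) ^ (L.1 : ℕ) • g (n - (0, j)) (L.1, 0) else 0))
    rw [h3, h4]

theorem superCoeff_congr (J : Fin 2) (h : Module.End ℂ V) {f g : BiSeries V} {n L}
    (hfg : f n L = g n L) : superCoeff J h f n L = superCoeff J h g n L := by
  match J with
  | 0 => exact congrArg h hfg
  | 1 => exact congrArg (fun v => (-1 : ℂ) ^ ((L.1 : ℕ) + L.2) • h v) hfg

theorem commOn_expOp {K : Submodule ℂ (BiSeries V)} {X : BiSeries V → BiSeries V}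
    (hK : Stable K) (hX : LinOn K K X) (hn : NilOn K X) {J : Fin 2} {h : Module.End ℂ V} {j : ℤ}
    {a b : ℂ} (hh : ∀ f ∈ K, superCoeff J h f ∈ K)
    (hc : ∀ f ∈ K, superCoeff J h (X f) = X (superCoeff J h f) + scalarCoeff J j a b f) :
    CommOn K (expOp X) J h j a b := by
  have hm : ∀ m, ∀ f ∈ K, superCoeff J h (X^[m + 1] f) =
      X^[m + 1] (superCoeff J h f) + (m + 1 : ℂ) • scalarCoeff J j a b (X^[m] f) := by
    intro m
    induction m with
    | zero => intro f hf; simp [hc f hf]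
    | succ m ih =>
      intro f hf
      rw [Function.iterate_succ_apply', hc _ ((hX.iterate _).maps f hf), ih f hf,
        hX.add _ ((hX.iterate _).maps _ (hh f hf)) _
          (K.smul_mem _ (scalarCoeff_mem hK _ _ _ _ ((hX.iterate m).maps f hf))),
        hX.smul _ _ (scalarCoeff_mem hK _ _ _ _ ((hX.iterate m).maps f hf)),
        hX.scalarCoeff hK _ _ _ _ ((hX.iterate m).maps f hf), ← Function.iterate_succ_apply' X,
        ← Function.iterate_succ_apply' X]
      push_cast
      module
  have hM : ∀ M, ∀ f ∈ K, superCoeff J h (expTrunc X (M + 1) f) =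
      expTrunc X (M + 1) (superCoeff J h f) + scalarCoeff J j a b (expTrunc X M f) := by
    intro M f hf
    induction M with
    | zero => simp [expTrunc]
    | succ M ih =>
      have e1 : ∀ g, expTrunc X (M + 1 + 1) g =
          expTrunc X (M + 1) g + (((M + 1).factorial : ℂ)⁻¹) • X^[M + 1] g := fun g =>
        Finset.sum_range_succ _ _
      have e2 : expTrunc X (M + 1) f = expTrunc X M f + ((M.factorial : ℂ)⁻¹) • X^[M] f :=
        Finset.sum_range_succ _ _
      have e3 : (((M + 1).factorial : ℂ)⁻¹) * (M + 1 : ℂ) = (M.factorial : ℂ)⁻¹ := by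
        rw [Nat.factorial_succ]
        have : (M.factorial : ℂ) ≠ 0 := by exact_mod_cast M.factorial_ne_zero
        have : (M + 1 : ℂ) ≠ 0 := by exact_mod_cast M.succ_ne_zero
        push_cast
        field_simp
      rw [e1, e1, map_add, ih, map_smul, hm M f hf, smul_add, smul_smul, e3]
      conv_rhs => rw [e2, map_add, map_smul]
      abel
  intro f hf
  ext n L
  obtain ⟨M₁, h₁⟩ := hn.exists_expTrunc hf n L
  obtain ⟨M₂, h₂⟩ := hn.exists_expTrunc (hh f hf) n L
  obtain ⟨M₃, h₃⟩ := hn.exists_expTrunc_finset hf {(n - (j, 0), L), (n - (0, j), L),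
    (n - (j, 0), (0, L.2)), (n - (0, j), (L.1, 0))}
  let M := max M₁ (max M₂ M₃)
  rw [superCoeff_congr J h (h₁ (M + 1) (by simp only [M]; omega)), hM M f hf, Pi.add_apply,
    Pi.add_apply, Pi.add_apply, Pi.add_apply, h₂ (M + 1) (by simp only [M]; omega),
    scalarCoeff_congr J j a b n L (h₃ M (by simp [M]))]

theorem expAct_eq_expOp {σ : Module.End ℂ V} (hσ : σ * σ = 1) {A : BiSeries (Module.End ℂ V)}
    (hA : SuperEven σ A) : expAct σ A = expOp (actComp A) := by
  funext f n L
  rw [expAct, expOp, act_eq_actComp hσ hA]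

end Calculus

section Classes

variable {V : Type*} [AddCommGroup V] [Module ℂ V]

theorem superCoeff_zero_apply (h : Module.End ℂ V) (f : BiSeries V) :
    superCoeff 0 h f = onCoeff h f := rfl

theorem superCoeff_one_apply (h : Module.End ℂ V) (f : BiSeries V) :
    superCoeff 1 h f = twist (onCoeff h f) := rfl

theorem scalarCoeff_zero_zero (J : Fin 2) (j : ℤ) (f : BiSeries V) :
    scalarCoeff J j 0 0 f = 0 := by
  have := scalarCoeff_add J j 0 0 0 0 f
  simpa using this

theorem superCoeff_mem {K : Submodule ℂ (BiSeries V)} (hK : Stable K) {h : Module.End ℂ V}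
    (hh : ∀ f ∈ K, onCoeff h f ∈ K) (J : Fin 2) : ∀ f ∈ K, superCoeff J h f ∈ K := by
  intro f hf
  match J with
  | 0 => exact hh f hf
  | 1 => exact hK.twist _ (hh f hf)

theorem superCoeff_convAct {a : ℤ × ℤ → Module.End ℂ V} {f : BiSeries V} {h : Module.End ℂ V}
    (hf : Summable a f) (hhf : Summable a (onCoeff h f)) (hc : ∀ k v, h (a k v) = a k (h v))
    (J : Fin 2) : superCoeff J h (convAct a f) = convAct a (superCoeff J h f) := by
  have := onCoeff_convAct (s := 1) (A := 0) (B := 0) (p := 0) (q := 0) hf hhf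
    (fun k v => by simp [hc])
  simp only [one_smul, zero_smul, add_zero] at this
  match J with
  | 0 => exact this
  | 1 => rw [superCoeff_one_apply, this, ← convAct_twist hhf]; rfl

theorem superCoeff_oddAct_zero {a₁ a₂ : ℤ × ℤ → Module.End ℂ V} {f : BiSeries V}
    {h : Module.End ℂ V} (h₁ : Summable a₁ f) (h₁' : Summable a₁ (onCoeff h f))
    (h₂ : Summable a₂ f) (h₂' : Summable a₂ (onCoeff h f))
    (hc₁ : ∀ k v, h (a₁ k v) = a₁ k (h v)) (hc₂ : ∀ k v, h (a₂ k v) = a₂ k (h v)) :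
    superCoeff 0 h (oddAct a₁ a₂ f) = oddAct a₁ a₂ (superCoeff 0 h f) := by
  have e₁ := superCoeff_convAct h₁ h₁' hc₁ 0
  have e₂ := superCoeff_convAct h₂ h₂' hc₂ 0
  simp only [superCoeff_zero_apply] at *
  rw [oddAct, map_add, onCoeff_mulTheta, onCoeff_mulZeta, onCoeff_twist, onCoeff_twist, e₁, e₂]
  rfl

theorem superCoeff_oddAct_one {a₁ a₂ : ℤ × ℤ → Module.End ℂ V} {f : BiSeries V}
    {h : Module.End ℂ V} (h₁ : Summable a₁ f) (h₁' : Summable a₁ (onCoeff h f))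
    (h₂ : Summable a₂ f) (h₂' : Summable a₂ (onCoeff h f)) {j : ℤ} {A B : ℂ}
    (hc₁ : ∀ k v, h (a₁ k v) = -a₁ k (h v) + (if k = (j, 0) then A else 0) • v)
    (hc₂ : ∀ k v, h (a₂ k v) = -a₂ k (h v) + (if k = (0, j) then B else 0) • v) :
    superCoeff 1 h (oddAct a₁ a₂ f) =
      oddAct a₁ a₂ (superCoeff 1 h f) + scalarCoeff 1 j A B f := by
  have e₁ := onCoeff_convAct (s := -1) (A := A) (B := 0) (p := (j, 0)) (q := 0) h₁ h₁'
    (fun k v => by rw [hc₁]; simp)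
  have e₂ := onCoeff_convAct (s := -1) (A := B) (B := 0) (p := (0, j)) (q := 0) h₂ h₂'
    (fun k v => by rw [hc₂]; simp)
  have e₃ : scalarCoeff 1 j A B f =
    -(A • mulTheta (shiftBy (j, 0) f) + B • mulZeta (shiftBy (0, j) f)) := rfl
  rw [superCoeff_one_apply, superCoeff_one_apply, oddAct, map_add, onCoeff_mulTheta,
    onCoeff_mulZeta, onCoeff_twist, onCoeff_twist, e₁, e₂, oddAct, convAct_twist h₁',
    convAct_twist h₂', e₃]
  simp only [map_add, map_smul, twist_mulTheta, twist_mulZeta, twist_twist, zero_smul, add_zero]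
  module

/-- Distributions with finitely many nonzero coefficients. -/
def finClass : Submodule ℂ (BiSeries V) where
  carrier := {f | (Function.support fun p : (ℤ × ℤ) × (Fin 2 × Fin 2) => f p.1 p.2).Finite}
  zero_mem' := by simp
  add_mem' {f g} hf hg := finite_support_add hf hg
  smul_mem' c f hf := hf.subset fun p hp h0 => hp (by
    simp only [Pi.smul_apply] at h0 ⊢; rw [h0, smul_zero])

theorem stable_finClass : Stable (finClass (V := V)) where
  shift m f hf := by
    refine (Set.Finite.image (fun p : (ℤ × ℤ) × (Fin 2 × Fin 2) => (p.1 + m, p.2)) hf).subset ?_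
    intro p hp
    exact ⟨(p.1 - m, p.2), hp, by simp⟩
  theta f hf := by
    refine (Set.Finite.image (fun p : (ℤ × ℤ) × (Fin 2 × Fin 2) => (p.1, (1, p.2.2))) hf).subset ?_
    rintro ⟨n, L⟩ hp
    by_cases h : L.1 = 1
    · refine ⟨(n, (0, L.2)), fun h0 => hp ?_, by simp [← h]⟩
      simp only [mulTheta_apply, if_pos h]
      exact h0
    · exact absurd (by simp [mulTheta_apply, h]) hp
  zeta f hf := by
    refine (Set.Finite.image (fun p : (ℤ × ℤ) × (Fin 2 × Fin 2) => (p.1, (p.2.1, 1))) hf).subset ?_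
    rintro ⟨n, L⟩ hp
    by_cases h : L.2 = 1
    · refine ⟨(n, (L.1, 0)), fun h0 => hp ?_, by simp [← h]⟩
      simp only [mulZeta_apply, if_pos h]
      simp only at h0
      rw [h0, smul_zero]
    · exact absurd (by simp [mulZeta_apply, h]) hp
  twist f hf := hf.subset fun p hp h0 => hp (by
    simp only [twist_apply] at h0 ⊢; rw [h0, smul_zero])

theorem onCoeff_mem_finClass (h : Module.End ℂ V) : ∀ f ∈ finClass, onCoeff h f ∈ finClass :=
  fun f hf => hf.subset fun p hp h0 => hp (by
    simp only [onCoeff_apply] at h0 ⊢; rw [h0, map_zero])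

theorem linOn_convAct_finClass {a : ℤ × ℤ → Module.End ℂ V}
    (ha : ∀ v, (Function.support fun k => a k v).Finite) :
    LinOn finClass finClass (convAct a) := by
  refine linOn_convAct (fun f hf n L => ?_) fun f hf => ?_
  · refine Set.Finite.subset (Set.Finite.image (fun p => n - p.1) hf) fun k hk => ?_
    exact ⟨(n - k, L), fun h0 => hk (by simp only at h0 ⊢; rw [h0, map_zero]), by simp⟩
  · have hfin : (Function.support fun p : (ℤ × ℤ) × (Fin 2 × Fin 2) => f p.1 p.2).Finite := hf
    refine (hfin.biUnion fun p _ => (ha (f p.1 p.2)).image fun k => (p.1 + k, p.2)).subset ?_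
    rintro ⟨n, L⟩ hp
    have : ∃ k, a k (f (n - k) L) ≠ 0 := by
      by_contra! h
      exact hp (finsum_eq_zero_of_forall_eq_zero h)
    obtain ⟨k, hk⟩ := this
    simp only [Set.mem_iUnion]
    refine ⟨(n - k, L), fun h0 => hk ?_, k, hk, by simp⟩
    simp only at h0
    rw [h0, map_zero]

theorem summable_of_mem_finClass {a : ℤ × ℤ → Module.End ℂ V} {f : BiSeries V}
    (hf : f ∈ finClass) : Summable a f := fun n L =>
  Set.Finite.subset (Set.Finite.image (fun p => n - p.1) hf) fun k hk =>
    ⟨(n - k, L), fun h0 => hk (by simp only at h0 ⊢; rw [h0, map_zero]), by simp⟩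

/-- Distributions with coefficients in `U` that vanish unless the exponents are at least `-c`. -/
def BddBy (U : Submodule ℂ V) (c : ℕ) (f : BiSeries V) : Prop :=
  (∀ n L, f n L ∈ U) ∧ ∀ n L, f n L ≠ 0 → -(c : ℤ) ≤ n.1 ∧ -(c : ℤ) ≤ n.2

/-- Distributions bounded below, with coefficients in a member of the family `T`. -/
def bddClass (T : ℕ →o Submodule ℂ V) : Submodule ℂ (BiSeries V) where
  carrier := {f | ∃ c, BddBy (T c) c f}
  zero_mem' := ⟨0, by simp [BddBy]⟩
  add_mem' {f g} hf hg := by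
    obtain ⟨c, hc, hc'⟩ := hf
    obtain ⟨d, hd, hd'⟩ := hg
    refine ⟨max c d, fun n L => add_mem (T.mono (le_max_left c d) (hc n L))
      (T.mono (le_max_right c d) (hd n L)), fun n L h => ?_⟩
    by_cases h0 : f n L = 0
    · have : g n L ≠ 0 := fun h1 => h (by simp [h0, h1])
      have := hd' n L this
      push_cast
      omega
    · have := hc' n L h0
      push_cast
      omega
  smul_mem' c f hf := by
    obtain ⟨d, hd, hd'⟩ := hf
    exact ⟨d, fun n L => Submodule.smul_mem _ _ (hd n L), fun n L h =>
      hd' n L fun h0 => h (by simp [h0])⟩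

theorem stable_bddClass (T : ℕ →o Submodule ℂ V) : Stable (bddClass T) where
  shift m f hf := by
    obtain ⟨d, hd, hd'⟩ := hf
    refine ⟨d + m.1.natAbs + m.2.natAbs, fun n L => T.mono (by lia) (hd _ L), fun n L h => ?_⟩
    have := hd' _ L h
    simp only [Prod.fst_sub, Prod.snd_sub] at this
    omega
  theta f hf := by
    obtain ⟨d, hd, hd'⟩ := hf
    refine ⟨d, fun n L => ?_, fun n L h => ?_⟩
    · rw [mulTheta_apply]; split_ifs
      exacts [hd _ _, zero_mem _]
    · rw [mulTheta_apply] at h; split_ifs at h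
      exacts [hd' _ _ h, absurd rfl h]
  zeta f hf := by
    obtain ⟨d, hd, hd'⟩ := hf
    refine ⟨d, fun n L => ?_, fun n L h => ?_⟩
    · rw [mulZeta_apply]; split_ifs
      exacts [Submodule.smul_mem _ _ (hd _ _), zero_mem _]
    · rw [mulZeta_apply] at h; split_ifs at h
      exacts [hd' _ _ (fun h0 => h (by rw [h0, smul_zero])), absurd rfl h]
  twist f hf := by
    obtain ⟨d, hd, hd'⟩ := hf
    exact ⟨d, fun n L => Submodule.smul_mem _ _ (hd n L), fun n L h =>
      hd' n L fun h0 => h (by rw [twist_apply, h0, smul_zero])⟩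

theorem onCoeff_mem_bddClass {T : ℕ →o Submodule ℂ V} {h : Module.End ℂ V} (r : ℕ)
    (hh : ∀ c, ∀ v ∈ T c, h v ∈ T (c + r)) : ∀ f ∈ bddClass T, onCoeff h f ∈ bddClass T := by
  rintro f ⟨c, hc, hc'⟩
  refine ⟨c + r, fun n L => hh c _ (hc n L), fun n L h0 => ?_⟩
  have := hc' n L fun h1 => h0 (by rw [onCoeff_apply, h1, map_zero])
  push_cast
  omega

theorem finClass_le_bddClass {T : ℕ →o Submodule ℂ V} (hT : ∀ v, ∃ c, v ∈ T c) :
    finClass ≤ bddClass T := by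
  intro f hf
  have hfin : (Function.support fun p : (ℤ × ℤ) × (Fin 2 × Fin 2) => f p.1 p.2).Finite := hf
  choose t ht using hT
  obtain ⟨M, hM⟩ : ∃ M : ℕ, ∀ n L, f n L ≠ 0 → t (f n L) + n.1.natAbs + n.2.natAbs ≤ M :=
    ⟨hfin.toFinset.sup fun p => t (f p.1 p.2) + p.1.1.natAbs + p.1.2.natAbs, fun n L h0 =>
      Finset.le_sup (f := fun p : (ℤ × ℤ) × (Fin 2 × Fin 2) =>
        t (f p.1 p.2) + p.1.1.natAbs + p.1.2.natAbs) (b := (n, L)) (by simpa using h0)⟩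
  refine ⟨M, fun n L => ?_, fun n L h0 => ?_⟩
  · by_cases h0 : f n L = 0
    · rw [h0]; exact zero_mem _
    · have := hM n L h0
      exact T.mono (by omega) (ht (f n L))
  · have := hM n L h0
    omega

theorem summable_of_mem_bddClass {T : ℕ →o Submodule ℂ V} {a : ℤ × ℤ → Module.End ℂ V}
    (ha : ∀ c, ∀ v ∈ T c, ∀ k, a k v ≠ 0 → -(c + 1 : ℤ) ≤ k.1 ∧ -(c + 1 : ℤ) ≤ k.2)
    {f : BiSeries V} (hf : f ∈ bddClass T) : Summable a f := by
  obtain ⟨c, hc, hc'⟩ := hf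
  intro n L
  refine (Set.finite_Icc ((-(c + 1 : ℤ), -(c + 1 : ℤ)) : ℤ × ℤ) (n.1 + c, n.2 + c)).subset ?_
  intro k hk
  have h1 := ha c _ (hc _ L) k hk
  have h2 := hc' (n - k) L fun h0 => hk (by simp only; rw [h0, map_zero])
  simp only [Prod.fst_sub, Prod.snd_sub] at h2
  constructor <;> constructor <;> simp only <;> omega

theorem linOn_convAct_bddClass {T T' : ℕ →o Submodule ℂ V} {a : ℤ × ℤ → Module.End ℂ V}
    (ha : ∀ c, ∀ v ∈ T c, ∀ k, a k v ∈ T' c)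
    (ha' : ∀ c, ∀ v ∈ T c, ∀ k, a k v ≠ 0 → -(c + 1 : ℤ) ≤ k.1 ∧ -(c + 1 : ℤ) ≤ k.2) :
    LinOn (bddClass T) (bddClass T') (convAct a) := by
  refine linOn_convAct (fun f hf => summable_of_mem_bddClass ha' hf) ?_
  rintro f ⟨c, hc, hc'⟩
  refine ⟨2 * c + 1, fun n L => convAct_mem _ n L fun k => T'.mono (by lia) (ha c _ (hc _ L) k),
    fun n L h0 => ?_⟩
  have : ∃ k, a k (f (n - k) L) ≠ 0 := by
    by_contra! h
    exact h0 (finsum_eq_zero_of_forall_eq_zero h)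
  obtain ⟨k, hk⟩ := this
  have h1 := ha' c _ (hc _ L) k hk
  have h2 := hc' (n - k) L fun h0 => hk (by rw [h0, map_zero])
  simp only [Prod.fst_sub, Prod.snd_sub] at h2
  push_cast
  omega

/-- Exponentials of operators of positive degree. -/
theorem bddBy_iterate {U : Submodule ℂ V} {a : ℤ × ℤ → Module.End ℂ V}
    (ha : ∀ v ∈ U, ∀ k, a k v ∈ U) (ha' : ∀ k v, a k v ≠ 0 → 0 ≤ k.1 ∧ 0 ≤ k.2 ∧ 1 ≤ k.1 + k.2)
    {c : ℕ} {f : BiSeries V} (hf : BddBy U c f) (m : ℕ) :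
    BddBy U c ((convAct a)^[m] f) ∧
      ∀ n L, ((convAct a)^[m] f) n L ≠ 0 → (m : ℤ) ≤ n.1 + n.2 + 2 * c := by
  induction m with
  | zero =>
    refine ⟨hf, fun n L h => ?_⟩
    have := hf.2 n L h
    push_cast
    omega
  | succ m ih =>
    rw [Function.iterate_succ_apply']
    obtain ⟨⟨h1, h2⟩, h3⟩ := ih
    have key : ∀ n L, convAct a ((convAct a)^[m] f) n L ≠ 0 → ∃ k, (0 ≤ k.1 ∧ 0 ≤ k.2 ∧
        1 ≤ k.1 + k.2) ∧ ((convAct a)^[m] f) (n - k) L ≠ 0 := by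
      intro n L h0
      have : ∃ k, a k (((convAct a)^[m] f) (n - k) L) ≠ 0 := by
        by_contra! h
        exact h0 (finsum_eq_zero_of_forall_eq_zero h)
      obtain ⟨k, hk⟩ := this
      exact ⟨k, ha' k _ hk, fun h0 => hk (by rw [h0, map_zero])⟩
    refine ⟨⟨fun n L => convAct_mem U n L fun k => ha _ (h1 _ L) k, fun n L h0 => ?_⟩,
      fun n L h0 => ?_⟩
    · obtain ⟨k, hk, hk'⟩ := key n L h0
      have := h2 _ L hk'
      simp only [Prod.fst_sub, Prod.snd_sub] at this
      omega
    · obtain ⟨k, hk, hk'⟩ := key n L h0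
      have := h3 _ L hk'
      simp only [Prod.fst_sub, Prod.snd_sub] at this
      push_cast
      omega

theorem bddBy_expOp {U : Submodule ℂ V} {X : BiSeries V → BiSeries V} {c : ℕ} {f : BiSeries V}
    (h : ∀ m, BddBy U c (X^[m] f)) : BddBy U c (expOp X f) := by
  refine ⟨fun n L => finsum_mem_submodule U fun m => U.smul_mem _ ((h m).1 n L), fun n L h0 => ?_⟩
  have : ∃ m, (X^[m] f) n L ≠ 0 := by
    by_contra! h
    exact h0 (finsum_eq_zero_of_forall_eq_zero fun m => by rw [h m, smul_zero])
  obtain ⟨m, hm⟩ := this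
  exact (h m).2 n L hm

theorem linOn_expOp_bddClass {T : ℕ →o Submodule ℂ V} {a : ℤ × ℤ → Module.End ℂ V}
    (ha : ∀ c, ∀ v ∈ T c, ∀ k, a k v ∈ T c)
    (ha' : ∀ k v, a k v ≠ 0 → 0 ≤ k.1 ∧ 0 ≤ k.2 ∧ 1 ≤ k.1 + k.2) :
    LinOn (bddClass T) (bddClass T) (convAct a) ∧ NilOn (bddClass T) (convAct a) ∧
      LinOn (bddClass T) (bddClass T) (expOp (convAct a)) := by
  have h1 : LinOn (bddClass T) (bddClass T) (convAct a) :=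
    linOn_convAct_bddClass ha fun c v _ k hk => by
      have := ha' k v hk
      omega
  have h2 : NilOn (bddClass T) (convAct a) := by
    rintro f ⟨c, hf⟩ n L
    refine ⟨(n.1 + n.2 + 2 * c).toNat + 1, fun m hm => ?_⟩
    by_contra h0
    have := (bddBy_iterate (ha c) ha' hf m).2 n L h0
    omega
  refine ⟨h1, h2, linOn_expOp (stable_bddClass T) h1 h2 ?_⟩
  rintro f ⟨c, hf⟩
  exact ⟨c, bddBy_expOp fun m => (bddBy_iterate (ha c) ha' hf m).1⟩

/-- Odd exponentials are polynomials of degree two. -/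
theorem oddAct_iterate_three {K : Submodule ℂ (BiSeries V)} (hK : Stable K)
    {a₁ a₂ : ℤ × ℤ → Module.End ℂ V}
    (h₁ : LinOn K K (convAct a₁)) (h₂ : LinOn K K (convAct a₂)) {f : BiSeries V}
    (m : ℕ) (hm : 3 ≤ m) : (oddAct a₁ a₂)^[m] f = 0 := by
  have h := linOn_oddAct hK h₁ h₂
  have key : ∀ g, (∀ n, oddAct a₁ a₂ g n (0, 0) = 0) := fun g n => by
    simp [oddAct, mulTheta_apply, mulZeta_apply]
  have key2 : ∀ g : BiSeries V, (∀ n, g n (0, 0) = 0) →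
      (∀ n, oddAct a₁ a₂ g n (1, 0) = 0) ∧ (∀ n, oddAct a₁ a₂ g n (0, 1) = 0) := fun g hg => by
    constructor <;> intro n <;> simp [oddAct, mulTheta_apply, mulZeta_apply, twist_apply, convAct, hg]
  have key3 : ∀ g : BiSeries V, (∀ n, g n (1, 0) = 0) → (∀ n, g n (0, 1) = 0) →
      (∀ n, oddAct a₁ a₂ g n (1, 1) = 0) := fun g hg hg' n => by
    simp [oddAct, mulTheta_apply, mulZeta_apply, twist_apply, convAct, hg, hg']
  have h3 : ∀ g, oddAct a₁ a₂ (oddAct a₁ a₂ (oddAct a₁ a₂ g)) = 0 := by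
    intro g
    funext n L
    refine forall_fin2_prod (P := fun L => oddAct a₁ a₂ (oddAct a₁ a₂ (oddAct a₁ a₂ g)) n L = 0)
      (key _ n) ((key2 _ (key _)).1 n) ((key2 _ (key _)).2 n) ?_ L
    exact key3 _ (key2 _ (key g)).1 (key2 _ (key g)).2 n
  obtain ⟨k, rfl⟩ := Nat.exists_eq_add_of_le' hm
  rw [Function.iterate_add_apply]
  simp only [Function.iterate_succ, Function.iterate_zero, Function.comp, id, h3]
  have := (h.iterate k).smul 0 0 (zero_mem _)
  simpa using this

theorem expOp_eq_expTrunc {X : BiSeries V → BiSeries V} {f : BiSeries V} {M : ℕ}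
    (h : ∀ m, M ≤ m → X^[m] f = 0) : expOp X f = expTrunc X M f := by
  ext n L
  rw [expOp, expTrunc, Finset.sum_apply, Finset.sum_apply]
  simp only [Pi.smul_apply]
  refine finsum_eq_sum_of_support_subset _ fun k hk => ?_
  by_contra h'
  simp only [Finset.coe_range, Set.mem_Iio, not_lt] at h'
  exact hk (by simp only; rw [h k h']; simp)

theorem linOn_expOp_oddAct {K : Submodule ℂ (BiSeries V)} (hK : Stable K)
    {a₁ a₂ : ℤ × ℤ → Module.End ℂ V}
    (h₁ : LinOn K K (convAct a₁)) (h₂ : LinOn K K (convAct a₂)) :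
    NilOn K (oddAct a₁ a₂) ∧ LinOn K K (expOp (oddAct a₁ a₂)) := by
  have h := linOn_oddAct hK h₁ h₂
  have hn : NilOn K (oddAct a₁ a₂) := fun f hf n L => ⟨3, fun m hm => by
    rw [oddAct_iterate_three hK h₁ h₂ m hm]; rfl⟩
  refine ⟨hn, linOn_expOp hK h hn fun f hf => ?_⟩
  rw [expOp_eq_expTrunc (oddAct_iterate_three hK h₁ h₂)]
  exact (h.linOn_expTrunc 3).maps f hf

theorem expOp_eq_self {X : BiSeries V → BiSeries V} {f : BiSeries V} (h0 : X 0 = 0)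
    (h : X f = 0) : expOp X f = f := by
  have hm : ∀ m, 1 ≤ m → X^[m] f = 0 := by
    intro m hm
    obtain ⟨k, rfl⟩ := Nat.exists_eq_add_of_le' hm
    rw [Function.iterate_succ_apply, h]
    exact Function.iterate_fixed h0 k
  rw [expOp_eq_expTrunc hm]
  simp [expTrunc]

/-- A functional that vanishes on the image of `X` does not see `exp X`. -/
theorem map_expOp {W : Type*} [AddCommGroup W] [Module ℂ W] (φ : V →ₗ[ℂ] W)
    {K : Submodule ℂ (BiSeries V)}
    {X : BiSeries V → BiSeries V} (hn : NilOn K X) {f : BiSeries V} (hf : f ∈ K)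
    (h : ∀ g n L, φ (X g n L) = 0) (n L) : φ (expOp X f n L) = φ (f n L) := by
  obtain ⟨M, hM⟩ := hn.exists_expTrunc hf n L
  rw [hM (M + 1) (by lia), expTrunc, Finset.sum_range_succ', Pi.add_apply, Pi.add_apply, map_add,
    Finset.sum_apply, Finset.sum_apply, map_sum, Finset.sum_eq_zero, zero_add]
  · simp
  · intro m _
    rw [Pi.smul_apply, Pi.smul_apply, map_smul, Function.iterate_succ_apply', h, smul_zero]

end Classes

section Steps

variable {Q : Type*} [AddCommGroup Q] (B : LinearMap.BilinForm ℤ Q)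

theorem hOp_zero (j : ℤ) (J : Fin 2) : hOp B 0 j J = 0 := by
  rw [← hOpLin_apply, map_zero]

theorem toH_zero : toH (0 : Q) = 0 := by simp [toH]

/-- The even parts `-∑ (z^n / (-n)) α_(-n|0)` over the exponents with `P`. -/
def bosX (P : ℤ → Prop) [DecidablePred P] (α : Q) : Series (Module.End ℂ (VQ Q)) :=
  fun n I => if P n ∧ I = 0 then -(((-n : ℤ) : ℂ)⁻¹ • hOp B (toH α) (-n) 0) else 0

/-- The odd parts `∑ z^n θ α_(-1-n|1)` over the exponents with `P`. -/
def oddX (P : ℤ → Prop) [DecidablePred P] (α : Q) : Series (Module.End ℂ (VQ Q)) :=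
  fun n I => if P n then oddAll B α n I else 0

/-- The coefficients of `bosX P α (Z) + bosX P β (W)`. -/
def bosK (P : ℤ → Prop) [DecidablePred P] (α β : Q) (k : ℤ × ℤ) : Module.End ℂ (VQ Q) :=
  (inZ (bosX B P α) + inW (bosX B P β)) k (0, 0)

/-- The coefficients of `θ` in `oddX P α (Z)`. -/
def oddZ (P : ℤ → Prop) [DecidablePred P] (α : Q) (k : ℤ × ℤ) : Module.End ℂ (VQ Q) :=
  inZ (oddX B P α) k (1, 0)

/-- The coefficients of `ζ` in `oddX P α (W)`. -/
def oddW (P : ℤ → Prop) [DecidablePred P] (α : Q) (k : ℤ × ℤ) : Module.End ℂ (VQ Q) :=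
  inW (oddX B P α) k (0, 1)

section

variable (P : ℤ → Prop) [DecidablePred P]

theorem bosK_apply (α β : Q) (k : ℤ × ℤ) (v : VQ Q) : bosK B P α β k v =
    (if k.2 = 0 ∧ P k.1 then -(((-k.1 : ℤ) : ℂ)⁻¹ • hOp B (toH α) (-k.1) 0 v) else 0) +
    (if k.1 = 0 ∧ P k.2 then -(((-k.2 : ℤ) : ℂ)⁻¹ • hOp B (toH β) (-k.2) 0 v) else 0) := by
  simp only [bosK, Pi.add_apply, inZ, inW, bosX, and_true, LinearMap.add_apply, ite_and]
  congr 1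
  · split_ifs <;> simp
  · split_ifs <;> simp

theorem oddZ_apply (α : Q) (k : ℤ × ℤ) (v : VQ Q) : oddZ B P α k v =
    if k.2 = 0 ∧ P k.1 then hOp B (toH α) (-1 - k.1) 1 v else 0 := by
  simp only [oddZ, inZ, oddX, oddAll, and_true, if_true, ite_and]
  split_ifs <;> simp

theorem oddW_apply (α : Q) (k : ℤ × ℤ) (v : VQ Q) : oddW B P α k v =
    if k.1 = 0 ∧ P k.2 then hOp B (toH α) (-1 - k.2) 1 v else 0 := by
  simp only [oddW, inW, oddX, oddAll, and_true, if_true, ite_and]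
  split_ifs <;> simp

theorem bosK_comm_even (hs : B.IsSymm) (hP : ¬P 0) (α β : Q) (h : Hsp Q) (j : ℤ) (k : ℤ × ℤ)
    (v : VQ Q) : hOp B h j 0 (bosK B P α β k v) = bosK B P α β k (hOp B h j 0 v) +
      ((if k = (j, 0) then if P j then formC B h (toH α) else 0 else 0) +
        (if k = (0, j) then if P j then formC B h (toH β) else 0 else 0)) • v := by
  have key : ∀ (α : Q) (m : ℤ), P m → hOp B h j 0 (-(((-m : ℤ) : ℂ)⁻¹ • hOp B (toH α) (-m) 0 v)) =
      -(((-m : ℤ) : ℂ)⁻¹ • hOp B (toH α) (-m) 0 (hOp B h j 0 v)) +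
        (if m = j then formC B h (toH α) else 0) • v := by
    intro α m hm
    have hm0 : (m : ℂ) ≠ 0 := by
      rintro h0
      rw [Int.cast_eq_zero] at h0
      exact hP (h0 ▸ hm)
    rw [map_neg, map_smul, hOp_even_even B hs, smul_add, neg_add, smul_smul, ← neg_smul]
    congr 2
    by_cases h : m = j
    · subst h
      simp only [add_neg_cancel, if_true]
      push_cast
      field_simp
      simp
    · rw [if_neg (by omega), if_neg h]
      simp
  rw [bosK_apply, bosK_apply, map_add, add_smul]
  have e1 : hOp B h j 0 (if k.2 = 0 ∧ P k.1 then -(((-k.1 : ℤ) : ℂ)⁻¹ •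
      hOp B (toH α) (-k.1) 0 v) else 0) = (if k.2 = 0 ∧ P k.1 then -(((-k.1 : ℤ) : ℂ)⁻¹ •
      hOp B (toH α) (-k.1) 0 (hOp B h j 0 v)) else 0) +
      (if k = (j, 0) then if P j then formC B h (toH α) else 0 else 0) • v := by
    by_cases hk : k.2 = 0 ∧ P k.1
    · rw [if_pos hk, if_pos hk, key _ _ hk.2]
      congr 2
      by_cases h1 : k.1 = j
      · rw [if_pos h1, if_pos (Prod.ext h1 hk.1), if_pos (h1 ▸ hk.2)]
      · rw [if_neg h1, if_neg (fun h => h1 (by rw [h]))]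
    · rw [if_neg hk, if_neg hk, map_zero, zero_add]
      by_cases h1 : k = (j, 0)
      · rw [if_pos h1, if_neg, zero_smul]
        exact fun h => hk (by rw [h1]; exact ⟨rfl, h⟩)
      · rw [if_neg h1, zero_smul]
  have e2 : hOp B h j 0 (if k.1 = 0 ∧ P k.2 then -(((-k.2 : ℤ) : ℂ)⁻¹ •
      hOp B (toH β) (-k.2) 0 v) else 0) = (if k.1 = 0 ∧ P k.2 then -(((-k.2 : ℤ) : ℂ)⁻¹ •
      hOp B (toH β) (-k.2) 0 (hOp B h j 0 v)) else 0) +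
      (if k = (0, j) then if P j then formC B h (toH β) else 0 else 0) • v := by
    by_cases hk : k.1 = 0 ∧ P k.2
    · rw [if_pos hk, if_pos hk, key _ _ hk.2]
      congr 2
      by_cases h1 : k.2 = j
      · rw [if_pos h1, if_pos (Prod.ext hk.1 h1), if_pos (h1 ▸ hk.2)]
      · rw [if_neg h1, if_neg (fun h => h1 (by rw [h]))]
    · rw [if_neg hk, if_neg hk, map_zero, zero_add]
      by_cases h1 : k = (0, j)
      · rw [if_pos h1, if_neg, zero_smul]
        exact fun h => hk (by rw [h1]; exact ⟨rfl, h⟩)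
      · rw [if_neg h1, zero_smul]
  rw [e1, e2]
  abel

theorem bosK_comm_odd (α β : Q) (h : Hsp Q) (j : ℤ) (k : ℤ × ℤ) (v : VQ Q) :
    hOp B h j 1 (bosK B P α β k v) = bosK B P α β k (hOp B h j 1 v) := by
  rw [bosK_apply, bosK_apply, map_add]
  congr 1 <;> split_ifs <;> simp [hOp_even_odd]

theorem bosK_comm_parity (α β : Q) (k : ℤ × ℤ) (v : VQ Q) :
    parity B (bosK B P α β k v) = bosK B P α β k (parity B v) := by
  rw [bosK_apply, bosK_apply, map_add]
  congr 1 <;> split_ifs <;> simp [parity_hOp]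

theorem oddZ_comm_even (α : Q) (h : Hsp Q) (j : ℤ) (k : ℤ × ℤ) (v : VQ Q) :
    hOp B h j 0 (oddZ B P α k v) = oddZ B P α k (hOp B h j 0 v) := by
  rw [oddZ_apply, oddZ_apply]
  split_ifs <;> simp [hOp_even_odd]

theorem oddW_comm_even (α : Q) (h : Hsp Q) (j : ℤ) (k : ℤ × ℤ) (v : VQ Q) :
    hOp B h j 0 (oddW B P α k v) = oddW B P α k (hOp B h j 0 v) := by
  rw [oddW_apply, oddW_apply]
  split_ifs <;> simp [hOp_even_odd]

theorem oddZ_comm_odd (hs : B.IsSymm) (α : Q) (h : Hsp Q) (j : ℤ) (k : ℤ × ℤ) (v : VQ Q) :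
    hOp B h j 1 (oddZ B P α k v) = -oddZ B P α k (hOp B h j 1 v) +
      (if k = (j, 0) then if P j then formC B h (toH α) else 0 else 0) • v := by
  rw [oddZ_apply, oddZ_apply]
  by_cases hk : k.2 = 0 ∧ P k.1
  · rw [if_pos hk, if_pos hk, hOp_odd_odd B hs, sub_eq_neg_add]
    congr 2
    by_cases h1 : k.1 = j
    · rw [if_pos (by omega), if_pos (Prod.ext h1 hk.1), if_pos (h1 ▸ hk.2)]
    · rw [if_neg (by omega), if_neg (fun h => h1 (by rw [h]))]
  · rw [if_neg hk, if_neg hk, map_zero, neg_zero, zero_add]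
    by_cases h1 : k = (j, 0)
    · rw [if_pos h1, if_neg, zero_smul]
      exact fun h => hk (by rw [h1]; exact ⟨rfl, h⟩)
    · rw [if_neg h1, zero_smul]

theorem oddW_comm_odd (hs : B.IsSymm) (α : Q) (h : Hsp Q) (j : ℤ) (k : ℤ × ℤ) (v : VQ Q) :
    hOp B h j 1 (oddW B P α k v) = -oddW B P α k (hOp B h j 1 v) +
      (if k = (0, j) then if P j then formC B h (toH α) else 0 else 0) • v := by
  rw [oddW_apply, oddW_apply]
  by_cases hk : k.1 = 0 ∧ P k.2
  · rw [if_pos hk, if_pos hk, hOp_odd_odd B hs, sub_eq_neg_add]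
    congr 2
    by_cases h1 : k.2 = j
    · rw [if_pos (by omega), if_pos (Prod.ext hk.1 h1), if_pos (h1 ▸ hk.2)]
    · rw [if_neg (by omega), if_neg (fun h => h1 (by rw [h]))]
  · rw [if_neg hk, if_neg hk, map_zero, neg_zero, zero_add]
    by_cases h1 : k = (0, j)
    · rw [if_pos h1, if_neg, zero_smul]
      exact fun h => hk (by rw [h1]; exact ⟨rfl, h⟩)
    · rw [if_neg h1, zero_smul]

theorem oddZ_comm_parity (α : Q) (k : ℤ × ℤ) (v : VQ Q) :
    parity B (oddZ B P α k v) = -oddZ B P α k (parity B v) := by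
  rw [oddZ_apply, oddZ_apply]
  split_ifs <;> simp [parity_hOp]

theorem oddW_comm_parity (α : Q) (k : ℤ × ℤ) (v : VQ Q) :
    parity B (oddW B P α k v) = -oddW B P α k (parity B v) := by
  rw [oddW_apply, oddW_apply]
  split_ifs <;> simp [parity_hOp]

end

/-- Classes of distributions stable under the variables, the modes and the parity. -/
structure Good (K : Submodule ℂ (BiSeries (VQ Q))) : Prop where
  stable : Stable K
  modes : ∀ h j J, ∀ f ∈ K, onCoeff (hOp B h j J) f ∈ K
  parity : ∀ f ∈ K, onCoeff (parity B) f ∈ K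

/-- A factor of a vertex operator: `μ j J` is its share in the commutators with `h_(j|J)`. -/
structure Step (α β : Q) (μ : ℤ → Fin 2 → ℂ) (K K' : Submodule ℂ (BiSeries (VQ Q)))
    (X : BiSeries (VQ Q) → BiSeries (VQ Q)) : Prop where
  lin : LinOn K K' X
  comm : ∀ h j J, CommOn K X J (hOp B h j J) j (μ j J * formC B h (toH α))
    (μ j J * formC B h (toH β))
  parity : CommOn K X 1 (parity B) 0 0 0

variable {B}

theorem Step.comp {α β : Q} {μ ν : ℤ → Fin 2 → ℂ} {K K' K'' : Submodule ℂ (BiSeries (VQ Q))}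
    {X Y : BiSeries (VQ Q) → BiSeries (VQ Q)} (hK : Good B K) (hK' : Good B K')
    (hX : Step B α β μ K K' X) (hY : Step B α β ν K' K'' Y) :
    Step B α β (μ + ν) K K'' (Y ∘ X) where
  lin := hX.lin.comp hY.lin
  comm h j J := by
    have := CommOn.comp hK'.stable (superCoeff_mem hK.stable (hK.modes h j J) J) hX.lin hY.lin
      (hX.comm h j J) (hY.comm h j J)
    simpa only [Pi.add_apply, add_mul] using this
  parity := by
    have := CommOn.comp hK'.stable (superCoeff_mem hK.stable hK.parity 1) hX.lin hY.lin
      hX.parity hY.parity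
    simpa only [add_zero] using this

theorem step_expOp_bos (hs : B.IsSymm) {P : ℤ → Prop} [DecidablePred P] (hP : ¬P 0) (α β : Q)
    {K : Submodule ℂ (BiSeries (VQ Q))} (hK : Good B K)
    (h1 : LinOn K K (convAct (bosK B P α β))) (hsum : ∀ f ∈ K, Summable (bosK B P α β) f)
    (hn : NilOn K (convAct (bosK B P α β))) (h2 : LinOn K K (expOp (convAct (bosK B P α β)))) :
    Step B α β (fun j J => if J = 0 ∧ P j then 1 else 0) K K
      (expOp (convAct (bosK B P α β))) where
  lin := h2
  comm h j J := by
    refine commOn_expOp hK.stable h1 hn (superCoeff_mem hK.stable (hK.modes h j J) J)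
      fun f hf => ?_
    match J with
    | 0 =>
      have := onCoeff_convAct (s := 1) (hsum f hf) (hsum _ (hK.modes h j 0 f hf)) (fun k v => by
        rw [one_smul]; exact bosK_comm_even B P hs hP α β h j k v)
      rw [superCoeff_zero_apply, this, one_smul, add_assoc]
      simp only [true_and, ite_mul, one_mul, zero_mul]
      rfl
    | 1 =>
      rw [superCoeff_convAct (hsum f hf) (hsum _ (hK.modes h j 1 f hf))
        (bosK_comm_odd B P α β h j)]
      simp [scalarCoeff_zero_zero]
  parity := by
    refine commOn_expOp hK.stable h1 hn (superCoeff_mem hK.stable hK.parity 1) fun f hf => ?_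
    rw [superCoeff_convAct (hsum f hf) (hsum _ (hK.parity f hf)) (bosK_comm_parity B P α β),
      scalarCoeff_zero_zero, add_zero]

theorem superCoeff_oddAct_hOp (hs : B.IsSymm) {P : ℤ → Prop} [DecidablePred P] (α β : Q)
    {K : Submodule ℂ (BiSeries (VQ Q))} (hK : Good B K)
    (hs₁ : ∀ f ∈ K, Summable (oddZ B P α) f) (hs₂ : ∀ f ∈ K, Summable (oddW B P β) f)
    (h : Hsp Q) (j : ℤ) (J : Fin 2) (f : BiSeries (VQ Q)) (hf : f ∈ K) :
    superCoeff J (hOp B h j J) (oddAct (oddZ B P α) (oddW B P β) f) =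
      oddAct (oddZ B P α) (oddW B P β) (superCoeff J (hOp B h j J) f) +
      scalarCoeff J j ((if J = 1 ∧ P j then 1 else 0) * formC B h (toH α))
        ((if J = 1 ∧ P j then 1 else 0) * formC B h (toH β)) f := by
  match J with
  | 0 =>
    rw [superCoeff_oddAct_zero (hs₁ f hf) (hs₁ _ (hK.modes h j 0 f hf)) (hs₂ f hf)
      (hs₂ _ (hK.modes h j 0 f hf)) (oddZ_comm_even B P α h j) (oddW_comm_even B P β h j)]
    simp [scalarCoeff_zero_zero]
  | 1 =>
    rw [superCoeff_oddAct_one (hs₁ f hf) (hs₁ _ (hK.modes h j 1 f hf)) (hs₂ f hf)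
      (hs₂ _ (hK.modes h j 1 f hf)) (oddZ_comm_odd B P hs α h j) (oddW_comm_odd B P hs β h j)]
    simp only [true_and, ite_mul, one_mul, zero_mul]

theorem superCoeff_oddAct_parity {P : ℤ → Prop} [DecidablePred P] (α β : Q)
    {K : Submodule ℂ (BiSeries (VQ Q))} (hK : Good B K)
    (hs₁ : ∀ f ∈ K, Summable (oddZ B P α) f) (hs₂ : ∀ f ∈ K, Summable (oddW B P β) f)
    (f : BiSeries (VQ Q)) (hf : f ∈ K) :
    superCoeff 1 (parity B) (oddAct (oddZ B P α) (oddW B P β) f) =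
      oddAct (oddZ B P α) (oddW B P β) (superCoeff 1 (parity B) f) := by
  rw [superCoeff_oddAct_one (j := 0) (A := 0) (B := 0) (hs₁ f hf) (hs₁ _ (hK.parity f hf))
    (hs₂ f hf) (hs₂ _ (hK.parity f hf))
    (fun k v => by rw [oddZ_comm_parity]; simp) (fun k v => by rw [oddW_comm_parity]; simp),
    scalarCoeff_zero_zero, add_zero]

theorem step_expOp_odd (hs : B.IsSymm) {P : ℤ → Prop} [DecidablePred P] (α β : Q)
    {K : Submodule ℂ (BiSeries (VQ Q))} (hK : Good B K)
    (h₁ : LinOn K K (convAct (oddZ B P α))) (h₂ : LinOn K K (convAct (oddW B P β)))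
    (hs₁ : ∀ f ∈ K, Summable (oddZ B P α) f) (hs₂ : ∀ f ∈ K, Summable (oddW B P β) f) :
    Step B α β (fun j J => if J = 1 ∧ P j then 1 else 0) K K
      (expOp (oddAct (oddZ B P α) (oddW B P β))) where
  lin := (linOn_expOp_oddAct hK.stable h₁ h₂).2
  comm h j J := commOn_expOp hK.stable (linOn_oddAct hK.stable h₁ h₂)
    (linOn_expOp_oddAct hK.stable h₁ h₂).1 (superCoeff_mem hK.stable (hK.modes h j J) J)
    fun f hf => superCoeff_oddAct_hOp hs α β hK hs₁ hs₂ h j J f hf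
  parity := commOn_expOp hK.stable (linOn_oddAct hK.stable h₁ h₂)
    (linOn_expOp_oddAct hK.stable h₁ h₂).1 (superCoeff_mem hK.stable hK.parity 1)
    fun f hf => by
      rw [superCoeff_oddAct_parity α β hK hs₁ hs₂ f hf, scalarCoeff_zero_zero, add_zero]

theorem convAct_zero_left {V : Type*} [AddCommGroup V] [Module ℂ V] (f : BiSeries V) :
    convAct (fun _ => 0) f = 0 := by
  ext n L; simp [convAct]

theorem oddW_zero (P : ℤ → Prop) [DecidablePred P] : oddW B P (0 : Q) = fun _ => 0 := by
  ext1 k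
  refine LinearMap.ext fun v => ?_
  rw [oddW_apply, toH_zero, hOp_zero]
  simp

theorem step_one_add_odd (hs : B.IsSymm) (α : Q)
    {K K' : Submodule ℂ (BiSeries (VQ Q))} (hK : Good B K) (hK' : Good B K') (hKK' : K ≤ K')
    (h₁ : LinOn K K' (convAct (oddZ B (fun _ => True) α)))
    (hs₁ : ∀ f ∈ K, Summable (oddZ B (fun _ => True) α) f) :
    Step B α 0 (fun _ J => if J = 1 then 1 else 0) K K'
      (fun f => f + oddAct (oddZ B (fun _ => True) α) (oddW B (fun _ => True) 0) f) := by
  have h₂ : LinOn K K' (convAct (oddW B (fun _ => True) (0 : Q))) := by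
    rw [oddW_zero]
    refine ⟨fun f _ => ?_, ?_, ?_, ?_, ?_, ?_⟩ <;> simp [convAct_zero_left]
  have hs₂ : ∀ f ∈ K, Summable (oddW B (fun _ => True) (0 : Q)) f := by
    intro f _ n L
    rw [oddW_zero]
    simp
  have hl := linOn_oddAct hK'.stable h₁ h₂
  constructor
  · refine ⟨fun f hf => add_mem (hKK' hf) (hl.maps f hf), fun f hf g hg => ?_, fun c f hf => ?_,
      fun m f hf => ?_, fun f hf => ?_, fun f hf => ?_⟩
    · rw [hl.add f hf g hg]; abel
    · rw [hl.smul c f hf, smul_add]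
    · rw [hl.shift m f hf, map_add]
    · rw [hl.theta f hf, map_add]
    · rw [hl.zeta f hf, map_add]
  · intro h j J f hf
    have e := superCoeff_oddAct_hOp hs α 0 hK hs₁ hs₂ h j J f hf
    simp only [and_true, toH_zero, map_zero, mul_zero] at e ⊢
    rw [map_add, e, map_add]
    match J with
    | 0 => simp only [zero_ne_one, if_false, zero_mul, scalarCoeff_zero_zero]; abel
    | 1 =>
      have : scalarCoeff 1 j ((if (1 : Fin 2) = 1 then (1 : ℂ) else 0) * formC B h (toH α)) 0
          (oddAct (oddZ B (fun _ => True) α) (oddW B (fun _ => True) 0) f) = 0 := by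
        have e₃ : ∀ (A : ℂ) (g : BiSeries (VQ Q)), scalarCoeff 1 j A 0 g =
          -(A • mulTheta (shiftBy (j, 0) g) + (0 : ℂ) • mulZeta (shiftBy (0, j) g)) :=
            fun _ _ => rfl
        have e₄ : ∀ g : BiSeries (VQ Q), mulTheta (shiftBy (j, 0) (mulTheta g)) = 0 := fun g =>
          mulTheta_mulTheta (shiftBy (j, 0) g)
        rw [e₃, oddAct, oddW_zero, convAct_zero_left]
        simp [e₄]
      rw [this]
      abel
  · intro f hf
    simp only
    rw [map_add, superCoeff_oddAct_parity α 0 hK hs₁ hs₂ f hf, scalarCoeff_zero_zero, add_zero]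

theorem step_convAct {a : ℤ × ℤ → Module.End ℂ (VQ Q)} (α β : Q)
    {K K' : Submodule ℂ (BiSeries (VQ Q))} (hK : Good B K)
    (hl : LinOn K K' (convAct a)) (hsum : ∀ f ∈ K, Summable a f)
    (hc : ∀ h j J k v, hOp B h j J (a k v) = a k (hOp B h j J v))
    (hp : ∀ k v, parity B (a k v) = a k (parity B v)) :
    Step B α β 0 K K' (convAct a) where
  lin := hl
  comm h j J f hf := by
    rw [superCoeff_convAct (hsum f hf) (hsum _ (hK.modes h j J f hf)) (hc h j J)]
    simp [scalarCoeff_zero_zero]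
  parity f hf := by
    rw [superCoeff_convAct (hsum f hf) (hsum _ (hK.parity f hf)) hp]
    simp [scalarCoeff_zero_zero]

/-! ### The classes -/

variable (B)

theorem good_finClass : Good B finClass :=
  ⟨stable_finClass, fun _ _ _ => onCoeff_mem_finClass _, onCoeff_mem_finClass _⟩

/-- Vectors whose weights are bounded with respect to `α` and `β`. -/
def wtBdd (α β : Q) : ℕ →o Submodule ℂ (VQ Q) where
  toFun c :=
    { carrier := {v | ∀ k : ℤ, c < k.natAbs → zPow B α k 0 v = 0 ∧ zPow B β k 0 v = 0}
      zero_mem' := by simp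
      add_mem' := fun {x y} hx hy k hk => by
        rw [map_add, map_add, (hx k hk).1, (hx k hk).2, (hy k hk).1, (hy k hk).2]; simp
      smul_mem' := fun a x hx k hk => by
        rw [map_smul, map_smul, (hx k hk).1, (hx k hk).2]; simp }
  monotone' c d h v hv k hk := hv k (by lia)

/-- Vectors of bounded weight killed by the odd modes of high index. -/
def tameBdd (α β : Q) : ℕ →o Submodule ℂ (VQ Q) where
  toFun c :=
    { carrier := {v | v ∈ wtBdd B α β c ∧ ∀ h (j : ℤ), (c : ℤ) < j → hOp B h j 1 v = 0}
      zero_mem' := by simp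
      add_mem' := fun {x y} hx hy => ⟨add_mem hx.1 hy.1, fun h j hj => by
        rw [map_add, hx.2 h j hj, hy.2 h j hj, add_zero]⟩
      smul_mem' := fun a x hx => ⟨Submodule.smul_mem _ _ hx.1, fun h j hj => by
        rw [map_smul, hx.2 h j hj, smul_zero]⟩ }
  monotone' c d hcd v hv := ⟨(wtBdd B α β).mono hcd hv.1, fun h j hj => hv.2 h j (by lia)⟩

theorem hOp_mem_wtBdd {α β : Q} {c : ℕ} (h : Hsp Q) (j : ℤ) (J : Fin 2) {v : VQ Q}
    (hv : v ∈ wtBdd B α β c) : hOp B h j J v ∈ wtBdd B α β c := fun k hk => by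
  rw [zPow_hOp, zPow_hOp, (hv k hk).1, (hv k hk).2, map_zero]
  exact ⟨rfl, rfl⟩

theorem hOp_even_mem_tameBdd {α β : Q} {c : ℕ} (h : Hsp Q) (j : ℤ) {v : VQ Q}
    (hv : v ∈ tameBdd B α β c) : hOp B h j 0 v ∈ tameBdd B α β c :=
  ⟨hOp_mem_wtBdd B h j 0 hv.1, fun h' k hk => by
    rw [← hOp_even_odd, hv.2 h' k hk, map_zero]⟩

theorem exists_mem_wtBdd (α β : Q) (v : VQ Q) : ∃ c, v ∈ wtBdd B α β c := by
  obtain ⟨N, hN⟩ := exists_zPow_eq_zero B α v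
  obtain ⟨M, hM⟩ := exists_zPow_eq_zero B β v
  exact ⟨max N M, fun k hk => ⟨hN k (by lia), hM k (by lia)⟩⟩

theorem exists_mem_tameBdd (hs : B.IsSymm) (α β : Q) (v : VQ Q) : ∃ c, v ∈ tameBdd B α β c := by
  obtain ⟨N, hN⟩ := exists_mem_wtBdd B α β v
  obtain ⟨M, hM⟩ := exists_hOp_eq_zero B hs v
  exact ⟨max N M, (wtBdd B α β).mono (le_max_left _ _) hN, fun h j hj => hM h j 1 (by lia)⟩

theorem good_bddClass_wtBdd (α β : Q) : Good B (bddClass (wtBdd B α β)) where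
  stable := stable_bddClass _
  modes h j J := onCoeff_mem_bddClass 0 fun c v hv => hOp_mem_wtBdd B h j J hv
  parity := onCoeff_mem_bddClass 0 fun c v hv k hk => by
    rw [zPow_parity, zPow_parity, (hv k hk).1, (hv k hk).2, map_zero]
    exact ⟨rfl, rfl⟩

theorem good_bddClass_tameBdd (hs : B.IsSymm) (α β : Q) : Good B (bddClass (tameBdd B α β)) where
  stable := stable_bddClass _
  modes h j J := onCoeff_mem_bddClass (j.natAbs + 1) fun c v hv =>
    ⟨hOp_mem_wtBdd B h j J ((wtBdd B α β).mono (by lia) hv.1), fun h' k hk => by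
      rw [hOp_hOp B hs, hv.2 h' k (by lia), hOpComm_eq_zero B _ _ _ _ (by lia) (by lia)]
      simp⟩
  parity := onCoeff_mem_bddClass 0 fun c v hv =>
    ⟨fun k hk => by
      rw [zPow_parity, zPow_parity, (hv.1 k hk).1, (hv.1 k hk).2, map_zero]
      exact ⟨rfl, rfl⟩, fun h k hk => by
      have := parity_hOp B h k 1 v
      rw [hv.2 h k hk, map_zero] at this
      simpa using this.symm⟩

theorem bddClass_tameBdd_le (α β : Q) : bddClass (tameBdd B α β) ≤ bddClass (wtBdd B α β) := by
  rintro f ⟨c, hc, hc'⟩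
  exact ⟨c, fun n L => (hc n L).1, hc'⟩

/-! ### The factors -/

theorem linOn_of_le {V : Type*} [AddCommGroup V] [Module ℂ V] {K K' K'' : Submodule ℂ (BiSeries V)}
    {X : BiSeries V → BiSeries V} (h : LinOn K K' X) (hK : K' ≤ K'') : LinOn K K'' X :=
  { h with maps := fun f hf => hK (h.maps f hf) }

theorem step_of_le {α β : Q} {μ : ℤ → Fin 2 → ℂ} {K K' K'' : Submodule ℂ (BiSeries (VQ Q))}
    {X : BiSeries (VQ Q) → BiSeries (VQ Q)} (h : Step B α β μ K K' X) (hK : K' ≤ K'') :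
    Step B α β μ K K'' X := ⟨linOn_of_le h.lin hK, h.comm, h.parity⟩

theorem finite_support_bosK_ann (hs : B.IsSymm) (α β : Q) (v : VQ Q) :
    (Function.support fun k => bosK B (· < 0) α β k v).Finite := by
  obtain ⟨N, hN⟩ := exists_hOp_eq_zero B hs v
  refine (Set.finite_Icc ((-N, -N) : ℤ × ℤ) (0, 0)).subset fun k hk => ?_
  by_contra h
  refine hk ?_
  simp only [Set.mem_Icc, Prod.le_def, not_and_or, not_le] at h
  simp only [bosK_apply]
  by_cases h1 : k.2 = 0 ∧ k.1 < 0
  · rw [if_pos h1, if_neg (by omega), hN _ _ _ (by omega)]; simp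
  · rw [if_neg h1]
    by_cases h2 : k.1 = 0 ∧ k.2 < 0
    · rw [if_pos h2, hN _ _ _ (by omega)]; simp
    · rw [if_neg h2]; simp

theorem finite_support_odd_ann (hs : B.IsSymm) (α : Q) (v : VQ Q) :
    (Function.support fun k => oddZ B (· < 0) α k v).Finite ∧
      (Function.support fun k => oddW B (· < 0) α k v).Finite := by
  obtain ⟨N, hN⟩ := exists_hOp_eq_zero B hs v
  constructor
  · refine (Set.finite_Icc ((-1 - N, 0) : ℤ × ℤ) (0, 0)).subset fun k hk => ?_
    by_contra h
    refine hk ?_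
    simp only [Set.mem_Icc, Prod.le_def, not_and_or, not_le] at h
    simp only [oddZ_apply]
    split_ifs
    exacts [hN _ _ _ (by omega), rfl]
  · refine (Set.finite_Icc ((0, -1 - N) : ℤ × ℤ) (0, 0)).subset fun k hk => ?_
    by_contra h
    refine hk ?_
    simp only [Set.mem_Icc, Prod.le_def, not_and_or, not_le] at h
    simp only [oddW_apply]
    split_ifs
    exacts [hN _ _ _ (by omega), rfl]

theorem iterate_convAct_mem_fockFil (hs : B.IsSymm) (α β : Q) {d : ℕ} {f : BiSeries (VQ Q)}
    (hf : ∀ n L, f n L ∈ fockFil B d) (m : ℕ) (hm : m ≤ d) (n L) :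
    ((convAct (bosK B (· < 0) α β))^[m] f) n L ∈ fockFil B (d - m) := by
  induction m generalizing n with
  | zero => exact hf n L
  | succ m ih =>
    rw [Function.iterate_succ_apply']
    refine convAct_mem _ n L fun k => ?_
    have h1 := ih (by lia) (n - k)
    rw [show d - m = (d - (m + 1)) + 1 by lia] at h1
    rw [bosK_apply]
    refine add_mem ?_ ?_ <;> split_ifs with h
    · exact neg_mem (Submodule.smul_mem _ _ (ann_mem_fockFil B hs _ (.inl (by omega)) _ h1))
    · exact zero_mem _
    · exact neg_mem (Submodule.smul_mem _ _ (ann_mem_fockFil B hs _ (.inl (by omega)) _ h1))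
    · exact zero_mem _

theorem iterate_convAct_ann_eq_zero (hs : B.IsSymm) (α β : Q) {f : BiSeries (VQ Q)}
    (hf : f ∈ finClass) : ∃ M : ℕ, ∀ m, M ≤ m → (convAct (bosK B (· < 0) α β))^[m] f = 0 := by
  have hfin : (Function.support fun p : (ℤ × ℤ) × (Fin 2 × Fin 2) => f p.1 p.2).Finite := hf
  choose t ht using exists_mem_fockFil B
  obtain ⟨d, hd⟩ : ∃ d : ℕ, ∀ n L, f n L ∈ fockFil B d := by
    refine ⟨hfin.toFinset.sup fun p => t (f p.1 p.2), fun n L => ?_⟩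
    by_cases h0 : f n L = 0
    · rw [h0]; exact zero_mem _
    · exact fockFil_mono B (Finset.le_sup (f := fun p : (ℤ × ℤ) × (Fin 2 × Fin 2) =>
        t (f p.1 p.2)) (b := (n, L)) (by simpa using h0)) (ht _)
  have h0 : convAct (bosK B (· < 0) α β) 0 = 0 := by ext n L; simp [convAct]
  have h1 : (convAct (bosK B (· < 0) α β))^[d + 1] f = 0 := by
    rw [Function.iterate_succ_apply']
    ext n L
    refine finsum_eq_zero_of_forall_eq_zero fun k => ?_
    have := iterate_convAct_mem_fockFil B hs α β hd d le_rfl (n - k) L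
    rw [Nat.sub_self] at this
    rw [bosK_apply]
    have a1 : ∀ (γ : Q) (l : ℤ), l < 0 → hOp B (toH γ) (-l) 0
        ((convAct (bosK B (· < 0) α β))^[d] f (n - k) L) = 0 := fun γ l hl =>
      ann_fockFil_zero B _ (.inl (by omega)) this
    split_ifs with h1 h2 h2
    · rw [a1 _ _ h1.2, a1 _ _ h2.2]; simp
    · rw [a1 _ _ h1.2]; simp
    · rw [a1 _ _ h2.2]; simp
    · simp
  refine ⟨d + 1, fun m hm => ?_⟩
  obtain ⟨k, rfl⟩ := Nat.exists_eq_add_of_le' hm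
  rw [Function.iterate_add_apply, h1]
  exact Function.iterate_fixed h0 k

theorem step_bosAnn (hs : B.IsSymm) (α β : Q) :
    Step B α β (fun j J => if J = 0 ∧ j < 0 then 1 else 0) finClass finClass
      (expOp (convAct (bosK B (· < 0) α β))) := by
  have h1 := linOn_convAct_finClass (finite_support_bosK_ann B hs α β)
  have hn : NilOn finClass (convAct (bosK B (· < 0) α β)) := fun f hf n L => by
    obtain ⟨M, hM⟩ := iterate_convAct_ann_eq_zero B hs α β hf
    exact ⟨M, fun m hm => by rw [hM m hm]; rfl⟩
  refine step_expOp_bos hs (by simp) α β (good_finClass B) h1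
    (fun f hf => summable_of_mem_finClass hf) hn (linOn_expOp stable_finClass h1 hn fun f hf => ?_)
  obtain ⟨M, hM⟩ := iterate_convAct_ann_eq_zero B hs α β hf
  rw [expOp_eq_expTrunc hM]
  exact (h1.linOn_expTrunc M).maps f hf

theorem step_oddAnn (hs : B.IsSymm) (α β : Q) :
    Step B α β (fun j J => if J = 1 ∧ j < 0 then 1 else 0) finClass finClass
      (expOp (oddAct (oddZ B (· < 0) α) (oddW B (· < 0) β))) :=
  step_expOp_odd hs α β (good_finClass B)
    (linOn_convAct_finClass fun v => (finite_support_odd_ann B hs α v).1)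
    (linOn_convAct_finClass fun v => (finite_support_odd_ann B hs β v).2)
    (fun _ hf => summable_of_mem_finClass hf) (fun _ hf => summable_of_mem_finClass hf)

theorem bosK_cre_ne_zero {α β : Q} {k : ℤ × ℤ} {v : VQ Q} (h : bosK B (0 < ·) α β k v ≠ 0) :
    0 ≤ k.1 ∧ 0 ≤ k.2 ∧ 1 ≤ k.1 + k.2 := by
  rw [bosK_apply] at h
  by_contra h0
  exact h (by rw [if_neg (by omega), if_neg (by omega), add_zero])

theorem linOn_bosCre {α β : Q} (T : ℕ →o Submodule ℂ (VQ Q))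
    (hT : ∀ c h j, ∀ v ∈ T c, hOp B h j 0 v ∈ T c) :
    LinOn (bddClass T) (bddClass T) (convAct (bosK B (0 < ·) α β)) ∧
      NilOn (bddClass T) (convAct (bosK B (0 < ·) α β)) ∧
      LinOn (bddClass T) (bddClass T) (expOp (convAct (bosK B (0 < ·) α β))) := by
  refine linOn_expOp_bddClass (fun c v hv k => ?_) fun k v h => bosK_cre_ne_zero B h
  rw [bosK_apply]
  refine add_mem ?_ ?_ <;> split_ifs
  · exact neg_mem (Submodule.smul_mem _ _ (hT _ _ _ v hv))
  · exact zero_mem _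
  · exact neg_mem (Submodule.smul_mem _ _ (hT _ _ _ v hv))
  · exact zero_mem _

theorem step_bosCre (hs : B.IsSymm) (α β : Q) (T : ℕ →o Submodule ℂ (VQ Q))
    (hT : ∀ c h j, ∀ v ∈ T c, hOp B h j 0 v ∈ T c) (hG : Good B (bddClass T)) :
    Step B α β (fun j J => if J = 0 ∧ 0 < j then 1 else 0) (bddClass T) (bddClass T)
      (expOp (convAct (bosK B (0 < ·) α β))) := by
  obtain ⟨h1, h2, h3⟩ := linOn_bosCre B (α := α) (β := β) T hT
  refine step_expOp_bos hs (by simp) α β hG h1 (fun f hf => ?_) h2 h3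
  exact summable_of_mem_bddClass (fun c v _ k hk => by
    have := bosK_cre_ne_zero B hk
    omega) hf

theorem oddCre_ne_zero {α : Q} {k : ℤ × ℤ} {v : VQ Q} :
    (oddZ B (0 ≤ ·) α k v ≠ 0 → 0 ≤ k.1 ∧ 0 ≤ k.2) ∧
      (oddW B (0 ≤ ·) α k v ≠ 0 → 0 ≤ k.1 ∧ 0 ≤ k.2) := by
  rw [oddZ_apply, oddW_apply]
  constructor <;> intro h <;> by_contra h0 <;> exact h (if_neg (by omega))

theorem linOn_oddCre (α β : Q) :
    LinOn (bddClass (wtBdd B α β)) (bddClass (wtBdd B α β)) (convAct (oddZ B (0 ≤ ·) α)) ∧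
      LinOn (bddClass (wtBdd B α β)) (bddClass (wtBdd B α β)) (convAct (oddW B (0 ≤ ·) β)) := by
  refine ⟨linOn_convAct_bddClass (fun c v hv k => ?_) fun c v _ k hk => ?_,
    linOn_convAct_bddClass (fun c v hv k => ?_) fun c v _ k hk => ?_⟩
  · rw [oddZ_apply]; split_ifs
    exacts [hOp_mem_wtBdd B _ _ _ hv, zero_mem _]
  · have := (oddCre_ne_zero B).1 hk; omega
  · rw [oddW_apply]; split_ifs
    exacts [hOp_mem_wtBdd B _ _ _ hv, zero_mem _]
  · have := (oddCre_ne_zero B).2 hk; omega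

theorem step_oddCre (hs : B.IsSymm) (α β : Q) :
    Step B α β (fun j J => if J = 1 ∧ 0 ≤ j then 1 else 0) (bddClass (wtBdd B α β))
      (bddClass (wtBdd B α β)) (expOp (oddAct (oddZ B (0 ≤ ·) α) (oddW B (0 ≤ ·) β))) := by
  refine step_expOp_odd hs α β (good_bddClass_wtBdd B α β) (linOn_oddCre B α β).1
    (linOn_oddCre B α β).2 (fun _ => summable_of_mem_bddClass fun c v _ k hk => ?_)
    (fun _ => summable_of_mem_bddClass fun c v _ k hk => ?_)
  · have := (oddCre_ne_zero B).1 hk; omega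
  · have := (oddCre_ne_zero B).2 hk; omega

theorem oddAll_ne_zero {α β γ : Q} {c : ℕ} {v : VQ Q} (hv : v ∈ tameBdd B β γ c) {k : ℤ × ℤ}
    (h : oddZ B (fun _ => True) α k v ≠ 0) : -(c + 1 : ℤ) ≤ k.1 ∧ -(c + 1 : ℤ) ≤ k.2 := by
  rw [oddZ_apply] at h
  split_ifs at h with h0
  · by_contra h1
    exact h (hv.2 _ _ (by omega))
  · exact absurd rfl h

theorem step_oneAddOdd (hs : B.IsSymm) (α : Q) :
    Step B α 0 (fun _ J => if J = 1 then 1 else 0) (bddClass (tameBdd B α 0))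
      (bddClass (wtBdd B α 0))
      (fun f => f + oddAct (oddZ B (fun _ => True) α) (oddW B (fun _ => True) 0) f) := by
  refine step_one_add_odd hs α (good_bddClass_tameBdd B hs α 0) (good_bddClass_wtBdd B α 0)
    (bddClass_tameBdd_le B α 0)
    (linOn_convAct_bddClass (fun c v hv k => ?_) fun c v hv k hk => ?_)
    (fun _ => summable_of_mem_bddClass fun c v hv k hk => ?_)
  · rw [oddZ_apply]; split_ifs
    exacts [hOp_mem_wtBdd B _ _ _ hv.1, zero_mem _]
  · exact oddAll_ne_zero B hv hk
  · exact oddAll_ne_zero B hv hk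

/-- The coefficients of `Z^(α_(0|0)|0)`. -/
def zPowZ (α : Q) (k : ℤ × ℤ) : Module.End ℂ (VQ Q) := if k.2 = 0 then zPow B α k.1 0 else 0

/-- The coefficients of `W^(α_(0|0)|0)`. -/
def zPowW (α : Q) (k : ℤ × ℤ) : Module.End ℂ (VQ Q) := if k.1 = 0 then zPow B α k.2 0 else 0

theorem step_zPowZ (α β : Q) : Step B α β 0 (bddClass (wtBdd B α β)) (bddClass (wtBdd B α β))
    (convAct (zPowZ B α)) := by
  have h0 : ∀ (c : ℕ), ∀ v ∈ wtBdd B α β c, ∀ k, zPowZ B α k v ≠ 0 →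
      -(c + 1 : ℤ) ≤ k.1 ∧ -(c + 1 : ℤ) ≤ k.2 := by
    intro c v hv k hk
    rw [zPowZ] at hk
    split_ifs at hk with h
    · by_contra h1
      exact hk (hv k.1 (by omega)).1
    · exact absurd rfl hk
  refine step_convAct α β (good_bddClass_wtBdd B α β)
    (linOn_convAct_bddClass (fun c v hv k => ?_) h0)
    (fun _ => summable_of_mem_bddClass h0) (fun h j J k v => ?_) (fun k v => ?_)
  · rw [zPowZ]; split_ifs
    · intro m hm
      rw [zPow_zPow, (hv m hm).1, zPow_zPow, (hv m hm).2, map_zero]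
      exact ⟨rfl, rfl⟩
    · exact zero_mem _
  · rw [zPowZ]; split_ifs
    exacts [(zPow_hOp B α _ h j J v).symm, by simp]
  · rw [zPowZ]; split_ifs
    exacts [(zPow_parity B α _ v).symm, by simp]

theorem step_zPowW (α β : Q) : Step B α β 0 (bddClass (wtBdd B α β)) (bddClass (wtBdd B α β))
    (convAct (zPowW B β)) := by
  have h0 : ∀ (c : ℕ), ∀ v ∈ wtBdd B α β c, ∀ k, zPowW B β k v ≠ 0 →
      -(c + 1 : ℤ) ≤ k.1 ∧ -(c + 1 : ℤ) ≤ k.2 := by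
    intro c v hv k hk
    rw [zPowW] at hk
    split_ifs at hk with h
    · by_contra h1
      exact hk (hv k.2 (by omega)).2
    · exact absurd rfl hk
  refine step_convAct α β (good_bddClass_wtBdd B α β)
    (linOn_convAct_bddClass (fun c v hv k => ?_) h0)
    (fun _ => summable_of_mem_bddClass h0) (fun h j J k v => ?_) (fun k v => ?_)
  · rw [zPowW]; split_ifs
    · intro m hm
      rw [zPow_zPow, (hv m hm).1, zPow_zPow, (hv m hm).2, map_zero]
      exact ⟨rfl, rfl⟩
    · exact zero_mem _
  · rw [zPowW]; split_ifs
    exacts [(zPow_hOp B β _ h j J v).symm, by simp]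
  · rw [zPowW]; split_ifs
    exacts [(zPow_parity B β _ v).symm, by simp]

end Steps

section VertexOperators

variable {Q : Type*} [AddCommGroup Q] (B : LinearMap.BilinForm ℤ Q)

/-! ### The factors in terms of components -/

theorem expAct_bosX (P : ℤ → Prop) [DecidablePred P] (α β : Q) :
    expAct (parity B) (inZ (bosX B P α) + inW (bosX B P β)) =
      expOp (convAct (bosK B P α β)) := by
  have h1 : ∀ k, (inZ (bosX B P α) + inW (bosX B P β)) k (1, 0) = 0 := fun k => by
    simp [inZ, inW, bosX]
  have h2 : ∀ k, (inZ (bosX B P α) + inW (bosX B P β)) k (0, 1) = 0 := fun k => by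
    simp [inZ, inW, bosX]
  have h3 : ∀ k, (inZ (bosX B P α) + inW (bosX B P β)) k (1, 1) = 0 := fun k => by
    simp [inZ, inW]
  rw [expAct_eq_expOp (parity_mul_self B) ⟨fun k I v => ?_, h3⟩]
  · congr 1
    funext f
    simp only [actComp, h1, h2, convAct_zero_left, map_zero, add_zero]
    rfl
  · refine forall_fin2_prod (P := fun I => parity B ((inZ (bosX B P α) + inW (bosX B P β)) k I v) =
      (-1 : ℂ) ^ ((I.1 : ℕ) + I.2) • (inZ (bosX B P α) + inW (bosX B P β)) k I (parity B v))
      ?_ ?_ ?_ ?_ I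
    · have := bosK_comm_parity B P α β k v
      rw [bosK] at this
      rw [this]; simp
    · rw [h1]; simp
    · rw [h2]; simp
    · rw [h3]; simp

theorem bosX_zero (P : ℤ → Prop) [DecidablePred P] : bosX B P (0 : Q) = 0 := by
  funext n I
  simp [bosX, toH_zero, hOp_zero]

theorem inW_zero {X : Type*} [Zero X] : inW (0 : Series X) = 0 := by
  funext n I; simp [inW]

theorem expAct_inZ_bosX (P : ℤ → Prop) [DecidablePred P] (α : Q) :
    expAct (parity B) (inZ (bosX B P α)) = expOp (convAct (bosK B P α 0)) := by
  rw [← expAct_bosX, bosX_zero, inW_zero, add_zero]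

theorem actComp_oddX (P : ℤ → Prop) [DecidablePred P] (α β : Q) :
    SuperEven (parity B) (inZ (oddX B P α) + inW (oddX B P β)) ∧
    actComp (inZ (oddX B P α) + inW (oddX B P β)) = oddAct (oddZ B P α) (oddW B P β) := by
  have h0 : ∀ k, (inZ (oddX B P α) + inW (oddX B P β)) k (0, 0) = 0 := fun k => by
    simp [inZ, inW, oddX, oddAll]
  have h3 : ∀ k, (inZ (oddX B P α) + inW (oddX B P β)) k (1, 1) = 0 := fun k => by
    simp [inZ, inW]
  have h1 : ∀ k, (inZ (oddX B P α) + inW (oddX B P β)) k (1, 0) = oddZ B P α k := fun k => by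
    simp [inZ, inW, oddZ]
  have h2 : ∀ k, (inZ (oddX B P α) + inW (oddX B P β)) k (0, 1) = oddW B P β k := fun k => by
    simp [inZ, inW, oddW]
  refine ⟨⟨fun k I v => ?_, h3⟩, ?_⟩
  · refine forall_fin2_prod (P := fun I => parity B ((inZ (oddX B P α) + inW (oddX B P β)) k I v) =
      (-1 : ℂ) ^ ((I.1 : ℕ) + I.2) • (inZ (oddX B P α) + inW (oddX B P β)) k I (parity B v))
      ?_ ?_ ?_ ?_ I
    · rw [h0]; simp
    · rw [h1, oddZ_comm_parity]; simp
    · rw [h2, oddW_comm_parity]; simp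
    · rw [h3]; simp
  · funext f
    simp only [actComp, h0, h1, h2, convAct_zero_left, zero_add]
    rfl

theorem expAct_oddX (P : ℤ → Prop) [DecidablePred P] (α β : Q) :
    expAct (parity B) (inZ (oddX B P α) + inW (oddX B P β)) =
      expOp (oddAct (oddZ B P α) (oddW B P β)) := by
  rw [expAct_eq_expOp (parity_mul_self B) (actComp_oddX B P α β).1, (actComp_oddX B P α β).2]

theorem act_oneAddOdd (α : Q) (f : BiSeries (VQ Q)) :
    act (parity B) (inZ (const 1 + oddAll B α)) f =
      f + oddAct (oddZ B (fun _ => True) α) (oddW B (fun _ => True) 0) f := by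
  let A : BiSeries (Module.End ℂ (VQ Q)) := inZ (const 1 + oddAll B α)
  have h0 : ∀ k, A k (0, 0) = if k = 0 then 1 else 0 := fun k => by
    change inZ (const 1 + oddAll B α) k (0, 0) = _
    by_cases h : k = 0
    · simp [inZ, const, oddAll, h]
    · rw [if_neg h]
      simp only [inZ, const, oddAll, Pi.add_apply]
      by_cases h2 : k.2 = 0
      · have : k.1 ≠ 0 := fun h1 => h (Prod.ext h1 h2)
        simp [h2, this]
      · simp [h2]
  have h1 : ∀ k, A k (1, 0) = oddZ B (fun _ => True) α k := fun k => by
    simp [A, inZ, oddZ, oddX, const]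
  have h2 : ∀ k, A k (0, 1) = oddW B (fun _ => True) (0 : Q) k :=
    fun k => by rw [oddW_zero]; simp [A, inZ]
  have h3 : ∀ k, A k (1, 1) = 0 := fun k => by simp [A, inZ]
  change act (parity B) A f = _
  rw [act_eq_actComp (parity_mul_self B) ⟨fun k I v => ?_, h3⟩]
  · simp only [actComp, h0, h1, h2, oddAct, add_assoc]
    congr 1
    funext n L
    rw [convAct, finsum_eq_single _ 0 fun k hk => by simp [hk]]
    simp
  · refine forall_fin2_prod (P := fun I => parity B (A k I v) =
      (-1 : ℂ) ^ ((I.1 : ℕ) + I.2) • A k I (parity B v))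
      ?_ ?_ ?_ ?_ I
    · rw [h0]; split_ifs <;> simp
    · rw [h1, oddZ_comm_parity]; simp
    · rw [h2, oddW_zero]; simp
    · rw [h3]; simp

theorem act_inZ_zPow (α : Q) :
    act (parity B) (inZ (zPow B α)) = convAct (zPowZ B α) := by
  have h0 : ∀ k, inZ (zPow B α) k (0, 0) = zPowZ B α k := fun k => by simp [inZ, zPowZ]
  have h1 : ∀ k, inZ (zPow B α) k (1, 0) = 0 := fun k => by simp [inZ, zPow]
  have h2 : ∀ k, inZ (zPow B α) k (0, 1) = 0 := fun k => by simp [inZ]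
  have h3 : ∀ k, inZ (zPow B α) k (1, 1) = 0 := fun k => by simp [inZ]
  rw [act_eq_actComp (parity_mul_self B) ⟨fun k I v => ?_, h3⟩]
  · funext f
    simp only [actComp, h0, h1, h2, convAct_zero_left, map_zero, add_zero]
  · refine forall_fin2_prod (P := fun I => parity B (inZ (zPow B α) k I v) =
      (-1 : ℂ) ^ ((I.1 : ℕ) + I.2) • inZ (zPow B α) k I (parity B v)) ?_ ?_ ?_ ?_ I
    · rw [h0, zPowZ]; split_ifs <;> simp [zPow_parity]
    · rw [h1]; simp
    · rw [h2]; simp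
    · rw [h3]; simp

theorem act_inW_zPow (α : Q) :
    act (parity B) (inW (zPow B α)) = convAct (zPowW B α) := by
  have h0 : ∀ k, inW (zPow B α) k (0, 0) = zPowW B α k := fun k => by simp [inW, zPowW]
  have h1 : ∀ k, inW (zPow B α) k (1, 0) = 0 := fun k => by simp [inW]
  have h2 : ∀ k, inW (zPow B α) k (0, 1) = 0 := fun k => by simp [inW, zPow]
  have h3 : ∀ k, inW (zPow B α) k (1, 1) = 0 := fun k => by simp [inW]
  rw [act_eq_actComp (parity_mul_self B) ⟨fun k I v => ?_, h3⟩]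
  · funext f
    simp only [actComp, h0, h1, h2, convAct_zero_left, map_zero, add_zero]
  · refine forall_fin2_prod (P := fun I => parity B (inW (zPow B α) k I v) =
      (-1 : ℂ) ^ ((I.1 : ℕ) + I.2) • inW (zPow B α) k I (parity B v)) ?_ ?_ ?_ ?_ I
    · rw [h0, zPowW]; split_ifs <;> simp [zPow_parity]
    · rw [h1]; simp
    · rw [h2]; simp
    · rw [h3]; simp

/-- Left multiplication of distributions by an operator `e` with `σ e = s e σ`. -/
def signE (s : ℂ) (e : Module.End ℂ (VQ Q)) : BiSeries (VQ Q) →ₗ[ℂ] BiSeries (VQ Q) where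
  toFun f n L := s ^ ((L.1 : ℕ) + L.2) • e (f n L)
  map_add' f g := by ext n L; simp
  map_smul' c f := by ext n L; simp [smul_comm c]

theorem signE_apply (s : ℂ) (e : Module.End ℂ (VQ Q)) (f : BiSeries (VQ Q)) (n L) :
    signE s e f n L = s ^ ((L.1 : ℕ) + L.2) • e (f n L) := rfl

theorem act_eOp (hs : B.IsSymm) (ε : Q → Q → ℂ) (α : Q) (f : BiSeries (VQ Q)) :
    act (parity B) (inZ (const (eOp B ε α))) f = signE ((-1) ^ (B α α)) (eOp B ε α) f := by
  funext n L
  have key : ∀ (m : ℕ) (v : VQ Q), (parity B ^ m) (eOp B ε α ((parity B ^ m) v)) =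
      (((-1 : ℂ) ^ (B α α)) ^ m) • eOp B ε α v := by
    intro m
    induction m with
    | zero => intro v; simp
    | succ m ih =>
      intro v
      rw [pow_succ' (parity B), Module.End.mul_apply, Module.End.mul_apply,
        show (parity B) ((parity B ^ m) v) = (parity B ^ m) (parity B v) by
          rw [← Module.End.mul_apply, ← pow_succ', pow_succ, Module.End.mul_apply], ih,
        map_smul, parity_eOp B ε hs, parity_parity, smul_smul, pow_succ]
  rw [act, Finset.sum_eq_single (0, 0)]
  · rw [finsum_eq_single _ 0]
    · simp only [inZ, const, Prod.fst_zero, Prod.snd_zero, and_self, if_true, Module.End.mul_apply,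
        Prod.mk_zero_zero, sub_zero]
      rw [key]
      simp [signE_apply]
    · intro k hk
      have : inZ (const (eOp B ε α)) k (0, 0) = 0 := by
        simp only [inZ, const, and_true]
        split_ifs with h1 h2
        · exact absurd (Prod.ext h2 h1) hk
        · rfl
        · rfl
      rw [this, mul_zero, zero_mul, LinearMap.zero_apply]
  · intro I _ hI
    have : ∀ k, inZ (const (eOp B ε α)) k I = 0 := fun k => by
      simp only [inZ, const]
      split_ifs with h1 h2
      · exact absurd (Prod.ext h2.2 h1.2) hI
      · rfl
      · rfl
    simp [this]
  · intro h
    refine absurd (Finset.mem_Iic.mpr ?_) h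
    exact Prod.le_def.mpr ⟨Fin.zero_le _, Fin.zero_le _⟩

/-! ### Vertex operators -/

/-- A family of operators with the commutation relations of `s`-even vertex operators of weight
`α` in `Z` and `β` in `W`. -/
structure VertexLike (α β : Q) (s : ℂ) (F : VQ Q →ₗ[ℂ] BiSeries (VQ Q)) : Prop where
  modes : ∀ h j (J : Fin 2) v, superCoeff J (hOp B h j J) (F v) =
    s ^ (J : ℕ) • F (hOp B h j J v) +
      scalarCoeff J j (formC B h (toH α)) (formC B h (toH β)) (F v)
  parity : ∀ v, superCoeff 1 (parity B) (F v) = s • F (parity B v)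

theorem const_mem_finClass (v : VQ Q) : inZ (const v) ∈ finClass := by
  refine (Set.finite_singleton ((0, 0) : (ℤ × ℤ) × (Fin 2 × Fin 2))).subset ?_
  rintro ⟨n, L⟩ hp
  by_contra h
  refine hp ?_
  simp only [inZ, const]
  split_ifs with h1 h2
  · exact absurd (Prod.ext (Prod.ext h2.1 h1.1) (Prod.ext h2.2 h1.2)) h
  · rfl
  · rfl

theorem inZ_const_apply (v : VQ Q) (n L) :
    inZ (const v) n L = if n = 0 ∧ L = 0 then v else 0 := by
  simp only [inZ, const]
  by_cases h : n = 0 ∧ L = 0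
  · simp [h]
  · rw [if_neg h]
    split_ifs with h1 h2
    · exact absurd ⟨Prod.ext h2.1 h1.1, Prod.ext h2.2 h1.2⟩ h
    · rfl
    · rfl

theorem superCoeff_const (J : Fin 2) (h : Module.End ℂ (VQ Q)) (v : VQ Q) :
    superCoeff J h (inZ (const v)) = inZ (const (h v)) := by
  match J with
  | 0 =>
    funext n L
    rw [superCoeff_zero_apply, onCoeff_apply, inZ_const_apply, inZ_const_apply]
    split_ifs <;> simp
  | 1 =>
    funext n L
    rw [superCoeff_one_apply, twist_apply, onCoeff_apply, inZ_const_apply, inZ_const_apply]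
    split_ifs with h0
    · simp [h0.2]
    · simp

/-- The linear map `v ↦ X v` for a factor `X`. -/
def constMap {K' : Submodule ℂ (BiSeries (VQ Q))} {X : BiSeries (VQ Q) → BiSeries (VQ Q)}
    (hX : LinOn finClass K' X) : VQ Q →ₗ[ℂ] BiSeries (VQ Q) where
  toFun v := X (inZ (const v))
  map_add' v w := by
    rw [← hX.add _ (const_mem_finClass v) _ (const_mem_finClass w)]
    congr 1
    funext n L
    simp only [Pi.add_apply, inZ_const_apply]
    split_ifs <;> simp
  map_smul' c v := by
    rw [RingHom.id_apply, ← hX.smul c _ (const_mem_finClass v)]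
    congr 1
    funext n L
    simp only [Pi.smul_apply, inZ_const_apply]
    split_ifs <;> simp

theorem vertexLike_of_step (hs : B.IsSymm) (ε : Q → Q → ℂ) {α β : Q} {μ : ℤ → Fin 2 → ℂ}
    {K' : Submodule ℂ (BiSeries (VQ Q))} {X : BiSeries (VQ Q) → BiSeries (VQ Q)}
    (hX : Step B α β μ finClass K' X)
    (hμ : ∀ j (J : Fin 2), μ j J + (if j = 0 ∧ J = 0 then 1 else 0) = 1) :
    VertexLike B α β ((-1) ^ (B (α + β) (α + β)))
      (signE ((-1) ^ (B (α + β) (α + β))) (eOp B ε (α + β)) ∘ₗ constMap hX.lin) := by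
  set s : ℂ := (-1) ^ (B (α + β) (α + β)) with hsdef
  have hss : s * s = 1 := neg_one_zpow_mul_self _
  set e := eOp B ε (α + β)
  have hc : ∀ v, constMap hX.lin v = X (inZ (const v)) := fun _ => rfl
  constructor
  · intro h j J v
    have h1 := hX.comm h j J _ (const_mem_finClass v)
    rw [superCoeff_const, ← hc, ← hc] at h1
    simp only [LinearMap.comp_apply]
    generalize constMap hX.lin v = f at *
    generalize constMap hX.lin (hOp B h j J v) = g at *
    match J with
    | 0 =>
      funext n L
      have h2 := congrFun (congrFun h1 n) L
      change hOp B h j 0 (f n L) = g n L + ((μ j 0 * formC B h (toH α)) • f (n - (j, 0)) L +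
        (μ j 0 * formC B h (toH β)) • f (n - (0, j)) L) at h2
      change hOp B h j 0 (s ^ ((L.1 : ℕ) + L.2) • e (f n L)) =
        s ^ 0 • (s ^ ((L.1 : ℕ) + L.2) • e (g n L)) +
        (formC B h (toH α) • (s ^ ((L.1 : ℕ) + L.2) • e (f (n - (j, 0)) L)) +
          formC B h (toH β) • (s ^ ((L.1 : ℕ) + L.2) • e (f (n - (0, j)) L)))
      have h3 := hμ j 0
      rw [map_smul, hOp_even_eOp, h2]
      by_cases hj : j = 0
      · subst hj
        simp only [and_self, if_true] at h3
        have h4 : μ 0 0 = 0 := by linear_combination h3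
        rw [h4]
        simp only [Prod.mk_zero_zero, sub_zero, if_true, formC_toH_add_right]
        simp only [zero_mul, zero_smul, add_zero, pow_zero, one_smul]
        module
      · simp only [hj, false_and, if_false, add_zero] at h3
        simp only [hj, if_false, zero_smul, add_zero, h3, one_mul, pow_zero, one_smul, map_add,
          map_smul]
        module
    | 1 =>
      have h3 : μ j 1 = 1 := by simpa using hμ j 1
      funext n L
      have h2 := congrFun (congrFun h1 n) L
      change (-1 : ℂ) ^ ((L.1 : ℕ) + L.2) • hOp B h j 1 (f n L) = g n L +
        -((μ j 1 * formC B h (toH α)) • (if L.1 = 1 then f (n - (j, 0)) (0, L.2) else 0) +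
          (μ j 1 * formC B h (toH β)) •
            (if L.2 = 1 then (-1 : ℂ) ^ (L.1 : ℕ) • f (n - (0, j)) (L.1, 0) else 0)) at h2
      change (-1 : ℂ) ^ ((L.1 : ℕ) + L.2) • hOp B h j 1 (s ^ ((L.1 : ℕ) + L.2) • e (f n L)) =
        s ^ 1 • (s ^ ((L.1 : ℕ) + L.2) • e (g n L)) +
        -(formC B h (toH α) • (if L.1 = 1 then s ^ (0 + (L.2 : ℕ)) • e (f (n - (j, 0)) (0, L.2))
            else 0) +
          formC B h (toH β) • (if L.2 = 1 then (-1 : ℂ) ^ (L.1 : ℕ) •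
            s ^ ((L.1 : ℕ) + 0) • e (f (n - (0, j)) (L.1, 0)) else 0))
      rw [h3, one_mul, one_mul] at h2
      rw [map_smul, hOp_odd_eOp, ← hsdef, smul_comm ((-1 : ℂ) ^ ((L.1 : ℕ) + L.2)),
        smul_comm ((-1 : ℂ) ^ ((L.1 : ℕ) + L.2)), ← map_smul e, h2]
      clear h2 h1
      obtain ⟨L₁, L₂⟩ := L
      fin_cases L₁ <;> fin_cases L₂ <;>
        simp only [Fin.zero_eta, Fin.mk_one, zero_ne_one, if_true, if_false,
          add_zero, zero_add, pow_zero, pow_one, one_smul, smul_zero,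
          neg_zero, map_add, map_neg, map_smul, Nat.reduceAdd]
      · match_scalars
        · ring
        · linear_combination (-(formC B h (toH β))) * hss
      · match_scalars
        · ring
        · linear_combination (-(formC B h (toH α))) * hss
      · match_scalars
        · ring
        · linear_combination (-(formC B h (toH α))) * s * hss
        · linear_combination ((formC B h (toH β))) * s * hss
  · intro v
    have h1 := hX.parity _ (const_mem_finClass v)
    rw [superCoeff_const, ← hc, ← hc, scalarCoeff_zero_zero, add_zero] at h1
    simp only [LinearMap.comp_apply]
    generalize constMap hX.lin v = f at *
    generalize constMap hX.lin (parity B v) = g at *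
    funext n L
    have h2 := congrFun (congrFun h1 n) L
    change (-1 : ℂ) ^ ((L.1 : ℕ) + L.2) • parity B (f n L) = g n L at h2
    change (-1 : ℂ) ^ ((L.1 : ℕ) + L.2) • parity B (s ^ ((L.1 : ℕ) + L.2) • e (f n L)) =
      s • (s ^ ((L.1 : ℕ) + L.2) • e (g n L))
    rw [← h2, map_smul, parity_eOp B ε hs, map_smul, ← hsdef]
    module

end VertexOperators

section VertexOperators

variable {Q : Type*} [AddCommGroup Q] (B : LinearMap.BilinForm ℤ Q)

theorem vacProj_bosCre (α β : Q) (f : BiSeries (VQ Q)) (n L) :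
    vacProj (convAct (bosK B (0 < ·) α β) f n L) = 0 := by
  have : convAct (bosK B (0 < ·) α β) f n L ∈ LinearMap.ker (vacProj (Q := Q)) := by
    refine convAct_mem _ n L fun k => ?_
    rw [bosK_apply]
    refine add_mem ?_ ?_ <;> split_ifs with h
    · exact neg_mem (Submodule.smul_mem _ _ (vacProj_cre B _ (by omega) _ _))
    · exact zero_mem _
    · exact neg_mem (Submodule.smul_mem _ _ (vacProj_cre B _ (by omega) _ _))
    · exact zero_mem _
  exact this

theorem vacProj_oddAct (P : ℤ → Prop) [DecidablePred P] (α β : Q) (f : BiSeries (VQ Q))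
    (hf : ∀ h (j : ℤ), P (-1 - j) → ∀ n L, vacProj (hOp B h j 1 (f n L)) = 0) (n L) :
    vacProj (oddAct (oddZ B P α) (oddW B P β) f n L) = 0 := by
  have h1 : ∀ n L, convAct (oddZ B P α) f n L ∈ LinearMap.ker (vacProj (Q := Q)) := fun n L => by
    refine convAct_mem _ n L fun k => ?_
    rw [oddZ_apply]
    split_ifs with h
    · exact hf _ _ (by simpa using h.2) _ _
    · exact zero_mem _
  have h2 : ∀ n L, convAct (oddW B P β) f n L ∈ LinearMap.ker (vacProj (Q := Q)) := fun n L => by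
    refine convAct_mem _ n L fun k => ?_
    rw [oddW_apply]
    split_ifs with h
    · exact hf _ _ (by simpa using h.2) _ _
    · exact zero_mem _
  have : oddAct (oddZ B P α) (oddW B P β) f n L ∈ LinearMap.ker (vacProj (Q := Q)) := by
    rw [oddAct, Pi.add_apply, Pi.add_apply, mulTheta_apply, mulZeta_apply]
    refine add_mem ?_ ?_ <;> split_ifs
    · exact Submodule.smul_mem _ _ (h1 _ _)
    · exact zero_mem _
    · exact Submodule.smul_mem _ _ (Submodule.smul_mem _ _ (h2 _ _))
    · exact zero_mem _
  exact this

theorem expOp_bosAnn_eState (α β γ : Q) :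
    expOp (convAct (bosK B (· < 0) α β)) (inZ (const (eState γ))) = inZ (const (eState γ)) := by
  refine expOp_eq_self (by ext n L; simp [convAct]) ?_
  ext n L
  refine finsum_eq_zero_of_forall_eq_zero fun k => ?_
  rw [inZ_const_apply]
  split_ifs
  · rw [bosK_apply]
    have : ∀ δ : Q, ∀ l : ℤ, l < 0 → hOp B (toH δ) (-l) 0 (eState γ) = 0 := fun δ l hl => by
      rw [hOp_eState B _ (by omega), if_neg (by omega)]
    split_ifs with h1 h2 h2
    · rw [this _ _ h1.2, this _ _ h2.2]; simp
    · rw [this _ _ h1.2]; simp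
    · rw [this _ _ h2.2]; simp
    · simp
  · simp

theorem expOp_oddAnn_eState (α β γ : Q) :
    expOp (oddAct (oddZ B (· < 0) α) (oddW B (· < 0) β)) (inZ (const (eState γ))) =
      inZ (const (eState γ)) := by
  have h0 : ∀ δ : Q, ∀ l : ℤ, l < 0 → hOp B (toH δ) (-1 - l) 1 (eState γ) = 0 := fun δ l hl => by
    rw [hOp_eState B _ (by omega), if_neg (by simp)]
  refine expOp_eq_self ?_ ?_
  · have : ∀ a : ℤ × ℤ → Module.End ℂ (VQ Q), convAct a 0 = 0 := fun a => by
      ext n L; simp [convAct]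
    simp [oddAct, this]
  · have h1 : convAct (oddZ B (· < 0) α) (inZ (const (eState γ))) = 0 := by
      ext n L
      refine finsum_eq_zero_of_forall_eq_zero fun k => ?_
      rw [inZ_const_apply, oddZ_apply]
      split_ifs with h h'
      · exact h0 _ _ h.2
      · simp
      · rfl
    have h2 : convAct (oddW B (· < 0) β) (inZ (const (eState γ))) = 0 := by
      ext n L
      refine finsum_eq_zero_of_forall_eq_zero fun k => ?_
      rw [inZ_const_apply, oddW_apply]
      split_ifs with h h'
      · exact h0 _ _ h.2
      · simp
      · rfl
    simp [oddAct, h1, h2]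

theorem vacProj_zPowZ {α β γ : Q} {f : BiSeries (VQ Q)} (hf : f ∈ bddClass (wtBdd B α β))
    (m : ℤ × ℤ)
    (h : ∀ n L, vacProj (f n L) = if n = m ∧ L = 0 then Finsupp.single γ 1 else 0) (n L) :
    vacProj (convAct (zPowZ B α) f n L) =
      if n = m + (B α γ, 0) ∧ L = 0 then Finsupp.single γ 1 else 0 := by
  have hsum : Summable (zPowZ B α) f := by
    refine summable_of_mem_bddClass (fun c v hv k hk => ?_) hf
    rw [zPowZ] at hk
    split_ifs at hk with h
    · by_contra h1
      exact hk (hv k.1 (by omega)).1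
    · exact absurd rfl hk
  rw [convAct, map_finsum _ (hsum n L), finsum_eq_single _ (n - m)]
  · rw [zPowZ]
    by_cases h2 : (n - m).2 = 0
    · rw [if_pos h2, vacProj_zPow, h, sub_sub_cancel]
      by_cases hL : L = 0
      · simp only [hL, and_true, if_true, diag_single]
        have e : n = m + (B α γ, 0) ↔ B α γ = (n - m).1 := by
          simp only [Prod.ext_iff, Prod.fst_add, Prod.snd_add, Prod.fst_sub, Prod.snd_sub] at h2 ⊢
          omega
        by_cases h3 : B α γ = (n - m).1
        · rw [if_pos (e.mpr h3), if_pos h3, one_smul]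
        · rw [if_neg (fun h => h3 (e.mp h)), if_neg h3, zero_smul]
      · simp [hL]
    · rw [if_neg h2, LinearMap.zero_apply, map_zero, if_neg]
      rintro ⟨h3, -⟩
      exact h2 (by rw [h3]; simp)
  · intro k hk
    rw [zPowZ]
    split_ifs
    · rw [vacProj_zPow, h, if_neg, map_zero]
      rintro ⟨h3, -⟩
      exact hk (by rw [← h3]; abel)
    · simp

theorem vacProj_zPowW {α β γ : Q} {f : BiSeries (VQ Q)} (hf : f ∈ bddClass (wtBdd B α β))
    (m : ℤ × ℤ)
    (h : ∀ n L, vacProj (f n L) = if n = m ∧ L = 0 then Finsupp.single γ 1 else 0) (n L) :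
    vacProj (convAct (zPowW B β) f n L) =
      if n = m + (0, B β γ) ∧ L = 0 then Finsupp.single γ 1 else 0 := by
  have hsum : Summable (zPowW B β) f := by
    refine summable_of_mem_bddClass (fun c v hv k hk => ?_) hf
    rw [zPowW] at hk
    split_ifs at hk with h
    · by_contra h1
      exact hk (hv k.2 (by omega)).2
    · exact absurd rfl hk
  rw [convAct, map_finsum _ (hsum n L), finsum_eq_single _ (n - m)]
  · rw [zPowW]
    by_cases h2 : (n - m).1 = 0
    · rw [if_pos h2, vacProj_zPow, h, sub_sub_cancel]
      by_cases hL : L = 0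
      · simp only [hL, and_true, if_true, diag_single]
        have e : n = m + (0, B β γ) ↔ B β γ = (n - m).2 := by
          simp only [Prod.ext_iff, Prod.fst_add, Prod.snd_add, Prod.fst_sub, Prod.snd_sub] at h2 ⊢
          omega
        by_cases h3 : B β γ = (n - m).2
        · rw [if_pos (e.mpr h3), if_pos h3, one_smul]
        · rw [if_neg (fun h => h3 (e.mp h)), if_neg h3, zero_smul]
      · simp [hL]
    · rw [if_neg h2, LinearMap.zero_apply, map_zero, if_neg]
      rintro ⟨h3, -⟩
      exact h2 (by rw [h3]; simp)
  · intro k hk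
    rw [zPowW]
    split_ifs
    · rw [vacProj_zPow, h, if_neg, map_zero]
      rintro ⟨h3, -⟩
      exact hk (by rw [← h3]; abel)
    · simp

theorem bdd_signE {α β : Q} {s : ℂ} {e : Module.End ℂ (VQ Q)} {f : BiSeries (VQ Q)}
    (hf : f ∈ bddClass (wtBdd B α β)) :
    ∃ c : ℤ, ∀ n L, signE s e f n L ≠ 0 → c ≤ n.1 ∧ c ≤ n.2 := by
  obtain ⟨c, -, hc⟩ := hf
  exact ⟨-c, fun n L h => hc n L fun h0 => h (by rw [signE_apply, h0, map_zero, smul_zero])⟩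

theorem vacProj_signE {ε : Q → Q → ℂ} {s : ℂ} {α γ : Q} {f : BiSeries (VQ Q)} {m : ℤ × ℤ}
    (h : ∀ n L, vacProj (f n L) = if n = m ∧ L = 0 then Finsupp.single γ 1 else 0) (n L) :
    vacProj (signE s (eOp B ε α) f n L) =
      if n = m ∧ L = 0 then ε α γ • Finsupp.single (α + γ) 1 else 0 := by
  rw [signE_apply, map_smul, vacProj_eOp, h]
  split_ifs with h0
  · rw [twMul_single, h0.2]; simp
  · simp

theorem exists_gamma (hs : B.IsSymm) (ε : Q → Q → ℂ) (α : Q) :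
    ∃ F : VQ Q →ₗ[ℂ] BiSeries (VQ Q), (∀ v, F v = gammaSeries B ε α v) ∧
      VertexLike B α 0 ((-1) ^ (B α α)) F ∧
      (∀ v, ∃ c : ℤ, ∀ n L, F v n L ≠ 0 → c ≤ n.1 ∧ c ≤ n.2) ∧
      ∀ γ n L, vacProj (F (eState γ) n L) =
        if n = (B α γ, 0) ∧ L = 0 then ε α γ • Finsupp.single (α + γ) 1 else 0 := by
  have hfin := good_finClass B
  have htame := good_bddClass_tameBdd B hs α 0
  have hwt := good_bddClass_wtBdd B α (0 : Q)
  have s1 := step_of_le B (step_bosAnn B hs α 0)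
    (finClass_le_bddClass (exists_mem_tameBdd B hs α 0))
  have s2 := step_bosCre B hs α 0 (tameBdd B α 0)
    (fun c h j v hv => hOp_even_mem_tameBdd B h j hv) htame
  have s12 := s1.comp hfin htame s2
  have s123 := s12.comp hfin htame (step_oneAddOdd B hs α)
  have st := s123.comp hfin hwt (step_zPowZ B α 0)
  have hv := vertexLike_of_step B hs ε st (by
    intro j J
    match J with
    | 0 =>
      rcases lt_trichotomy j 0 with h | h | h
      · simp [h, h.not_gt, h.ne]
      · simp [h]
      · simp [h, h.not_gt, h.ne']
    | 1 => simp)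
  rw [add_zero] at hv
  refine ⟨_, fun v => ?_, hv, fun v => bdd_signE B (st.lin.maps _ (const_mem_finClass v)),
    fun γ n L => ?_⟩
  · have e1 : bosCre B α = bosX B (0 < ·) α := rfl
    have e2 : bosAnn B α = bosX B (· < 0) α := rfl
    rw [gammaSeries, act_eOp B hs, act_inZ_zPow, act_oneAddOdd, e1, e2, expAct_inZ_bosX,
      expAct_inZ_bosX]
    rfl
  · refine vacProj_signE B (fun n L => ?_) n L
    have h0 := expOp_bosAnn_eState B α 0 γ
    have hmem : inZ (const (eState γ)) ∈ bddClass (tameBdd B α 0) :=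
      finClass_le_bddClass (exists_mem_tameBdd B hs α 0) (const_mem_finClass _)
    set g := expOp (convAct (bosK B (0 < ·) α 0)) (inZ (const (eState γ))) with hg
    have hgm : g ∈ bddClass (tameBdd B α 0) := s2.lin.maps _ hmem
    have h1 : ∀ n L, vacProj (g n L) = if n = 0 ∧ L = 0 then Finsupp.single γ 1 else 0 := by
      intro n L
      rw [hg, map_expOp vacProj (linOn_bosCre B (tameBdd B α 0)
        (fun c h j v hv => hOp_even_mem_tameBdd B h j hv)).2.1 hmem (vacProj_bosCre B α 0),
        inZ_const_apply]
      split_ifs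
      · exact vacProj_eState γ
      · simp
    have h2 : ∀ h (j : ℤ) n L, vacProj (hOp B h j 1 (g n L)) = 0 := by
      intro h j n L
      rcases lt_or_ge j 0 with hj | hj
      · exact vacProj_cre B h hj 1 _
      · have h3 := s2.comm h j 1 _ hmem
        have h4 : inZ (const (0 : VQ Q)) = 0 := by
          ext n L; rw [inZ_const_apply]; simp
        have h5 := s2.lin.smul 0 0 (zero_mem _)
        rw [zero_smul, zero_smul] at h5
        rw [superCoeff_const, hOp_eState B h hj, if_neg (by simp), h4, h5] at h3
        simp only [one_ne_zero, false_and, if_false, zero_mul, scalarCoeff_zero_zero,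
          add_zero] at h3
        have h6 := congrFun (congrFun h3 n) L
        rw [superCoeff_one_apply, twist_apply, onCoeff_apply] at h6
        have h7 : hOp B h j 1 (g n L) = 0 := by
          refine (smul_eq_zero.mp h6).resolve_left ?_
          exact pow_ne_zero _ (by norm_num)
        rw [h7, map_zero]
    have h3 : ∀ n L, vacProj ((g + oddAct (oddZ B (fun _ => True) α) (oddW B (fun _ => True) 0) g)
        n L) = if n = 0 ∧ L = 0 then Finsupp.single γ 1 else 0 := by
      intro n L
      rw [Pi.add_apply, Pi.add_apply, map_add, vacProj_oddAct B _ α 0 g (fun h j _ => h2 h j),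
        add_zero, h1]
    have h4 := vacProj_zPowZ B ((step_oneAddOdd B hs α).lin.maps g hgm) 0 h3 n L
    rw [zero_add] at h4
    rw [← h4]
    change vacProj (convAct (zPowZ B α) ((fun f => f + oddAct (oddZ B (fun _ => True) α)
      (oddW B (fun _ => True) 0) f) (expOp (convAct (bosK B (0 < ·) α 0))
        (expOp (convAct (bosK B (· < 0) α 0)) (inZ (const (eState γ)))))) n L) = _
    rw [h0]

theorem exists_gamma₂ (hs : B.IsSymm) (ε : Q → Q → ℂ) (α β : Q) :
    ∃ F : VQ Q →ₗ[ℂ] BiSeries (VQ Q), (∀ v, F v = Gam₂ B ε α β v) ∧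
      VertexLike B α β ((-1) ^ (B (α + β) (α + β))) F ∧
      (∀ v, ∃ c : ℤ, ∀ n L, F v n L ≠ 0 → c ≤ n.1 ∧ c ≤ n.2) ∧
      ∀ γ n L, vacProj (F (eState γ) n L) =
        if n = (B α γ, B β γ) ∧ L = 0 then ε (α + β) γ • Finsupp.single (α + β + γ) 1 else 0 := by
  have hfin := good_finClass B
  have hwt := good_bddClass_wtBdd B α β
  have s0 := step_oddAnn B hs α β
  have s1 := s0.comp hfin hfin (step_of_le B (step_bosAnn B hs α β)
    (finClass_le_bddClass (exists_mem_wtBdd B α β)))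
  have t2 := step_bosCre B hs α β (wtBdd B α β)
    (fun c h j v hv => hOp_mem_wtBdd B h j 0 hv) hwt
  have s2 := s1.comp hfin hwt t2
  have s3 := s2.comp hfin hwt (step_oddCre B hs α β)
  have s4 := s3.comp hfin hwt (step_zPowW B α β)
  have st := s4.comp hfin hwt (step_zPowZ B α β)
  have hv := vertexLike_of_step B hs ε st (by
    intro j J
    match J with
    | 0 =>
      rcases lt_trichotomy j 0 with h | h | h
      · simp [h, h.not_gt, h.ne]
      · simp [h]
      · simp [h, h.not_gt, h.ne']
    | 1 =>
      rcases lt_or_ge j 0 with h | h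
      · simp [h]
      · simp [h, not_lt.mpr h])
  refine ⟨_, fun v => ?_, hv, fun v => bdd_signE B (st.lin.maps _ (const_mem_finClass v)),
    fun γ n L => ?_⟩
  · have e1 : ∀ α, bosCre B α = bosX B (0 < ·) α := fun _ => rfl
    have e2 : ∀ α, bosAnn B α = bosX B (· < 0) α := fun _ => rfl
    have e3 : ∀ α, oddCre B α = oddX B (0 ≤ ·) α := fun _ => rfl
    have e4 : ∀ α, oddAnn B α = oddX B (· < 0) α := fun _ => rfl
    rw [Gam₂, act_eOp B hs, act_inZ_zPow, act_inW_zPow]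
    simp only [e1, e2, e3, e4, expAct_bosX, expAct_oddX]
    rfl
  · refine vacProj_signE B (fun n L => ?_) n L
    have hmem : inZ (const (eState γ)) ∈ bddClass (wtBdd B α β) :=
      finClass_le_bddClass (exists_mem_wtBdd B α β) (const_mem_finClass _)
    set g := expOp (convAct (bosK B (0 < ·) α β)) (inZ (const (eState γ))) with hg
    have hgm : g ∈ bddClass (wtBdd B α β) := t2.lin.maps _ hmem
    have h1 : ∀ n L, vacProj (g n L) = if n = 0 ∧ L = 0 then Finsupp.single γ 1 else 0 := by
      intro n L
      rw [hg, map_expOp vacProj (linOn_bosCre B (wtBdd B α β)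
        (fun c h j v hv => hOp_mem_wtBdd B h j 0 hv)).2.1 hmem (vacProj_bosCre B α β),
        inZ_const_apply]
      split_ifs
      · exact vacProj_eState γ
      · simp
    set g' := expOp (oddAct (oddZ B (0 ≤ ·) α) (oddW B (0 ≤ ·) β)) g with hg'
    have hgm' : g' ∈ bddClass (wtBdd B α β) := (step_oddCre B hs α β).lin.maps _ hgm
    have hn : NilOn (bddClass (wtBdd B α β)) (oddAct (oddZ B (0 ≤ ·) α) (oddW B (0 ≤ ·) β)) :=
      (linOn_expOp_oddAct hwt.stable (linOn_oddCre B α β).1 (linOn_oddCre B α β).2).1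
    have h3 : ∀ n L, vacProj (g' n L) = if n = 0 ∧ L = 0 then Finsupp.single γ 1 else 0 := by
      intro n L
      rw [hg', map_expOp vacProj hn hgm (fun g n L => vacProj_oddAct B _ α β g
        (fun h j hj n L => vacProj_cre B h (by omega) 1 _) n L), h1]
    have h4 := vacProj_zPowW B hgm' 0 h3
    have h5 := vacProj_zPowZ B ((step_zPowW B α β).lin.maps _ hgm') _ h4 n L
    rw [show (0 : ℤ × ℤ) + (0, B β γ) + (B α γ, 0) = (B α γ, B β γ) by simp] at h5
    rw [← h5]
    change vacProj (convAct (zPowZ B α) (convAct (zPowW B β)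
      (expOp (oddAct (oddZ B (0 ≤ ·) α) (oddW B (0 ≤ ·) β)) (expOp (convAct (bosK B (0 < ·) α β))
        (expOp (convAct (bosK B (· < 0) α β)) (expOp (oddAct (oddZ B (· < 0) α) (oddW B (· < 0) β))
          (inZ (const (eState γ)))))))) n L) = _
    rw [expOp_oddAnn_eState, expOp_bosAnn_eState]

end VertexOperators

section Fields

variable {Q : Type*} [AddCommGroup Q] {B : LinearMap.BilinForm ℤ Q}

theorem scalarCoeff_zero_apply {V : Type*} [AddCommGroup V] [Module ℂ V] (j : ℤ) (a b : ℂ)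
    (f : BiSeries V) (n L) :
    scalarCoeff 0 j a b f n L = a • f (n - (j, 0)) L + b • f (n - (0, j)) L := rfl

theorem scalarCoeff_one_apply {V : Type*} [AddCommGroup V] [Module ℂ V] (j : ℤ) (a b : ℂ)
    (f : BiSeries V) (n L) :
    scalarCoeff 1 j a b f n L = -(a • (if L.1 = 1 then f (n - (j, 0)) (0, L.2) else 0) +
      b • (if L.2 = 1 then (-1 : ℂ) ^ (L.1 : ℕ) • f (n - (0, j)) (L.1, 0) else 0)) := rfl

theorem neg_one_pow_mul_self (k : ℕ) : (-1 : ℂ) ^ k * (-1) ^ k = 1 := by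
  rw [← mul_pow]; simp

theorem VertexLike.sub {α β : Q} {s : ℂ} {F G : VQ Q →ₗ[ℂ] BiSeries (VQ Q)}
    (hF : VertexLike B α β s F) (hG : VertexLike B α β s G) : VertexLike B α β s (F - G) where
  modes h j J v := by
    simp only [LinearMap.sub_apply, map_sub, hF.modes, hG.modes, smul_sub]; abel
  parity v := by simp only [LinearMap.sub_apply, map_sub, hF.parity, hG.parity, smul_sub]

theorem VertexLike.smul {α β : Q} {s : ℂ} {F : VQ Q →ₗ[ℂ] BiSeries (VQ Q)}
    (hF : VertexLike B α β s F) (c : ℂ) : VertexLike B α β s (c • F) where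
  modes h j J v := by
    simp only [LinearMap.smul_apply, map_smul, hF.modes, smul_add, smul_comm c]
  parity v := by simp only [LinearMap.smul_apply, map_smul, hF.parity, smul_comm c]

variable [Module.Free ℤ Q] [Module.Finite ℤ Q]

theorem VertexLike.eq_zero (hs : B.IsSymm) (hnd : B.Nondegenerate) {α β : Q} {s : ℂ} (hs0 : s ≠ 0)
    {F : VQ Q →ₗ[ℂ] BiSeries (VQ Q)} (hF : VertexLike B α β s F)
    (hvac : ∀ γ n L, vacProj (F (eState γ) n L) = 0) (v : VQ Q) : F v = 0 := by
  let F' : (ℤ × ℤ) × (Fin 2 × Fin 2) → Module.End ℂ (VQ Q) := fun i =>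
    { toFun := fun v => F v i.1 i.2
      map_add' := fun v w => by rw [map_add]; rfl
      map_smul' := fun c v => by rw [map_smul]; rfl }
  have hF' : ∀ i v, F' i v = F v i.1 i.2 := fun _ _ => rfl
  have hmem : ∀ n L v, F v n L ∈ Submodule.span ℂ (Set.range fun k => F' k v) := fun n L v =>
    Submodule.subset_span ⟨(n, L), rfl⟩
  have := rigidity B hs hnd F' (fun h j J => ?_) (fun i γ => hvac γ _ _)
  · funext n L
    exact DFunLike.congr_fun (this (n, L)) v
  · match J with
    | 0 =>
      refine ⟨fun _ => 1, fun _ => one_ne_zero, fun i v => ?_⟩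
      have h1 := congrFun (congrFun (hF.modes h j 0 v) i.1) i.2
      rw [Pi.add_apply, Pi.add_apply, scalarCoeff_zero_apply] at h1
      have h2 : hOp B h j 0 (F' i v) = _ := h1
      rw [h2]
      simp only [Fin.val_zero, pow_zero, one_smul, hF', add_sub_cancel_left]
      exact add_mem (Submodule.smul_mem _ _ (hmem _ _ _)) (Submodule.smul_mem _ _ (hmem _ _ _))
    | 1 =>
      refine ⟨fun i => (-1) ^ ((i.2.1 : ℕ) + i.2.2) * s,
        fun _ => mul_ne_zero (pow_ne_zero _ (by norm_num)) hs0, fun i v => ?_⟩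
      have h1 := congrFun (congrFun (hF.modes h j 1 v) i.1) i.2
      rw [Pi.add_apply, Pi.add_apply, scalarCoeff_one_apply, superCoeff_one_apply,
        twist_apply, onCoeff_apply] at h1
      have h2 : hOp B h j 1 (F' i v) = (-1 : ℂ) ^ ((i.2.1 : ℕ) + i.2.2) •
          ((-1 : ℂ) ^ ((i.2.1 : ℕ) + i.2.2) • hOp B h j 1 (F v i.1 i.2)) := by
        rw [smul_smul, neg_one_pow_mul_self, one_smul, hF']
      rw [h2, h1, smul_add, Fin.val_one, pow_one, Pi.smul_apply, Pi.smul_apply, smul_smul, hF',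
        add_sub_cancel_left]
      refine Submodule.smul_mem _ _ (neg_mem (add_mem (Submodule.smul_mem _ _ ?_)
        (Submodule.smul_mem _ _ ?_)))
      · split_ifs
        exacts [hmem _ _ _, zero_mem _]
      · split_ifs
        exacts [Submodule.smul_mem _ _ (hmem _ _ _), zero_mem _]

theorem VertexLike.ext (hs : B.IsSymm) (hnd : B.Nondegenerate) {α β : Q} {s : ℂ} (hs0 : s ≠ 0)
    {F G : VQ Q →ₗ[ℂ] BiSeries (VQ Q)} (hF : VertexLike B α β s F) (hG : VertexLike B α β s G)
    (hvac : ∀ γ n L, vacProj (F (eState γ) n L) = vacProj (G (eState γ) n L)) (v : VQ Q) :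
    F v = G v := by
  have := (hF.sub hG).eq_zero hs hnd hs0 (fun γ n L => by
    rw [LinearMap.sub_apply, Pi.sub_apply, Pi.sub_apply, map_sub, hvac, sub_self]) v
  rwa [LinearMap.sub_apply, sub_eq_zero] at this

theorem vacProj_apply_eq_zero_of_weight (hnd : B.Nondegenerate) {x : VQ Q} {δ : Q}
    (hx : ∀ h, hOp B h 0 0 x = formC B h (toH δ) • x) {γ : Q} (hγ : γ ≠ δ) :
    vacProj x γ = 0 := by
  by_contra h0
  refine hγ (toH_injective_form B hnd fun h => ?_)
  have h1 := vacProj_hOp_zero B h x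
  rw [hx, map_smul] at h1
  have h2 := DFunLike.congr_fun h1 γ
  rw [Finsupp.smul_apply, diag_apply, smul_eq_mul] at h2
  exact (mul_right_cancel₀ h0 h2).symm

theorem vacProj_eq_zero_of_parity (hnd : B.Nondegenerate) {x : VQ Q} {δ : Q}
    (hx : ∀ h, hOp B h 0 0 x = formC B h (toH δ) • x)
    (hp : parity B x = -((-1 : ℂ) ^ (B δ δ) • x)) : vacProj x = 0 := by
  ext γ
  rw [Finsupp.zero_apply]
  by_cases hγ : γ = δ
  · subst hγ
    have h1 := vacProj_parity B x
    rw [hp, map_neg, map_smul] at h1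
    have h2 := DFunLike.congr_fun h1 γ
    rw [Finsupp.neg_apply, Finsupp.smul_apply, diag_apply, smul_eq_mul] at h2
    have h3 : (-1 : ℂ) ^ (B γ γ) ≠ 0 := zpow_ne_zero _ (by norm_num)
    have h4 : (-1 : ℂ) ^ (B γ γ) * (2 * vacProj x γ) = 0 := by linear_combination -h2
    have := (mul_eq_zero.mp h4).resolve_left h3
    simpa using this
  · exact vacProj_apply_eq_zero_of_weight hnd hx hγ

theorem VertexLike.vacProj_odd (hs : B.IsSymm) (hnd : B.Nondegenerate) {α β : Q}
    {F : VQ Q →ₗ[ℂ] BiSeries (VQ Q)}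
    (hF : VertexLike B α β ((-1) ^ (B (α + β) (α + β))) F) (γ : Q) (n) (L : Fin 2 × Fin 2)
    (hL : (-1 : ℂ) ^ ((L.1 : ℕ) + L.2) = -1) : vacProj (F (eState γ) n L) = 0 := by
  refine vacProj_eq_zero_of_parity (B := B) (δ := α + β + γ) hnd (fun h => ?_) ?_
  · have h1 := congrFun (congrFun (hF.modes h 0 0 (eState γ)) n) L
    rw [Pi.add_apply, Pi.add_apply, scalarCoeff_zero_apply, superCoeff_zero_apply,
      onCoeff_apply, hOp_eState B h le_rfl] at h1
    simp only [and_self, if_true, map_smul, Fin.val_zero, pow_zero, one_smul, Prod.mk_zero_zero,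
      sub_zero, Pi.smul_apply] at h1
    rw [h1, formC_toH_add_right, formC_toH_add_right]
    module
  · have h1 := congrFun (congrFun (hF.parity (eState γ)) n) L
    rw [superCoeff_one_apply, twist_apply, onCoeff_apply, hL, parity_eState, map_smul,
      neg_one_smul] at h1
    rw [neg_one_zpow_form_add B hs (α + β) γ, mul_smul, ← neg_eq_iff_eq_neg, h1]
    rfl

/-! ### Even components of vertex operators -/

variable (B)

/-- The commutation relations of the even component of a vertex operator of weight `α`, with
leading coefficients `c`. -/
structure VertexField (α : Q) (s : ℂ) (c : Q → ℂ) (A : ℤ → Module.End ℂ (VQ Q)) : Prop where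
  even : ∀ h j n v, hOp B h j 0 (A n v) = A n (hOp B h j 0 v) +
    formC B h (toH α) • A (n - j) v
  odd : ∀ h j n v, hOp B h j 1 (A n v) = s • A n (hOp B h j 1 v)
  vac : ∀ γ n, vacProj (A n (eState γ)) =
    if n = B α γ then c γ • Finsupp.single (α + γ) 1 else 0

/-- The relation of the odd component `D` to the even component `A` of a vertex operator. -/
structure VertexPair (α : Q) (s : ℂ) (A D : ℤ → Module.End ℂ (VQ Q)) : Prop where
  even : ∀ h j n v, hOp B h j 0 (D n v) = D n (hOp B h j 0 v) + formC B h (toH α) • D (n - j) v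
  odd : ∀ h j n v, hOp B h j 1 (D n v) = -(s • D n (hOp B h j 1 v)) +
    formC B h (toH α) • A (n - j) v
  vac : ∀ γ n, vacProj (D n (eState γ)) = 0

/-- The superfield `Γ_α`. -/
def gamOp (hs : B.IsSymm) (ε : Q → Q → ℂ) (α : Q) (n : ℤ) (I : Fin 2) : Module.End ℂ (VQ Q) where
  toFun v := Gam B ε α n I v
  map_add' v w := by
    obtain ⟨F, hF, -⟩ := exists_gamma B hs ε α
    simp only [Gam, ← hF, map_add, Pi.add_apply]
  map_smul' c v := by
    obtain ⟨F, hF, -⟩ := exists_gamma B hs ε α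
    simp only [Gam, ← hF, map_smul, Pi.smul_apply, RingHom.id_apply]

theorem gamOp_apply (hs : B.IsSymm) (ε : Q → Q → ℂ) (α : Q) (n : ℤ) (I : Fin 2) (v : VQ Q) :
    gamOp B hs ε α n I v = Gam B ε α n I v := rfl

theorem gamOp_even (hs : B.IsSymm) (ε : Q → Q → ℂ) (α : Q) (h : Hsp Q) (j n : ℤ) (I : Fin 2)
    (v : VQ Q) : hOp B h j 0 (gamOp B hs ε α n I v) = gamOp B hs ε α n I (hOp B h j 0 v) +
      formC B h (toH α) • gamOp B hs ε α (n - j) I v := by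
  obtain ⟨F, hF, h2, -⟩ := exists_gamma B hs ε α
  have h1 := congrFun (congrFun (h2.modes h j 0 v) (n, 0)) (I, 0)
  rw [Pi.add_apply, Pi.add_apply, scalarCoeff_zero_apply, superCoeff_zero_apply,
    onCoeff_apply, toH_zero, map_zero, zero_smul, add_zero] at h1
  simp only [Fin.val_zero, pow_zero, one_smul, hF, Prod.mk_sub_mk, sub_zero] at h1
  exact h1

theorem gamOp_parity (hs : B.IsSymm) (ε : Q → Q → ℂ) (α : Q) (n : ℤ) (I : Fin 2)
    (v : VQ Q) : parity B (gamOp B hs ε α n I v) =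
      ((-1 : ℂ) ^ (B α α) * (-1) ^ (I : ℕ)) • gamOp B hs ε α n I (parity B v) := by
  obtain ⟨F, hF, h2, -⟩ := exists_gamma B hs ε α
  have h1 := congrFun (congrFun (h2.parity v) (n, 0)) (I, 0)
  rw [superCoeff_one_apply, twist_apply, onCoeff_apply, Pi.smul_apply, Pi.smul_apply, hF, hF,
    Fin.val_zero, add_zero] at h1
  have h3 : parity B (gamOp B hs ε α n I v) = (-1 : ℂ) ^ (I : ℕ) • ((-1 : ℂ) ^ (I : ℕ) •
      parity B (gammaSeries B ε α v (n, 0) (I, 0))) := by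
    rw [smul_smul, neg_one_pow_mul_self, one_smul]; rfl
  rw [h3, h1, smul_smul, mul_comm]
  rfl

theorem gamOp_odd_zero (hs : B.IsSymm) (ε : Q → Q → ℂ) (α : Q) (h : Hsp Q) (j n : ℤ)
    (v : VQ Q) : hOp B h j 1 (gamOp B hs ε α n 0 v) =
      (-1 : ℂ) ^ (B α α) • gamOp B hs ε α n 0 (hOp B h j 1 v) := by
  obtain ⟨F, hF, h2, -⟩ := exists_gamma B hs ε α
  have h1 := congrFun (congrFun (h2.modes h j 1 v) (n, 0)) (0, 0)
  rw [Pi.add_apply, Pi.add_apply, scalarCoeff_one_apply, superCoeff_one_apply, twist_apply,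
    onCoeff_apply] at h1
  simp only [Fin.val_zero, Fin.val_one, pow_zero, pow_one, add_zero, one_smul, hF, zero_ne_one,
    if_false, smul_zero, neg_zero, Pi.smul_apply] at h1
  exact h1

theorem gamOp_odd_one (hs : B.IsSymm) (ε : Q → Q → ℂ) (α : Q) (h : Hsp Q) (j n : ℤ)
    (v : VQ Q) : hOp B h j 1 (gamOp B hs ε α n 1 v) =
      -((-1 : ℂ) ^ (B α α) • gamOp B hs ε α n 1 (hOp B h j 1 v)) +
        formC B h (toH α) • gamOp B hs ε α (n - j) 0 v := by
  obtain ⟨F, hF, h2, -⟩ := exists_gamma B hs ε α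
  have h1 := congrFun (congrFun (h2.modes h j 1 v) (n, 0)) (1, 0)
  rw [Pi.add_apply, Pi.add_apply, scalarCoeff_one_apply, superCoeff_one_apply, twist_apply,
    onCoeff_apply, toH_zero] at h1
  simp only [Fin.val_zero, Fin.val_one, pow_one, add_zero, hF, zero_ne_one,
    if_false, smul_zero, Pi.smul_apply, if_true, neg_one_smul, Prod.mk_sub_mk,
    sub_zero] at h1
  rw [neg_eq_iff_eq_neg, neg_add, neg_neg] at h1
  exact h1

theorem gamOp_bdd (hs : B.IsSymm) (ε : Q → Q → ℂ) (α : Q) (v : VQ Q) :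
    ∃ N : ℤ, ∀ n < N, ∀ I, gamOp B hs ε α n I v = 0 := by
  obtain ⟨F, hF, -, h3, -⟩ := exists_gamma B hs ε α
  obtain ⟨c, hc⟩ := h3 v
  refine ⟨c, fun n hn I => ?_⟩
  by_contra h0
  rw [gamOp_apply, Gam, ← hF] at h0
  exact absurd (hc _ _ h0).1 (not_le.mpr hn)

theorem vertexField_gamOp (hs : B.IsSymm) (ε : Q → Q → ℂ) (α : Q) :
    VertexField B α ((-1) ^ (B α α)) (ε α) (fun n => gamOp B hs ε α n 0) where
  even h j n v := gamOp_even B hs ε α h j n 0 v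
  odd h j n v := gamOp_odd_zero B hs ε α h j n v
  vac γ n := by
    obtain ⟨F, hF, -, -, h4⟩ := exists_gamma B hs ε α
    rw [gamOp_apply, Gam, ← hF, h4]
    simp

theorem vertexPair_gamOp (hs : B.IsSymm) (ε : Q → Q → ℂ) (α : Q) :
    VertexPair B α ((-1) ^ (B α α)) (fun n => gamOp B hs ε α n 0)
      (fun n => gamOp B hs ε α n 1) where
  even h j n v := gamOp_even B hs ε α h j n 1 v
  odd h j n v := gamOp_odd_one B hs ε α h j n v
  vac γ n := by
    obtain ⟨F, hF, -, -, h4⟩ := exists_gamma B hs ε α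
    rw [gamOp_apply, Gam, ← hF, h4]
    simp

variable {B}

theorem rigidity_family (hs : B.IsSymm) (hnd : B.Nondegenerate) {α : Q} {s : ℂ} (hs0 : s ≠ 0)
    {A : ℤ → Module.End ℂ (VQ Q)}
    (even : ∀ h j n v, hOp B h j 0 (A n v) = A n (hOp B h j 0 v) +
      formC B h (toH α) • A (n - j) v)
    (odd : ∀ h j n v, hOp B h j 1 (A n v) = s • A n (hOp B h j 1 v))
    (vac : ∀ γ n, vacProj (A n (eState γ)) = 0) (n : ℤ) : A n = 0 := by
  refine rigidity B hs hnd A (fun h j J => ?_) (fun n γ => vac γ n) n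
  match J with
  | 0 =>
    refine ⟨fun _ => 1, fun _ => one_ne_zero, fun n v => ?_⟩
    rw [even, one_smul, add_sub_cancel_left]
    exact Submodule.smul_mem _ _ (Submodule.subset_span ⟨n - j, rfl⟩)
  | 1 =>
    refine ⟨fun _ => s, fun _ => hs0, fun n v => ?_⟩
    rw [odd, sub_self]
    exact zero_mem _

theorem VertexField.ext (hs : B.IsSymm) (hnd : B.Nondegenerate) {α : Q} {s : ℂ} (hs0 : s ≠ 0)
    {c : Q → ℂ} {A A' : ℤ → Module.End ℂ (VQ Q)} (hA : VertexField B α s c A)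
    (hA' : VertexField B α s c A') : A = A' := by
  funext n
  rw [← sub_eq_zero]
  refine rigidity_family (A := fun n => A n - A' n) (α := α) hs hnd hs0 (fun h j n v => ?_)
    (fun h j n v => ?_) (fun γ n => ?_) n
  · simp only [LinearMap.sub_apply, map_sub, hA.even, hA'.even, smul_sub]; abel
  · simp only [LinearMap.sub_apply, map_sub, hA.odd, hA'.odd, smul_sub]
  · simp only [LinearMap.sub_apply, map_sub, hA.vac, hA'.vac, sub_self]

theorem VertexField.apply_eState_of_lt (hs : B.IsSymm) (hnd : B.Nondegenerate) {α : Q} {s : ℂ}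
    {c : Q → ℂ} {A : ℤ → Module.End ℂ (VQ Q)} (hA : VertexField B α s c A) (γ : Q) {n : ℤ}
    (hn : n < B α γ) : A n (eState γ) = 0 := by
  refine eq_zero_of_stable B hs hnd
    (Submodule.span ℂ {x | ∃ m < B α γ, A m (eState γ) = x}) (fun h j J hj v hv => ?_)
    (fun v hv => ?_) _ (Submodule.subset_span ⟨n, hn, rfl⟩)
  · induction hv using Submodule.span_induction with
    | mem x hx =>
      obtain ⟨m, hm, rfl⟩ := hx
      have h0 : hOp B h j J (eState γ) = 0 := by
        rw [hOp_eState B h (by omega), if_neg]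
        rintro ⟨rfl, rfl⟩
        simp at hj
      match J with
      | 0 =>
        rw [hA.even, h0, map_zero, zero_add]
        exact Submodule.smul_mem _ _ (Submodule.subset_span ⟨m - j, by omega, rfl⟩)
      | 1 => rw [hA.odd, h0, map_zero, smul_zero]; exact zero_mem _
    | zero => simp
    | add x y _ _ hx hy => rw [map_add]; exact add_mem hx hy
    | smul a x _ hx => rw [map_smul]; exact Submodule.smul_mem _ _ hx
  · induction hv using Submodule.span_induction with
    | mem x hx =>
      obtain ⟨m, hm, rfl⟩ := hx
      rw [hA.vac, if_neg hm.ne]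
    | zero => simp
    | add x y _ _ hx hy => rw [map_add, hx, hy, add_zero]
    | smul a x _ hx => rw [map_smul, hx, smul_zero]

theorem eq_zero_of_ann (hs : B.IsSymm) (hnd : B.Nondegenerate) {x : VQ Q}
    (hx : ∀ h (j : ℤ) J, (0 < j ∨ j = 0 ∧ J = 1) → hOp B h j J x = 0) (hvac : vacProj x = 0) :
    x = 0 := by
  refine eq_zero_of_stable B hs hnd (Submodule.span ℂ {x}) (fun h j J hj v hv => ?_)
    (fun v hv => ?_) x (Submodule.mem_span_singleton_self x)
  · obtain ⟨a, rfl⟩ := Submodule.mem_span_singleton.mp hv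
    rw [map_smul, hx h j J hj, smul_zero]; exact zero_mem _
  · obtain ⟨a, rfl⟩ := Submodule.mem_span_singleton.mp hv
    rw [map_smul, hvac, smul_zero]

theorem VertexField.apply_eState_self (hs : B.IsSymm) (hnd : B.Nondegenerate) {α : Q} {s : ℂ}
    {c : Q → ℂ} {A : ℤ → Module.End ℂ (VQ Q)} (hA : VertexField B α s c A) (γ : Q) :
    A (B α γ) (eState γ) = c γ • eState (α + γ) := by
  rw [← sub_eq_zero]
  refine eq_zero_of_ann hs hnd (fun h j J hj => ?_) ?_
  · have h0 : ∀ δ, hOp B h j J (eState δ) = 0 := fun δ => by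
      rw [hOp_eState B h (by omega), if_neg]
      rintro ⟨rfl, rfl⟩
      simp at hj
    rw [map_sub, map_smul, h0, smul_zero, sub_zero]
    match J with
    | 0 =>
      rw [hA.even, h0, map_zero, zero_add, hA.apply_eState_of_lt hs hnd γ (by omega), smul_zero]
    | 1 => rw [hA.odd, h0, map_zero, smul_zero]
  · rw [map_sub, map_smul, hA.vac, if_pos rfl, vacProj_eState, sub_self]

/-! ### Translation -/

variable (B) in
/-- `S` is the odd translation operator. -/
structure IsTranslation (S : Module.End ℂ (VQ Q)) : Prop where
  odd : ∀ h j v, S (hOp B h j 1 v) = hOp B h j 0 v - hOp B h j 1 (S v)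
  even : ∀ h j v, S (hOp B h j 0 v) = hOp B h j 0 (S v) - (j : ℂ) • hOp B h (j - 1) 1 v
  eState : ∀ α, S (eState α) = hOp B (toH α) (-1) 1 (SUSY.eState α)

theorem IsTranslation.vacProj_apply {S : Module.End ℂ (VQ Q)} (hS : IsTranslation B S) (v : VQ Q) :
    vacProj (S v) = 0 := by
  induction v using vq_induction B with
  | e β => rw [hS.eState]; exact vacProj_cre B _ (by norm_num) _ _
  | smul c x hx => rw [map_smul, map_smul, hx, smul_zero]
  | add x y hx hy => rw [map_add, map_add, hx, hy, add_zero]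
  | cre h j J x hj hx =>
    match J with
    | 0 => rw [hS.even, map_sub, map_smul, vacProj_cre B _ hj, vacProj_cre B _ (by omega)]; simp
    | 1 => rw [hS.odd, map_sub, vacProj_cre B _ hj, vacProj_cre B _ hj]; simp

theorem IsTranslation.parity_apply {S : Module.End ℂ (VQ Q)} (hS : IsTranslation B S) (v : VQ Q) :
    parity B (S v) = -S (parity B v) := by
  induction v using vq_induction B with
  | e β => rw [hS.eState, parity_hOp, parity_eState, map_smul, map_smul, hS.eState]; simp
  | smul c x hx => rw [map_smul, map_smul, map_smul, map_smul, hx, smul_neg]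
  | add x y hx hy => rw [map_add, map_add, map_add, map_add, hx, hy]; abel
  | cre h j J x hj hx =>
    match J with
    | 0 =>
      rw [hS.even, map_sub, map_smul, parity_hOp, parity_hOp, parity_hOp, hx, map_smul, hS.even]
      simp
      abel
    | 1 =>
      rw [hS.odd, map_sub, parity_hOp, parity_hOp, parity_hOp, hx, map_smul, hS.odd]
      simp

theorem IsTranslation.sq_hOp {S : Module.End ℂ (VQ Q)} (hS : IsTranslation B S) (h : Hsp Q)
    (j : ℤ) (J : Fin 2) (v : VQ Q) :
    S (S (hOp B h j J v)) = hOp B h j J (S (S v)) - (j : ℂ) • hOp B h (j - 1) J v := by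
  match J with
  | 0 =>
    rw [hS.even, map_sub, map_smul, hS.even, hS.odd, smul_sub]; abel
  | 1 =>
    rw [hS.odd, map_sub, hS.even, hS.odd]; abel

theorem IsTranslation.sq_eState {S : Module.End ℂ (VQ Q)} (hS : IsTranslation B S) (hs : B.IsSymm)
    (γ : Q) : S (S (SUSY.eState γ)) = hOp B (toH γ) (-1) 0 (SUSY.eState γ) := by
  have h1 := hOp_odd_odd B hs (toH γ) (toH γ) (-1) (-1) (SUSY.eState γ)
  rw [if_neg (by norm_num), zero_smul, zero_sub, eq_neg_iff_add_eq_zero, ← two_smul ℂ,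
    smul_eq_zero, or_iff_right two_ne_zero] at h1
  rw [hS.eState, hS.odd, hS.eState, h1, sub_zero]

/-- The odd component is the supercommutator of `S` with the even component. -/
theorem VertexPair.eq_comm (hs : B.IsSymm) (hnd : B.Nondegenerate) {S : Module.End ℂ (VQ Q)}
    (hS : IsTranslation B S) {α : Q} {s : ℂ} (hss : s * s = 1) {c : Q → ℂ}
    {A D : ℤ → Module.End ℂ (VQ Q)} (hA : VertexField B α s c A) (hD : VertexPair B α s A D)
    (n : ℤ) (v : VQ Q) : D n v = S (A n v) - s • A n (S v) := by
  have hs0 : -s ≠ 0 := neg_ne_zero.mpr (left_ne_zero_of_mul_eq_one hss)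
  have h0 := rigidity_family (A := fun n => D n - (S * A n - s • (A n * S))) hs hnd hs0 (α := α)
    (fun h j n v => ?_) (fun h j n v => ?_) (fun γ n => ?_) n
  · have := DFunLike.congr_fun h0 v
    simpa [sub_eq_zero] using this
  · simp only [LinearMap.sub_apply, Module.End.mul_apply, LinearMap.smul_apply, map_sub, map_smul]
    have e1 : ∀ x, hOp B h j 0 (S x) = S (hOp B h j 0 x) + (j : ℂ) • hOp B h (j - 1) 1 x :=
      fun x => by rw [hS.even]; abel
    rw [hD.even, e1, hA.even, hA.odd, hA.even, e1]
    simp only [map_add, map_smul]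
    module
  · simp only [LinearMap.sub_apply, Module.End.mul_apply, LinearMap.smul_apply, map_sub, map_smul]
    have e1 : ∀ x, hOp B h j 1 (S x) = hOp B h j 0 x - S (hOp B h j 1 x) :=
      fun x => by rw [hS.odd]; abel
    rw [hD.odd, e1, hA.even, hA.odd, hA.odd, e1]
    simp only [map_sub, map_smul, smul_sub, smul_smul, hss]
    simp only [neg_smul, one_smul, neg_mul, hss]
    module
  · simp only [LinearMap.sub_apply, Module.End.mul_apply, LinearMap.smul_apply, map_sub, map_smul]
    have e2 : vacProj (A n (hOp B (toH γ) (-1) 1 (SUSY.eState γ))) = 0 := by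
      have h1 := hA.odd (toH γ) (-1) n (SUSY.eState γ)
      have h2 : s • hOp B (toH γ) (-1) 1 (A n (SUSY.eState γ)) =
          A n (hOp B (toH γ) (-1) 1 (SUSY.eState γ)) := by
        rw [h1, smul_smul, hss, one_smul]
      rw [← h2, map_smul, vacProj_cre B _ (by norm_num), smul_zero]
    rw [hD.vac, hS.vacProj_apply, hS.eState, e2]
    simp

/-- Translation covariance of the even component. -/
theorem VertexField.comm_sq (hs : B.IsSymm) (hnd : B.Nondegenerate) {S : Module.End ℂ (VQ Q)}
    (hS : IsTranslation B S) {α : Q} {s : ℂ} (hss : s * s = 1) {c : Q → ℂ}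
    {A : ℤ → Module.End ℂ (VQ Q)} (hA : VertexField B α s c A) (n : ℤ) (v : VQ Q) :
    S (S (A n v)) - A n (S (S v)) = ((n + 1 : ℤ) : ℂ) • A (n + 1) v := by
  have hs0 : s ≠ 0 := left_ne_zero_of_mul_eq_one hss
  have h0 := rigidity_family (A := fun n => S * S * A n - A n * (S * S) -
    ((n + 1 : ℤ) : ℂ) • A (n + 1)) hs hnd hs0 (α := α)
    (fun h j n v => ?_) (fun h j n v => ?_) (fun γ n => ?_) n
  · have := DFunLike.congr_fun h0 v
    simpa [sub_eq_zero] using this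
  · simp only [LinearMap.sub_apply, Module.End.mul_apply, LinearMap.smul_apply, map_sub, map_smul]
    have e1 : ∀ x, hOp B h j 0 (S (S x)) = S (S (hOp B h j 0 x)) + (j : ℂ) • hOp B h (j - 1) 0 x :=
      fun x => by rw [hS.sq_hOp]; abel
    rw [e1, hA.even, hA.even, hA.even, hA.even, e1]
    simp only [map_add, map_smul, smul_add, smul_sub]
    rw [show n - (j - 1) = n + 1 - j by ring, show n - j + 1 = n + 1 - j by ring]
    push_cast
    module
  · simp only [LinearMap.sub_apply, Module.End.mul_apply, LinearMap.smul_apply, map_sub, map_smul]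
    have e1 : ∀ x, hOp B h j 1 (S (S x)) = S (S (hOp B h j 1 x)) + (j : ℂ) • hOp B h (j - 1) 1 x :=
      fun x => by rw [hS.sq_hOp]; abel
    rw [e1, hA.odd, hA.odd, hA.odd, hA.odd, e1]
    simp only [map_add, map_smul, smul_add, smul_sub]
    module
  · simp only [LinearMap.sub_apply, Module.End.mul_apply, LinearMap.smul_apply, map_sub, map_smul]
    have h1 := congrArg vacProj (hA.even (toH γ) (-1) n (SUSY.eState γ))
    rw [vacProj_cre B _ (by norm_num), map_add, map_smul, formC_toH, sub_neg_eq_add, hs.eq γ α] at h1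
    rw [hS.vacProj_apply, hS.sq_eState hs, zero_sub]
    rw [hA.vac] at h1 ⊢
    split_ifs at h1 ⊢ with h2
    · rw [← h2] at h1
      rw [neg_eq_of_add_eq_zero_right h1.symm, sub_self]
    · simp only [smul_zero, add_zero] at h1
      rw [← h1]; simp

end Fields

/-! ### The expansions of `(z - w)^N` -/

/-- The coefficient of `z^a w^b`, `b ≥ 0`, in the expansion of `(z - w)^N` for `|z| > |w|`. -/
def expAux (N : ℤ) : ℕ → ℤ → ℂ
  | 0, a => if a = N then 1 else 0
  | b + 1, a => -((a + 1 : ℤ) : ℂ) / (b + 1 : ℂ) * expAux N b (a + 1)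

/-- The coefficient of `z^a w^b` in the expansion of `(z - w)^N` for `|z| > |w|`. -/
def expZW (N a b : ℤ) : ℂ := if 0 ≤ b then expAux N b.toNat a else 0

theorem expZW_of_neg (N a : ℤ) {b : ℤ} (hb : b < 0) : expZW N a b = 0 := if_neg (not_le.mpr hb)

theorem expZW_zero (N a : ℤ) : expZW N a 0 = if a = N then 1 else 0 := by
  simp [expZW, expAux]

theorem expZW_rec (N a b : ℤ) :
    ((b + 1 : ℤ) : ℂ) * expZW N a (b + 1) = -((a + 1 : ℤ) : ℂ) * expZW N (a + 1) b := by
  rcases lt_trichotomy b (-1) with hb | rfl | hb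
  · rw [expZW_of_neg N _ (by omega), expZW_of_neg N _ (by omega)]; simp
  · rw [expZW_of_neg N (a + 1) (by omega)]; simp
  · obtain ⟨k, rfl⟩ := Int.eq_ofNat_of_zero_le (show 0 ≤ b by omega)
    rw [expZW, expZW, if_pos (by omega), if_pos (by omega), show ((k : ℤ) + 1).toNat = k + 1 by omega,
      Int.toNat_natCast, expAux]
    have : (k + 1 : ℂ) ≠ 0 := by exact_mod_cast k.succ_ne_zero
    push_cast
    field_simp

theorem eq_of_rec {M : Type*} [AddCommGroup M] [Module ℂ M] {f g : ℤ → ℤ → M}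
    (hneg : ∀ a b, b < 0 → f a b = g a b) (h0 : ∀ a, f a 0 = g a 0)
    (hf : ∀ a b, 0 ≤ b → ((b + 1 : ℤ) : ℂ) • f a (b + 1) = -((a + 1 : ℤ) : ℂ) • f (a + 1) b)
    (hg : ∀ a b, 0 ≤ b → ((b + 1 : ℤ) : ℂ) • g a (b + 1) = -((a + 1 : ℤ) : ℂ) • g (a + 1) b)
    (a b : ℤ) : f a b = g a b := by
  rcases lt_or_ge b 0 with hb | hb
  · exact hneg a b hb
  · obtain ⟨k, rfl⟩ := Int.eq_ofNat_of_zero_le hb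
    clear hb
    induction k generalizing a with
    | zero => exact h0 a
    | succ k ih =>
      have h1 := hf a k (by omega)
      rw [ih, ← hg a k (by omega)] at h1
      have : (((k : ℤ) + 1 : ℤ) : ℂ) ≠ 0 := by exact_mod_cast k.succ_ne_zero
      exact smul_right_injective _ this h1

theorem expZW_mulSub (N a b : ℤ) : expZW N (a - 1) b - expZW N a (b - 1) = expZW (N + 1) a b := by
  refine eq_of_rec (f := fun a b => expZW N (a - 1) b - expZW N a (b - 1)) (fun a b hb => ?_)
    (fun a => ?_) (fun a b _ => ?_) (fun a b _ => ?_) a b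
  · simp only [expZW_of_neg N _ hb, expZW_of_neg N _ (show b - 1 < 0 by omega),
      expZW_of_neg (N + 1) _ hb, sub_zero]
  · simp only [expZW_zero, expZW_of_neg N _ (show (0 : ℤ) - 1 < 0 by omega), sub_zero]
    congr 1
    simp only [eq_iff_iff]; omega
  · have h1 := expZW_rec N (a - 1) b
    have h2 := expZW_rec N a (b - 1)
    simp only [sub_add_cancel] at h1 h2
    simp only [smul_eq_mul, add_sub_cancel_right]
    push_cast at h1 h2 ⊢
    linear_combination h1 - h2
  · exact expZW_rec (N + 1) a b

theorem expZW_dw (N a b : ℤ) :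
    ((b + 1 : ℤ) : ℂ) * expZW N a (b + 1) = -(N : ℂ) * expZW (N - 1) a b := by
  refine eq_of_rec (f := fun a b => ((b + 1 : ℤ) : ℂ) * expZW N a (b + 1))
    (g := fun a b => -(N : ℂ) * expZW (N - 1) a b) (fun a b hb => ?_)
    (fun a => ?_) (fun a b _ => ?_) (fun a b _ => ?_) a b
  · rcases eq_or_ne b (-1) with rfl | h
    · simp [expZW_of_neg (N - 1) a (show (-1 : ℤ) < 0 by omega)]
    · simp only [expZW_of_neg _ _ (show b + 1 < 0 by omega), expZW_of_neg _ _ hb, mul_zero]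
  · simp only [expZW_rec, expZW_zero]
    by_cases h : a + 1 = N
    · rw [if_pos h, if_pos (by omega), h]
    · rw [if_neg h, if_neg (by omega)]; simp
  · have h1 := expZW_rec N (a) (b + 1)
    simp only [smul_eq_mul]
    linear_combination ((b + 1 : ℤ) : ℂ) * h1
  · have h1 := expZW_rec (N - 1) a b
    simp only [smul_eq_mul]
    linear_combination (-(N : ℂ)) * h1

theorem expZW_zero_left (a b : ℤ) : expZW 0 a b = if a = 0 ∧ b = 0 then 1 else 0 := by
  refine eq_of_rec (f := expZW 0) (g := fun a b => if a = 0 ∧ b = 0 then 1 else 0)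
    (fun a b hb => ?_) (fun a => ?_) (fun a b _ => expZW_rec 0 a b) (fun a b hb => ?_) a b
  · rw [expZW_of_neg _ _ hb, if_neg (by omega)]
  · rw [expZW_zero]; simp
  · rw [if_neg (by omega)]
    by_cases h : a + 1 = 0
    · rw [h]; simp
    · rw [if_neg (by omega)]; simp

theorem expZW_swap (N : ℕ) (a b : ℤ) : expZW N b a = (-1) ^ N * expZW N a b := by
  induction N generalizing a b with
  | zero =>
    rw [Nat.cast_zero, expZW_zero_left, expZW_zero_left, pow_zero, one_mul]
    congr 1
    simp only [eq_iff_iff]; omega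
  | succ N ih =>
    push_cast
    rw [← expZW_mulSub, ← expZW_mulSub, ih a (b - 1), ih (a - 1) b, pow_succ]
    ring

/-- `i_{z,w} (z-w)^N - i_{w,z} (z-w)^N`. -/
def expDiff (N a b : ℤ) : ℂ := expZW N a b - (-1) ^ N * expZW N b a

theorem neg_one_zpow_add_one (N : ℤ) : (-1 : ℂ) ^ (N + 1) = -(-1) ^ N := by
  rw [zpow_add₀ (by norm_num)]; simp

theorem neg_one_zpow_sub_one (N : ℤ) : (-1 : ℂ) ^ (N - 1) = -(-1) ^ N := by
  rw [zpow_sub₀ (by norm_num)]; simp [div_neg]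

theorem expDiff_mulSub (N a b : ℤ) :
    expDiff N (a - 1) b - expDiff N a (b - 1) = expDiff (N + 1) a b := by
  rw [expDiff, expDiff, expDiff, ← expZW_mulSub, ← expZW_mulSub, neg_one_zpow_add_one]
  ring

theorem expDiff_of_nonneg {N : ℤ} (hN : 0 ≤ N) (a b : ℤ) : expDiff N a b = 0 := by
  obtain ⟨k, rfl⟩ := Int.eq_ofNat_of_zero_le hN
  rw [expDiff, expZW_swap k a b, zpow_natCast, ← mul_assoc, neg_one_pow_mul_self, one_mul, sub_self]

theorem expDiff_dw (N a b : ℤ) :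
    ((b + 1 : ℤ) : ℂ) * expDiff N a (b + 1) = -(N : ℂ) * expDiff (N - 1) a b := by
  have h1 := expZW_dw N a b
  have h2 := expZW_rec N b a
  have h3 := expZW_dw N b a
  rw [expDiff, expDiff, neg_one_zpow_sub_one]
  linear_combination h1 - (-1) ^ N * h2 + (-1) ^ N * h3

theorem expDiff_neg_one (a b : ℤ) : expDiff (-1) a b = if a + b = -1 then 1 else 0 := by
  have key : ∀ a b, expZW (-1) a b = if a + b = -1 ∧ 0 ≤ b then 1 else 0 := by
    refine eq_of_rec (fun a b hb => ?_) (fun a => ?_) (fun a b _ => expZW_rec (-1) a b)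
      (fun a b hb => ?_)
    · rw [expZW_of_neg _ _ hb, if_neg (by omega)]
    · rw [expZW_zero]; simp
    · by_cases h : a + 1 + b = -1
      · rw [if_pos (by omega), if_pos (by omega)]
        have : (a + 1 : ℤ) = -(b + 1) := by omega
        rw [this]; push_cast; ring
      · rw [if_neg (by omega), if_neg (by omega)]; simp
  rw [expDiff, key, key]
  by_cases h : a + b = -1
  · rw [if_pos h]
    rcases lt_or_ge b 0 with hb | hb
    · rw [if_neg (by omega), if_pos (by omega)]; norm_num
    · rw [if_pos (by omega), if_neg (by omega)]; norm_num
  · rw [if_neg h, if_neg (by omega), if_neg (by omega)]; simp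

theorem dw_iterate_expDiff (j : ℕ) (f : BiSeries ℂ) (I)
    (hf : ∀ a b, f (a, b) I = expDiff (-1) a b) (a b : ℤ) :
    (dw^[j] f) (a, b) I = (j.factorial : ℂ) * expDiff (-1 - j) a b := by
  induction j generalizing a b with
  | zero => simp [hf]
  | succ j ih =>
    rw [Function.iterate_succ_apply', dw, ih]
    have h1 := expDiff_dw (-1 - j) a b
    rw [Nat.factorial_succ, show (-1 - ((j + 1 : ℕ) : ℤ)) = -1 - j - 1 by push_cast; ring]
    push_cast at h1 ⊢
    linear_combination (j.factorial : ℂ) * h1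

theorem dw_apply_of_zero (j : ℕ) (f : BiSeries ℂ) (I) (hf : ∀ n, f n I = 0) (n) :
    (dw^[j] f) n I = 0 := by
  induction j generalizing n with
  | zero => exact hf n
  | succ j ih => rw [Function.iterate_succ_apply', dw, ih, mul_zero]

/-- The components of `D_W^(j|1) δ(Z, W)`. -/
theorem DWdiv_delta (j : ℕ) (n : ℤ × ℤ) (I : Fin 2 × Fin 2) : DWdiv j delta n I =
    if I = (0, 0) then expDiff (-1 - j) n.1 n.2
    else if I = (1, 1) then ((n.2 + 1 : ℤ) : ℂ) * expDiff (-1 - j) n.1 (n.2 + 1) else 0 := by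
  obtain ⟨a, b⟩ := n
  have hj : (j.factorial : ℂ) ≠ 0 := by exact_mod_cast j.factorial_ne_zero
  refine forall_fin2_prod (P := fun I => DWdiv j delta (a, b) I =
    if I = (0, 0) then expDiff (-1 - j) a b
    else if I = (1, 1) then ((b + 1 : ℤ) : ℂ) * expDiff (-1 - j) a (b + 1) else 0) ?_ ?_ ?_ ?_ I
  · have h0 := dw_iterate_expDiff j (fun n I => -DW delta n I) (0, 0) (fun a b => by
      rw [expDiff_neg_one]
      simp only [DW, delta]
      split_ifs <;> simp_all) a b
    have h1 : ∀ (j : ℕ) (f : BiSeries ℂ), dw^[j] (fun n I => -f n I) = fun n I => -(dw^[j] f) n I := by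
      intro j f
      induction j with
      | zero => rfl
      | succ j ih => rw [Function.iterate_succ_apply', ih, Function.iterate_succ_apply']; funext n I; simp [dw]
    rw [h1] at h0
    rw [DWdiv, if_pos rfl]
    field_simp
    linear_combination h0
  · rw [DWdiv, dw_apply_of_zero j _ _ (fun n => by simp [DW, delta])]; simp
  · rw [DWdiv, dw_apply_of_zero j _ _ (fun n => by simp [DW, delta, dw])]; simp
  · have h2 : ∀ (j : ℕ) (f : BiSeries ℂ) n, (dw^[j] (DW f)) n (1, 1) = -(dw^[j + 1] f) n (1, 0) := by
      intro j f
      induction j with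
      | zero => intro n; simp [DW]
      | succ j ih =>
        intro n
        rw [Function.iterate_succ_apply' (n := j), dw, ih, Function.iterate_succ_apply' (n := j + 1),
          dw]
        ring
    have h0 := dw_iterate_expDiff (j + 1) delta (1, 0) (fun a b => by
      rw [expDiff_neg_one]; simp [delta]) a b
    have h3 := expDiff_dw (-1 - j) a b
    rw [DWdiv, h2, h0, if_neg (by simp), if_pos rfl, h3, Nat.factorial_succ,
      show (-1 - ((j + 1 : ℕ) : ℤ)) = -1 - j - 1 by push_cast; ring]
    push_cast
    field_simp
    ring

section Products

variable {Q : Type*} [AddCommGroup Q] [Module.Free ℤ Q] [Module.Finite ℤ Q]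
  {B : LinearMap.BilinForm ℤ Q}

/-! ### Operations on families of vertex operators -/

theorem superCoeff_shiftBy {V : Type*} [AddCommGroup V] [Module ℂ V] (J : Fin 2)
    (h : Module.End ℂ V) (m) (f : BiSeries V) :
    superCoeff J h (shiftBy m f) = shiftBy m (superCoeff J h f) := by
  match J with
  | 0 => rfl
  | 1 => rfl

theorem scalarCoeff_shiftBy {V : Type*} [AddCommGroup V] [Module ℂ V] (J : Fin 2)
    (j : ℤ) (a b : ℂ) (m) (f : BiSeries V) :
    scalarCoeff J j a b (shiftBy m f) = shiftBy m (scalarCoeff J j a b f) := by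
  match J with
  | 0 =>
    funext n L
    simp only [shiftBy_apply, scalarCoeff_zero_apply, sub_right_comm n m]
  | 1 =>
    funext n L
    simp only [shiftBy_apply, scalarCoeff_one_apply, sub_right_comm n m]

/-- Multiplication by `z - w`. -/
def mulSubLin {V : Type*} [AddCommGroup V] [Module ℂ V] : BiSeries V →ₗ[ℂ] BiSeries V :=
  shiftBy (1, 0) - shiftBy (0, 1)

theorem mulSubLin_apply {V : Type*} [AddCommGroup V] [Module ℂ V] (f : BiSeries V) :
    mulSubLin f = mulSub f := by
  funext ⟨a, b⟩ L
  simp [mulSubLin, mulSub, shiftBy_apply]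

theorem VertexLike.mulSub {α β : Q} {s : ℂ} {F : VQ Q →ₗ[ℂ] BiSeries (VQ Q)}
    (hF : VertexLike B α β s F) : VertexLike B α β s (mulSubLin ∘ₗ F) where
  modes h j J v := by
    simp only [LinearMap.comp_apply, mulSubLin, LinearMap.sub_apply, map_sub, superCoeff_shiftBy,
      hF.modes, map_add, map_smul, scalarCoeff_shiftBy, smul_sub]
    abel
  parity v := by
    simp only [LinearMap.comp_apply, mulSubLin, LinearMap.sub_apply, map_sub, superCoeff_shiftBy,
      hF.parity, map_smul, smul_sub]

theorem VertexLike.mulSub_iterate {α β : Q} {s : ℂ} {F : VQ Q →ₗ[ℂ] BiSeries (VQ Q)}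
    (hF : VertexLike B α β s F) (M : ℕ) :
    VertexLike B α β s (((mulSubLin : Module.End ℂ (BiSeries (VQ Q))) ^ M) ∘ₗ F) := by
  induction M with
  | zero => rw [pow_zero]; exact hF
  | succ M ih => rw [pow_succ']; exact ih.mulSub

theorem mulSubLin_pow_apply {V : Type*} [AddCommGroup V] [Module ℂ V] (M : ℕ) (f : BiSeries V) :
    ((mulSubLin : Module.End ℂ (BiSeries V)) ^ M) f = mulSub^[M] f := by
  induction M with
  | zero => rfl
  | succ M ih => rw [pow_succ', Module.End.mul_apply, ih, mulSubLin_apply,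
      Function.iterate_succ_apply']

/-- The exchange of the variables `Z` and `W`. -/
def swapLin {V : Type*} [AddCommGroup V] [Module ℂ V] : BiSeries V →ₗ[ℂ] BiSeries V where
  toFun f n L := (-1 : ℂ) ^ ((L.1 : ℕ) * L.2) • f (n.2, n.1) (L.2, L.1)
  map_add' f g := by ext n L; simp
  map_smul' c f := by ext n L; simp [smul_comm c]

theorem swapLin_apply {V : Type*} [AddCommGroup V] [Module ℂ V] (f : BiSeries V) (n L) :
    swapLin f n L = (-1 : ℂ) ^ ((L.1 : ℕ) * L.2) • f (n.2, n.1) (L.2, L.1) := rfl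

theorem VertexLike.swap {α β : Q} {s : ℂ} {F : VQ Q →ₗ[ℂ] BiSeries (VQ Q)}
    (hF : VertexLike B α β s F) : VertexLike B β α s (swapLin ∘ₗ F) where
  modes h j J v := by
    have h0 := hF.modes h j J v
    simp only [LinearMap.comp_apply]
    generalize F v = f at *
    generalize F (hOp B h j J v) = g at *
    funext ⟨m, n⟩ ⟨I, K⟩
    have h1 := congrFun (congrFun h0 (n, m)) (K, I)
    match J with
    | 0 =>
      rw [Pi.add_apply, Pi.add_apply, scalarCoeff_zero_apply, superCoeff_zero_apply, onCoeff_apply,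
        Pi.smul_apply, Pi.smul_apply] at h1 ⊢
      simp only [swapLin_apply, map_smul, h1, Fin.val_zero, pow_zero, one_smul, Prod.mk_sub_mk,
        sub_zero]
      module
    | 1 =>
      rw [Pi.add_apply, Pi.add_apply, scalarCoeff_one_apply, superCoeff_one_apply, twist_apply,
        onCoeff_apply, Pi.smul_apply, Pi.smul_apply] at h1 ⊢
      simp only [swapLin_apply, map_smul] at h1 ⊢
      rw [smul_comm, add_comm (I : ℕ) K, h1]
      clear h1 h0
      fin_cases I <;> fin_cases K <;>
        simp only [Fin.zero_eta, Fin.mk_one, Fin.val_zero, Fin.val_one, zero_ne_one, if_true,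
          if_false, pow_zero, pow_one, one_smul, mul_zero, mul_one, smul_zero, add_zero,
          zero_add, neg_zero, Prod.mk_sub_mk, sub_zero] <;> module
  parity v := by
    have h0 := hF.parity v
    simp only [LinearMap.comp_apply]
    generalize F v = f at *
    generalize F (SUSY.parity B v) = g at *
    funext ⟨m, n⟩ ⟨I, K⟩
    have h1 := congrFun (congrFun h0 (n, m)) (K, I)
    rw [superCoeff_one_apply, twist_apply, onCoeff_apply, Pi.smul_apply, Pi.smul_apply] at h1 ⊢
    simp only [swapLin_apply, map_smul] at h1 ⊢
    rw [smul_comm, add_comm (I : ℕ) K, h1, smul_comm]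

/-! ### Products of two vertex operators -/

theorem parity_pow_gamOp (hs : B.IsSymm) (ε : Q → Q → ℂ) (α : Q) (n : ℤ) (I K : Fin 2) (v : VQ Q) :
    (parity B ^ (K : ℕ)) (gamOp B hs ε α n I ((parity B ^ (K : ℕ)) v)) =
      (((-1 : ℂ) ^ (B α α)) ^ (K : ℕ) * (-1) ^ ((I : ℕ) * K)) • gamOp B hs ε α n I v := by
  match K with
  | 0 => simp
  | 1 => simp [gamOp_parity, parity_parity]

/-- The family `Γ_α(Z) Γ_β(W)`. -/
def prodLin (hs : B.IsSymm) (ε : Q → Q → ℂ) (α β : Q) : VQ Q →ₗ[ℂ] BiSeries (VQ Q) where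
  toFun v n I := (((-1 : ℂ) ^ (B α α)) ^ (I.2 : ℕ) * (-1) ^ ((I.1 : ℕ) * I.2)) •
    gamOp B hs ε α n.1 I.1 (gamOp B hs ε β n.2 I.2 v)
  map_add' v w := by ext n I; simp
  map_smul' c v := by ext n I; simp [smul_comm c]

theorem prodLin_apply (hs : B.IsSymm) (ε : Q → Q → ℂ) (α β : Q) (v : VQ Q) (n I) :
    prodLin hs ε α β v n I = (((-1 : ℂ) ^ (B α α)) ^ (I.2 : ℕ) * (-1) ^ ((I.1 : ℕ) * I.2)) •
      gamOp B hs ε α n.1 I.1 (gamOp B hs ε β n.2 I.2 v) := rfl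

theorem mulZW_Gam (hs : B.IsSymm) (ε : Q → Q → ℂ) (α β : Q) (v : VQ Q) :
    mulZW (parity B) (Gam B ε α) (Gam B ε β) v = prodLin hs ε α β v := by
  funext n I
  exact parity_pow_gamOp hs ε α n.1 I.1 I.2 (gamOp B hs ε β n.2 I.2 v)

theorem mulWZ_Gam (hs : B.IsSymm) (ε : Q → Q → ℂ) (α β : Q) (v : VQ Q) :
    mulWZ (parity B) (Gam B ε α) (Gam B ε β) v = swapLin (prodLin hs ε β α v) := by
  rw [← mulZW_Gam]
  rfl

theorem vertexLike_prodLin (hs : B.IsSymm) (ε : Q → Q → ℂ) (α β : Q) :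
    VertexLike B α β ((-1) ^ (B α α) * (-1) ^ (B β β)) (prodLin hs ε α β) := by
  have hss := neg_one_zpow_mul_self (B α α)
  have hodd : ∀ α h j n (I : Fin 2) v, hOp B h j 1 (gamOp B hs ε α n I v) =
      ((-1 : ℂ) ^ (B α α) * (-1) ^ (I : ℕ)) • gamOp B hs ε α n I (hOp B h j 1 v) +
        (if I = 1 then formC B h (toH α) else 0) • gamOp B hs ε α (n - j) 0 v := by
    intro α h j n I v
    match I with
    | 0 => rw [gamOp_odd_zero]; simp
    | 1 => rw [gamOp_odd_one]; simp
  constructor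
  · intro h j J v
    funext ⟨m, n⟩ ⟨I, K⟩
    match J with
    | 0 =>
      rw [Pi.add_apply, Pi.add_apply, scalarCoeff_zero_apply, superCoeff_zero_apply, onCoeff_apply,
        Pi.smul_apply, Pi.smul_apply]
      simp only [prodLin_apply, map_smul, gamOp_even, map_add, Fin.val_zero, pow_zero, one_smul,
        Prod.mk_sub_mk, sub_zero]
      module
    | 1 =>
      rw [Pi.add_apply, Pi.add_apply, scalarCoeff_one_apply, superCoeff_one_apply, twist_apply,
        onCoeff_apply, Pi.smul_apply, Pi.smul_apply]
      simp only [prodLin_apply, map_smul, hodd, map_add, Prod.mk_sub_mk, sub_zero]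
      generalize (-1 : ℂ) ^ (B α α) = s at *
      generalize (-1 : ℂ) ^ (B β β) = s' at *
      fin_cases I <;> fin_cases K <;>
        simp only [Fin.zero_eta, Fin.mk_one, Fin.val_zero, Fin.val_one, zero_ne_one, if_true,
          if_false, pow_zero, pow_one, one_smul, mul_zero, mul_one, smul_zero, add_zero,
          zero_add, neg_zero, zero_smul]
      · match_scalars <;> ring
      · match_scalars
        · ring
        · linear_combination (-(formC B h (toH β))) * hss
      · match_scalars <;> ring
      · match_scalars
        · ring
        · linear_combination (formC B h (toH β)) * hss
        · ring
  · intro v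
    funext ⟨m, n⟩ ⟨I, K⟩
    rw [superCoeff_one_apply, twist_apply, onCoeff_apply, Pi.smul_apply, Pi.smul_apply]
    simp only [prodLin_apply, map_smul, gamOp_parity, smul_smul]
    congr 1
    have h1 := neg_one_pow_mul_self I
    have h2 := neg_one_pow_mul_self K
    simp only [pow_add]
    linear_combination ((-1 : ℂ) ^ (K : ℕ) * (-1) ^ (K : ℕ) * ((-1) ^ (B α α)) ^ (K : ℕ) *
      (-1) ^ ((I : ℕ) * K) * (-1) ^ (B α α) * (-1) ^ (B β β)) * h1 +
      (((-1) ^ (B α α)) ^ (K : ℕ) *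
      (-1) ^ ((I : ℕ) * K) * (-1) ^ (B α α) * (-1) ^ (B β β)) * h2

theorem vacProj_gamOp_gamOp_rec (hs : B.IsSymm) (hnd : B.Nondegenerate) (ε : Q → Q → ℂ)
    (α β γ : Q) (m n : ℤ) :
    ((n + 1 - B β γ : ℤ) : ℂ) •
        vacProj (gamOp B hs ε α m 0 (gamOp B hs ε β (n + 1) 0 (eState γ))) =
      -((m + 1 - B α γ : ℤ) : ℂ) •
        vacProj (gamOp B hs ε α (m + 1) 0 (gamOp B hs ε β n 0 (eState γ))) := by
  obtain ⟨S, h1, h2, h3⟩ := exists_translation B hs hnd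
  have hS : IsTranslation B S := ⟨h1, h2, h3⟩
  have hT := fun α => (vertexField_gamOp B hs ε α).comm_sq hs hnd hS (neg_one_zpow_mul_self (B α α))
  have e1 := hT α m (gamOp B hs ε β n 0 (eState γ))
  have e2 := hT β n (eState γ)
  rw [hS.sq_eState hs] at e2
  have e3 := gamOp_even B hs ε β (toH γ) (-1) n 0 (eState γ)
  have e4 := gamOp_even B hs ε α (toH γ) (-1) m 0 (gamOp B hs ε β n 0 (eState γ))
  rw [formC_toH, sub_neg_eq_add] at e3 e4
  have e5 := congrArg vacProj e4
  rw [vacProj_cre B _ (by norm_num), e3] at e5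
  have e6 := congrArg vacProj e1
  simp only [map_sub, map_add, map_smul, hS.vacProj_apply] at e5 e6
  have e7 : S (S (gamOp B hs ε β n 0 (eState γ))) = ((n + 1 : ℤ) : ℂ) • gamOp B hs ε β (n + 1) 0
      (eState γ) + gamOp B hs ε β n 0 (hOp B (toH γ) (-1) 0 (eState γ)) := by
    rw [← e2]; abel
  rw [e7] at e6
  simp only [map_add, map_smul] at e6
  rw [hs.eq γ α, hs.eq γ β] at e5
  push_cast at *
  generalize vacProj (gamOp B hs ε α (m + 1) 0 (gamOp B hs ε β n 0 (eState γ))) = x at *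
  generalize vacProj (gamOp B hs ε α m 0 (gamOp B hs ε β (n + 1) 0 (eState γ))) = y at *
  generalize vacProj (gamOp B hs ε α m 0 (gamOp B hs ε β n 0 (hOp B (toH γ) (-1) 0 (eState γ)))) = z
    at *
  linear_combination (norm := module) e5 - e6

theorem vacProj_gamOp_gamOp (hs : B.IsSymm) (hnd : B.Nondegenerate) (ε : Q → Q → ℂ)
    (α β γ : Q) (m n : ℤ) :
    vacProj (gamOp B hs ε α m 0 (gamOp B hs ε β n 0 (eState γ))) =
      (ε β γ * ε α (β + γ) * expZW (B α β) (m - B α γ) (n - B β γ)) •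
        Finsupp.single (α + (β + γ)) 1 := by
  have h1 := eq_of_rec
    (f := fun a b => vacProj (gamOp B hs ε α (a + B α γ) 0 (gamOp B hs ε β (b + B β γ) 0 (eState γ))))
    (g := fun a b => (ε β γ * ε α (β + γ) * expZW (B α β) a b) •
        Finsupp.single (α + (β + γ)) (1 : ℂ)) (fun a b hb => ?_) (fun a => ?_) (fun a b _ => ?_)
    (fun a b _ => ?_) (m - B α γ) (n - B β γ)
  · simpa using h1
  · simp only [expZW_of_neg _ _ hb]
    rw [(vertexField_gamOp B hs ε β).apply_eState_of_lt hs hnd γ (by omega)]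
    simp
  · simp only [zero_add, expZW_zero]
    rw [(vertexField_gamOp B hs ε β).apply_eState_self hs hnd γ, map_smul, map_smul,
      (vertexField_gamOp B hs ε α).vac, map_add]
    by_cases h : a = B α β
    · rw [if_pos (by omega), if_pos h, smul_smul, mul_one]
    · rw [if_neg (by omega), if_neg h]; simp
  · have h2 := vacProj_gamOp_gamOp_rec hs hnd ε α β γ (a + B α γ) (b + B β γ)
    rw [show b + B β γ + 1 - B β γ = b + 1 by ring, show a + B α γ + 1 - B α γ = a + 1 by ring,
      show b + B β γ + 1 = b + 1 + B β γ by ring, show a + B α γ + 1 = a + 1 + B α γ by ring] at h2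
    exact h2
  · have := expZW_rec (B α β) a b
    rw [smul_smul, smul_smul]
    congr 1
    linear_combination (ε β γ * ε α (β + γ)) * this

theorem vacProj_gamOp_one_one (hs : B.IsSymm) (hnd : B.Nondegenerate) (ε : Q → Q → ℂ)
    (α β γ : Q) (m n : ℤ) :
    vacProj (gamOp B hs ε α m 1 (gamOp B hs ε β n 1 (eState γ))) =
      ((-1) ^ (B α α) * ((m + 1 - B α γ : ℤ) : ℂ)) •
        vacProj (gamOp B hs ε α (m + 1) 0 (gamOp B hs ε β n 0 (eState γ))) := by
  obtain ⟨S, h1, h2, h3⟩ := exists_translation B hs hnd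
  have hS : IsTranslation B S := ⟨h1, h2, h3⟩
  have hss := neg_one_zpow_mul_self (B α α)
  have hss' := neg_one_zpow_mul_self (B β β)
  have hD := fun α => (vertexPair_gamOp B hs ε α).eq_comm hs hnd hS (neg_one_zpow_mul_self (B α α))
    (vertexField_gamOp B hs ε α)
  have hT := fun α => (vertexField_gamOp B hs ε α).comm_sq hs hnd hS (neg_one_zpow_mul_self (B α α))
  have e1 : ∀ x, S (gamOp B hs ε α m 1 x) + (-1 : ℂ) ^ (B α α) • gamOp B hs ε α m 1 (S x) =
      ((m + 1 : ℤ) : ℂ) • gamOp B hs ε α (m + 1) 0 x := fun x => by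
    rw [← hT α m x, hD α m x, hD α m (S x), map_sub, map_smul, smul_sub, smul_smul, hss, one_smul]
    abel
  have e2 := congrArg vacProj (e1 (gamOp B hs ε β n 0 (eState γ)))
  simp only [map_add, map_smul, hS.vacProj_apply, zero_add] at e2
  have e3 := congrArg vacProj (gamOp_odd_one B hs ε α (toH γ) (-1) m
    (gamOp B hs ε β n 0 (eState γ)))
  rw [vacProj_cre B _ (by norm_num), gamOp_odd_zero, formC_toH, sub_neg_eq_add, hs.eq γ α] at e3
  simp only [map_add, map_smul, map_neg] at e3
  rw [hD β n, map_sub, map_smul, map_sub, map_smul, hS.eState]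
  generalize (-1 : ℂ) ^ (B α α) = s at *
  generalize (-1 : ℂ) ^ (B β β) = s' at *
  generalize vacProj (gamOp B hs ε α (m + 1) 0 (gamOp B hs ε β n 0 (eState γ))) = x at *
  generalize vacProj (gamOp B hs ε α m 1 (S (gamOp B hs ε β n 0 (eState γ)))) = y at *
  generalize vacProj (gamOp B hs ε α m 1 (gamOp B hs ε β n 0 (hOp B (toH γ) (-1) 1 (eState γ)))) = z
    at *
  have e4 : y = s • ((m + 1 : ℤ) : ℂ) • x := by rw [← e2, smul_smul, hss, one_smul]
  have e5 : s' • z = s • ((B α γ : ℤ) : ℂ) • x := by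
    have : s • s' • z = ((B α γ : ℤ) : ℂ) • x := by
      rw [eq_comm, neg_add_eq_zero] at e3; exact e3
    rw [← this, smul_smul, hss, one_smul]
  rw [e4, e5]
  push_cast
  module

/-- The scalar factor of `Γ_α(Z) Γ_β(W)` on `e^γ`. -/
theorem vacProj_prodLin (hs : B.IsSymm) (hnd : B.Nondegenerate) (ε : Q → Q → ℂ)
    (α β γ : Q) (n : ℤ × ℤ) (L : Fin 2 × Fin 2) :
    vacProj (prodLin hs ε α β (eState γ) n L) =
      (ε β γ * ε α (β + γ) * (if L = (0, 0) then expZW (B α β) (n.1 - B α γ) (n.2 - B β γ)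
        else if L = (1, 1) then ((n.2 - B β γ + 1 : ℤ) : ℂ) *
          expZW (B α β) (n.1 - B α γ) (n.2 - B β γ + 1) else 0)) •
        Finsupp.single (α + (β + γ)) 1 := by
  have hv := vertexLike_prodLin hs ε α β
  rw [← neg_one_zpow_form_add B hs] at hv
  obtain ⟨m, n⟩ := n
  obtain ⟨I, K⟩ := L
  fin_cases I <;> fin_cases K
  · simp [prodLin_apply, vacProj_gamOp_gamOp hs hnd]
  · exact (hv.vacProj_odd hs hnd γ _ (0, 1) (by norm_num)).trans (by simp)
  · exact (hv.vacProj_odd hs hnd γ _ (1, 0) (by norm_num)).trans (by simp)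
  · have hss := neg_one_zpow_mul_self (B α α)
    have h1 := expZW_rec (B α β) (m - B α γ) (n - B β γ)
    simp only [Fin.mk_one, prodLin_apply, map_smul, vacProj_gamOp_one_one hs hnd,
      vacProj_gamOp_gamOp hs hnd, smul_smul, Fin.val_one, pow_one, mul_one]
    rw [if_neg (by simp), if_pos trivial, h1, show m + 1 - B α γ = m - B α γ + 1 by ring]
    congr 1
    linear_combination (-(((m - B α γ + 1 : ℤ) : ℂ) * (ε β γ * ε α (β + γ) *
      expZW (B α β) (m - B α γ + 1) (n - B β γ)))) * hss

end Products

section ScalarMul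

variable {Q : Type*} [AddCommGroup Q] {B : LinearMap.BilinForm ℤ Q}

/-- Distributions bounded below. -/
def belowClass (V : Type*) [AddCommGroup V] [Module ℂ V] : Submodule ℂ (BiSeries V) :=
  bddClass ⟨fun _ => ⊤, fun _ _ _ => le_rfl⟩

theorem mem_belowClass {V : Type*} [AddCommGroup V] [Module ℂ V] {f : BiSeries V} {c : ℤ}
    (h : ∀ n L, f n L ≠ 0 → c ≤ n.1 ∧ c ≤ n.2) : f ∈ belowClass V :=
  ⟨c.natAbs, fun _ _ => trivial, fun n L h0 => by have := h n L h0; omega⟩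

theorem summable_smul_one {V : Type*} [AddCommGroup V] [Module ℂ V] {d : ℤ × ℤ → ℂ} {t : ℤ}
    (hd : ∀ k, d k ≠ 0 → k.1 + k.2 = t) {f : BiSeries V} (hf : f ∈ belowClass V) :
    Summable (fun k => d k • (1 : Module.End ℂ V)) f := by
  obtain ⟨c, -, hc⟩ := hf
  intro n L
  refine (Set.finite_Icc ((t - n.2 - c, t - n.1 - c) : ℤ × ℤ) (n.1 + c, n.2 + c)).subset
    fun k hk => ?_
  have h1 : d k ≠ 0 := fun h0 => hk (by simp [h0])
  have h2 : f (n - k) L ≠ 0 := fun h0 => hk (by simp [h0])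
  have h3 := hd k h1
  have h4 := hc _ _ h2
  simp only [Prod.fst_sub, Prod.snd_sub] at h4
  constructor <;> constructor <;> simp only <;> omega

/-- Multiplication by the scalar distribution `d(z,w)`. -/
def smulConv {V : Type*} [AddCommGroup V] [Module ℂ V] (d : ℤ × ℤ → ℂ) :
    BiSeries V → BiSeries V := convAct fun k => d k • (1 : Module.End ℂ V)

theorem linOn_smulConv {V : Type*} [AddCommGroup V] [Module ℂ V] {d : ℤ × ℤ → ℂ} {t : ℤ}
    (hd : ∀ k, d k ≠ 0 → k.1 + k.2 = t) : LinOn (belowClass V) ⊤ (smulConv d) :=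
  linOn_convAct (fun _ hf => summable_smul_one hd hf) fun _ _ => trivial

theorem good_belowClass : Good B (belowClass (VQ Q)) :=
  ⟨stable_bddClass _, fun _ _ _ => onCoeff_mem_bddClass 0 fun _ _ _ => trivial,
    onCoeff_mem_bddClass 0 fun _ _ _ => trivial⟩

theorem VertexLike.smulConv {α β : Q} {s : ℂ} {F : VQ Q →ₗ[ℂ] BiSeries (VQ Q)}
    (hF : VertexLike B α β s F) (hb : ∀ v, F v ∈ belowClass (VQ Q)) {d : ℤ × ℤ → ℂ} {t : ℤ}
    (hd : ∀ k, d k ≠ 0 → k.1 + k.2 = t) {G : VQ Q →ₗ[ℂ] BiSeries (VQ Q)}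
    (hG : ∀ v, G v = SUSY.smulConv d (F v)) : VertexLike B α β s G where
  modes h j J v := by
    have hl := linOn_smulConv (V := VQ Q) hd
    have hg := good_belowClass (Q := Q) (B := B)
    have h1 : superCoeff J (hOp B h j J) (SUSY.smulConv d (F v)) = _ :=
      superCoeff_convAct (summable_smul_one hd (hb v))
        (summable_smul_one hd (hg.modes h j J _ (hb v))) (fun k v => by simp) J
    rw [hG, hG, h1, hF.modes]
    change SUSY.smulConv d _ = _
    rw [hl.add _ (Submodule.smul_mem _ _ (hb _)) _ (scalarCoeff_mem hg.stable _ _ _ _ (hb v)),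
      hl.smul _ _ (hb _), hl.scalarCoeff hg.stable _ _ _ _ (hb v)]
  parity v := by
    have hl := linOn_smulConv (V := VQ Q) hd
    have hg := good_belowClass (Q := Q) (B := B)
    have h1 : superCoeff 1 (SUSY.parity B) (SUSY.smulConv d (F v)) = _ :=
      superCoeff_convAct (summable_smul_one hd (hb v))
        (summable_smul_one hd (hg.parity _ (hb v))) (fun k v => by simp) 1
    rw [hG, hG, h1, hF.parity]
    change SUSY.smulConv d _ = _
    rw [hl.smul _ _ (hb _)]

/-- Multiplication by `θζ`. -/
def thetaZeta {V : Type*} [AddCommGroup V] [Module ℂ V] : BiSeries V →ₗ[ℂ] BiSeries V :=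
  mulTheta ∘ₗ mulZeta

theorem thetaZeta_apply {V : Type*} [AddCommGroup V] [Module ℂ V] (f : BiSeries V) (n L) :
    thetaZeta f n L = if L = (1, 1) then f n (0, 0) else 0 := by
  refine forall_fin2_prod (P := fun L => thetaZeta f n L = if L = (1, 1) then f n (0, 0) else 0)
    ?_ ?_ ?_ ?_ L <;> simp [thetaZeta, mulTheta_apply, mulZeta_apply]

theorem VertexLike.thetaZeta {α β : Q} {s : ℂ} {F : VQ Q →ₗ[ℂ] BiSeries (VQ Q)}
    (hF : VertexLike B α β s F) : VertexLike B α β s (SUSY.thetaZeta ∘ₗ F) where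
  modes h j J v := by
    have h0 := hF.modes h j J v
    simp only [LinearMap.comp_apply]
    generalize F v = f at *
    generalize F (hOp B h j J v) = g at *
    funext n L
    have h1 := congrFun (congrFun h0 n) (0, 0)
    rw [Pi.add_apply, Pi.add_apply, Pi.smul_apply, Pi.smul_apply] at h1 ⊢
    match J with
    | 0 =>
      rw [scalarCoeff_zero_apply, superCoeff_zero_apply, onCoeff_apply] at h1 ⊢
      simp only [thetaZeta_apply]
      split_ifs
      · exact h1
      · simp
    | 1 =>
      rw [scalarCoeff_one_apply, superCoeff_one_apply, twist_apply, onCoeff_apply] at h1 ⊢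
      simp only [thetaZeta_apply]
      by_cases hL : L = (1, 1)
      · subst hL
        simpa using h1
      · simp [hL]
  parity v := by
    have h0 := hF.parity v
    simp only [LinearMap.comp_apply]
    generalize F v = f at *
    generalize F (SUSY.parity B v) = g at *
    funext n L
    have h1 := congrFun (congrFun h0 n) (0, 0)
    rw [superCoeff_one_apply, twist_apply, onCoeff_apply, Pi.smul_apply, Pi.smul_apply] at h1 ⊢
    simp only [thetaZeta_apply]
    split_ifs with hL
    · simp only [Fin.val_zero, add_zero, pow_zero, one_smul] at h1
      rw [hL, h1]
      simp
    · simp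

theorem VertexLike.add {α β : Q} {s : ℂ} {F G : VQ Q →ₗ[ℂ] BiSeries (VQ Q)}
    (hF : VertexLike B α β s F) (hG : VertexLike B α β s G) : VertexLike B α β s (F + G) where
  modes h j J v := by
    simp only [LinearMap.add_apply, map_add, hF.modes, hG.modes, smul_add]; abel
  parity v := by simp only [LinearMap.add_apply, map_add, hF.parity, hG.parity, smul_add]

theorem act_scalarOp (d : BiSeries ℂ) (h10 : ∀ n, d n (1, 0) = 0) (h01 : ∀ n, d n (0, 1) = 0)
    (f : BiSeries (VQ Q)) : act (parity B) (scalarOp d) f =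
      smulConv (d · (0, 0)) f + thetaZeta (smulConv (d · (1, 1)) f) := by
  have hσ : ∀ (m : ℕ) (x : VQ Q), (parity B ^ m) ((parity B ^ m) x) = x := by
    intro m x
    rw [← Module.End.mul_apply, ← pow_add, ← two_mul, pow_mul, pow_two, parity_mul_self, one_pow]
    rfl
  have key : ∀ (m : ℕ) (c : ℂ) (x : VQ Q), (parity B ^ m * (c • 1) * parity B ^ m) x = c • x := by
    intro m c x
    simp [Module.End.mul_apply, hσ]
  funext n L
  simp only [act, scalarOp, key, Pi.add_apply, smulConv, convAct, thetaZeta_apply,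
    LinearMap.smul_apply, Module.End.one_apply]
  have i00 : Finset.Iic ((0, 0) : Fin 2 × Fin 2) = {(0, 0)} := by decide
  have i10 : Finset.Iic ((1, 0) : Fin 2 × Fin 2) = {(0, 0), (1, 0)} := by decide
  have i01 : Finset.Iic ((0, 1) : Fin 2 × Fin 2) = {(0, 0), (0, 1)} := by decide
  have i11 : Finset.Iic ((1, 1) : Fin 2 × Fin 2) = {(0, 0), (1, 0), (0, 1), (1, 1)} := by decide
  obtain ⟨I, K⟩ := L
  fin_cases I <;> fin_cases K <;> simp [i00, i10, i01, i11, h10, h01] <;> rfl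

theorem vacProj_smulConv {d : ℤ × ℤ → ℂ} {t : ℤ} (hd : ∀ k, d k ≠ 0 → k.1 + k.2 = t)
    {f : BiSeries (VQ Q)} (hf : f ∈ belowClass (VQ Q)) {m : ℤ × ℤ} {x : Q →₀ ℂ}
    (h : ∀ n L, vacProj (f n L) = if n = m ∧ L = 0 then x else 0) (n L) :
    vacProj (smulConv d f n L) = if L = 0 then d (n - m) • x else 0 := by
  rw [smulConv, convAct, map_finsum _ (summable_smul_one hd hf n L), finsum_eq_single _ (n - m)]
  · simp only [LinearMap.smul_apply, Module.End.one_apply, map_smul, sub_sub_cancel, h, true_and]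
    split_ifs <;> simp
  · intro k hk
    simp only [LinearMap.smul_apply, Module.End.one_apply, map_smul, h]
    rw [if_neg, smul_zero]
    rintro ⟨h1, -⟩
    exact hk (by rw [← h1]; abel)

end ScalarMul

section Brackets

variable {Q : Type*} [AddCommGroup Q] [Module.Free ℤ Q] [Module.Finite ℤ Q]
  {B : LinearMap.BilinForm ℤ Q}

/-- The family `[Γ_α(Z), Γ_β(W)]`. -/
def bracketLin (hs : B.IsSymm) (ε : Q → Q → ℂ) (α β : Q) : VQ Q →ₗ[ℂ] BiSeries (VQ Q) :=
  prodLin hs ε α β - (-1 : ℂ) ^ (B α α * B β β) • (swapLin ∘ₗ prodLin hs ε β α)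

theorem bracket_Gam (hs : B.IsSymm) (ε : Q → Q → ℂ) (α β : Q) (v : VQ Q) :
    bracket (parity B) (B α α) (B β β) (Gam B ε α) (Gam B ε β) v = bracketLin hs ε α β v := by
  funext n I
  rw [bracket, mulZW_Gam hs, mulWZ_Gam hs]
  rfl

theorem vertexLike_bracketLin (hs : B.IsSymm) (ε : Q → Q → ℂ) (α β : Q) :
    VertexLike B α β ((-1) ^ (B (α + β) (α + β))) (bracketLin hs ε α β) := by
  have h1 := vertexLike_prodLin hs ε α β
  have h2 := (vertexLike_prodLin hs ε β α).swap
  rw [mul_comm] at h2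
  rw [neg_one_zpow_form_add B hs]
  exact h1.sub (h2.smul _)

variable {ε : Q → Q → ℂˣ}

/-- The scalar factor of `[Γ_α(Z), Γ_β(W)]` on `e^γ`. -/
theorem vacProj_bracketLin (hs : B.IsSymm) (hnd : B.Nondegenerate) (hε : IsTwoCocycle ε)
    (α β γ : Q) (n : ℤ × ℤ) (L : Fin 2 × Fin 2) :
    vacProj (bracketLin hs (val ε) α β (eState γ) n L) =
      (if L = (0, 0) then
        val ε α β * expZW (B α β) (n.1 - B α γ) (n.2 - B β γ) -
          (-1) ^ (B α α * B β β) * val ε β α * expZW (B α β) (n.2 - B β γ) (n.1 - B α γ)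
      else if L = (1, 1) then ((n.2 - B β γ + 1 : ℤ) : ℂ) *
        (val ε α β * expZW (B α β) (n.1 - B α γ) (n.2 - B β γ + 1) -
          (-1) ^ (B α α * B β β) * val ε β α * expZW (B α β) (n.2 - B β γ + 1) (n.1 - B α γ))
      else 0) • val ε (α + β) γ • Finsupp.single (α + β + γ) (1 : ℂ) := by
  have c1 : val ε β γ * val ε α (β + γ) = val ε α β * val ε (α + β) γ := by
    have := hε α β γ
    simp only [val]
    exact_mod_cast this.symm
  have c2 : val ε α γ * val ε β (α + γ) = val ε β α * val ε (α + β) γ := by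
    have := hε β α γ
    simp only [val]
    rw [add_comm β α] at this
    exact_mod_cast this.symm
  simp only [bracketLin, LinearMap.sub_apply, LinearMap.smul_apply, LinearMap.comp_apply,
    Pi.sub_apply, Pi.smul_apply, map_sub, map_smul, swapLin_apply, vacProj_prodLin hs hnd, c1, c2,
    hs.eq β α, ← add_assoc, add_comm β α, smul_smul, ← sub_smul]
  congr 1
  obtain ⟨m, n⟩ := n
  have h1 := expZW_rec (B α β) (n - B β γ) (m - B α γ)
  obtain ⟨I, K⟩ := L
  fin_cases I <;> fin_cases K
  · simp; ring
  · simp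
  · simp
  · simp at h1 ⊢
    linear_combination ((-1) ^ (B α α * B β β) * val ε β α * val ε (α + β) γ) * h1

theorem SignRule.val_eq {α β : Q} (h : SignRule B ε α β) :
    (-1 : ℂ) ^ (B α α * B β β) * val ε β α = val ε α β * (-1) ^ (B α β) := by
  have h1 : val ε α β = (-1 : ℂ) ^ (B α β + B α α * B β β) * val ε β α := by
    have := congrArg Units.val h
    simpa [val] using this
  rw [h1, zpow_add₀ (by norm_num)]
  linear_combination (-((-1 : ℂ) ^ (B α α * B β β) * val ε β α)) * neg_one_zpow_mul_self (B α β)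

theorem vacProj_bracketLin_of_signRule (hs : B.IsSymm) (hnd : B.Nondegenerate)
    (hε : IsTwoCocycle ε) {α β : Q} (hsr : SignRule B ε α β) (γ : Q) (n : ℤ × ℤ)
    (L : Fin 2 × Fin 2) :
    vacProj (bracketLin hs (val ε) α β (eState γ) n L) =
      (val ε α β * (if L = (0, 0) then expDiff (B α β) (n.1 - B α γ) (n.2 - B β γ)
      else if L = (1, 1) then ((n.2 - B β γ + 1 : ℤ) : ℂ) *
        expDiff (B α β) (n.1 - B α γ) (n.2 - B β γ + 1)
      else 0)) • val ε (α + β) γ • Finsupp.single (α + β + γ) (1 : ℂ) := by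
  rw [vacProj_bracketLin hs hnd hε, hsr.val_eq]
  congr 1
  split_ifs
  · rw [expDiff]; ring
  · rw [expDiff]; ring
  · ring

theorem bracketLin_eq_zero (hs : B.IsSymm) (hnd : B.Nondegenerate)
    (hε : IsTwoCocycle ε) {α β : Q} (hsr : SignRule B ε α β) (hN : 0 ≤ B α β) (v : VQ Q) :
    bracketLin hs (val ε) α β v = 0 := by
  refine (vertexLike_bracketLin hs (val ε) α β).eq_zero hs hnd (zpow_ne_zero _ (by norm_num))
    (fun γ n L => ?_) v
  rw [vacProj_bracketLin_of_signRule hs hnd hε hsr]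
  simp only [expDiff_of_nonneg hN, mul_zero, ite_self, zero_smul]

theorem expDiff_ne_zero_sum {N a b : ℤ} (h : expDiff N a b ≠ 0) : a + b = N := by
  have key : ∀ (k : ℕ) (a b : ℤ), expZW N a k ≠ 0 → a + k = N := by
    intro k
    induction k with
    | zero => intro a _ h; rw [Nat.cast_zero, expZW_zero] at h; simpa using h
    | succ k ih =>
      intro a b h
      have h1 := expZW_rec N a k
      have h2 : expZW N (a + 1) k ≠ 0 := by
        intro h0
        rw [h0, mul_zero, mul_eq_zero] at h1
        rcases h1 with h1 | h1
        · rw [Int.cast_eq_zero] at h1; omega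
        · exact h (by exact_mod_cast h1)
      have := ih (a + 1) b h2
      push_cast
      omega
  have key' : ∀ a b, expZW N a b ≠ 0 → a + b = N := by
    intro a b h
    rcases lt_or_ge b 0 with hb | hb
    · exact absurd (expZW_of_neg N a hb) h
    · obtain ⟨k, rfl⟩ := Int.eq_ofNat_of_zero_le hb
      exact key k a 0 h
  by_contra h0
  refine h ?_
  have h1 : expZW N a b = 0 := by by_contra h2; exact h0 (key' a b h2)
  have h2 : expZW N b a = 0 := by by_contra h2; exact h0 (by rw [add_comm]; exact key' b a h2)
  rw [expDiff, h1, h2]; simp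

theorem bracketLin_eq_delta (hs : B.IsSymm) (hnd : B.Nondegenerate)
    (hε : IsTwoCocycle ε) {α β : Q} (hsr : SignRule B ε α β) (hN : B α β < 0) (v : VQ Q) :
    bracketLin hs (val ε) α β v = (ε α β : ℂ) • act (parity B)
      (scalarOp (DWdiv (-1 - B α β).toNat delta)) (Gam₂ B (val ε) α β v) := by
  obtain ⟨F, hF, hFv, hFb, hFvac⟩ := exists_gamma₂ B hs (val ε) α β
  have hb : ∀ v, F v ∈ belowClass (VQ Q) := fun v => by
    obtain ⟨c, hc⟩ := hFb v
    exact mem_belowClass hc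
  set D := DWdiv (-1 - B α β).toNat delta with hD
  have hj : (-1 : ℤ) - ((-1 - B α β).toNat : ℤ) = B α β := by omega
  have d00 : ∀ n, D n (0, 0) = expDiff (B α β) n.1 n.2 := fun n => by
    rw [hD, DWdiv_delta, if_pos rfl, hj]
  have d11 : ∀ n, D n (1, 1) = ((n.2 + 1 : ℤ) : ℂ) * expDiff (B α β) n.1 (n.2 + 1) := fun n => by
    rw [hD, DWdiv_delta, if_neg (by simp), if_pos rfl, hj]
  have d10 : ∀ n, D n (1, 0) = 0 := fun n => by
    rw [hD, DWdiv_delta, if_neg (by simp), if_neg (by simp)]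
  have d01 : ∀ n, D n (0, 1) = 0 := fun n => by
    rw [hD, DWdiv_delta, if_neg (by simp), if_neg (by simp)]
  have t00 : ∀ k, D k (0, 0) ≠ 0 → k.1 + k.2 = B α β := fun k hk => by
    rw [d00] at hk; exact expDiff_ne_zero_sum hk
  have t11 : ∀ k, D k (1, 1) ≠ 0 → k.1 + k.2 = B α β - 1 := fun k hk => by
    rw [d11] at hk
    have := expDiff_ne_zero_sum (right_ne_zero_of_mul hk)
    omega
  have l00 := linOn_smulConv (V := VQ Q) t00
  have l11 := linOn_smulConv (V := VQ Q) t11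
  let G₀ : VQ Q →ₗ[ℂ] BiSeries (VQ Q) :=
    { toFun := fun v => smulConv (D · (0, 0)) (F v)
      map_add' := fun v w => by rw [map_add, l00.add _ (hb v) _ (hb w)]
      map_smul' := fun c v => by rw [map_smul, l00.smul c _ (hb v)]; rfl }
  let G₁ : VQ Q →ₗ[ℂ] BiSeries (VQ Q) :=
    { toFun := fun v => smulConv (D · (1, 1)) (F v)
      map_add' := fun v w => by rw [map_add, l11.add _ (hb v) _ (hb w)]
      map_smul' := fun c v => by rw [map_smul, l11.smul c _ (hb v)]; rfl }
  have hG₀ : VertexLike B α β _ G₀ := hFv.smulConv hb t00 fun _ => rfl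
  have hG₁ : VertexLike B α β _ G₁ := hFv.smulConv hb t11 fun _ => rfl
  have hG := (hG₀.add hG₁.thetaZeta).smul (ε α β : ℂ)
  have := (vertexLike_bracketLin hs (val ε) α β).ext hs hnd (zpow_ne_zero _ (by norm_num)) hG
    (fun γ n L => ?_) v
  · rw [this, ← hF, act_scalarOp D d10 d01]
    rfl
  · have e0 : ∀ n L, vacProj (G₀ (eState γ) n L) = _ :=
      vacProj_smulConv t00 (hb _) (hFvac γ)
    have e1 : ∀ n L, vacProj (G₁ (eState γ) n L) = _ :=
      vacProj_smulConv t11 (hb _) (hFvac γ)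
    rw [vacProj_bracketLin_of_signRule hs hnd hε hsr]
    simp only [LinearMap.smul_apply, LinearMap.add_apply, LinearMap.comp_apply, Pi.smul_apply,
      Pi.add_apply, map_smul, map_add, thetaZeta_apply]
    rw [e0, d00, show (ε α β : ℂ) = val ε α β from rfl]
    obtain ⟨m, n⟩ := n
    by_cases h1 : L = (0, 0)
    · subst h1
      rw [if_pos rfl, if_pos (show ((0, 0) : Fin 2 × Fin 2) = 0 from rfl), if_neg (by decide),
        map_zero, add_zero, mul_smul]
      rfl
    · rw [if_neg h1, if_neg (show ¬L = 0 from h1)]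
      by_cases h2 : L = (1, 1)
      · rw [if_pos h2, if_pos h2, e1, d11,
          if_pos (show ((0, 0) : Fin 2 × Fin 2) = 0 from rfl), zero_add, mul_smul]
        rfl
      · rw [if_neg h2, if_neg h2]; simp

theorem mulSub_iterate_apply {V : Type*} [AddCommGroup V] [Module ℂ V] {f : BiSeries V} {L}
    {g : ℤ → ℤ × ℤ → V} (hg : ∀ K n, g K (n.1 - 1, n.2) - g K (n.1, n.2 - 1) = g (K + 1) n)
    {K : ℤ} (hf : ∀ n, f n L = g K n) (M : ℕ) (n) : (mulSub^[M] f) n L = g (K + M) n := by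
  induction M generalizing n with
  | zero => simp [hf]
  | succ M ih =>
    rw [Function.iterate_succ_apply', mulSub, ih, ih, hg]
    push_cast
    rw [add_assoc]

theorem map_mulSub_iterate {V W : Type*} [AddCommGroup V] [Module ℂ V] [AddCommGroup W] [Module ℂ W]
    (φ : V →ₗ[ℂ] W) (f : BiSeries V) (M : ℕ) (n L) :
    φ ((mulSub^[M] f) n L) = (mulSub^[M] fun n L => φ (f n L)) n L := by
  induction M generalizing n with
  | zero => rfl
  | succ M ih =>
    rw [Function.iterate_succ_apply', mulSub, map_sub, ih, ih, Function.iterate_succ_apply', mulSub]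

theorem mulSub_iterate_bracketLin_eq_zero (hs : B.IsSymm) (hnd : B.Nondegenerate)
    (hε : IsTwoCocycle ε) {α β : Q} (hsr : SignRule B ε α β) (v : VQ Q) :
    mulSub^[(B α β).natAbs + 1] (bracketLin hs (val ε) α β v) = 0 := by
  have h := ((vertexLike_bracketLin hs (val ε) α β).mulSub_iterate ((B α β).natAbs + 1)).eq_zero hs
    hnd (zpow_ne_zero _ (by norm_num)) (fun γ n L => ?_) v
  · rwa [LinearMap.comp_apply, mulSubLin_pow_apply] at h
  rw [LinearMap.comp_apply, mulSubLin_pow_apply, map_mulSub_iterate]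
  simp only [vacProj_bracketLin_of_signRule hs hnd hε hsr]
  generalize val ε (α + β) γ • Finsupp.single (α + β + γ) (1 : ℂ) = x
  refine (mulSub_iterate_apply (K := 0) (g := fun K n => (val ε α β *
    (if L = (0, 0) then expDiff (B α β + K) (n.1 - B α γ) (n.2 - B β γ)
      else if L = (1, 1) then -(B α β : ℂ) * expDiff (B α β - 1 + K) (n.1 - B α γ) (n.2 - B β γ)
      else 0)) • x) (fun K n => ?_) (fun n => ?_) _ n).trans ?_
  · rw [← sub_smul, ← mul_sub]
    congr 2
    split_ifs
    · rw [sub_right_comm, sub_right_comm n.2, expDiff_mulSub, add_assoc]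
    · rw [← mul_sub, sub_right_comm, sub_right_comm n.2, expDiff_mulSub, add_assoc]
    · simp
  · simp only [add_zero, expDiff_dw]
  · simp only [zero_add]
    rw [expDiff_of_nonneg (by omega), expDiff_of_nonneg (by omega)]
    simp

theorem signRule_of_mulSub_iterate (hs : B.IsSymm) (hnd : B.Nondegenerate)
    (hε : IsTwoCocycle ε) {α β : Q} {M : ℕ}
    (h : ∀ v n L, (mulSub^[M] (bracketLin hs (val ε) α β v)) n L = 0) : SignRule B ε α β := by
  obtain ⟨M', hM, hM'⟩ : ∃ M' : ℕ, M ≤ M' ∧ 0 ≤ B α β + M' := ⟨M + (B α β).natAbs, by omega,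
    by omega⟩
  have h' : ∀ v n L, (mulSub^[M'] (bracketLin hs (val ε) α β v)) n L = 0 := by
    intro v n L
    obtain ⟨k, rfl⟩ := Nat.exists_eq_add_of_le' hM
    rw [Function.iterate_add_apply, show mulSub^[M] (bracketLin hs (val ε) α β v) = 0 from
      funext fun n => funext fun L => h v n L, ← mulSubLin_pow_apply, map_zero]
    rfl
  obtain ⟨k, hk⟩ := Int.eq_ofNat_of_zero_le hM'
  have h1 := congrArg vacProj (h' (eState 0) ((k : ℤ), 0) (0, 0))
  rw [map_mulSub_iterate, map_zero] at h1
  simp only [vacProj_bracketLin hs hnd hε] at h1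
  rw [mulSub_iterate_apply (K := 0) (g := fun K n => (val ε α β *
    expZW (B α β + K) n.1 n.2 - (-1) ^ K * (-1) ^ (B α α * B β β) * val ε β α *
      expZW (B α β + K) n.2 n.1) • val ε (α + β) 0 • Finsupp.single (α + β + 0) (1 : ℂ))
      (fun K n => ?_) (fun n => ?_)] at h1
  · simp only [zero_add, hk, expZW_zero, expZW_swap k k 0] at h1
    rw [smul_smul, smul_eq_zero] at h1
    have h2 := h1.resolve_right (by simp)
    have h3 := (mul_eq_zero.mp h2).resolve_right (by simp [val])
    simp only [if_true, mul_one] at h3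
    have h4 : (-1 : ℂ) ^ (M' : ℤ) * (-1) ^ k = (-1) ^ (B α β) := by
      have e : B α β = k - M' := by
        have : ((k : ℕ) : ℤ) = Int.ofNat k := rfl
        omega
      rw [e, zpow_sub₀ (by norm_num), zpow_natCast, zpow_natCast, div_eq_mul_inv, ← inv_pow]
      norm_num [mul_comm]
    have h5 : val ε α β = (-1 : ℂ) ^ (B α β + B α α * B β β) * val ε β α := by
      rw [zpow_add₀ (by norm_num), ← h4]
      linear_combination h3
    refine Units.ext ?_
    simpa [val] using h5
  · simp only
    rw [← sub_smul, ← add_assoc, ← expZW_mulSub, ← expZW_mulSub, neg_one_zpow_add_one]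
    congr 1
    ring
  · simp

theorem mutuallyLocal_Gam_iff (hs : B.IsSymm) (hnd : B.Nondegenerate)
    (hε : IsTwoCocycle ε) (α β : Q) : MutuallyLocal (parity B) (B α α) (B β β)
      (Gam B (val ε) α) (Gam B (val ε) β) ↔ SignRule B ε α β := by
  constructor
  · rintro ⟨M, hM⟩
    exact signRule_of_mulSub_iterate hs hnd hε fun v n L => by
      rw [← bracket_Gam]; exact hM v n L
  · intro h
    refine ⟨(B α β).natAbs + 1, fun v n L => ?_⟩
    rw [bracket_Gam hs, mulSub_iterate_bracketLin_eq_zero hs hnd hε h]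
    rfl

theorem bracket_Gam_eq (hs : B.IsSymm) (hnd : B.Nondegenerate) (hε : IsTwoCocycle ε) {α β : Q}
    (h : SignRule B ε α β) (v : VQ Q) :
    bracket (parity B) (B α α) (B β β) (Gam B (val ε) α) (Gam B (val ε) β) v =
      if 0 ≤ B α β then 0 else (ε α β : ℂ) • act (parity B)
        (scalarOp (DWdiv (-1 - B α β).toNat delta)) (Gam₂ B (val ε) α β v) := by
  rw [bracket_Gam hs]
  split_ifs with hN
  · exact bracketLin_eq_zero hs hnd hε h hN v
  · exact bracketLin_eq_delta hs hnd hε h (not_le.mp hN) v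

end Brackets

section Locality

variable {V X Y : Type*} [AddCommGroup V] [Module ℂ V] [AddCommGroup X] [Module ℂ X]
  [AddCommGroup Y] [Module ℂ Y]

variable (X) in
/-- Multiplication by `z - w` on distributions in two even variables. -/
def subZW : Module.End ℂ (ℤ → ℤ → X) where
  toFun f m n := f (m - 1) n - f m (n - 1)
  map_add' f g := by funext m n; simp only [Pi.add_apply]; abel
  map_smul' c f := by funext m n; simp only [Pi.smul_apply, smul_sub, RingHom.id_apply]

theorem subZW_apply (f : ℤ → ℤ → X) (m n : ℤ) : subZW X f m n = f (m - 1) n - f m (n - 1) := rfl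

theorem subZW_pow_map (φ : X →ₗ[ℂ] Y) (f : ℤ → ℤ → X) (N : ℕ) :
    (subZW Y ^ N) (fun m n => φ (f m n)) = fun m n => φ ((subZW X ^ N) f m n) := by
  induction N with
  | zero => rfl
  | succ N ih =>
    rw [pow_succ', pow_succ', Module.End.mul_apply, ih]
    funext m n
    simp only [Module.End.mul_apply, subZW_apply, map_sub]

theorem subZW_pow_swap (f : ℤ → ℤ → X) (N : ℕ) (m n : ℤ) :
    (subZW X ^ N) (fun m n => f n m) m n = (-1 : ℂ) ^ N • (subZW X ^ N) f n m := by
  induction N generalizing m n with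
  | zero => simp
  | succ N ih =>
    rw [pow_succ', pow_succ', Module.End.mul_apply, Module.End.mul_apply, subZW_apply, ih, ih,
      subZW_apply, mul_smul, neg_one_smul, smul_sub, neg_sub]

theorem subZW_pow_shift (f : ℤ → ℤ → X) (N : ℕ) (k : ℤ) :
    (subZW X ^ N) (fun m n => f (m + k) n) = fun m n => (subZW X ^ N) f (m + k) n := by
  induction N with
  | zero => rfl
  | succ N ih =>
    rw [pow_succ', Module.End.mul_apply, ih]
    funext m n
    simp only [Module.End.mul_apply, subZW_apply]
    rw [show m - 1 + k = m + k - 1 by ring]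

theorem subZW_pow_eq_zero_mono {f : ℤ → ℤ → X} {N N' : ℕ} (h : N ≤ N')
    (hf : (subZW X ^ N) f = 0) : (subZW X ^ N') f = 0 := by
  obtain ⟨k, rfl⟩ := Nat.exists_eq_add_of_le h
  rw [add_comm, pow_add, Module.End.mul_apply, hf, map_zero]

theorem eq_zero_of_subZW_pow {f : ℤ → ℤ → X} {N : ℕ} (hf : (subZW X ^ N) f = 0) {n₀ : ℤ}
    (h0 : ∀ m n, n < n₀ → f m n = 0) : f = 0 := by
  induction N with
  | zero => exact hf
  | succ N ih =>
    refine ih ?_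
    rw [pow_succ', Module.End.mul_apply] at hf
    have hlow : ∀ m n, n < n₀ → (subZW X ^ N) f m n = 0 := by
      clear ih hf
      induction N with
      | zero => exact h0
      | succ N ih =>
        intro m n hn
        rw [pow_succ', Module.End.mul_apply, subZW_apply, ih _ _ hn, ih _ _ (by omega), sub_zero]
    generalize (subZW X ^ N) f = g at hf hlow
    have key : ∀ (k : ℕ) m n, n < n₀ + k → g m n = 0 := by
      intro k
      induction k with
      | zero => simpa using hlow
      | succ k ih =>
        intro m n hn
        have h1 := congrFun (congrFun hf (m + 1)) n
        rw [subZW_apply, add_sub_cancel_right, ih (m + 1) (n - 1) (by push_cast at hn; omega),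
          sub_zero] at h1
        exact h1
    funext m n
    exact key (n - n₀ + 1).toNat m n (by omega)

theorem eq_zero_of_subZW_pow' {f : ℤ → ℤ → X} {N : ℕ} (hf : (subZW X ^ N) f = 0) {m₀ : ℤ}
    (h0 : ∀ m n, m < m₀ → f m n = 0) : f = 0 := by
  have h1 : (subZW X ^ N) (fun m n => f n m) = 0 := by
    funext m n
    rw [subZW_pow_swap, hf]
    simp
  have h2 := eq_zero_of_subZW_pow h1 (n₀ := m₀) fun m n hn => h0 n m hn
  funext m n
  exact congrFun (congrFun h2 n) m

theorem subZW_pow_deriv {f : ℤ → ℤ → X} {N : ℕ} (hf : (subZW X ^ N) f = 0) :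
    (subZW X ^ (N + 1)) (fun m n => ((m + 1 : ℤ) : ℂ) • f (m + 1) n) = 0 := by
  induction N generalizing f with
  | zero =>
    have : f = 0 := hf
    subst this
    convert map_zero (subZW X ^ (0 + 1)) using 2
    simp only [Pi.zero_apply, smul_zero]
    rfl
  | succ N ih =>
    rw [pow_succ, Module.End.mul_apply] at hf ⊢
    have h1 := ih hf
    have h2 : subZW X (fun m n => ((m + 1 : ℤ) : ℂ) • f (m + 1) n) =
        (fun m n => ((m + 1 : ℤ) : ℂ) • subZW X f (m + 1) n) - f := by
      funext m n
      simp only [subZW_apply, Pi.sub_apply, sub_add_cancel, add_sub_cancel_right]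
      push_cast
      module
    rw [h2, map_sub, h1, zero_sub, neg_eq_zero, pow_succ, Module.End.mul_apply]
    exact hf

/-- `a(z) b(w) = s b(w) a(z)` up to a power of `z - w`. -/
def Loc (s : ℂ) (a b : ℤ → Module.End ℂ V) : Prop :=
  ∃ N : ℕ, (subZW (Module.End ℂ V) ^ N) (fun m n => a m * b n - s • (b n * a m)) = 0

theorem Loc.add {s : ℂ} {a a' b : ℤ → Module.End ℂ V} (h : Loc s a b) (h' : Loc s a' b) :
    Loc s (a + a') b := by
  obtain ⟨N, hN⟩ := h
  obtain ⟨N', hN'⟩ := h'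
  refine ⟨max N N', ?_⟩
  have h1 := subZW_pow_eq_zero_mono (le_max_left N N') hN
  have h2 := subZW_pow_eq_zero_mono (le_max_right N N') hN'
  rw [← add_zero (0 : ℤ → ℤ → Module.End ℂ V)]
  nth_rw 1 [← h1]
  rw [← h2, ← map_add]
  congr 1
  funext m n
  simp only [Pi.add_apply, add_mul, mul_add, smul_add]
  abel

theorem Loc.smul {s : ℂ} {a b : ℤ → Module.End ℂ V} (h : Loc s a b) (c : ℂ) :
    Loc s (c • a) b := by
  obtain ⟨N, hN⟩ := h
  refine ⟨N, ?_⟩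
  rw [← smul_zero c, ← hN, ← map_smul]
  congr 1
  funext m n
  simp only [Pi.smul_apply, smul_mul_assoc, mul_smul_comm, smul_sub, smul_comm s c]

theorem Loc.neg {s : ℂ} {a b : ℤ → Module.End ℂ V} (h : Loc s a b) : Loc s (-a) b := by
  rw [← neg_one_smul ℂ]
  exact h.smul _

theorem Loc.sub {s : ℂ} {a a' b : ℤ → Module.End ℂ V} (h : Loc s a b) (h' : Loc s a' b) :
    Loc s (a - a') b := by
  rw [sub_eq_add_neg]
  exact h.add h'.neg

theorem Loc.zero {s : ℂ} {b : ℤ → Module.End ℂ V} : Loc s (0 : ℤ → Module.End ℂ V) b :=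
  ⟨0, by funext m n; simp⟩

theorem Loc.symm {s : ℂ} (hss : s * s = 1) {a b : ℤ → Module.End ℂ V} (h : Loc s a b) :
    Loc s b a := by
  obtain ⟨N, hN⟩ := h
  refine ⟨N, ?_⟩
  have h1 : (fun m n => b m * a n - s • (a n * b m)) =
      fun m n => ((-s) • LinearMap.id : Module.End ℂ (Module.End ℂ V)) (a n * b m - s • (b m * a n)) := by
    funext m n
    simp only [LinearMap.smul_apply, LinearMap.id_apply, smul_sub, smul_smul, neg_mul, hss]
    simp only [neg_smul, one_smul]
    abel
  rw [h1, subZW_pow_map]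
  funext m n
  rw [subZW_pow_swap (fun m n => a m * b n - s • (b n * a m)), hN]
  simp

theorem Loc.shift {s : ℂ} {a b : ℤ → Module.End ℂ V} (h : Loc s a b) (k : ℤ) :
    Loc s (fun n => a (n + k)) b := by
  obtain ⟨N, hN⟩ := h
  refine ⟨N, ?_⟩
  rw [subZW_pow_shift (fun m n => a m * b n - s • (b n * a m)), hN]
  rfl

/-- The coefficients of `∂_z a(z)`. -/
def derivField (a : ℤ → Module.End ℂ V) : ℤ → Module.End ℂ V :=
  fun n => ((n + 1 : ℤ) : ℂ) • a (n + 1)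

theorem Loc.deriv {s : ℂ} {a b : ℤ → Module.End ℂ V} (h : Loc s a b) :
    Loc s (derivField a) b := by
  obtain ⟨N, hN⟩ := h
  refine ⟨N + 1, ?_⟩
  rw [← subZW_pow_deriv hN]
  congr 1
  funext m n
  simp only [derivField, smul_mul_assoc, mul_smul_comm, smul_sub, smul_comm s]

/-! Distributions in three variables `z, w, u`. -/

variable (X) in
/-- Multiplication by `w - u`. -/
def subWU : Module.End ℂ (ℤ → ℤ → ℤ → X) where
  toFun f m := subZW X (f m)
  map_add' f g := by funext m; simp only [Pi.add_apply, map_add]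
  map_smul' c f := by funext m; simp only [Pi.smul_apply, map_smul, RingHom.id_apply]

variable (X) in
/-- Multiplication by `z - u`. -/
def subZU : Module.End ℂ (ℤ → ℤ → ℤ → X) := subZW (ℤ → X) + subWU X

theorem subWU_apply (f : ℤ → ℤ → ℤ → X) (m n l : ℤ) :
    subWU X f m n l = f m (n - 1) l - f m n (l - 1) := rfl

theorem subZU_apply (f : ℤ → ℤ → ℤ → X) (m n l : ℤ) :
    subZU X f m n l = f (m - 1) n l - f m n (l - 1) := by
  simp only [subZU, LinearMap.add_apply, Pi.add_apply, subWU_apply, subZW_apply, Pi.sub_apply]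
  abel

theorem subWU_pow_apply (f : ℤ → ℤ → ℤ → X) (N : ℕ) (m : ℤ) :
    (subWU X ^ N) f m = (subZW X ^ N) (f m) := by
  induction N with
  | zero => rfl
  | succ N ih =>
    rw [pow_succ', pow_succ', Module.End.mul_apply, Module.End.mul_apply, ← ih]
    rfl

theorem subZU_pow_apply (f : ℤ → ℤ → ℤ → X) (N : ℕ) (m n l : ℤ) :
    (subZU X ^ N) f m n l = (subZW X ^ N) (fun m l => f m n l) m l := by
  induction N generalizing m l with
  | zero => rfl
  | succ N ih =>
    rw [pow_succ', pow_succ', Module.End.mul_apply, Module.End.mul_apply, subZU_apply, ih, ih]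
    rfl

theorem commute_subZW_subWU : Commute (subZW (ℤ → X)) (subWU X) := by
  ext f m n l
  simp only [Module.End.mul_apply, subZW_apply, subWU_apply, Pi.sub_apply]
  abel

theorem commute_subZU_subWU : Commute (subZU X) (subWU X) :=
  commute_subZW_subWU.add_left (Commute.refl _)

theorem sub_pow_apply_eq_zero {E : Type*} [AddCommGroup E] [Module ℂ E] {P R : Module.End ℂ E}
    (hc : Commute P R) {i j : ℕ} {f : E} (hP : (P ^ i) f = 0) (hR : (R ^ j) f = 0) :
    ((R - P) ^ (i + j)) f = 0 := by
  induction h : i + j generalizing i j f with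
  | zero =>
    obtain rfl : i = 0 := by omega
    exact hP
  | succ k ih =>
    match i, j with
    | 0, _ => rw [show f = 0 from hP, map_zero]
    | _, 0 => rw [show f = 0 from hR, map_zero]
    | i + 1, j + 1 =>
      rw [pow_succ, Module.End.mul_apply, LinearMap.sub_apply, map_sub,
        ih (i := i + 1) (j := j) (f := R f) ?_ ?_ (by omega),
        ih (i := i) (j := j + 1) (f := P f) ?_ ?_ (by omega), sub_zero]
      · rw [← Module.End.mul_apply, ← pow_succ]; exact hP
      · rw [← Module.End.mul_apply, ← (hc.pow_right _).eq, Module.End.mul_apply, hR, map_zero]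
      · rw [← Module.End.mul_apply, (hc.pow_left _).eq, Module.End.mul_apply, hP, map_zero]
      · rw [← Module.End.mul_apply, ← pow_succ]; exact hR

theorem subWU_pow_eq_zero {f : ℤ → ℤ → ℤ → X} {M K : ℕ} (h1 : (subZW (ℤ → X) ^ M) f = 0)
    (h2 : (subZU X ^ M * subWU X ^ K) f = 0) : (subWU X ^ (M + M + K)) f = 0 := by
  have hc := commute_subZW_subWU (X := X)
  have he : subWU X = subZU X - subZW (ℤ → X) := by rw [subZU]; abel
  rw [pow_add, Module.End.mul_apply]
  nth_rw 1 [he]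
  refine sub_pow_apply_eq_zero ((Commute.refl _).add_right hc) ?_ h2
  rw [← Module.End.mul_apply, (hc.pow_pow M K).eq, Module.End.mul_apply, h1, map_zero]

/-- The family `[a(z) b(w), c(u)]`. -/
theorem subZU_subWU_comm {a b c : ℤ → Module.End ℂ V} {t r : ℂ} {M K : ℕ}
    (hac : (subZW (Module.End ℂ V) ^ M) (fun m l => a m * c l - t • (c l * a m)) = 0)
    (hbc : (subZW (Module.End ℂ V) ^ K) (fun n l => b n * c l - r • (c l * b n)) = 0) :
    (subZU (Module.End ℂ V) ^ M * subWU (Module.End ℂ V) ^ K)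
      (fun m n l => a m * b n * c l - (t * r) • (c l * (a m * b n))) = 0 ∧
    (subZU (Module.End ℂ V) ^ M * subWU (Module.End ℂ V) ^ K)
      (fun m n l => b n * a m * c l - (t * r) • (c l * (b n * a m))) = 0 := by
  have hcm := (commute_subZU_subWU (X := Module.End ℂ V)).pow_pow M K
  have k1 : ∀ φ : ℤ → Module.End ℂ V →ₗ[ℂ] Module.End ℂ V, (subZU (Module.End ℂ V) ^ M * subWU (Module.End ℂ V) ^ K)
      (fun m n l => φ m (b n * c l - r • (c l * b n))) = 0 := by
    intro φ
    rw [Module.End.mul_apply]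
    convert map_zero (subZU (Module.End ℂ V) ^ M) using 2
    funext m
    rw [subWU_pow_apply, subZW_pow_map, hbc]
    simp
    rfl
  have k2 : ∀ φ : ℤ → Module.End ℂ V →ₗ[ℂ] Module.End ℂ V, (subZU (Module.End ℂ V) ^ M * subWU (Module.End ℂ V) ^ K)
      (fun m n l => φ n (a m * c l - t • (c l * a m))) = 0 := by
    intro φ
    rw [hcm.eq, Module.End.mul_apply]
    convert map_zero (subWU (Module.End ℂ V) ^ K) using 2
    funext m n l
    rw [subZU_pow_apply, subZW_pow_map, hac]
    simp
  constructor
  · have h1 := k1 (fun m => LinearMap.mulLeft ℂ (a m))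
    have h2 := k2 (fun n => r • LinearMap.mulRight ℂ (b n))
    rw [← add_zero (0 : ℤ → ℤ → ℤ → Module.End ℂ V)]
    nth_rw 1 [← h1]
    rw [← h2, ← map_add]
    congr 1
    funext m n l
    simp only [Pi.add_apply, LinearMap.mulLeft_apply, LinearMap.smul_apply, LinearMap.mulRight_apply,
      mul_sub, sub_mul, smul_mul_assoc, mul_smul_comm, smul_sub, smul_smul, mul_assoc, mul_comm r t]
    abel
  · have h1 := k1 (fun m => t • LinearMap.mulRight ℂ (a m))
    have h2 := k2 (fun n => LinearMap.mulLeft ℂ (b n))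
    rw [← add_zero (0 : ℤ → ℤ → ℤ → Module.End ℂ V)]
    nth_rw 1 [← h1]
    rw [← h2, ← map_add]
    congr 1
    funext m n l
    simp only [Pi.add_apply, LinearMap.mulLeft_apply, LinearMap.smul_apply, LinearMap.mulRight_apply,
      mul_sub, sub_mul, smul_mul_assoc, mul_smul_comm, smul_sub, smul_smul, mul_assoc]
    abel

theorem subWU_comm_comm {a b c : ℤ → Module.End ℂ V} {s t r : ℂ} {M K : ℕ}
    (hab : (subZW (Module.End ℂ V) ^ M) (fun m n => a m * b n - s • (b n * a m)) = 0)
    (hac : (subZW (Module.End ℂ V) ^ M) (fun m l => a m * c l - t • (c l * a m)) = 0)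
    (hbc : (subZW (Module.End ℂ V) ^ K) (fun n l => b n * c l - r • (c l * b n)) = 0) :
    (subWU _ ^ (M + M + K)) (fun m n l => (a m * b n - s • (b n * a m)) * c l -
      (t * r) • (c l * (a m * b n - s • (b n * a m)))) = 0 := by
  refine subWU_pow_eq_zero ?_ ?_
  · let φ : Module.End ℂ V →ₗ[ℂ] (ℤ → Module.End ℂ V) :=
      LinearMap.pi fun l => LinearMap.mulRight ℂ (c l) - (t * r) • LinearMap.mulLeft ℂ (c l)
    have := subZW_pow_map φ (fun m n => a m * b n - s • (b n * a m)) M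
    rw [hab] at this
    refine this.trans ?_
    funext m n
    exact map_zero φ
  · obtain ⟨h1, h2⟩ := subZU_subWU_comm hac hbc
    rw [← sub_zero (0 : ℤ → ℤ → ℤ → Module.End ℂ V)]
    nth_rw 1 [← h1]
    rw [← smul_zero (A := ℤ → ℤ → ℤ → Module.End ℂ V) s, ← h2, ← map_smul, ← map_sub]
    congr 1
    funext m n l
    simp only [Pi.sub_apply, Pi.smul_apply, mul_sub, sub_mul, smul_mul_assoc, mul_smul_comm,
      smul_sub, smul_smul, mul_comm s]
    abel

/-- For fixed `m` the field `[a_m, b(w)]` is local with `c(u)` if `a, b, c` are pairwise local. -/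
theorem Loc.comm {a b c : ℤ → Module.End ℂ V} {s t r : ℂ} (hab : Loc s a b) (hac : Loc t a c)
    (hbc : Loc r b c) (m : ℤ) : Loc (t * r) (fun n => a m * b n - s • (b n * a m)) c := by
  obtain ⟨M, hM⟩ := hab
  obtain ⟨M', hM'⟩ := hac
  obtain ⟨K, hK⟩ := hbc
  have := subWU_comm_comm (subZW_pow_eq_zero_mono (le_max_left M M') hM)
    (subZW_pow_eq_zero_mono (le_max_right M M') hM') hK
  have h2 := congrFun this m
  rw [subWU_pow_apply] at h2
  exact ⟨_, h2⟩

end Locality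

section NormalOrder

variable {V X Y : Type*} [AddCommGroup V] [Module ℂ V] [AddCommGroup X] [Module ℂ X]
  [AddCommGroup Y] [Module ℂ Y]

/-- Finiteness of the sums over the antidiagonals `m + n = k`. -/
def DiagFinite (g : ℤ → ℤ → ℤ → X) : Prop :=
  ∀ k l, (Function.support fun m => g m (k - m) l).Finite

/-- The substitution `z = w`. -/
def diagonal (g : ℤ → ℤ → ℤ → X) : ℤ → ℤ → X := fun k l => ∑ᶠ m, g m (k - m) l

theorem DiagFinite.subWU {g : ℤ → ℤ → ℤ → X} (hg : DiagFinite g) :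
    DiagFinite (SUSY.subWU X g) ∧ diagonal (SUSY.subWU X g) = subZW X (diagonal g) := by
  have e : ∀ k l m, SUSY.subWU X g m (k - m) l = g m (k - 1 - m) l - g m (k - m) (l - 1) := by
    intro k l m
    rw [subWU_apply, show k - m - 1 = k - 1 - m by ring]
  constructor
  · intro k l
    simp only [e]
    exact ((hg (k - 1) l).union (hg k (l - 1))).subset (Function.support_sub _ _)
  · funext k l
    simp only [diagonal, e, subZW_apply]
    exact finsum_sub_distrib (hg _ _) (hg _ _)

theorem DiagFinite.subZU {g : ℤ → ℤ → ℤ → X} (hg : DiagFinite g) :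
    DiagFinite (SUSY.subZU X g) ∧ diagonal (SUSY.subZU X g) = subZW X (diagonal g) := by
  have e : ∀ k l m, SUSY.subZU X g m (k - m) l =
      (fun m => g m (k - 1 - m) l) (Equiv.subRight 1 m) - g m (k - m) (l - 1) := by
    intro k l m
    simp only [subZU_apply, Equiv.subRight_apply]
    rw [show k - 1 - (m - 1) = k - m by ring]
  have h1 : ∀ k l, (Function.support fun m =>
      (fun m => g m (k - 1 - m) l) (Equiv.subRight 1 m)).Finite := fun k l =>
    (hg (k - 1) l).preimage (Equiv.subRight (1 : ℤ)).injective.injOn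
  constructor
  · intro k l
    simp only [e]
    exact ((h1 k l).union (hg k (l - 1))).subset (Function.support_sub _ _)
  · funext k l
    simp only [diagonal, e, subZW_apply]
    rw [finsum_sub_distrib (h1 k l) (hg _ _),
      finsum_comp_equiv (Equiv.subRight (1 : ℤ)) (f := fun m => g m (k - 1 - m) l)]

theorem DiagFinite.pow {g : ℤ → ℤ → ℤ → X} (hg : DiagFinite g) (M K : ℕ) :
    diagonal ((SUSY.subZU X ^ M * SUSY.subWU X ^ K) g) = (subZW X ^ (M + K)) (diagonal g) := by
  have h1 : ∀ K, DiagFinite ((SUSY.subWU X ^ K) g) ∧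
      diagonal ((SUSY.subWU X ^ K) g) = (subZW X ^ K) (diagonal g) := by
    intro K
    induction K with
    | zero => exact ⟨hg, rfl⟩
    | succ K ih =>
      rw [pow_succ', pow_succ', Module.End.mul_apply, Module.End.mul_apply, ← ih.2]
      exact ih.1.subWU
  have h2 : ∀ M, DiagFinite ((SUSY.subZU X ^ M * SUSY.subWU X ^ K) g) ∧
      diagonal ((SUSY.subZU X ^ M * SUSY.subWU X ^ K) g) = (subZW X ^ (M + K)) (diagonal g) := by
    intro M
    induction M with
    | zero => simpa using h1 K
    | succ M ih =>
      rw [pow_succ', show M + 1 + K = M + K + 1 by ring, pow_succ', mul_assoc, Module.End.mul_apply,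
        Module.End.mul_apply (subZW X), ← ih.2]
      exact ih.1.subZU
  exact (h2 M).2

theorem subZU_subWU_map (φ : X →ₗ[ℂ] Y) (f : ℤ → ℤ → ℤ → X) (M K : ℕ) :
    (subZU Y ^ M * subWU Y ^ K) (fun m n l => φ (f m n l)) =
      fun m n l => φ ((subZU X ^ M * subWU X ^ K) f m n l) := by
  have h1 : (subWU Y ^ K) (fun m n l => φ (f m n l)) =
      fun m n l => φ ((subWU X ^ K) f m n l) := by
    funext m
    simp only [subWU_pow_apply]
    exact subZW_pow_map φ _ _
  rw [Module.End.mul_apply, h1]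
  funext m n l
  rw [subZU_pow_apply, Module.End.mul_apply, subZU_pow_apply,
    subZW_pow_map φ (fun m l => (subWU X ^ K) f m n l)]

/-- The operators `∑_m N m (k - m)` are defined. -/
def DiagSummable (N : ℤ → ℤ → Module.End ℂ V) : Prop :=
  ∀ v k, (Function.support fun m => N m (k - m) v).Finite

/-- The coefficients of `N(w, w)`. -/
def diagField (N : ℤ → ℤ → Module.End ℂ V) (hN : DiagSummable N) (k : ℤ) : Module.End ℂ V where
  toFun v := ∑ᶠ m, N m (k - m) v
  map_add' v w := by
    simp only [map_add]
    exact finsum_add_distrib (hN v k) (hN w k)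
  map_smul' c v := by
    simp only [map_smul, RingHom.id_apply]
    exact (smul_finsum c _).symm

theorem diagField_apply (N : ℤ → ℤ → Module.End ℂ V) (hN : DiagSummable N) (k : ℤ) (v : V) :
    diagField N hN k v = ∑ᶠ m, N m (k - m) v := rfl

theorem Loc.diagField {N : ℤ → ℤ → Module.End ℂ V} (hN : DiagSummable N)
    {c : ℤ → Module.End ℂ V} {s : ℂ} {M K : ℕ}
    (h : (subZU (Module.End ℂ V) ^ M * subWU (Module.End ℂ V) ^ K)
      (fun m n l => N m n * c l - s • (c l * N m n)) = 0) : Loc s (SUSY.diagField N hN) c := by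
  refine ⟨M + K, ?_⟩
  funext k l
  ext v
  have h1 : ∀ l k, (Function.support fun m => c l (N m (k - m) v)).Finite := fun l k =>
    (hN v k).subset fun m hm h0 => hm (by simp only [h0, map_zero])
  have hg : DiagFinite fun m n l => (N m n * c l - s • (c l * N m n)) v := fun k l =>
    ((hN (c l v) k).union (h1 l k)).subset fun m hm => by
      by_contra h0
      rw [Set.mem_union, not_or, Function.notMem_support, Function.notMem_support] at h0
      exact hm (by simp [h0.1, h0.2])
  have h2 := subZU_subWU_map (LinearMap.applyₗ v)
    (fun m n l => N m n * c l - s • (c l * N m n)) M K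
  rw [h] at h2
  have h3 := hg.pow M K
  rw [show (subZU V ^ M * subWU V ^ K) (fun m n l => (N m n * c l - s • (c l * N m n)) v) = 0 from
    h2.trans (by funext; simp)] at h3
  have h4 := subZW_pow_map (LinearMap.applyₗ v)
    (fun k l => SUSY.diagField N hN k * c l - s • (c l * SUSY.diagField N hN k)) (M + K)
  have h5 : (fun k l => (LinearMap.applyₗ v)
      (SUSY.diagField N hN k * c l - s • (c l * SUSY.diagField N hN k))) =
      diagonal fun m n l => (N m n * c l - s • (c l * N m n)) v := by
    funext k l
    simp only [LinearMap.applyₗ_apply_apply, diagonal, LinearMap.sub_apply, Module.End.mul_apply,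
      LinearMap.smul_apply, diagField_apply]
    rw [finsum_sub_distrib (hN _ _), ← smul_finsum, map_finsum _ (hN v k)]
    exact (h1 l k).subset fun m hm h0 => hm (by simp only [h0, smul_zero])
  rw [h5, ← h3] at h4
  have h6 := congrFun (congrFun h4 k) l
  simp only [LinearMap.applyₗ_apply_apply] at h6
  rw [← h6]
  simp [diagonal]

/-- The coefficients of `a_-(z) b(w) + s b(w) a_+(z)`. -/
def normalFamily (s : ℂ) (a b : ℤ → Module.End ℂ V) (m n : ℤ) : Module.End ℂ V :=
  if 0 ≤ m then a m * b n else s • (b n * a m)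

theorem diagSummable_normalFamily (s : ℂ) {a b : ℤ → Module.End ℂ V}
    (ha : ∀ v, ∃ N : ℤ, ∀ n < N, a n v = 0) (hb : ∀ v, ∃ N : ℤ, ∀ n < N, b n v = 0) :
    DiagSummable (normalFamily s a b) := by
  intro v k
  obtain ⟨N, hN⟩ := ha v
  obtain ⟨N', hN'⟩ := hb v
  refine (Set.finite_Icc (min N 0) (max (k - N') 0)).subset fun m hm => ?_
  rw [Function.mem_support, normalFamily] at hm
  split_ifs at hm with h0
  · have : ¬k - m < N' := fun h => hm (by rw [Module.End.mul_apply, hN' _ h, map_zero])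
    exact ⟨by omega, by omega⟩
  · have : ¬m < N := fun h => hm (by
      rw [LinearMap.smul_apply, Module.End.mul_apply, hN _ h, map_zero, smul_zero])
    exact ⟨by omega, by omega⟩

/-- Dong's lemma for normally ordered products. -/
theorem Loc.normal {a b c : ℤ → Module.End ℂ V} {s t r : ℂ} (hab : Loc s a b) (hac : Loc t a c)
    (hbc : Loc r b c) (hN : DiagSummable (normalFamily s a b)) :
    Loc (t * r) (SUSY.diagField _ hN) c := by
  obtain ⟨M, hM⟩ := hab
  obtain ⟨M', hM'⟩ := hac
  obtain ⟨K, hK⟩ := hbc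
  replace hM := subZW_pow_eq_zero_mono (le_max_left M M') hM
  replace hM' := subZW_pow_eq_zero_mono (le_max_right M M') hM'
  generalize max M M' = L at hM hM'
  have h1 := (subZU_subWU_comm hM' hK).1
  have h2 := subWU_comm_comm hM hM' hK
  refine Loc.diagField hN (M := L) (K := L + L + K) ?_
  have h3 : (subZU (Module.End ℂ V) ^ L * subWU (Module.End ℂ V) ^ (L + L + K))
      (fun m n l => if m < 0 then (a m * b n - s • (b n * a m)) * c l -
        (t * r) • (c l * (a m * b n - s • (b n * a m))) else 0) = 0 := by
    rw [Module.End.mul_apply]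
    convert map_zero (subZU (Module.End ℂ V) ^ L) using 2
    funext m
    rw [subWU_pow_apply]
    by_cases hm : m < 0
    · have := congrFun h2 m
      rw [subWU_pow_apply] at this
      simpa only [hm, if_true] using this
    · simp only [hm, if_false]
      exact map_zero _
  have h4 : (subZU (Module.End ℂ V) ^ L * subWU (Module.End ℂ V) ^ (L + L + K))
      (fun m n l => a m * b n * c l - (t * r) • (c l * (a m * b n))) = 0 := by
    rw [pow_add, ← mul_assoc, ((commute_subZU_subWU (X := Module.End ℂ V)).pow_pow L (L + L)).eq,
      mul_assoc, Module.End.mul_apply, h1, map_zero]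
  rw [← sub_zero (0 : ℤ → ℤ → ℤ → Module.End ℂ V)]
  nth_rw 1 [← h4]
  rw [← h3, ← map_sub]
  congr 1
  funext m n l
  simp only [Pi.sub_apply, normalFamily]
  by_cases hm : m < 0
  · rw [if_pos hm, if_neg (not_le.mpr hm)]
    simp only [mul_sub, sub_mul, smul_mul_assoc, mul_smul_comm, smul_sub]
    abel
  · rw [if_neg hm, if_pos (not_lt.mp hm), sub_zero]

end NormalOrder

section FieldSpace

variable {V : Type*} [AddCommGroup V] [Module ℂ V]

/-- `A(z)` is a translation covariant field of parity `p` which is regular on the vacuum and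
local with the fields in `H` (a set of pairs of a parity and a field). -/
structure FieldIn (σ T : Module.End ℂ V) (vac : V) (H : Set (ℤ × (ℤ → Module.End ℂ V))) (p : ℤ)
    (A : ℤ → Module.End ℂ V) : Prop where
  bdd : ∀ v, ∃ N : ℤ, ∀ n < N, A n v = 0
  parity : ∀ n v, σ (A n v) = (-1 : ℂ) ^ p • A n (σ v)
  vac : ∀ n < 0, A n vac = 0
  transl : ∀ n v, T (A n v) = A n (T v) + ((n + 1 : ℤ) : ℂ) • A (n + 1) v
  loc : ∀ h ∈ H, Loc ((-1) ^ (p * h.1)) A h.2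

variable {σ T : Module.End ℂ V} {vac : V} {H : Set (ℤ × (ℤ → Module.End ℂ V))} {p q : ℤ}
  {A A' : ℤ → Module.End ℂ V}

theorem FieldIn.zero : FieldIn σ T vac H p 0 where
  bdd v := ⟨0, fun _ _ => rfl⟩
  parity n v := by simp
  vac n _ := rfl
  transl n v := by simp
  loc h _ := Loc.zero

theorem FieldIn.add (hA : FieldIn σ T vac H p A) (hA' : FieldIn σ T vac H p A') :
    FieldIn σ T vac H p (A + A') where
  bdd v := by
    obtain ⟨N, hN⟩ := hA.bdd v
    obtain ⟨N', hN'⟩ := hA'.bdd v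
    refine ⟨min N N', fun n hn => ?_⟩
    rw [Pi.add_apply, LinearMap.add_apply, hN n (by omega), hN' n (by omega), add_zero]
  parity n v := by
    simp only [Pi.add_apply, LinearMap.add_apply, map_add, hA.parity, hA'.parity, smul_add]
  vac n hn := by simp only [Pi.add_apply, LinearMap.add_apply, hA.vac n hn, hA'.vac n hn, add_zero]
  transl n v := by
    simp only [Pi.add_apply, LinearMap.add_apply, map_add, hA.transl, hA'.transl, smul_add]
    abel
  loc h hh := (hA.loc h hh).add (hA'.loc h hh)

theorem FieldIn.smul (hA : FieldIn σ T vac H p A) (c : ℂ) : FieldIn σ T vac H p (c • A) where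
  bdd v := by
    obtain ⟨N, hN⟩ := hA.bdd v
    exact ⟨N, fun n hn => by rw [Pi.smul_apply, LinearMap.smul_apply, hN n hn, smul_zero]⟩
  parity n v := by
    simp only [Pi.smul_apply, LinearMap.smul_apply, map_smul, hA.parity, smul_comm c]
  vac n hn := by simp only [Pi.smul_apply, LinearMap.smul_apply, hA.vac n hn, smul_zero]
  transl n v := by
    simp only [Pi.smul_apply, LinearMap.smul_apply, map_smul, hA.transl, smul_add, smul_comm c]
  loc h hh := (hA.loc h hh).smul c

variable (σ T vac H) in
/-- The space of fields of parity `p`. -/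
def fieldSpace (p : ℤ) : Submodule ℂ (ℤ → Module.End ℂ V) where
  carrier := {A | FieldIn σ T vac H p A}
  zero_mem' := FieldIn.zero
  add_mem' := FieldIn.add
  smul_mem' c _ hA := FieldIn.smul hA c

theorem FieldIn.sub (hA : FieldIn σ T vac H p A) (hA' : FieldIn σ T vac H p A') :
    FieldIn σ T vac H p (A - A') :=
  (fieldSpace σ T vac H p).sub_mem hA hA'

theorem neg_one_zpow_congr {p q : ℤ} (h : Even (p - q)) : (-1 : ℂ) ^ p = (-1) ^ q := by
  rw [show p = q + (p - q) by ring, zpow_add₀ (by norm_num), h.neg_one_zpow, mul_one]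

theorem FieldIn.congr (hA : FieldIn σ T vac H p A) (h : Even (p - q)) :
    FieldIn σ T vac H q A where
  bdd := hA.bdd
  parity n v := by rw [hA.parity, neg_one_zpow_congr h]
  vac := hA.vac
  transl := hA.transl
  loc x hx := by
    rw [← neg_one_zpow_congr (p := p * x.1) (by rw [← sub_mul]; exact h.mul_right _)]
    exact hA.loc x hx

theorem FieldIn.deriv (hA : FieldIn σ T vac H p A) : FieldIn σ T vac H p (derivField A) where
  bdd v := by
    obtain ⟨N, hN⟩ := hA.bdd v
    exact ⟨N - 1, fun n hn => by
      rw [derivField, LinearMap.smul_apply, hN _ (by omega), smul_zero]⟩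
  parity n v := by
    simp only [derivField, LinearMap.smul_apply, map_smul, hA.parity, smul_comm ((-1 : ℂ) ^ p)]
  vac n hn := by
    rw [derivField, LinearMap.smul_apply]
    rcases eq_or_ne n (-1) with rfl | h
    · simp
    · rw [hA.vac _ (by omega), smul_zero]
  transl n v := by
    simp only [derivField, LinearMap.smul_apply, map_smul, hA.transl, smul_add]
  loc h hh := (hA.loc h hh).deriv

theorem FieldIn.apply_vac (hT : T vac = 0) (hA : FieldIn σ T vac H p A) (h0 : A 0 vac = 0)
    (n : ℤ) : A n vac = 0 := by
  rcases lt_or_ge n 0 with hn | hn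
  · exact hA.vac n hn
  · lift n to ℕ using hn
    induction n with
    | zero => exact h0
    | succ n ih =>
      have h1 := hA.transl n vac
      rw [ih, hT, map_zero, map_zero, zero_add, eq_comm, smul_eq_zero] at h1
      exact h1.resolve_left (by exact_mod_cast Nat.succ_ne_zero n)

variable (vac H) in
/-- The vacuum generates `V` under the fields in `H`. -/
def Generates : Prop :=
  ∀ K : Submodule ℂ V, vac ∈ K → (∀ h ∈ H, ∀ n : ℤ, 0 ≤ n → ∀ v ∈ K, h.2 n v ∈ K) → K = ⊤

/-- A field which is local with generating fields and kills the vacuum is zero. -/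
theorem eq_zero_of_loc (hgen : Generates vac H)
    (hH : ∀ h ∈ H, ∀ v, ∃ N : ℤ, ∀ n < N, h.2 n v = 0)
    (hA : ∀ h ∈ H, ∃ s, Loc s A h.2) (hvac : ∀ n, A n vac = 0) : A = 0 := by
  have h1 := hgen (⨅ n, LinearMap.ker (A n)) (by simpa using hvac) (fun h hh n _ v hv => ?_)
  · funext n
    ext v
    have : v ∈ ⨅ n, LinearMap.ker (A n) := h1 ▸ Submodule.mem_top
    exact (Submodule.mem_iInf _).mp this n
  · have hv' : ∀ n, A n v = 0 := fun n => (Submodule.mem_iInf _).mp hv n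
    obtain ⟨s, N, hN⟩ := hA h hh
    obtain ⟨n₀, hn₀⟩ := hH h hh v
    have h2 := subZW_pow_map (LinearMap.applyₗ v) (fun m n => A m * h.2 n - s • (h.2 n * A m)) N
    rw [hN] at h2
    have h3 : (subZW V ^ N) (fun m n => A m (h.2 n v)) = 0 := by
      have h5 : (fun m n => A m (h.2 n v)) =
          fun m n => LinearMap.applyₗ v (A m * h.2 n - s • (h.2 n * A m)) := by
        funext m n
        simp [hv']
      rw [h5, h2]
      rfl
    have h4 := eq_zero_of_subZW_pow h3 (n₀ := n₀) fun m n hn => by rw [hn₀ n hn, map_zero]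
    exact (Submodule.mem_iInf _).mpr fun m => congrFun (congrFun h4 m) n

/-- The normally ordered product. -/
theorem FieldIn.normal {a b : ℤ → Module.End ℂ V} (ha : FieldIn σ T vac H q a)
    (hb : FieldIn σ T vac H p b) (hab : Loc ((-1) ^ (q * p)) a b) :
    FieldIn σ T vac H (q + p) (diagField _
      (diagSummable_normalFamily ((-1) ^ (q * p)) ha.bdd hb.bdd)) where
  bdd v := by
    obtain ⟨N, hN⟩ := ha.bdd v
    obtain ⟨N', hN'⟩ := hb.bdd v
    choose L hL using fun m => hb.bdd (a m v)
    obtain ⟨C, hC⟩ := (((Set.finite_Icc N 0).image fun m => L m + m).insert N').bddBelow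
    refine ⟨C, fun k hk => ?_⟩
    rw [diagField_apply]
    refine (finsum_congr fun m => ?_).trans finsum_zero
    rw [normalFamily]
    have hCN : C ≤ N' := hC (Set.mem_insert _ _)
    split_ifs with hm
    · rw [Module.End.mul_apply, hN' _ (by omega), map_zero]
    · rw [LinearMap.smul_apply, Module.End.mul_apply]
      rcases lt_or_ge m N with h | h
      · rw [hN m h, map_zero, smul_zero]
      · have : C ≤ L m + m := hC (Set.mem_insert_of_mem _ ⟨m, ⟨h, by omega⟩, rfl⟩)
        rw [hL m _ (by omega), smul_zero]
  parity n v := by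
    have hd := diagSummable_normalFamily ((-1) ^ (q * p)) ha.bdd hb.bdd v n
    rw [diagField_apply, diagField_apply, map_finsum _ hd, smul_finsum]
    refine finsum_congr fun m => ?_
    rw [normalFamily]
    split_ifs
    · rw [Module.End.mul_apply, Module.End.mul_apply, ha.parity, hb.parity, map_smul, smul_smul,
        zpow_add₀ (by norm_num)]
    · rw [LinearMap.smul_apply, LinearMap.smul_apply, map_smul, Module.End.mul_apply,
        Module.End.mul_apply, hb.parity, ha.parity, map_smul, smul_smul, smul_smul, smul_smul,
        zpow_add₀ (by norm_num)]
      congr 1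
      ring
  vac n hn := by
    rw [diagField_apply]
    refine (finsum_congr fun m => ?_).trans finsum_zero
    rw [normalFamily]
    split_ifs with hm
    · rw [Module.End.mul_apply, hb.vac _ (by omega), map_zero]
    · rw [LinearMap.smul_apply, Module.End.mul_apply, ha.vac _ (by omega), map_zero, smul_zero]
  transl k v := by
    set s : ℂ := (-1) ^ (q * p)
    have hd := diagSummable_normalFamily s ha.bdd hb.bdd
    have key : ∀ m n, T (normalFamily s a b m n v) = normalFamily s a b m n (T v) +
        (((m + 1 : ℤ) : ℂ) • normalFamily s a b (m + 1) n v +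
          ((n + 1 : ℤ) : ℂ) • normalFamily s a b m (n + 1) v) := by
      intro m n
      simp only [normalFamily]
      rcases lt_trichotomy m (-1) with hm | rfl | hm
      · rw [if_neg (by omega), if_neg (by omega), if_neg (by omega)]
        simp only [LinearMap.smul_apply, Module.End.mul_apply, map_smul, hb.transl, ha.transl,
          map_add]
        module
      · simp only [show ¬(0 : ℤ) ≤ -1 by omega, if_false, LinearMap.smul_apply,
          Module.End.mul_apply, map_smul, hb.transl, ha.transl, neg_add_cancel, Int.cast_zero, zero_smul, add_zero, zero_add, smul_add]
        module
      · rw [if_pos (by omega), if_pos (by omega), if_pos (by omega)]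
        simp only [Module.End.mul_apply, map_smul, hb.transl, ha.transl, map_add]
        module
    have hf : ∀ (c : ℤ → ℂ) k, (Function.support fun m =>
        c m • normalFamily s a b m (k - m) v).Finite := fun c k =>
      (hd v k).subset fun m hm h0 => hm (by simp only [h0, smul_zero])
    have e1 : ∀ m, ((m + 1 : ℤ) : ℂ) • normalFamily s a b (m + 1) (k - m) v =
        (fun m : ℤ => (m : ℂ) • normalFamily s a b m (k + 1 - m) v) (Equiv.addRight (1 : ℤ) m) := by
      intro m
      simp only [Equiv.coe_addRight]
      rw [show k + 1 - (m + 1) = k - m by ring]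
    have e2 : ∀ m, ((k - m + 1 : ℤ) : ℂ) • normalFamily s a b m (k - m + 1) v =
        ((k + 1 - m : ℤ) : ℂ) • normalFamily s a b m (k + 1 - m) v := by
      intro m
      rw [show k - m + 1 = k + 1 - m by ring]
    have hf1 : (Function.support fun m =>
        (fun m => ((m : ℤ) : ℂ) • normalFamily s a b m (k + 1 - m) v)
          (Equiv.addRight (1 : ℤ) m)).Finite :=
      (hf (fun m => (m : ℂ)) (k + 1)).preimage (Equiv.addRight (1 : ℤ)).injective.injOn
    have hf2 := hf (fun m => ((k + 1 - m : ℤ) : ℂ)) (k + 1)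
    rw [diagField_apply, diagField_apply, diagField_apply, map_finsum _ (hd v k)]
    simp only [key, e1, e2]
    rw [finsum_add_distrib (hd _ _) ((hf1.union hf2).subset (Function.support_add _ _)),
      finsum_add_distrib hf1 hf2, finsum_comp_equiv (Equiv.addRight (1 : ℤ))
        (f := fun m : ℤ => (m : ℂ) • normalFamily s a b m (k + 1 - m) v),
      ← finsum_add_distrib (hf _ _) hf2, smul_finsum]
    congr 1
    refine finsum_congr fun m => ?_
    rw [← add_smul]
    congr 1
    push_cast
    ring
  loc h hh := by
    have := hab.normal (ha.loc h hh) (hb.loc h hh)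
      (diagSummable_normalFamily ((-1) ^ (q * p)) ha.bdd hb.bdd)
    rwa [← zpow_add₀ (by norm_num), ← add_mul] at this

theorem normal_zero_vac {a b : ℤ → Module.End ℂ V} (ha : FieldIn σ T vac H q a)
    (hb : FieldIn σ T vac H p b) :
    diagField _ (diagSummable_normalFamily ((-1) ^ (q * p)) ha.bdd hb.bdd) 0 vac =
      a 0 (b 0 vac) := by
  rw [diagField_apply, finsum_eq_single _ 0]
  · simp [normalFamily]
  · intro m hm
    rw [normalFamily]
    split_ifs with h
    · rw [Module.End.mul_apply, hb.vac _ (by omega), map_zero]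
    · rw [LinearMap.smul_apply, Module.End.mul_apply, ha.vac _ (by omega), map_zero, smul_zero]

end FieldSpace

section Superfields

variable {V : Type*} [AddCommGroup V] [Module ℂ V] {σ : Module.End ℂ V}

theorem mulSub_iterate_eq_subZW (f : BiSeries V) (N : ℕ) (m n : ℤ) (L : Fin 2 × Fin 2) :
    (mulSub^[N] f) (m, n) L = (subZW V ^ N) (fun m n => f (m, n) L) m n := by
  induction N generalizing m n with
  | zero => rfl
  | succ N ih =>
    rw [Function.iterate_succ_apply', pow_succ', Module.End.mul_apply, mulSub, subZW_apply, ih, ih]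

theorem pow_conj_apply (hσ : σ * σ = 1) {A : Module.End ℂ V} {c : ℂ} (hA : σ * A = c • (A * σ))
    (k : ℕ) (x : V) : (σ ^ k) (A ((σ ^ k) x)) = c ^ k • A x := by
  have h1 : ∀ x, σ (A x) = c • A (σ x) := fun x => DFunLike.congr_fun hA x
  have h2 : ∀ x, σ (σ x) = x := fun x => DFunLike.congr_fun hσ x
  induction k generalizing x with
  | zero => simp
  | succ k ih =>
    have e1 : ∀ y, (σ ^ (k + 1)) y = (σ ^ k) (σ y) := fun y => by
      rw [pow_succ, Module.End.mul_apply]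
    have e2 : (σ ^ (k + 1)) x = σ ((σ ^ k) x) := by rw [pow_succ', Module.End.mul_apply]
    rw [e1, e2, h1, h2, map_smul, ih, smul_smul, pow_succ']

/-- The components of a supercommutator are, up to sign, supercommutators of components. -/
theorem bracket_apply (hσ : σ * σ = 1) {p q : ℤ} {a b : Series (Module.End ℂ V)}
    (ha : ∀ n (I : Fin 2), σ * a n I = (-1 : ℂ) ^ (p + ((I : ℕ) : ℤ)) • (a n I * σ))
    (hb : ∀ n (I : Fin 2), σ * b n I = (-1 : ℂ) ^ (q + ((I : ℕ) : ℤ)) • (b n I * σ)) (v : V)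
    (m n : ℤ) (I K : Fin 2) :
    bracket σ p q (toFuns a) (toFuns b) v (m, n) (I, K) =
      ((-1 : ℂ) ^ (p + ((I : ℕ) : ℤ))) ^ (K : ℕ) • (a m I * b n K -
        (-1 : ℂ) ^ ((p + ((I : ℕ) : ℤ)) * (q + ((K : ℕ) : ℤ))) • (b n K * a m I)) v := by
  have h1 : mulZW σ (toFuns a) (toFuns b) v (m, n) (I, K) =
      ((-1 : ℂ) ^ (p + ((I : ℕ) : ℤ))) ^ (K : ℕ) • a m I (b n K v) :=
    pow_conj_apply hσ (ha m I) K _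
  have h2 : mulWZ σ (toFuns a) (toFuns b) v (m, n) (I, K) = (-1 : ℂ) ^ ((I : ℕ) * (K : ℕ)) •
      ((-1 : ℂ) ^ (q + ((K : ℕ) : ℤ))) ^ (I : ℕ) • b n K (a m I v) :=
    congrArg _ (pow_conj_apply hσ (hb n K) I _)
  rw [bracket, h1, h2, LinearMap.sub_apply, LinearMap.smul_apply, Module.End.mul_apply,
    Module.End.mul_apply, smul_sub, smul_smul, smul_smul, smul_smul]
  congr 2
  simp only [← zpow_natCast, ← zpow_mul]
  rw [← zpow_add₀ (by norm_num), ← zpow_add₀ (by norm_num), ← zpow_add₀ (by norm_num)]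
  refine neg_one_zpow_congr ⟨-(p * K), ?_⟩
  push_cast
  ring

theorem mutuallyLocal_iff (hσ : σ * σ = 1) {p q : ℤ} {a b : Series (Module.End ℂ V)}
    (ha : ∀ n (I : Fin 2), σ * a n I = (-1 : ℂ) ^ (p + ((I : ℕ) : ℤ)) • (a n I * σ))
    (hb : ∀ n (I : Fin 2), σ * b n I = (-1 : ℂ) ^ (q + ((I : ℕ) : ℤ)) • (b n I * σ)) :
    MutuallyLocal σ p q (toFuns a) (toFuns b) ↔
      ∀ I K : Fin 2, Loc ((-1) ^ ((p + ((I : ℕ) : ℤ)) * (q + ((K : ℕ) : ℤ))))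
        (fun n => a n I) (fun n => b n K) := by
  have key : ∀ N v m n I K, (mulSub^[N] (bracket σ p q (toFuns a) (toFuns b) v)) (m, n) (I, K) =
      ((-1 : ℂ) ^ (p + ((I : ℕ) : ℤ))) ^ (K : ℕ) • (subZW (Module.End ℂ V) ^ N)
        (fun m n => a m I * b n K - (-1 : ℂ) ^ ((p + ((I : ℕ) : ℤ)) * (q + ((K : ℕ) : ℤ))) •
          (b n K * a m I)) m n v := by
    intro N v m n I K
    rw [mulSub_iterate_eq_subZW]
    simp only [bracket_apply hσ ha hb]
    exact congrFun (congrFun (subZW_pow_map (((-1 : ℂ) ^ (p + ((I : ℕ) : ℤ))) ^ (K : ℕ) •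
      (LinearMap.applyₗ v : Module.End ℂ V →ₗ[ℂ] V)) (fun m n => a m I * b n K -
        (-1 : ℂ) ^ ((p + ((I : ℕ) : ℤ)) * (q + ((K : ℕ) : ℤ))) • (b n K * a m I)) N) m) n
  constructor
  · rintro ⟨N, hN⟩ I K
    refine ⟨N, ?_⟩
    funext m n
    ext v
    have h1 := hN v (m, n) (I, K)
    rw [key, smul_eq_zero] at h1
    exact h1.resolve_left (pow_ne_zero _ (zpow_ne_zero _ (by norm_num)))
  · intro h
    choose N hN using h
    refine ⟨∑ I, ∑ K, N I K, ?_⟩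
    rintro v ⟨m, n⟩ ⟨I, K⟩
    rw [key, subZW_pow_eq_zero_mono _ (hN I K)]
    · simp
    · exact (Finset.single_le_sum (f := fun K => N I K) (fun _ _ => Nat.zero_le _)
        (Finset.mem_univ K)).trans (Finset.single_le_sum (f := fun I => ∑ K, N I K)
          (fun _ _ => Nat.zero_le _) (Finset.mem_univ I))

/-- Superfields of parity `q` which are regular on the vacuum and covariant with respect to `S`. -/
structure Superfield (σ S : Module.End ℂ V) (vac : V) (q : ℤ) (G : Series (Module.End ℂ V)) :
    Prop where
  parity : ∀ n (I : Fin 2), σ * G n I = (-1 : ℂ) ^ (q + ((I : ℕ) : ℤ)) • (G n I * σ)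
  bdd : ∀ v, ∃ N : ℤ, ∀ n < N, ∀ I, G n I v = 0
  vac : ∀ n I, n < 0 → G n I vac = 0
  transl : ∀ n (I : Fin 2), (-1 : ℂ) ^ (I : ℕ) • (S * G n I) - (-1 : ℂ) ^ q • (G n I * S) =
    dBar G n I

variable {S : Module.End ℂ V} {vac : V} {q : ℤ} {G : Series (Module.End ℂ V)}

theorem Superfield.transl_zero (hG : Superfield σ S vac q G) (n : ℤ) (v : V) :
    S (G n 0 v) = (-1 : ℂ) ^ q • G n 0 (S v) + G n 1 v := by
  have := DFunLike.congr_fun (hG.transl n 0) v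
  simp only [Fin.val_zero, pow_zero, one_smul, LinearMap.sub_apply, LinearMap.smul_apply,
    Module.End.mul_apply, dBar, if_true] at this
  rw [← this]
  abel

theorem Superfield.transl_one (hG : Superfield σ S vac q G) (n : ℤ) (v : V) :
    S (G n 1 v) = -((-1 : ℂ) ^ q • G n 1 (S v)) + ((n + 1 : ℤ) : ℂ) • G (n + 1) 0 v := by
  have := DFunLike.congr_fun (hG.transl n 1) v
  simp only [Fin.val_one, pow_one, neg_one_smul, LinearMap.sub_apply, LinearMap.smul_apply,
    Module.End.mul_apply, dBar, one_ne_zero, if_false, LinearMap.neg_apply] at this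
  rw [← sub_eq_zero] at this ⊢
  rw [← neg_eq_zero, ← this]
  abel

theorem Superfield.fieldIn (hG : Superfield σ S vac q G) {H : Set (ℤ × (ℤ → Module.End ℂ V))}
    (I : Fin 2)
    (hH : ∀ h ∈ H, Loc ((-1) ^ ((q + ((I : ℕ) : ℤ)) * h.1)) (fun n => G n I) h.2) :
    FieldIn σ (S * S) vac H (q + ((I : ℕ) : ℤ)) (fun n => G n I) where
  bdd v := by
    obtain ⟨N, hN⟩ := hG.bdd v
    exact ⟨N, fun n hn => hN n hn I⟩
  parity n v := DFunLike.congr_fun (hG.parity n I) v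
  vac n hn := hG.vac n I hn
  transl n v := by
    have hq := neg_one_zpow_mul_self q
    match I with
    | 0 =>
      simp only [Module.End.mul_apply, hG.transl_zero, hG.transl_one, map_add, map_smul, smul_add,
        smul_smul, hq, one_smul]
      abel
    | 1 =>
      simp only [Module.End.mul_apply, hG.transl_zero, hG.transl_one, map_add, map_neg, map_smul,
        smul_add, smul_neg, smul_smul, hq, one_smul, smul_comm ((n + 1 : ℤ) : ℂ)]
      module
  loc := hH

theorem SUSYVertexAlgebra.superfield (𝒱 : SUSYVertexAlgebra V σ vac) {p : ℤ} {a : V}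
    (ha : σ a = (-1 : ℂ) ^ p • a) : Superfield σ 𝒱.S vac p (𝒱.Y a) where
  parity := 𝒱.Y_parity p a ha
  bdd := 𝒱.field a
  vac := 𝒱.Y_apply_vac_neg a
  transl := 𝒱.translation p a ha

theorem SUSYVertexAlgebra.loc (𝒱 : SUSYVertexAlgebra V σ vac) {p q : ℤ} {a b : V}
    (ha : σ a = (-1 : ℂ) ^ p • a) (hb : σ b = (-1 : ℂ) ^ q • b) (I K : Fin 2) :
    Loc ((-1) ^ ((p + ((I : ℕ) : ℤ)) * (q + ((K : ℕ) : ℤ))))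
      (fun n => 𝒱.Y a n I) (fun n => 𝒱.Y b n K) :=
  (mutuallyLocal_iff 𝒱.sigma_sq (𝒱.Y_parity p a ha) (𝒱.Y_parity q b hb)).mp
    (𝒱.locality p q a b ha hb) I K

/-- Every vector is a sum of an even and an odd one. -/
theorem exists_even_odd (hσ : σ * σ = 1) (a : V) :
    ∃ b c, σ b = (-1 : ℂ) ^ (0 : ℤ) • b ∧ σ c = (-1 : ℂ) ^ (1 : ℤ) • c ∧ a = b + c := by
  have h2 : σ (σ a) = a := DFunLike.congr_fun hσ a
  refine ⟨(2⁻¹ : ℂ) • (a + σ a), (2⁻¹ : ℂ) • (a - σ a), ?_, ?_, ?_⟩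
  · rw [map_smul, map_add, h2, add_comm]; simp
  · rw [map_smul, map_sub, h2]; simp [← smul_neg]
  · module

/-- The even parts of all superfields of a SUSY vertex algebra. -/
def SUSYVertexAlgebra.fields (𝒱 : SUSYVertexAlgebra V σ vac) :
    Set (ℤ × (ℤ → Module.End ℂ V)) :=
  {h | ∃ a, σ a = (-1 : ℂ) ^ h.1 • a ∧ h.2 = fun n => 𝒱.Y a n 0}

theorem SUSYVertexAlgebra.generates_fields (𝒱 : SUSYVertexAlgebra V σ vac) :
    Generates vac 𝒱.fields := by
  intro K hv hK
  rw [eq_top_iff]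
  intro a _
  have h1 : ∀ (p : ℤ) a, σ a = (-1 : ℂ) ^ p • a → a ∈ K := fun p a ha => by
    have := hK (p, fun n => 𝒱.Y a n 0) ⟨a, ha, rfl⟩ 0 le_rfl vac hv
    rwa [𝒱.Y_apply_vac] at this
  obtain ⟨b, c, hb, hc, rfl⟩ := exists_even_odd 𝒱.sigma_sq a
  exact K.add_mem (h1 _ b hb) (h1 _ c hc)

theorem SUSYVertexAlgebra.fieldIn (𝒱 : SUSYVertexAlgebra V σ vac) {p : ℤ} {a : V}
    (ha : σ a = (-1 : ℂ) ^ p • a) (I : Fin 2) :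
    FieldIn σ (𝒱.S * 𝒱.S) vac 𝒱.fields (p + ((I : ℕ) : ℤ)) (fun n => 𝒱.Y a n I) := by
  refine (𝒱.superfield ha).fieldIn I ?_
  rintro ⟨q, B⟩ ⟨b, hb, hB⟩
  simp only at hb hB ⊢
  rw [hB]
  have := 𝒱.loc ha hb I 0
  simpa using this

/-- If `a_(j) b = 0` for `j > 0`, then `[a(z), b(w)] = δ(z, w) (a_(0) b)(w)`. -/
theorem FieldIn.comm_eq {T : Module.End ℂ V} {H : Set (ℤ × (ℤ → Module.End ℂ V))}
    (hgen : Generates vac H) (hH : ∀ h ∈ H, ∀ v, ∃ N : ℤ, ∀ n < N, h.2 n v = 0) (hT : T vac = 0)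
    {p q : ℤ} {a b c : ℤ → Module.End ℂ V} (ha : FieldIn σ T vac H p a)
    (hb : FieldIn σ T vac H q b) (hc : FieldIn σ T vac H (p + q) c)
    (hab : Loc ((-1) ^ (p * q)) a b) (h0 : a (-1) (b 0 vac) = c 0 vac)
    (h1 : ∀ n < -1, a n (b 0 vac) = 0) (m n : ℤ) (v : V) :
    a m (b n v) = (-1 : ℂ) ^ (p * q) • b n (a m v) + c (m + n + 1) v := by
  have hvac : ∀ (k : ℕ) (m : ℤ), m < 0 → a m (b k vac) = c (m + k + 1) vac := by
    intro k
    induction k with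
    | zero =>
      intro m hm
      rcases eq_or_ne m (-1) with rfl | hm'
      · simpa using h0
      · rw [hc.vac _ (by push_cast; omega)]
        exact h1 m (by omega)
    | succ k ih =>
      intro m hm
      have e1 := hb.transl k vac
      rw [hT, map_zero, zero_add] at e1
      have e2 := ha.transl m (b k vac)
      have e3 := hc.transl (m + k + 1) vac
      rw [hT, map_zero, zero_add] at e3
      have e4 : ((m + 1 : ℤ) : ℂ) • a (m + 1) (b k vac) =
          ((m + 1 : ℤ) : ℂ) • c (m + 1 + k + 1) vac := by
        rcases eq_or_ne m (-1) with rfl | hm'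
        · simp
        · rw [ih _ (by omega)]
      rw [e1, map_smul, ih m hm, e3, e4, ← sub_eq_iff_eq_add,
        show m + 1 + (k : ℤ) + 1 = m + k + 1 + 1 by ring, ← sub_smul] at e2
      have hk : (((k : ℤ) + 1 : ℤ) : ℂ) ≠ 0 := by exact_mod_cast Nat.succ_ne_zero k
      have e5 : (((m + k + 1 + 1 : ℤ) : ℂ) - ((m + 1 : ℤ) : ℂ)) = (((k : ℤ) + 1 : ℤ) : ℂ) := by
        push_cast; ring
      rw [e5] at e2
      have e6 := smul_right_injective V hk e2
      push_cast
      rw [← e6]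
      congr 2
      ring
  have hneg : ∀ m < 0, (fun n => a m * b n - (-1 : ℂ) ^ (p * q) • (b n * a m)) =
      fun n => c (n + (m + 1)) := by
    intro m hm
    rw [← sub_eq_zero]
    refine eq_zero_of_loc hgen hH (fun h hh => ⟨(-1) ^ (p * h.1) * (-1) ^ (q * h.1), ?_⟩)
      fun n => ?_
    · refine (hab.comm (ha.loc h hh) (hb.loc h hh) m).sub ?_
      rw [← zpow_add₀ (by norm_num), ← add_mul]
      exact (hc.loc h hh).shift (m + 1)
    · rw [Pi.sub_apply, LinearMap.sub_apply, LinearMap.sub_apply, LinearMap.smul_apply,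
        Module.End.mul_apply, Module.End.mul_apply, ha.vac m hm, map_zero, smul_zero, sub_zero]
      rcases lt_or_ge n 0 with hn | hn
      · rw [hb.vac n hn, hc.vac _ (by omega), map_zero, sub_zero]
      · lift n to ℕ using hn
        rw [hvac n m hm, show m + (n : ℤ) + 1 = n + (m + 1) by ring, sub_self]
  have hall : (fun m n => a m * b n - (-1 : ℂ) ^ (p * q) • (b n * a m) - c (m + n + 1)) = 0 := by
    obtain ⟨N, hN⟩ := hab
    refine eq_zero_of_subZW_pow' (N := N + 1) (m₀ := 0) ?_ fun m n hm => ?_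
    · have h2 : (subZW (Module.End ℂ V) ^ (N + 1)) (fun m n => c (m + n + 1)) = 0 := by
        rw [pow_succ, Module.End.mul_apply]
        convert map_zero (subZW (Module.End ℂ V) ^ N) using 2
        funext m n
        rw [subZW_apply, show m - 1 + n + 1 = m + (n - 1) + 1 by ring, sub_self]
        rfl
      have h3 := subZW_pow_eq_zero_mono (Nat.le_succ N) hN
      have := congrArg₂ (· - ·) h3 h2
      rwa [← map_sub, sub_zero] at this
    · have := congrFun (hneg m hm) n
      rw [this, show n + (m + 1) = m + n + 1 by ring, sub_self]
  have h2 := DFunLike.congr_fun (congrFun (congrFun hall m) n) v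
  simp only [LinearMap.sub_apply, LinearMap.smul_apply, Module.End.mul_apply, Pi.zero_apply,
    LinearMap.zero_apply] at h2
  rw [← sub_eq_zero, ← h2]
  abel

end Superfields

section Reconstruction

variable {V : Type*} [AddCommGroup V] [Module ℂ V] {σ S : Module.End ℂ V} {vac : V}

/-- The field `Id`. -/
def idField : ℤ → Module.End ℂ V := fun n => if n = 0 then 1 else 0

theorem fieldIn_idField {T : Module.End ℂ V} {H : Set (ℤ × (ℤ → Module.End ℂ V))} :
    FieldIn σ T vac H 0 idField where
  bdd v := ⟨0, fun n hn => by rw [idField, if_neg hn.ne]; rfl⟩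
  parity n v := by
    rw [idField]
    split_ifs <;> simp
  vac n hn := by rw [idField, if_neg hn.ne]; rfl
  transl n v := by
    rcases eq_or_ne n (-1) with rfl | hn
    · simp [idField]
    · rw [idField, idField, if_neg (show n + 1 ≠ 0 by omega)]
      split_ifs <;> simp
  loc h _ := ⟨0, by
    funext m n
    simp only [pow_zero, Module.End.one_apply, idField]
    split_ifs <;> simp⟩

theorem derivField_iterate (a : ℤ → Module.End ℂ V) (k m : ℕ) :
    ∃ c : ℂ, c ≠ 0 ∧ derivField^[k] a m = c • a (m + k) := by
  induction k generalizing m with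
  | zero => exact ⟨1, one_ne_zero, by simp⟩
  | succ k ih =>
    obtain ⟨c, hc, h⟩ := ih (m + 1)
    refine ⟨((m : ℤ) + 1 : ℤ) * c, mul_ne_zero (by exact_mod_cast Nat.succ_ne_zero m) hc, ?_⟩
    rw [Function.iterate_succ_apply', derivField]
    push_cast at h ⊢
    rw [h, smul_smul]
    congr 2
    ring

theorem FieldIn.deriv_iterate {T : Module.End ℂ V} {H : Set (ℤ × (ℤ → Module.End ℂ V))} {p : ℤ}
    {A : ℤ → Module.End ℂ V} (hA : FieldIn σ T vac H p A) (k : ℕ) :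
    FieldIn σ T vac H p (derivField^[k] A) := by
  induction k with
  | zero => exact hA
  | succ k ih => rw [Function.iterate_succ_apply']; exact ih.deriv

theorem Loc.deriv_iterate {s : ℂ} {a b : ℤ → Module.End ℂ V} (h : Loc s a b) (k : ℕ) :
    Loc s (derivField^[k] a) b := by
  induction k with
  | zero => exact h
  | succ k ih => rw [Function.iterate_succ_apply']; exact ih.deriv

theorem Loc.comm_odd {s tA tg : ℂ} (htA : tA * tA = 1) {A g h : ℤ → Module.End ℂ V}
    (hh : ∀ n, h n = S * g n - tg • (g n * S)) (hAg : Loc s A g) (hAh : Loc (s * tA) A h) :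
    Loc (s * tg) (fun n => S * A n - tA • (A n * S)) g := by
  obtain ⟨N, hN⟩ := hAg
  obtain ⟨M, hM⟩ := hAh
  refine ⟨N + M, ?_⟩
  replace hN := subZW_pow_eq_zero_mono (Nat.le_add_right N M) hN
  replace hM := subZW_pow_eq_zero_mono (Nat.le_add_left M N) hM
  have h1 := subZW_pow_map (LinearMap.mulLeft ℂ S - (tA * tg) • LinearMap.mulRight ℂ S)
    (fun m n => A m * g n - s • (g n * A m)) (N + M)
  rw [hN] at h1
  have h2 : (subZW (Module.End ℂ V) ^ (N + M))
      (tA • fun m n => A m * h n - (s * tA) • (h n * A m)) = 0 := by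
    rw [map_smul, hM, smul_zero]
  have e : (fun m n => (S * A m - tA • (A m * S)) * g n - (s * tg) • (g n *
      (S * A m - tA • (A m * S)))) = (fun m n => (LinearMap.mulLeft ℂ S -
        (tA * tg) • LinearMap.mulRight ℂ S) (A m * g n - s • (g n * A m))) -
      tA • fun m n => A m * h n - (s * tA) • (h n * A m) := by
    funext m n
    simp only [Pi.sub_apply, Pi.smul_apply, hh, LinearMap.sub_apply, LinearMap.smul_apply,
      LinearMap.mulLeft_apply, LinearMap.mulRight_apply, mul_sub, sub_mul, smul_sub,
      mul_smul_comm, smul_mul_assoc, smul_smul, mul_assoc]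
    have e1 : tA * (s * tA) = s := by linear_combination s * htA
    have e2 : tA * (s * (tA * tg)) = s * tg := by linear_combination s * tg * htA
    rw [e1, e2, show s * (tg * tA) = tA * (tg * s) by ring]
    abel
  rw [e, map_sub, h1, h2, sub_zero]
  funext m n
  simp

variable {ι : Type*} {q : ι → ℤ} {G : ι → Series (Module.End ℂ V)}

/-- The components of the superfields `G`. -/
def components (q : ι → ℤ) (G : ι → Series (Module.End ℂ V)) :
    Set (ℤ × (ℤ → Module.End ℂ V)) :=
  Set.range fun x : ι × Fin 2 => (q x.1 + ((x.2 : ℕ) : ℤ), fun n => G x.1 n x.2)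

theorem mem_components (q : ι → ℤ) (G : ι → Series (Module.End ℂ V)) (i : ι) (I : Fin 2) :
    (q i + ((I : ℕ) : ℤ), fun n => G i n I) ∈ components q G := ⟨(i, I), rfl⟩

/-- Mutually local superfields which generate `V` from the vacuum. -/
structure Generators (σ S : Module.End ℂ V) (vac : V) (q : ι → ℤ)
    (G : ι → Series (Module.End ℂ V)) : Prop where
  sigma_sq : σ * σ = 1
  vac_even : σ vac = vac
  S_odd : σ * S = -(S * σ)
  S_vac : S vac = 0
  superfield : ∀ i, Superfield σ S vac (q i) (G i)
  loc : ∀ i j, MutuallyLocal σ (q i) (q j) (toFuns (G i)) (toFuns (G j))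
  gen : Generates vac (components q G)

theorem Generators.loc_components (h : Generators σ S vac q G) (i j : ι) (I K : Fin 2) :
    Loc ((-1) ^ ((q i + ((I : ℕ) : ℤ)) * (q j + ((K : ℕ) : ℤ))))
      (fun n => G i n I) (fun n => G j n K) :=
  (mutuallyLocal_iff h.sigma_sq (h.superfield i).parity (h.superfield j).parity).mp
    (h.loc i j) I K

theorem Generators.bdd (h : Generators σ S vac q G) :
    ∀ x ∈ components q G, ∀ v, ∃ N : ℤ, ∀ n < N, x.2 n v = 0 := by
  rintro _ ⟨⟨i, I⟩, rfl⟩ v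
  obtain ⟨N, hN⟩ := (h.superfield i).bdd v
  exact ⟨N, fun n hn => hN n hn I⟩

theorem Generators.T_vac (h : Generators σ S vac q G) : (S * S) vac = 0 := by
  rw [Module.End.mul_apply, h.S_vac, map_zero]

theorem Generators.eq_zero (h : Generators σ S vac q G) {p : ℤ} {A : ℤ → Module.End ℂ V}
    (hA : FieldIn σ (S * S) vac (components q G) p A) (h0 : A 0 vac = 0) : A = 0 :=
  eq_zero_of_loc h.gen h.bdd (fun x hx => ⟨_, hA.loc x hx⟩) (hA.apply_vac h.T_vac h0)

/-- Every homogeneous vector is the state of a field. -/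
theorem Generators.exists_fieldIn (h : Generators σ S vac q G)
    {H : Set (ℤ × (ℤ → Module.End ℂ V))} (hsub : components q G ⊆ H)
    (hH : ∀ i (I : Fin 2), ∀ x ∈ H,
      Loc ((-1) ^ ((q i + ((I : ℕ) : ℤ)) * x.1)) (fun n => G i n I) x.2)
    {p : ℤ} {a : V} (ha : σ a = (-1 : ℂ) ^ p • a) :
    ∃ A, FieldIn σ (S * S) vac H p A ∧ A 0 vac = a := by
  let F : ℤ → Submodule ℂ V := fun p => (fieldSpace σ (S * S) vac H p).map
    (LinearMap.applyₗ vac ∘ₗ LinearMap.proj 0)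
  have hF : ∀ p x, x ∈ F p ↔ ∃ A, FieldIn σ (S * S) vac H p A ∧ A 0 vac = x := fun _ _ => Iff.rfl
  have hFeven : ∀ p, F p ≤ F 0 ⊔ F 1 := by
    intro p x hx
    obtain ⟨A, hA, rfl⟩ := (hF p x).mp hx
    rcases Int.even_or_odd p with hp | hp
    · exact Submodule.mem_sup_left ((hF _ _).mpr ⟨A, hA.congr (by simpa using hp), rfl⟩)
    · exact Submodule.mem_sup_right ((hF _ _).mpr ⟨A, hA.congr (hp.sub_odd odd_one), rfl⟩)
  have htop : F 0 ⊔ F 1 = ⊤ := by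
    refine h.gen _ (hFeven 0 ((hF _ _).mpr ⟨idField, fieldIn_idField, by simp [idField]⟩)) ?_
    rintro _ ⟨⟨i, I⟩, rfl⟩ n hn v hv
    lift n to ℕ using hn
    have key : ∀ p, ∀ v ∈ F p, G i n I v ∈ F 0 ⊔ F 1 := by
      intro p v hv
      obtain ⟨A, hA, rfl⟩ := (hF p v).mp hv
      obtain ⟨c, hc, hc'⟩ := derivField_iterate (fun n => G i n I) n 0
      have hGi := ((h.superfield i).fieldIn (H := H) I (hH i I)).deriv_iterate n
      have hl : Loc _ (fun n => G i n I) A :=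
        (hA.loc _ (hsub (mem_components q G i I))).symm (neg_one_zpow_mul_self _)
      rw [mul_comm] at hl
      have hN := hGi.normal hA (hl.deriv_iterate n)
      refine hFeven _ ((hF _ _).mpr ⟨_, hN.smul c⁻¹, ?_⟩)
      rw [Pi.smul_apply, LinearMap.smul_apply, normal_zero_vac hGi hA, ← Nat.cast_zero, hc',
        LinearMap.smul_apply, smul_smul, inv_mul_cancel₀ hc, one_smul]
      simp
    obtain ⟨x, hx, y, hy, rfl⟩ := Submodule.mem_sup.mp hv
    rw [map_add]
    exact add_mem (key _ x hx) (key _ y hy)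
  have hpar : ∀ p, ∀ x ∈ F p, σ x = (-1 : ℂ) ^ p • x := by
    intro p x hx
    obtain ⟨A, hA, rfl⟩ := (hF p x).mp hx
    rw [hA.parity, h.vac_even]
  obtain ⟨x, hx, y, hy, hxy⟩ := Submodule.mem_sup.mp (htop ▸ Submodule.mem_top : a ∈ F 0 ⊔ F 1)
  have h0 := hpar 0 x hx
  have h1 := hpar 1 y hy
  rw [zpow_zero, one_smul] at h0
  rw [zpow_one, neg_one_smul] at h1
  rw [← hxy, map_add, h0, h1] at ha
  rcases Int.even_or_odd p with hp | hp
  · rw [hp.neg_one_zpow, one_smul, ← sub_eq_zero] at ha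
    have hy0 : y = 0 := by
      have : (-2 : ℂ) • y = 0 := by rw [← ha]; module
      exact (smul_eq_zero.mp this).resolve_left (by norm_num)
    obtain ⟨A, hA, hA'⟩ := (hF 0 x).mp hx
    exact ⟨A, hA.congr (by simpa using hp.neg), by rw [hA', ← hxy, hy0, add_zero]⟩
  · rw [hp.neg_one_zpow, neg_one_smul, ← sub_eq_zero] at ha
    have hx0 : x = 0 := by
      have : (2 : ℂ) • x = 0 := by rw [← ha]; module
      exact (smul_eq_zero.mp this).resolve_left (by norm_num)
    obtain ⟨A, hA, hA'⟩ := (hF 1 y).mp hy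
    exact ⟨A, hA.congr (odd_one.sub_odd hp), by rw [hA', ← hxy, hx0, zero_add]⟩

theorem Generators.loc_fieldIn (h : Generators σ S vac q G) {p r : ℤ}
    {A C : ℤ → Module.End ℂ V} (hA : FieldIn σ (S * S) vac (components q G) p A)
    (hC : FieldIn σ (S * S) vac (components q G) r C) : Loc ((-1) ^ (p * r)) A C := by
  have hpA : σ (A 0 vac) = (-1 : ℂ) ^ p • A 0 vac := by rw [hA.parity, h.vac_even]
  have hl : ∀ i (I : Fin 2), ∀ x ∈ insert (r, C) (components q G),
      Loc ((-1) ^ ((q i + ((I : ℕ) : ℤ)) * x.1)) (fun n => G i n I) x.2 := by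
    rintro i I x (rfl | ⟨⟨j, K⟩, rfl⟩)
    · have := (hC.loc _ (mem_components q G i I)).symm (neg_one_zpow_mul_self _)
      rwa [mul_comm] at this
    · exact h.loc_components i j I K
  obtain ⟨A', hA', h0⟩ := h.exists_fieldIn (Set.subset_insert _ _) hl hpA
  have hA'' : FieldIn σ (S * S) vac (components q G) p A' :=
    { hA' with loc := fun x hx => hA'.loc x (Set.mem_insert_of_mem _ hx) }
  have : A' - A = 0 := h.eq_zero (hA''.sub hA) (by
    rw [Pi.sub_apply, LinearMap.sub_apply, h0, sub_self])
  rw [← sub_eq_zero.mp this]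
  exact hA'.loc (r, C) (Set.mem_insert _ _)

/-- The space of fields is stable under `[S, ·]`. -/
theorem Generators.fieldIn_comm (h : Generators σ S vac q G) {p : ℤ} {A : ℤ → Module.End ℂ V}
    (hA : FieldIn σ (S * S) vac (components q G) p A) :
    FieldIn σ (S * S) vac (components q G) (p + 1)
      (fun n => S * A n - (-1 : ℂ) ^ p • (A n * S)) where
  bdd v := by
    obtain ⟨N, hN⟩ := hA.bdd v
    obtain ⟨N', hN'⟩ := hA.bdd (S v)
    refine ⟨min N N', fun n hn => ?_⟩
    rw [LinearMap.sub_apply, LinearMap.smul_apply, Module.End.mul_apply, Module.End.mul_apply,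
      hN n (by omega), hN' n (by omega), map_zero, smul_zero, sub_zero]
  parity n v := by
    have hS : ∀ x, σ (S x) = -S (σ x) := fun x => DFunLike.congr_fun h.S_odd x
    simp only [LinearMap.sub_apply, LinearMap.smul_apply, Module.End.mul_apply, map_sub, map_smul,
      hS, hA.parity, map_neg, smul_neg, zpow_add₀ (show (-1 : ℂ) ≠ 0 by norm_num), zpow_one]
    module
  vac n hn := by
    rw [LinearMap.sub_apply, LinearMap.smul_apply, Module.End.mul_apply, Module.End.mul_apply,
      hA.vac n hn, h.S_vac, map_zero, map_zero, smul_zero, sub_zero]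
  transl n v := by
    have hT : ∀ n v, S (S (A n v)) = A n (S (S v)) + ((n + 1 : ℤ) : ℂ) • A (n + 1) v := hA.transl
    simp only [LinearMap.sub_apply, LinearMap.smul_apply, Module.End.mul_apply, map_sub, map_smul,
      hT, map_add, smul_sub, smul_add, smul_comm ((-1 : ℂ) ^ p)]
    abel
  loc := by
    rintro _ ⟨⟨i, I⟩, rfl⟩
    have hl : ∀ K : Fin 2, Loc ((-1) ^ (p * (q i + ((K : ℕ) : ℤ)))) A (fun n => G i n K) :=
      fun K => hA.loc _ (mem_components q G i K)
    have hG := h.superfield i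
    simp only
    match I with
    | 0 =>
      have := Loc.comm_odd (S := S) (tg := (-1) ^ (q i)) (neg_one_zpow_mul_self p)
        (fun n => ?_) (hl 0) (h := fun n => G i n 1) ?_
      · rw [← zpow_add₀ (by norm_num)] at this
        convert this using 2
        simp only [Fin.val_zero]
        push_cast
        ring
      · ext v
        simp only [LinearMap.sub_apply, LinearMap.smul_apply, Module.End.mul_apply, hG.transl_zero]
        abel
      · have h1 := hl 1
        rw [← zpow_add₀ (by norm_num)]
        convert h1 using 2
        simp only [Fin.val_zero, Fin.val_one]
        push_cast
        ring
    | 1 =>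
      have := Loc.comm_odd (S := S) (tg := (-1) ^ (q i + 1)) (neg_one_zpow_mul_self p)
        (fun n => ?_) (hl 1) (h := derivField fun n => G i n 0) ?_
      · rw [← zpow_add₀ (by norm_num)] at this
        convert this using 2
        simp only [Fin.val_one]
        push_cast
        ring
      · ext v
        simp only [LinearMap.sub_apply, LinearMap.smul_apply, Module.End.mul_apply, hG.transl_one,
          derivField, zpow_add₀ (show (-1 : ℂ) ≠ 0 by norm_num), zpow_one]
        module
      · have h1 := (((hl 0).symm (neg_one_zpow_mul_self _)).deriv).symm (neg_one_zpow_mul_self _)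
        rw [← zpow_add₀ (by norm_num)]
        rw [neg_one_zpow_congr (q := p * (q i + ((0 : Fin 2) : ℕ)))]
        · exact h1
        · simp only [Fin.val_zero, Fin.val_one]
          exact ⟨p, by push_cast; ring⟩

/-- Reconstruction theorem. -/
theorem Generators.exists_structure (h : Generators σ S vac q G) :
    ∃ 𝒱 : SUSYVertexAlgebra V σ vac, 𝒱.S = S ∧ ∀ i, 𝒱.Y (G i 0 0 vac) = G i := by
  have hsub := Set.Subset.refl (components q G)
  have hloc : ∀ i (I : Fin 2), ∀ x ∈ components q G,
      Loc ((-1) ^ ((q i + ((I : ℕ) : ℤ)) * x.1)) (fun n => G i n I) x.2 := by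
    rintro i I _ ⟨⟨j, K⟩, rfl⟩
    exact h.loc_components i j I K
  have huniq : ∀ {p A A'}, FieldIn σ (S * S) vac (components q G) p A →
      FieldIn σ (S * S) vac (components q G) p A' → A 0 vac = A' 0 vac → A = A' :=
    fun hA hA' e => sub_eq_zero.mp (h.eq_zero (hA.sub hA') (by
      rw [Pi.sub_apply, LinearMap.sub_apply, e, sub_self]))
  let F : ℤ → Submodule ℂ (ℤ → Module.End ℂ V) := fieldSpace σ (S * S) vac (components q G)
  let ev : ↥(F 0 ⊔ F 1) →ₗ[ℂ] V :=
    (LinearMap.applyₗ vac ∘ₗ LinearMap.proj 0) ∘ₗ (F 0 ⊔ F 1).subtype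
  have hev : ∀ x, ev x = (x : ℤ → Module.End ℂ V) 0 vac := fun _ => rfl
  have hmem : ∀ {p A}, FieldIn σ (S * S) vac (components q G) p A → A ∈ F 0 ⊔ F 1 := by
    intro p A hA
    rcases Int.even_or_odd p with hp | hp
    · exact Submodule.mem_sup_left (hA.congr (by simpa using hp))
    · exact Submodule.mem_sup_right (hA.congr (hp.sub_odd odd_one))
  have hbij : Function.Bijective ev := by
    constructor
    · rw [← LinearMap.ker_eq_bot, LinearMap.ker_eq_bot']
      rintro ⟨A, hA⟩ h0
      obtain ⟨x, hx, y, hy, rfl⟩ := Submodule.mem_sup.mp hA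
      have hx' : FieldIn σ (S * S) vac (components q G) 0 x := hx
      have hy' : FieldIn σ (S * S) vac (components q G) 1 y := hy
      rw [hev] at h0
      simp only [Pi.add_apply, LinearMap.add_apply] at h0
      have h1 := congrArg σ h0
      rw [map_add, hx'.parity, hy'.parity, h.vac_even, map_zero, zpow_zero, one_smul, zpow_one,
        neg_one_smul] at h1
      have hx0 : x 0 vac = 0 := by
        have : (2 : ℂ) • x 0 vac = (x 0 vac + y 0 vac) + (x 0 vac + -y 0 vac) := by module
        rw [h0, h1, add_zero] at this
        exact (smul_eq_zero.mp this).resolve_left (by norm_num)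
      have hy0 : y 0 vac = 0 := by rwa [hx0, zero_add] at h0
      simp only [h.eq_zero hx' hx0, h.eq_zero hy' hy0, add_zero]
      rfl
    · intro a
      obtain ⟨b, c, hb, hc, rfl⟩ := exists_even_odd h.sigma_sq a
      obtain ⟨B, hB, hB'⟩ := h.exists_fieldIn hsub hloc hb
      obtain ⟨C, hC, hC'⟩ := h.exists_fieldIn hsub hloc hc
      refine ⟨⟨B + C, add_mem (hmem hB) (hmem hC)⟩, ?_⟩
      rw [hev]
      simp [hB', hC']
  let e := LinearEquiv.ofBijective ev hbij
  let y : V →ₗ[ℂ] (ℤ → Module.End ℂ V) := (F 0 ⊔ F 1).subtype ∘ₗ e.symm.toLinearMap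
  have hyA : ∀ {p A}, FieldIn σ (S * S) vac (components q G) p A → y (A 0 vac) = A := by
    intro p A hA
    have : e ⟨A, hmem hA⟩ = A 0 vac := rfl
    rw [← this]
    change ((e.symm (e ⟨A, hmem hA⟩) : ↥(F 0 ⊔ F 1)) : ℤ → Module.End ℂ V) = A
    rw [e.symm_apply_apply]
  have hyF : ∀ {p a}, σ a = (-1 : ℂ) ^ p • a →
      FieldIn σ (S * S) vac (components q G) p (y a) := by
    intro p a ha
    obtain ⟨A, hA, rfl⟩ := h.exists_fieldIn hsub hloc ha
    rwa [hyA hA]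
  have hy0 : ∀ a, y a 0 vac = a := fun a => e.apply_symm_apply a
  have hS : ∀ x, σ (S x) = -S (σ x) := fun x => DFunLike.congr_fun h.S_odd x
  have hSp : ∀ {p : ℤ} {a}, σ a = (-1 : ℂ) ^ p • a → σ (S a) = (-1 : ℂ) ^ (p + 1) • S a := by
    intro p a ha
    rw [hS, ha, map_smul, zpow_add₀ (by norm_num), zpow_one, mul_neg_one, neg_smul]
  have hyS : ∀ {p : ℤ} {a}, σ a = (-1 : ℂ) ^ p • a → ∀ n,
      y (S a) n = S * y a n - (-1 : ℂ) ^ p • (y a n * S) := by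
    intro p a ha n
    have h1 := huniq (hyF (hSp ha)) (h.fieldIn_comm (hyF ha)) (by
      rw [hy0, LinearMap.sub_apply, LinearMap.smul_apply, Module.End.mul_apply,
        Module.End.mul_apply, hy0, h.S_vac, map_zero, smul_zero, sub_zero])
    exact congrFun h1 n
  let Y : V →ₗ[ℂ] Series (Module.End ℂ V) :=
    { toFun := fun a n I => if I = 0 then y a n else y (S a) n
      map_add' := fun a b => by
        funext n I
        simp only [map_add, Pi.add_apply]
        split_ifs <;> rfl
      map_smul' := fun c a => by
        funext n I
        simp only [map_smul, Pi.smul_apply, RingHom.id_apply]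
        split_ifs <;> rfl }
  have hY0 : ∀ a n, Y a n 0 = y a n := fun _ _ => rfl
  have hY1 : ∀ a n, Y a n 1 = y (S a) n := fun _ _ => rfl
  have hYF : ∀ {p a}, σ a = (-1 : ℂ) ^ p • a → ∀ I : Fin 2,
      FieldIn σ (S * S) vac (components q G) (p + ((I : ℕ) : ℤ)) (fun n => Y a n I) := by
    intro p a ha I
    match I with
    | 0 =>
      rw [show p + (((0 : Fin 2) : ℕ) : ℤ) = p by simp]
      exact hyF ha
    | 1 => exact hyF (hSp ha)
  have hYpar : ∀ (p : ℤ) (a : V), σ a = (-1 : ℂ) ^ p • a → ∀ n (I : Fin 2),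
      σ * Y a n I = (-1 : ℂ) ^ (p + ((I : ℕ) : ℤ)) • (Y a n I * σ) := by
    intro p a ha n I
    ext v
    exact (hYF ha I).parity n v
  have hbdd : ∀ a v, ∃ N : ℤ, ∀ n < N, y a n v = 0 := by
    intro a v
    obtain ⟨b, c, hb, hc, rfl⟩ := exists_even_odd h.sigma_sq a
    obtain ⟨N, hN⟩ := (hyF hb).bdd v
    obtain ⟨M, hM⟩ := (hyF hc).bdd v
    refine ⟨min N M, fun n hn => ?_⟩
    rw [map_add, Pi.add_apply, LinearMap.add_apply, hN n (by omega), hM n (by omega), add_zero]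
  have hvac : ∀ a, ∀ n < 0, y a n vac = 0 := by
    intro a n hn
    obtain ⟨b, c, hb, hc, rfl⟩ := exists_even_odd h.sigma_sq a
    rw [map_add, Pi.add_apply, LinearMap.add_apply, (hyF hb).vac n hn, (hyF hc).vac n hn, add_zero]
  refine ⟨⟨S, Y, h.sigma_sq, h.vac_even, h.S_odd, hYpar, ?_, ?_, h.S_vac, ?_, hy0, ?_, ?_⟩,
    rfl, ?_⟩
  · intro a v
    obtain ⟨N, hN⟩ := hbdd a v
    obtain ⟨M, hM⟩ := hbdd (S a) v
    refine ⟨min N M, fun n hn I => ?_⟩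
    match I with
    | 0 => exact hN n (by omega)
    | 1 => exact hM n (by omega)
  · funext n I
    match I with
    | 0 =>
      have h1 := hyA (fieldIn_idField (σ := σ) (T := S * S) (vac := vac) (H := components q G))
      simp only [idField, if_true, Module.End.one_apply] at h1
      rw [hY0, h1]
      simp [const, idField]
    | 1 => rw [hY1, h.S_vac, map_zero]; simp [const]
  · intro a n I hn
    match I with
    | 0 => exact hvac a n hn
    | 1 => exact hvac (S a) n hn
  · intro p a ha n I
    have hss := neg_one_zpow_mul_self p
    have hT : S * S * y a n = y a n * (S * S) + ((n + 1 : ℤ) : ℂ) • y a (n + 1) := by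
      ext v
      exact (hyF ha).transl n v
    match I with
    | 0 => rw [hY0, dBar, if_pos rfl, hY1, hyS ha]; simp
    | 1 =>
      rw [hY1, dBar, if_neg one_ne_zero, hY0, hyS ha]
      simp only [Fin.val_one, pow_one, neg_one_smul, mul_sub, sub_mul, mul_smul_comm,
        smul_mul_assoc, smul_sub, smul_smul, hss, one_smul, ← mul_assoc, hT]
      rw [mul_assoc (y a n)]
      module
  · intro p r a b ha hb
    rw [mutuallyLocal_iff h.sigma_sq (hYpar p a ha) (hYpar r b hb)]
    exact fun I K => h.loc_fieldIn (hYF ha I) (hYF hb K)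
  · intro i
    have hG := (h.superfield i).fieldIn (H := components q G)
    funext n I
    change Y _ n I = _
    match I with
    | 0 =>
      rw [hY0]
      exact congrFun (hyA (hG 0 (hloc i 0))) n
    | 1 =>
      have h1 := (h.superfield i).transl_zero 0 vac
      rw [h.S_vac, map_zero, smul_zero, zero_add] at h1
      rw [hY1, h1]
      exact congrFun (hyA (hG 1 (hloc i 1))) n

theorem Generators.eq_of_Y_eq (h : Generators σ S vac q G) {𝒱 𝒱' : SUSYVertexAlgebra V σ vac}
    (hS : 𝒱.S = S) (hS' : 𝒱'.S = S) {x : ι → V}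
    (hx : ∀ i, σ (x i) = (-1 : ℂ) ^ (q i) • x i) (hY : ∀ i, 𝒱.Y (x i) = G i)
    (hY' : ∀ i, 𝒱'.Y (x i) = G i) : 𝒱 = 𝒱' := by
  have key : ∀ (𝒲 : SUSYVertexAlgebra V σ vac), 𝒲.S = S → (∀ i, 𝒲.Y (x i) = G i) →
      ∀ {p a}, σ a = (-1 : ℂ) ^ p • a → ∀ I : Fin 2,
        FieldIn σ (S * S) vac (components q G) (p + ((I : ℕ) : ℤ)) (fun n => 𝒲.Y a n I) := by
    rintro 𝒲 rfl h2 p a ha I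
    refine (𝒲.superfield ha).fieldIn I ?_
    rintro _ ⟨⟨i, K⟩, rfl⟩
    have := 𝒲.loc ha (hx i) I K
    rwa [h2] at this
  have hY0 : ∀ {p : ℤ} {a}, σ a = (-1 : ℂ) ^ p • a → 𝒱.Y a = 𝒱'.Y a := by
    intro p a ha
    have e0 : (fun n => 𝒱.Y a n 0) = fun n => 𝒱'.Y a n 0 :=
      sub_eq_zero.mp (h.eq_zero ((key 𝒱 hS hY ha 0).sub (key 𝒱' hS' hY' ha 0)) (by
        rw [Pi.sub_apply, LinearMap.sub_apply, 𝒱.Y_apply_vac, 𝒱'.Y_apply_vac, sub_self]))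
    funext n I
    match I with
    | 0 => exact congrFun e0 n
    | 1 =>
      ext v
      have h1 := (𝒱.superfield ha).transl_zero n v
      have h2 := (𝒱'.superfield ha).transl_zero n v
      have e1 : 𝒱.Y a n 0 = 𝒱'.Y a n 0 := congrFun e0 n
      rw [hS, e1] at h1
      rw [hS', h1] at h2
      exact add_left_cancel h2
  refine SUSYVertexAlgebra.ext (hS.trans hS'.symm) (LinearMap.ext fun a => ?_)
  obtain ⟨b, c, hb, hc, rfl⟩ := exists_even_odd h.sigma_sq a
  rw [map_add, map_add, hY0 hb, hY0 hc]

end Reconstruction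

section Modes

variable {V : Type*} [AddCommGroup V] [Module ℂ V] {σ : Module.End ℂ V} {vac : V}

theorem SUSYVertexAlgebra.Y_eq_mode (𝒱 : SUSYVertexAlgebra V σ vac) (a : V) (n : ℤ) (I : Fin 2) :
    𝒱.Y a n I = 𝒱.mode a (-1 - n) (1 - I) := by
  rw [mode, sub_sub_cancel, sub_sub_cancel]

theorem SUSYVertexAlgebra.comm_eq (𝒱 : SUSYVertexAlgebra V σ vac) {p q : ℤ} {a b c : V}
    (ha : σ a = (-1 : ℂ) ^ p • a) (hb : σ b = (-1 : ℂ) ^ q • b) (I : Fin 2)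
    (h0 : 𝒱.Y a (-1) I b = c) (h1 : ∀ n < -1, 𝒱.Y a n I b = 0) (m n : ℤ) (v : V) :
    𝒱.Y a m I (𝒱.Y b n 0 v) = (-1 : ℂ) ^ ((p + ((I : ℕ) : ℤ)) * q) • 𝒱.Y b n 0 (𝒱.Y a m I v) +
      𝒱.Y c (m + n + 1) 0 v := by
  have hc : σ c = (-1 : ℂ) ^ (p + ((I : ℕ) : ℤ) + q) • c := by
    have := DFunLike.congr_fun (𝒱.Y_parity p a ha (-1) I) b
    simp only [Module.End.mul_apply, LinearMap.smul_apply, hb, map_smul, smul_smul, h0] at this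
    rw [this, zpow_add₀ (by norm_num) _ q]
  have hb' := 𝒱.fieldIn hb 0
  have hc' := 𝒱.fieldIn hc 0
  have hl := 𝒱.loc ha hb I 0
  simp only [Fin.val_zero, Nat.cast_zero, add_zero] at hb' hc' hl
  refine FieldIn.comm_eq 𝒱.generates_fields ?_ ?_ (𝒱.fieldIn ha I) hb' hc' hl ?_ ?_ m n v
  · rintro ⟨r, X⟩ ⟨x, hx, hX⟩ w
    obtain ⟨N, hN⟩ := 𝒱.field x w
    simp only at hX
    rw [hX]
    exact ⟨N, fun n hn => hN n hn 0⟩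
  · rw [Module.End.mul_apply, 𝒱.S_vac, map_zero]
  · rw [𝒱.Y_apply_vac, 𝒱.Y_apply_vac, h0]
  · rw [𝒱.Y_apply_vac]
    exact h1

end Modes

section Forced

variable {Q : Type*} [AddCommGroup Q] {B : LinearMap.BilinForm ℤ Q} {ε : Q → Q → ℂˣ}

theorem vacuum_eq (ε : Q → Q → ℂ) : vacuum ε = (ε 0 0)⁻¹ • eState 0 := by
  rw [vacuum, twOne, TensorProduct.tmul_smul]
  rfl

theorem hState_eq (ε : Q → Q → ℂ) (h : Hsp Q) : hState ε h = hOp B h (-1) 1 (vacuum ε) := by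
  rw [hOp, if_neg (by simp), vacuum, LinearMap.rTensor_tmul, hState, fockOp]
  rw [if_neg one_ne_zero, if_pos (by norm_num), fockRight, fockMk, fockMk]
  congr 1
  refine Eq.trans ?_ (LinearMap.lTensor_tmul _ _ _ _).symm
  simp
  rfl

theorem parity_vacuum (ε : Q → Q → ℂ) : parity B (vacuum ε) = vacuum ε := by
  rw [vacuum_eq, map_smul, parity_eState]
  simp

theorem parity_hState (ε : Q → Q → ℂ) (h : Hsp Q) :
    parity B (hState ε h) = (-1 : ℂ) ^ (1 : ℤ) • hState ε h := by
  rw [hState_eq (B := B), parity_hOp, parity_vacuum]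
  simp

theorem hOp_vacuum (ε : Q → Q → ℂ) (h : Hsp Q) {j : ℤ} (hj : 0 ≤ j) (J : Fin 2) :
    hOp B h j J (vacuum ε) = 0 := by
  rw [vacuum_eq, map_smul, hOp_eState B h hj, show toH (0 : Q) = 0 from TensorProduct.tmul_zero _ _]
  simp

namespace Str

variable {𝒱 : Str B ε}

theorem smul_factorial_inj {V : Type*} [AddCommGroup V] [Module ℂ V] {j : ℕ} {P : Prop}
    [Decidable P] {x y : V} (h : ((j.factorial : ℂ)⁻¹) • x = if j = 0 ∧ P then y else 0) :
    x = if j = 0 ∧ P then y else 0 := by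
  rcases eq_or_ne j 0 with rfl | hj
  · simpa using h
  · rw [if_neg (fun h => hj h.1)] at h ⊢
    exact (smul_eq_zero.mp h).resolve_left (inv_ne_zero (by exact_mod_cast j.factorial_ne_zero))

theorem HasBrackets.mode_hState (hb : 𝒱.HasBrackets) (h h' : Hsp Q) {j : ℤ} (hj : 0 ≤ j)
    (J : Fin 2) : SUSYVertexAlgebra.mode 𝒱 (hState (val ε) h) j J (hState (val ε) h') =
      if j = 0 ∧ J = 1 then formC B h h' • vacuum (val ε) else 0 := by
  lift j to ℕ using hj
  have := smul_factorial_inj (congrFun (congrFun (hb.1 h h') j) J)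
  simpa using this

theorem HasBrackets.mode_eState (hb : 𝒱.HasBrackets) (h : Hsp Q) (β : Q) {j : ℤ} (hj : 0 ≤ j)
    (J : Fin 2) : SUSYVertexAlgebra.mode 𝒱 (hState (val ε) h) j J (eState β) =
      if j = 0 ∧ J = 0 then formC B h (toH β) • eState β else 0 := by
  lift j to ℕ using hj
  have := smul_factorial_inj (congrFun (congrFun (hb.2 h β) j) J)
  simpa using this

theorem HasBrackets.odd_odd (hb : 𝒱.HasBrackets) (h h' : Hsp Q) (m n : ℤ) (v : VQ Q) :
    𝒱.Y (hState (val ε) h) m 0 (𝒱.Y (hState (val ε) h') n 0 v) =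
      -𝒱.Y (hState (val ε) h') n 0 (𝒱.Y (hState (val ε) h) m 0 v) +
        (if m + n + 1 = 0 then formC B h h' else 0) • v := by
  rw [SUSYVertexAlgebra.comm_eq 𝒱 (parity_hState _ h) (parity_hState _ h') 0
    (c := formC B h h' • vacuum (val ε)) ?_ ?_, map_smul, 𝒱.Y_vac]
  · simp only [Fin.val_zero, Nat.cast_zero, add_zero, mul_one, zpow_one, neg_one_smul,
      Pi.smul_apply, const, and_true, ite_smul, zero_smul, LinearMap.smul_apply]
    split_ifs <;> simp
  · rw [SUSYVertexAlgebra.Y_eq_mode, hb.mode_hState _ _ (by norm_num)]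
    simp
  · intro n hn
    rw [SUSYVertexAlgebra.Y_eq_mode, hb.mode_hState _ _ (by omega), if_neg (by omega)]

theorem HasBrackets.even_odd (hb : 𝒱.HasBrackets) (h h' : Hsp Q) (m n : ℤ) (v : VQ Q) :
    𝒱.Y (hState (val ε) h) m 1 (𝒱.Y (hState (val ε) h') n 0 v) =
      𝒱.Y (hState (val ε) h') n 0 (𝒱.Y (hState (val ε) h) m 1 v) := by
  have h0 : ∀ n ≤ -1, 𝒱.Y (hState (val ε) h) n 1 (hState (val ε) h') = 0 := fun n hn => by
    rw [SUSYVertexAlgebra.Y_eq_mode, hb.mode_hState _ _ (by omega), if_neg (by simp)]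
  rw [SUSYVertexAlgebra.comm_eq 𝒱 (parity_hState _ h) (parity_hState _ h') 1
    (h0 _ le_rfl) (fun n hn => h0 n hn.le), map_zero]
  simp [show (1 : ℤ) + 1 = 2 from rfl]

theorem transl_odd (𝒱 : Str B ε) (h : Hsp Q) (n : ℤ) (v : VQ Q) :
    𝒱.S (𝒱.Y (hState (val ε) h) n 0 v) =
      𝒱.Y (hState (val ε) h) n 1 v - 𝒱.Y (hState (val ε) h) n 0 (𝒱.S v) := by
  rw [(SUSYVertexAlgebra.superfield 𝒱 (parity_hState _ h)).transl_zero]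
  simp only [zpow_one, neg_one_smul]
  abel

theorem transl_even (𝒱 : Str B ε) (h : Hsp Q) (n : ℤ) (v : VQ Q) :
    𝒱.S (𝒱.Y (hState (val ε) h) n 1 v) =
      𝒱.Y (hState (val ε) h) n 1 (𝒱.S v) +
        ((n + 1 : ℤ) : ℂ) • 𝒱.Y (hState (val ε) h) (n + 1) 0 v := by
  rw [(SUSYVertexAlgebra.superfield 𝒱 (parity_hState _ h)).transl_one]
  simp only [zpow_one, neg_one_smul, neg_neg]

theorem HasBrackets.odd_even (hb : 𝒱.HasBrackets) (h h' : Hsp Q) (m n : ℤ) (v : VQ Q) :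
    𝒱.Y (hState (val ε) h) m 0 (𝒱.Y (hState (val ε) h') n 1 v) =
      𝒱.Y (hState (val ε) h') n 1 (𝒱.Y (hState (val ε) h) m 0 v) := by
  have e1 := hb.odd_odd h h' m n v
  have e2 := hb.odd_odd h h' m n (𝒱.S v)
  have e3 := hb.even_odd h h' m n v
  have e4 := congrArg 𝒱.S e1
  simp only [map_add, map_neg, map_smul, transl_odd] at e4
  rw [map_sub, e2, e3, map_sub] at e4
  rw [← sub_eq_zero] at e4 ⊢
  rw [← neg_eq_zero, ← e4]
  abel

theorem HasBrackets.even_even (hb : 𝒱.HasBrackets) (h h' : Hsp Q) (m n : ℤ) (v : VQ Q) :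
    𝒱.Y (hState (val ε) h) m 1 (𝒱.Y (hState (val ε) h') n 1 v) =
      𝒱.Y (hState (val ε) h') n 1 (𝒱.Y (hState (val ε) h) m 1 v) -
        ((m + 1 : ℤ) : ℂ) • (if m + 1 + n + 1 = 0 then formC B h h' else 0) • v := by
  have e1 := congrArg 𝒱.S (hb.even_odd h h' m n v)
  rw [transl_even, transl_odd, transl_odd, transl_even, map_sub, map_add, hb.even_odd, map_smul,
    hb.odd_odd h h' (m + 1) n, smul_add] at e1
  rw [← sub_eq_zero] at e1 ⊢
  rw [← e1]
  module

theorem HasBrackets.mode_mode (hb : 𝒱.HasBrackets) (h h' : Hsp Q) (j k : ℤ) (J K : Fin 2)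
    (v : VQ Q) : SUSYVertexAlgebra.mode 𝒱 (hState (val ε) h) j J
        (SUSYVertexAlgebra.mode 𝒱 (hState (val ε) h') k K v) =
      (-1 : ℂ) ^ ((J : ℕ) * K) • SUSYVertexAlgebra.mode 𝒱 (hState (val ε) h') k K
        (SUSYVertexAlgebra.mode 𝒱 (hState (val ε) h) j J v) + hOpComm B h h' j k J K • v := by
  simp only [SUSYVertexAlgebra.mode]
  match J, K with
  | 0, 0 =>
    simp only [sub_zero]
    rw [hb.even_even, sub_eq_add_neg]
    simp only [hOpComm, Fin.val_zero, mul_zero, pow_zero, one_smul, and_self, if_true,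
      add_right_inj]
    rw [← neg_smul, smul_smul]
    congr 1
    by_cases hjk : j + k = 0
    · rw [if_pos (by omega), if_pos (by omega)]
      push_cast
      ring
    · rw [if_neg (by omega), if_neg (by omega), mul_zero]
  | 0, 1 => simpa [hOpComm] using hb.even_odd h h' (-1 - j) (-1 - k) v
  | 1, 0 => simpa [hOpComm] using hb.odd_even h h' (-1 - j) (-1 - k) v
  | 1, 1 =>
    simp only [sub_self]
    rw [hb.odd_odd]
    have e : hOpComm B h h' j k 1 1 = if j + k = -1 then formC B h h' else 0 := by simp [hOpComm]
    rw [e]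
    simp only [Fin.val_one, mul_one, pow_one, neg_one_smul, add_right_inj]
    congr 1
    by_cases hjk : j + k = -1
    · rw [if_pos (by omega), if_pos hjk]
    · rw [if_neg (by omega), if_neg hjk]

theorem Creation.toExtends (hc : 𝒱.Creation) (hs : B.IsSymm) (hb : 𝒱.HasBrackets) : 𝒱.Extends := by
  intro h j J
  rcases lt_or_ge j 0 with hj | hj
  · exact hc h j J hj
  refine LinearMap.ext fun v => ?_
  induction v using vq_induction B with
  | e β => rw [hb.mode_eState h β hj, hOp_eState B h hj]
  | smul c x hx => rw [map_smul, map_smul, hx]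
  | add x y hx hy => rw [map_add, map_add, hx, hy]
  | cre h' k K x hk hx =>
    rw [hOp_hOp B hs, ← hx, ← hc h' k K hk, hb.mode_mode]

end Str

end Forced

section Forced

variable {Q : Type*} [AddCommGroup Q] [Module.Free ℤ Q] [Module.Finite ℤ Q]
  {B : LinearMap.BilinForm ℤ Q} {ε : Q → Q → ℂˣ}

theorem IsTranslation.ext {S S' : Module.End ℂ (VQ Q)} (hS : IsTranslation B S)
    (hS' : IsTranslation B S') : S = S' := by
  refine LinearMap.ext fun v => ?_
  induction v using vq_induction B with
  | e β => rw [hS.eState, hS'.eState]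
  | smul c x hx => rw [map_smul, map_smul, hx]
  | add x y hx hy => rw [map_add, map_add, hx, hy]
  | cre h j J x hj hx =>
    match J with
    | 0 => rw [hS.even, hS'.even, hx]
    | 1 => rw [hS.odd, hS'.odd, hx]

theorem IsTwoCocycle.apply_zero (hε : IsTwoCocycle ε) (α : Q) : ε α 0 = ε 0 0 := by
  have := hε α 0 0
  rw [add_zero, add_zero] at this
  exact mul_right_cancel this

namespace Str

variable {𝒱 : Str B ε}

theorem Extends.Y_zero (hE : 𝒱.Extends) (h : Hsp Q) (n : ℤ) :
    𝒱.Y (hState (val ε) h) n 0 = hOp B h (-1 - n) 1 := by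
  rw [SUSYVertexAlgebra.Y_eq_mode, hE]
  rfl

theorem Extends.Y_one (hE : 𝒱.Extends) (h : Hsp Q) (n : ℤ) :
    𝒱.Y (hState (val ε) h) n 1 = hOp B h (-1 - n) 0 := by
  rw [SUSYVertexAlgebra.Y_eq_mode, hE]
  rfl

theorem Extends.isTranslation (hE : 𝒱.Extends) (hs : B.IsSymm) (hnd : B.Nondegenerate) :
    IsTranslation B 𝒱.S := by
  have hodd : ∀ h j v, 𝒱.S (hOp B h j 1 v) = hOp B h j 0 v - hOp B h j 1 (𝒱.S v) := by
    intro h j v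
    have := transl_odd 𝒱 h (-1 - j) v
    rwa [hE.Y_zero, hE.Y_one, sub_sub_cancel] at this
  have heven : ∀ h j v, 𝒱.S (hOp B h j 0 v) =
      hOp B h j 0 (𝒱.S v) - (j : ℂ) • hOp B h (j - 1) 1 v := by
    intro h j v
    have := transl_even 𝒱 h (-1 - j) v
    rw [hE.Y_zero, hE.Y_one, sub_sub_cancel, show -1 - (-1 - j + 1) = j - 1 by ring] at this
    rw [this]
    push_cast
    module
  refine ⟨hodd, heven, fun α => ?_⟩
  have hodd' : ∀ h j v, hOp B h j 1 (𝒱.S v) = hOp B h j 0 v - 𝒱.S (hOp B h j 1 v) := by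
    intro h j v
    rw [hodd]; abel
  have heven' : ∀ h j v, hOp B h j 0 (𝒱.S v) =
      𝒱.S (hOp B h j 0 v) + (j : ℂ) • hOp B h (j - 1) 1 v := by
    intro h j v
    rw [heven]; abel
  rw [← sub_eq_zero]
  refine eq_zero_of_ann hs hnd (fun h j J hj => ?_) ?_
  · match J with
    | 0 =>
      have hj' : 0 < j := by simpa using hj
      rw [map_sub, heven', hOp_even_odd, hOp_eState B h hj'.le, hOp_eState B h (by omega),
        if_neg (by omega), if_neg (by simp)]
      simp
    | 1 =>
      have hj' : 0 ≤ j := by omega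
      rw [map_sub, hodd', hOp_odd_odd B hs, hOp_eState B h hj', hOp_eState B h hj',
        if_neg (c := j = 0 ∧ (1 : Fin 2) = 0) (by simp)]
      by_cases h0 : j = 0
      · simp [h0]
      · rw [if_neg (by simp [h0]), if_neg (by omega)]
        simp
  · rw [map_sub, vacProj_cre B _ (by norm_num), sub_zero]
    refine vacProj_eq_zero_of_parity (B := B) (δ := α) hnd (fun h => ?_) ?_
    · rw [heven', hOp_eState B h le_rfl]
      simp
    · have h1 := DFunLike.congr_fun 𝒱.S_odd (eState α)
      rw [Module.End.mul_apply, LinearMap.neg_apply, Module.End.mul_apply, parity_eState,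
        map_smul] at h1
      exact h1

theorem Extends.Y_eState_even (hE : 𝒱.Extends) (hb : 𝒱.HasBrackets) (α : Q) (h : Hsp Q)
    (j n : ℤ) (v : VQ Q) : hOp B h j 0 (𝒱.Y (eState α) n 0 v) =
      𝒱.Y (eState α) n 0 (hOp B h j 0 v) + formC B h (toH α) • 𝒱.Y (eState α) (n - j) 0 v := by
  have := SUSYVertexAlgebra.comm_eq 𝒱 (parity_hState (val ε) h) (parity_eState B α) 1
    (c := formC B h (toH α) • eState α) (by
      rw [SUSYVertexAlgebra.Y_eq_mode, hb.mode_eState _ _ (by norm_num)]; simp) (fun n hn => by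
      rw [SUSYVertexAlgebra.Y_eq_mode, hb.mode_eState _ _ (by omega), if_neg (by omega)])
    (-1 - j) n v
  rw [hE.Y_one, sub_sub_cancel, map_smul, show -1 - j + n + 1 = n - j by ring,
    neg_one_zpow_congr (q := 0) ⟨B α α, by simp; ring⟩, zpow_zero, one_smul] at this
  exact this

theorem Extends.Y_eState_odd (hE : 𝒱.Extends) (hb : 𝒱.HasBrackets) (α : Q) (h : Hsp Q)
    (j n : ℤ) (v : VQ Q) : hOp B h j 1 (𝒱.Y (eState α) n 0 v) =
      (-1 : ℂ) ^ (B α α) • 𝒱.Y (eState α) n 0 (hOp B h j 1 v) := by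
  have h0 : ∀ n ≤ -1, 𝒱.Y (hState (val ε) h) n 0 (eState α) = 0 := fun n hn => by
    rw [SUSYVertexAlgebra.Y_eq_mode, hb.mode_eState _ _ (by omega), if_neg (by simp)]
  have := SUSYVertexAlgebra.comm_eq 𝒱 (parity_hState (val ε) h) (parity_eState B α) 0
    (h0 _ le_rfl) (fun n hn => h0 n hn.le) (-1 - j) n v
  rw [hE.Y_zero, sub_sub_cancel, map_zero] at this
  simpa using this

theorem Extends.exists_vertexField (hE : 𝒱.Extends) (hs : B.IsSymm) (hnd : B.Nondegenerate)
    (hb : 𝒱.HasBrackets) (α : Q) :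
    ∃ c, VertexField B α ((-1) ^ (B α α)) c (fun n => 𝒱.Y (eState α) n 0) := by
  have hS := hE.isTranslation hs hnd
  refine ⟨fun γ => vacProj (𝒱.Y (eState α) (B α γ) 0 (eState γ)) (α + γ),
    hE.Y_eState_even hb α, hE.Y_eState_odd hb α, fun γ n => ?_⟩
  have hw : ∀ n δ, δ ≠ α + γ → vacProj (𝒱.Y (eState α) n 0 (eState γ)) δ = 0 := by
    intro n δ hδ
    refine vacProj_apply_eq_zero_of_weight (B := B) hnd (fun h => ?_) hδ
    rw [hE.Y_eState_even hb, hOp_eState B h le_rfl, if_pos ⟨rfl, rfl⟩, map_smul, sub_zero,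
      formC_toH_add_right, add_smul, add_comm]
  by_cases hn : n = B α γ
  · rw [if_pos hn]
    subst hn
    classical
    ext δ
    rw [Finsupp.smul_apply, Finsupp.single_apply]
    split_ifs with hδ
    · rw [← hδ, smul_eq_mul, mul_one]
    · rw [hw _ δ (Ne.symm hδ), smul_zero]
  · rw [if_neg hn]
    obtain ⟨k, rfl⟩ : ∃ k, n = k + 1 := ⟨n - 1, by ring⟩
    have h1 := ((SUSYVertexAlgebra.fieldIn 𝒱 (parity_eState B α) 0).transl k (eState γ))
    rw [Module.End.mul_apply, Module.End.mul_apply, hS.sq_eState hs] at h1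
    have h2 := hE.Y_eState_even hb α (toH γ) (-1) k (eState γ)
    have h3 := congrArg vacProj h1
    have h4 := congrArg vacProj h2
    rw [hS.vacProj_apply, map_add, map_smul] at h3
    rw [vacProj_cre B _ (by norm_num), map_add, map_smul, sub_neg_eq_add, formC_toH,
      hs.eq γ α] at h4
    have h5 : (((k + 1 : ℤ) : ℂ) - (B α γ : ℂ)) •
        vacProj (𝒱.Y (eState α) (k + 1) 0 (eState γ)) = 0 := by
      rw [sub_smul, sub_eq_zero]
      exact add_left_cancel (h3.symm.trans h4)
    refine (smul_eq_zero.mp h5).resolve_left ?_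
    rw [sub_eq_zero]
    exact_mod_cast hn

theorem Extends.toFuns_eq (hE : 𝒱.Extends) (hs : B.IsSymm) (hnd : B.Nondegenerate) {α : Q}
    {ε' : Q → Q → ℂ}
    (hV : VertexField B α ((-1) ^ (B α α)) (ε' α) (fun n => 𝒱.Y (eState α) n 0)) :
    toFuns (𝒱.Y (eState α)) = Gam B ε' α := by
  have hS := hE.isTranslation hs hnd
  have e0 := hV.ext hs hnd (zpow_ne_zero _ (by norm_num)) (vertexField_gamOp B hs ε' α)
  funext n I v
  match I with
  | 0 => exact DFunLike.congr_fun (congrFun e0 n) v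
  | 1 =>
    have h1 := (vertexPair_gamOp B hs ε' α).eq_comm hs hnd hS (neg_one_zpow_mul_self _)
      (vertexField_gamOp B hs ε' α) n v
    have h2 := (SUSYVertexAlgebra.superfield 𝒱 (parity_eState B α)).transl_zero n v
    have e1 : 𝒱.Y (eState α) n 0 = gamOp B hs ε' α n 0 := congrFun e0 n
    rw [e1] at h2
    change 𝒱.Y (eState α) n 1 v = gamOp B hs ε' α n 1 v
    rw [h1, h2]
    abel

theorem Extends.exists_toFuns_eq (hE : 𝒱.Extends) (hs : B.IsSymm) (hnd : B.Nondegenerate)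
    (hε : IsTwoCocycle ε) (hb : 𝒱.HasBrackets) : ∃ c : Q → Q → ℂ, (∀ α, c α 0 = 1) ∧
      ∀ α, toFuns (𝒱.Y (eState α)) = Gam B (fun α β => c α β * val ε α β) α := by
  choose c hc using hE.exists_vertexField hs hnd hb
  have hval : ∀ α β, val ε α β ≠ 0 := fun α β => (ε α β).ne_zero
  refine ⟨fun α β => c α β / val ε α β, fun α => ?_, fun α => hE.toFuns_eq hs hnd ?_⟩
  · have h1 := (hc α).vac 0 0
    rw [map_zero, if_pos rfl] at h1
    have h2 : 𝒱.Y (eState α) 0 0 ((val ε 0 0)⁻¹ • eState 0) = eState α :=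
      (congrArg _ (vacuum_eq (val ε)).symm).trans (SUSYVertexAlgebra.Y_apply_vac 𝒱 _)
    rw [map_smul] at h2
    have h3 := congrArg vacProj h2
    rw [map_smul, h1, vacProj_eState, add_zero, smul_smul] at h3
    have h4 := DFunLike.congr_fun h3 α
    simp only [Finsupp.smul_apply, Finsupp.single_eq_same, smul_eq_mul, mul_one] at h4
    have h5 : val ε α 0 = val ε 0 0 := congrArg Units.val (hε.apply_zero α)
    change c α 0 / val ε α 0 = 1
    rw [h5, div_eq_inv_mul]
    exact h4
  · convert hc α using 1
    funext β
    exact div_mul_cancel₀ _ (hval α β)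

theorem Extends.toFuns_eq_of_normalized (hE : 𝒱.Extends) (hs : B.IsSymm) (hnd : B.Nondegenerate)
    (hb : 𝒱.HasBrackets) (hn : 𝒱.Normalized) (α : Q) :
    toFuns (𝒱.Y (eState α)) = Gam B (val ε) α := by
  obtain ⟨c, hc⟩ := hE.exists_vertexField hs hnd hb α
  refine hE.toFuns_eq hs hnd ?_
  convert hc using 1
  funext β
  have h1 := hc.apply_eState_self hs hnd β
  have h2 := hn α β
  rw [SUSYVertexAlgebra.mode, sub_sub_cancel, sub_self, h1, twMul_single,
    TensorProduct.tmul_smul] at h2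
  have h3 : vacProj (c β • eState (α + β)) = vacProj (val ε α β • eState (α + β)) :=
    congrArg vacProj h2
  rw [map_smul, map_smul, vacProj_eState] at h3
  have h4 := DFunLike.congr_fun h3 (α + β)
  simp only [Finsupp.smul_apply, Finsupp.single_eq_same, smul_eq_mul, mul_one] at h4
  exact h4.symm

end Str

end Forced

section Existence

variable {Q : Type*} [AddCommGroup Q] [Module.Free ℤ Q] [Module.Finite ℤ Q]
  {B : LinearMap.BilinForm ℤ Q} {ε : Q → Q → ℂˣ}

theorem loc_of_comm_eq {V : Type*} [AddCommGroup V] [Module ℂ V] {s : ℂ}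
    {a b g : ℤ → Module.End ℂ V}
    (h : ∀ m n v, a m (b n v) = s • b n (a m v) + g (m + n) v) : Loc s a b := by
  refine ⟨1, ?_⟩
  have e : (fun m n => a m * b n - s • (b n * a m)) = fun m n => g (m + n) := by
    funext m n
    ext v
    simp [h]
  rw [e]
  funext m n
  rw [pow_one, subZW_apply, show m - 1 + n = m + (n - 1) by ring, sub_self]
  rfl

/-- The superfields `h(Z)` and `Γ_α(Z)`. -/
def genField (hs : B.IsSymm) (ε : Q → Q → ℂ) : Hsp Q ⊕ Q → Series (Module.End ℂ (VQ Q))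
  | .inl h => fun n I => hOp B h (-1 - n) (1 - I)
  | .inr α => gamOp B hs ε α

variable (B) in
/-- The parities of the generating superfields. -/
def genParity : Hsp Q ⊕ Q → ℤ
  | .inl _ => 1
  | .inr α => B α α

theorem neg_one_pow_one_sub (I : Fin 2) :
    (-1 : ℂ) ^ ((1 - I : Fin 2) : ℕ) = (-1) ^ ((1 : ℤ) + ((I : ℕ) : ℤ)) := by
  match I with
  | 0 => simp
  | 1 => rw [show (1 : Fin 2) - 1 = 0 from rfl]; norm_num

theorem IsTranslation.vacuum {S : Module.End ℂ (VQ Q)} (hS : IsTranslation B S) (ε : Q → Q → ℂ) :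
    S (vacuum ε) = 0 := by
  rw [vacuum_eq, map_smul, hS.eState, show toH (0 : Q) = 0 from TensorProduct.tmul_zero _ _,
    hOp_zero]
  simp

theorem superfield_hOp (hs : B.IsSymm) {S : Module.End ℂ (VQ Q)} (hS : IsTranslation B S)
    (ε : Q → Q → ℂ) (h : Hsp Q) :
    Superfield (parity B) S (vacuum ε) 1 (genField hs ε (.inl h)) where
  parity n I := by
    refine LinearMap.ext fun v => ?_
    rw [Module.End.mul_apply, LinearMap.smul_apply, Module.End.mul_apply, ← neg_one_pow_one_sub]
    exact parity_hOp B h _ _ v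
  bdd v := by
    obtain ⟨N, hN⟩ := exists_hOp_eq_zero B hs v
    exact ⟨-1 - N, fun n hn I => hN h _ _ (by omega)⟩
  vac n I hn := hOp_vacuum ε h (by omega) _
  transl n I := by
    refine LinearMap.ext fun v => ?_
    match I with
    | 0 =>
      have := hS.odd h (-1 - n) v
      simp only [Fin.val_zero, pow_zero, one_smul, zpow_one, neg_one_smul, sub_neg_eq_add,
        LinearMap.sub_apply, LinearMap.smul_apply, Module.End.mul_apply, dBar,
        if_true, genField, sub_zero, sub_self, this]
      module
    | 1 =>
      have := hS.even h (-1 - n) v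
      simp only [Fin.val_one, pow_one, zpow_one, neg_one_smul, sub_neg_eq_add,
        LinearMap.sub_apply, LinearMap.neg_apply, LinearMap.smul_apply,
        Module.End.mul_apply, dBar, one_ne_zero, if_false, genField, sub_zero, sub_self, this]
      rw [show -1 - n - 1 = -1 - (n + 1) by ring]
      push_cast
      module

theorem superfield_gamOp (hs : B.IsSymm) (hnd : B.Nondegenerate) {S : Module.End ℂ (VQ Q)}
    (hS : IsTranslation B S) (ε : Q → Q → ℂ) (α : Q) :
    Superfield (parity B) S (vacuum ε) (B α α) (gamOp B hs ε α) := by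
  have hA := vertexField_gamOp B hs ε α
  have hD : ∀ n v, gamOp B hs ε α n 1 v = _ := fun n v =>
    (vertexPair_gamOp B hs ε α).eq_comm hs hnd hS (neg_one_zpow_mul_self _) hA n v
  have hv : ∀ n < 0, gamOp B hs ε α n 0 (vacuum ε) = 0 := fun n hn => by
    rw [vacuum_eq, map_smul, hA.apply_eState_of_lt hs hnd 0 (by simpa using hn), smul_zero]
  refine ⟨fun n I => ?_, gamOp_bdd B hs ε α, fun n I hn => ?_, fun n I => ?_⟩
  · refine LinearMap.ext fun v => ?_
    rw [zpow_add₀ (by norm_num), zpow_natCast]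
    exact gamOp_parity B hs ε α n I v
  · match I with
    | 0 => exact hv n hn
    | 1 => rw [hD, hv n hn, hS.vacuum, map_zero, map_zero, smul_zero, sub_zero]
  · refine LinearMap.ext fun v => ?_
    match I with
    | 0 => simp [dBar, hD]
    | 1 =>
      have h1 := hA.comm_sq hs hnd hS (neg_one_zpow_mul_self _) n v
      simp only [Fin.val_one, pow_one, neg_one_smul, LinearMap.sub_apply, LinearMap.neg_apply,
        LinearMap.smul_apply, Module.End.mul_apply, dBar, one_ne_zero, if_false, hD, map_sub,
        map_smul, smul_sub, smul_smul, neg_one_zpow_mul_self, one_smul, ← h1]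
      module

theorem loc_hOp_hOp (hs : B.IsSymm) (h h' : Hsp Q) (J K : Fin 2) :
    Loc ((-1) ^ ((J : ℕ) * (K : ℕ))) (fun n => hOp B h (-1 - n) J)
      (fun n => hOp B h' (-1 - n) K) := by
  by_cases h00 : J = 0 ∧ K = 0
  · obtain ⟨rfl, rfl⟩ := h00
    refine ⟨2, ?_⟩
    have e : (fun m n => hOp B h (-1 - m) 0 * hOp B h' (-1 - n) 0 -
        ((-1 : ℂ) ^ (((0 : Fin 2) : ℕ) * ((0 : Fin 2) : ℕ))) •
          (hOp B h' (-1 - n) 0 * hOp B h (-1 - m) 0)) =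
        fun m n => (((-1 - m : ℤ) : ℂ) * if m + n = -2 then formC B h h' else 0) •
          (1 : Module.End ℂ (VQ Q)) := by
      funext m n
      refine LinearMap.ext fun v => ?_
      rw [LinearMap.sub_apply, LinearMap.smul_apply, Module.End.mul_apply, Module.End.mul_apply,
        hOp_even_even B hs, Fin.val_zero, mul_zero, pow_zero, one_smul, add_sub_cancel_left,
        LinearMap.smul_apply, Module.End.one_apply]
      congr 1
      by_cases hmn : m + n = -2
      · rw [if_pos (by omega), if_pos hmn]
      · rw [if_neg (by omega), if_neg hmn, mul_zero]
    rw [e, pow_two, Module.End.mul_apply]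
    funext m n
    simp only [subZW_apply, Pi.zero_apply]
    rw [show m - 1 - 1 + n = m + n - 2 by ring, show m - 1 + (n - 1) = m + n - 2 by ring,
      show m + (n - 1 - 1) = m + n - 2 by ring]
    push_cast
    module
  · refine loc_of_comm_eq (g := fun k => (if J = 1 ∧ K = 1 ∧ k = -1 then formC B h h' else 0) • 1)
      fun m n v => ?_
    rw [hOp_hOp B hs, hOpComm, if_neg h00]
    congr 1
    rw [LinearMap.smul_apply, Module.End.one_apply]
    congr 1
    by_cases h11 : J = 1 ∧ K = 1
    · obtain ⟨rfl, rfl⟩ := h11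
      by_cases hmn : m + n = -1
      · rw [if_pos ⟨rfl, rfl⟩, if_pos (by omega), if_pos ⟨rfl, rfl, hmn⟩]
      · rw [if_pos ⟨rfl, rfl⟩, if_neg (by omega), if_neg fun h => hmn h.2.2]
    · rw [if_neg h11, if_neg fun h => h11 ⟨h.1, h.2.1⟩]

theorem loc_hOp_gamOp (hs : B.IsSymm) (ε : Q → Q → ℂ) (h : Hsp Q) (α : Q) (I K : Fin 2) :
    Loc ((-1) ^ ((1 + ((I : ℕ) : ℤ)) * (B α α + ((K : ℕ) : ℤ))))
      (fun n => hOp B h (-1 - n) (1 - I)) (fun n => gamOp B hs ε α n K) := by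
  match I with
  | 1 =>
    rw [neg_one_zpow_congr (q := 0) ⟨B α α + ((K : ℕ) : ℤ), by simp; ring⟩]
    refine loc_of_comm_eq (g := fun k => formC B h (toH α) • gamOp B hs ε α (k + 1) K)
      fun m n v => ?_
    rw [zpow_zero, one_smul, sub_self, gamOp_even, show n - (-1 - m) = m + n + 1 by ring]
    rfl
  | 0 =>
    rw [sub_zero]
    match K with
    | 0 =>
      refine loc_of_comm_eq (g := 0) fun m n v => ?_
      rw [gamOp_odd_zero]
      simp
    | 1 =>
      refine loc_of_comm_eq (g := fun k => formC B h (toH α) • gamOp B hs ε α (k + 1) 0)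
        fun m n v => ?_
      rw [gamOp_odd_one, show n - (-1 - m) = m + n + 1 by ring]
      simp [zpow_add₀ (show (-1 : ℂ) ≠ 0 by norm_num)]

theorem gamOp_vacuum (hs : B.IsSymm) (hnd : B.Nondegenerate) (hε : IsTwoCocycle ε) (α : Q) :
    gamOp B hs (val ε) α 0 0 (vacuum (val ε)) = eState α := by
  have h1 := (vertexField_gamOp B hs (val ε) α).apply_eState_self hs hnd 0
  have h5 : val ε α 0 = val ε 0 0 := congrArg Units.val (hε.apply_zero α)
  rw [map_zero, h5, add_zero] at h1
  rw [vacuum_eq, map_smul, h1, smul_smul, inv_mul_cancel₀ (show val ε 0 0 ≠ 0 from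
    (ε 0 0).ne_zero), one_smul]

theorem generators_genField (hs : B.IsSymm) (hnd : B.Nondegenerate) (hε : IsTwoCocycle ε)
    (hsr : ∀ α β, SignRule B ε α β) {S : Module.End ℂ (VQ Q)} (hS : IsTranslation B S) :
    Generators (parity B) S (vacuum (val ε)) (genParity B) (genField hs (val ε)) where
  sigma_sq := parity_mul_self B
  vac_even := parity_vacuum _
  S_odd := LinearMap.ext fun v => hS.parity_apply v
  S_vac := hS.vacuum _
  superfield
    | .inl h => superfield_hOp hs hS _ h
    | .inr α => superfield_gamOp hs hnd hS _ α
  loc i j := by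
    have hp : ∀ i, Superfield (parity B) S (vacuum (val ε)) (genParity B i)
        (genField hs (val ε) i)
      | .inl h => superfield_hOp hs hS _ h
      | .inr α => superfield_gamOp hs hnd hS _ α
    match i, j with
    | .inl h, .inl h' =>
      rw [mutuallyLocal_iff (parity_mul_self B) (hp _).parity (hp _).parity]
      intro I K
      have := loc_hOp_hOp hs h h' (1 - I) (1 - K)
      rw [pow_mul, neg_one_pow_one_sub, ← zpow_natCast, ← zpow_mul, mul_comm, zpow_mul,
        zpow_natCast, neg_one_pow_one_sub, ← zpow_mul, mul_comm] at this
      exact this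
    | .inl h, .inr α =>
      rw [mutuallyLocal_iff (parity_mul_self B) (hp _).parity (hp _).parity]
      exact fun I K => loc_hOp_gamOp hs _ h α I K
    | .inr α, .inl h =>
      rw [mutuallyLocal_iff (parity_mul_self B) (hp _).parity (hp _).parity]
      intro I K
      have := (loc_hOp_gamOp hs (val ε) h α K I).symm (neg_one_zpow_mul_self _)
      rw [mul_comm] at this
      exact this
    | .inr α, .inr β => exact (mutuallyLocal_Gam_iff hs hnd hε α β).mpr (hsr α β)
  gen K hv hK := by
    rw [eq_top_iff]
    intro v _
    induction v using vq_induction B with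
    | e β =>
      have := hK _ (mem_components (genParity B) (genField hs (val ε)) (.inr β) 0) 0 le_rfl _ hv
      simp only [genField] at this
      rwa [gamOp_vacuum hs hnd hε] at this
    | smul c x hx => exact K.smul_mem c (hx trivial)
    | add x y hx hy => exact K.add_mem (hx trivial) (hy trivial)
    | cre h j J x hj hx =>
      have := hK _ (mem_components (genParity B) (genField hs (val ε)) (.inl h) (1 - J)) (-1 - j)
        (by omega) _ (hx trivial)
      simp only [genField, sub_sub_cancel] at this
      exact this

theorem Str.Extends.hasBrackets (hs : B.IsSymm) {𝒱 : Str B ε} (hE : 𝒱.Extends) :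
    𝒱.HasBrackets := by
  constructor
  · intro h h'
    funext j J
    rw [SUSYVertexAlgebra.lambdaBracket, hE, hState_eq (B := B) (val ε) h', hOp_hOp B hs,
      hOp_vacuum _ _ (Int.natCast_nonneg j), map_zero, smul_zero, zero_add]
    match J with
    | 0 => simp [hOpComm]
    | 1 =>
      rcases eq_or_ne j 0 with rfl | hj
      · simp [hOpComm]
      · simp [hOpComm, hj]
  · intro h β
    funext j J
    rw [SUSYVertexAlgebra.lambdaBracket, hE, hOp_eState B h (Int.natCast_nonneg j)]
    rcases eq_or_ne j 0 with rfl | hj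
    · simp
    · simp [hj]

theorem exists_unique_structure (hs : B.IsSymm) (hnd : B.Nondegenerate) (hε : IsTwoCocycle ε)
    (hsr : ∀ α β, SignRule B ε α β) :
    ∃ 𝒱 : Str B ε, (𝒱.HasBrackets ∧ 𝒱.Extends ∧ 𝒱.Normalized) ∧
      ∀ 𝒱' : Str B ε, 𝒱'.HasBrackets → 𝒱'.Creation → 𝒱'.Normalized → 𝒱' = 𝒱 := by
  obtain ⟨S, hS1, hS2, hS3⟩ := exists_translation B hs hnd
  have hS : IsTranslation B S := ⟨hS1, hS2, hS3⟩
  have hG := generators_genField hs hnd hε hsr hS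
  obtain ⟨𝒱, h𝒱S, h𝒱⟩ := hG.exists_structure
  have hst : ∀ i, genField hs (val ε) i 0 0 (vacuum (val ε)) =
      Sum.elim (hState (val ε)) eState i := by
    rintro (h | α)
    · exact (hState_eq (B := B) (val ε) h).symm
    · exact gamOp_vacuum hs hnd hε α
  have hY : ∀ i, 𝒱.Y (Sum.elim (hState (val ε)) eState i) = genField hs (val ε) i := fun i => by
    rw [← hst, h𝒱]
  have hE : Str.Extends 𝒱 := fun h j J => by
    have := hY (.inl h)
    rw [Sum.elim_inl] at this
    rw [SUSYVertexAlgebra.mode, this]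
    simp only [genField, sub_sub_cancel]
  have hN : Str.Normalized 𝒱 := fun α β => by
    have := hY (.inr α)
    rw [Sum.elim_inr] at this
    rw [SUSYVertexAlgebra.mode, this, sub_sub_cancel, sub_self, twMul_single,
      TensorProduct.tmul_smul]
    exact (vertexField_gamOp B hs (val ε) α).apply_eState_self hs hnd β
  refine ⟨𝒱, ⟨hE.hasBrackets hs, hE, hN⟩, fun 𝒱' hb hc hn => ?_⟩
  have hE' := hc.toExtends hs hb
  refine hG.eq_of_Y_eq ((hE'.isTranslation hs hnd).ext hS) h𝒱S
    (x := Sum.elim (hState (val ε)) eState) ?_ ?_ hY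
  · rintro (h | α)
    · exact parity_hState _ h
    · exact parity_eState B α
  · rintro (h | α)
    · funext n I
      rw [Sum.elim_inl, SUSYVertexAlgebra.Y_eq_mode, hE']
      rfl
    · funext n I
      exact LinearMap.ext fun v => congrFun (congrFun (congrFun
        (hE'.toFuns_eq_of_normalized hs hnd hb hn α) n) I) v

theorem exists_cocycle (hs : B.IsSymm) :
    ∃ ε : Q → Q → ℂˣ, IsTwoCocycle ε ∧ ∀ α β, SignRule B ε α β := by
  let e := Module.finBasis ℤ Q
  let b : LinearMap.BilinForm ℤ Q := Matrix.toBilin e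
    (Matrix.of fun i j => if i < j then B (e i) (e j) + B (e i) (e i) * B (e j) (e j) else 0)
  have hbe : ∀ i j, b (e i) (e j) =
      if i < j then B (e i) (e j) + B (e i) (e i) * B (e j) (e j) else 0 := by
    intro i j
    rw [← LinearMap.BilinForm.toMatrix_apply e b, LinearMap.BilinForm.toMatrix_toBilin]
    rfl
  let c : ℤ →ₗ[ℤ] ZMod 2 := (Int.castAddHom (ZMod 2)).toIntLinearMap
  let χ : Q →ₗ[ℤ] ZMod 2 := AddMonoidHom.toIntLinearMap
    { toFun := fun α => (B α α : ZMod 2)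
      map_zero' := by simp
      map_add' := fun α β => by
        have h2 : (2 : ZMod 2) = 0 := rfl
        simp only [map_add, LinearMap.add_apply, hs.eq β α]
        push_cast
        linear_combination (B α β : ZMod 2) * h2 }
  have hχ : ∀ α, χ α = (B α α : ZMod 2) := fun _ => rfl
  have key : (b + b.flip).compr₂ c =
      B.compr₂ c + (LinearMap.mul ℤ (ZMod 2)).compl₁₂ χ χ := by
    refine LinearMap.ext_basis e e fun i j => ?_
    have h2 : ∀ x : ZMod 2, x + x * x = 0 := by decide
    simp only [LinearMap.compr₂_apply, LinearMap.add_apply, LinearMap.BilinForm.flip_apply,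
      LinearMap.compl₁₂_apply, LinearMap.mul_apply', hχ, hbe]
    change (((_ : ℤ) : ZMod 2)) = ((_ : ℤ) : ZMod 2) + _
    rcases lt_trichotomy i j with hij | rfl | hij
    · rw [if_pos hij, if_neg hij.not_gt]
      push_cast; ring
    · simp [h2]
    · rw [if_neg hij.not_gt, if_pos hij, hs.eq (e i) (e j)]
      push_cast; ring
  refine ⟨fun α β => (-1) ^ b α β, fun α β γ => ?_, fun α β => ?_⟩
  · rw [← zpow_add, ← zpow_add]
    congr 1
    simp only [map_add, LinearMap.add_apply]
    ring
  · have h1 := DFunLike.congr_fun (DFunLike.congr_fun key α) β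
    simp only [LinearMap.compr₂_apply, LinearMap.add_apply, LinearMap.BilinForm.flip_apply,
      LinearMap.compl₁₂_apply, LinearMap.mul_apply', hχ] at h1
    change ((b α β + b β α : ℤ) : ZMod 2) = ((B α β : ℤ) : ZMod 2) + _ at h1
    have h2 : ((b α β - (B α β + B α α * B β β + b β α) : ℤ) : ZMod 2) = 0 := by
      have h2 : (2 : ZMod 2) = 0 := rfl
      push_cast at h1 ⊢
      linear_combination h1 - (b β α : ZMod 2) * h2
    rw [ZMod.intCast_zmod_eq_zero_iff_dvd] at h2
    rw [SignRule, ← zpow_add]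
    obtain ⟨k, hk⟩ := h2
    rw [show b α β = B α β + B α α * B β β + b β α + 2 * k by push_cast at hk; omega, zpow_add _ _ (2 * k),
      zpow_mul]
    simp

end Existence

end SUSY

end

theorem mainTheorem1 {Q : Type*} [AddCommGroup Q] [Module.Free ℤ Q] [Module.Finite ℤ Q]
    (B : LinearMap.BilinForm ℤ Q) (hsymm : B.IsSymm) (hnd : B.Nondegenerate) :
    -- admissible cocycles exist
    (∃ ε : Q → Q → ℂˣ, SUSY.IsTwoCocycle ε ∧ ∀ α β, SUSY.SignRule B ε α β) ∧
    ∀ ε : Q → Q → ℂˣ, SUSY.IsTwoCocycle ε →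
      -- existence and uniqueness of the structure
      ((∀ α β, SUSY.SignRule B ε α β) →
        ∃ 𝒱 : SUSY.Str B ε, (𝒱.HasBrackets ∧ 𝒱.Extends ∧ 𝒱.Normalized) ∧
          ∀ 𝒱' : SUSY.Str B ε, 𝒱'.HasBrackets → 𝒱'.Creation → 𝒱'.Normalized → 𝒱' = 𝒱) ∧
      -- the superfields `Γ_α` are forced, up to the normalization of the products `e^α e^β`
      (∀ 𝒱 : SUSY.Str B ε, 𝒱.HasBrackets → 𝒱.Creation →
        𝒱.Extends ∧
        ∃ c : Q → Q → ℂ, (∀ α, c α 0 = 1) ∧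
          ∀ α, SUSY.toFuns (𝒱.Y (SUSY.eState α)) =
            SUSY.Gam B (fun α β => c α β * SUSY.val ε α β) α) ∧
      (∀ 𝒱 : SUSY.Str B ε, 𝒱.HasBrackets → 𝒱.Creation → 𝒱.Normalized →
        (∀ α, SUSY.toFuns (𝒱.Y (SUSY.eState α)) = SUSY.Gam B (SUSY.val ε) α) ∧
          ∀ α β, SUSY.SignRule B ε α β) ∧
      -- locality
      (∀ α β, SUSY.MutuallyLocal (SUSY.parity B) (B α α) (B β β)
          (SUSY.Gam B (SUSY.val ε) α) (SUSY.Gam B (SUSY.val ε) β) ↔ SUSY.SignRule B ε α β) ∧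
      -- commutators
      (∀ α β, SUSY.SignRule B ε α β → ∀ v,
        SUSY.bracket (SUSY.parity B) (B α α) (B β β)
            (SUSY.Gam B (SUSY.val ε) α) (SUSY.Gam B (SUSY.val ε) β) v =
          if 0 ≤ B α β then 0
          else (ε α β : ℂ) •
            SUSY.act (SUSY.parity B)
              (SUSY.scalarOp (SUSY.DWdiv (-1 - B α β).toNat SUSY.delta))
              (SUSY.Gam₂ B (SUSY.val ε) α β v)) := by
  refine ⟨SUSY.exists_cocycle hsymm, fun ε hε => ⟨SUSY.exists_unique_structure hsymm hnd hε,
    fun 𝒱 hb hc => ?_, fun 𝒱 hb hc hn => ?_, SUSY.mutuallyLocal_Gam_iff hsymm hnd hε,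
    fun α β h v => SUSY.bracket_Gam_eq hsymm hnd hε h v⟩⟩
  · have hE := hc.toExtends hsymm hb
    exact ⟨hE, hE.exists_toFuns_eq hsymm hnd hε hb⟩
  · have hY := (hc.toExtends hsymm hb).toFuns_eq_of_normalized hsymm hnd hb hn
    refine ⟨hY, fun α β => ?_⟩
    rw [← SUSY.mutuallyLocal_Gam_iff hsymm hnd hε, ← hY, ← hY]
    exact 𝒱.locality _ _ _ _ (SUSY.parity_eState B α) (SUSY.parity_eState B β)
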